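/- **Setting.** Let $d\ge 1$ and let $f:\mathbb R^d\to\mathbb R$ be twice differentiable with, for all $x,y$, $|f(x)-f(y)|\le f_{\max}$, $\|\nabla f(x)-\nabla f(y)\|\le L\|x-y\|$ and $\|\nabla^2 f(x)-\nabla^2 f(y)\|\le\rho\|x-y\|$, where $f_{\max}\ge 0$ and $L,\rho>0$. Let $\nabla F(x,\theta)$, $\theta\sim\mathcal D$, be a stochastic gradient oracle with $\mathbb E_\theta\nabla F(x,\theta)=\nabla f(x)$ and $\mathbb E_\theta\|\nabla F(x,\theta)-\nabla f(x)\|^2\le\sigma^2$ for all $x$. Let $0<\mu\le 1$ and let $\mathcal C(x,\tilde\theta)$, $\tilde\theta\sim\tilde{\mathcal D}$, be a $\mu$-compressor: $\mathbb E_{\tilde\theta}\|x-\mathcal C(x,\tilde\theta)\|^2\le(1-\mu)\|x\|^2$ for all $x$. Put $\alpha=1$ if the oracle is assumed Lipschitz, i.e. $\|\nabla F(x,\theta)-\nabla F(y,\theta)\|\le\tilde\ell\|x-y\|$ for all $x,y,\theta$, and $\alpha=d$ if no such assumption is made. A point $x$ is an $\varepsilon$-SOSP if $\|\nabla f(x)\|\le\varepsilon$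 and $\lambda_{\min}(\nabla^2 f(x))\ge-\sqrt{\rho\varepsilon}$. **Algorithm** (compressed SGD with $reset\_error=true$ and parameters $\eta,r,\mathcal I,\mathcal R,T$). Start at $x_0$ with $e_0=0$, $t'=0$. For $t=0,\dots,T-1$: if $t-t'>\mathcal I$ or $\|x_{t'}-(x_t-\eta e_t)\|>\mathcal R$ (a *reset*), set $t'\leftarrow t$, $x_t\leftarrow x_t-\eta e_t$, $e_t\leftarrow 0$, and call the new $x_t$ a *reset point*. Then draw independent $\xi_t\sim\mathcal N(0,\frac{r^2}{d}I_d)$ (total variance $r^2$), $\theta_t\sim\mathcal D$, $\tilde\theta_t\sim\tilde{\mathcal D}$, independently of the past, and set $g_t=\mathcal C(e_t+\nabla F(x_t,\theta_t)+\xi_t,\tilde\theta_t)$, $x_{t+1}=x_t-\eta g_t$, $e_{t+1}=e_t+\nabla F(x_t,\theta_t)+\xi_t-g_t$. A reset transmits the uncompressed vector $e_t$, i.e. $d$ numbers. **Theorem.** There are universal constants $K>0$ and $k\in\mathbb N$ such that the following holds. Let $0<\varepsilon\le 1$, $0<\mu\le 1$, $0<\delta<1$, $d\ge 1$, $f_{\max},\sigma,\tilde\ell\ge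 0$, $L,\rho>0$, fix which of the two cases for $\alpha$ is considered, and let $$A=K\Bigl(1+f_{\max}+L+\tfrac1L+\rho+\tfrac1\rho+\sigma+\tilde\ell+\tfrac1\delta\Bigr)^{k}\Bigl(1+\log\tfrac{d}{\varepsilon\mu}\Bigr)^{k}.$$ Write $a\asymp_A b$ for $b/A\le a\le Ab$. Then there are parameters $\eta,r,\mathcal R\in\mathbb R$ and $\mathcal I,T\in\mathbb N$, depending only on these quantities, with $$\eta\asymp_A\min\Bigl(\frac{\varepsilon^2}{\alpha},\frac{\mu\varepsilon}{\sqrt{1-\mu}},\frac{\mu^2\sqrt\varepsilon}{(1-\mu)d}\Bigr),\quad r\asymp_A\frac{\varepsilon}{\sqrt\eta},\quad \mathcal R\asymp_A\sqrt\varepsilon,\quad \mathcal I\asymp_A\frac1{\eta\sqrt\varepsilon},\quad T\asymp_A\frac1{\varepsilon^2\eta}$$ (the last two terms of the minimum are $+\infty$ if $\mu=1$) and $$T\le A\Bigl(\frac{\alpha}{\varepsilon^4}+\frac{\sqrt{1-\mu}}{\mu\varepsilon^3}+\frac{d(1-\mu)}{\mu^2\varepsilon^{2}\sqrt\varepsilon}\Bigr),$$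 such that for all $f$, $\nabla F$, $\mathcal D$, $\mathcal C$, $\tilde{\mathcal D}$ as above and every starting point $x_0$, with probability at least $1-\delta$ all of the following hold for the $T$ iterations of the algorithm: at least one reset occurs; at least half of the reset points (counted by iteration) are $\varepsilon$-SOSP; and the total additional communication due to resets, $d$ times the number of resets, is at most $A\,d/\varepsilon^{3/2}$. -/

import Mathlib

open MeasureTheory ProbabilityTheory
open scoped ENNReal

/-! ### Objective, stochastic gradient oracle, compressor, stationary points -/

/-- The Hessian of `f` at `x`, as the derivative of the gradient field. -/
noncomputable def hessian {d : ℕ} (f : EuclideanSpace ℝ (Fin d) → ℝ)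
    (x : EuclideanSpace ℝ (Fin d)) :
    EuclideanSpace ℝ (Fin d) →L[ℝ] EuclideanSpace ℝ (Fin d) :=
  fderiv ℝ (gradient f) x

/-- `f` is twice differentiable, `fmax`-bounded, `L`-smooth and has a `ρ`-Lipschitz Hessian. -/
structure IsRegularObjective {d : ℕ} (f : EuclideanSpace ℝ (Fin d) → ℝ)
    (fmax L ρ : ℝ) : Prop where
  differentiable : Differentiable ℝ f
  differentiable_gradient : Differentiable ℝ (gradient f)
  bounded : ∀ x y, |f x - f y| ≤ fmax
  smooth : ∀ x y, ‖gradient f x - gradient f y‖ ≤ L * ‖x - y‖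
  lipschitz_hessian : ∀ x y, ‖hessian f x - hessian f y‖ ≤ ρ * ‖x - y‖

/-- `G x θ` (written `∇F(x, θ)` in the literature), with `θ ∼ D`, is an unbiased stochastic
gradient of `f` at `x` with variance at most `σ ^ 2`. The variance is a `[0, ∞]`-valued integral,
so the bound includes square integrability. -/
structure IsStochasticGradient {d : ℕ} {Θ : Type*} [MeasurableSpace Θ]
    (f : EuclideanSpace ℝ (Fin d) → ℝ)
    (G : EuclideanSpace ℝ (Fin d) → Θ → EuclideanSpace ℝ (Fin d))
    (D : Measure Θ) (σ : ℝ) : Prop where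
  measurable : Measurable (fun p : EuclideanSpace ℝ (Fin d) × Θ => G p.1 p.2)
  unbiased : ∀ x, Integrable (G x) D ∧ ∫ θ, G x θ ∂D = gradient f x
  variance_le : ∀ x, ∫⁻ θ, ‖G x θ - gradient f x‖ₑ ^ 2 ∂D ≤ ENNReal.ofReal (σ ^ 2)

/-- Lipschitz stochastic gradient: `‖G x θ - G y θ‖ ≤ ℓ ‖x - y‖` for all `x`, `y`, `θ`. -/
def IsLipschitzStochasticGradient {d : ℕ} {Θ : Type*}
    (G : EuclideanSpace ℝ (Fin d) → Θ → EuclideanSpace ℝ (Fin d)) (ℓ : ℝ) : Prop :=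
  ∀ x y θ, ‖G x θ - G y θ‖ ≤ ℓ * ‖x - y‖

/-- `C` is a `μ`-compressor:
`E ‖x - C (x, θ')‖² ≤ (1 - μ) ‖x‖²` for all `x`, where `θ' ∼ D'`. -/
structure IsCompressor {d : ℕ} {Θ' : Type*} [MeasurableSpace Θ']
    (C : EuclideanSpace ℝ (Fin d) → Θ' → EuclideanSpace ℝ (Fin d))
    (D' : Measure Θ') (μ : ℝ) : Prop where
  measurable : Measurable (fun p : EuclideanSpace ℝ (Fin d) × Θ' => C p.1 p.2)
  compress : ∀ x, ∫⁻ θ', ‖x - C x θ'‖ₑ ^ 2 ∂D' ≤ ENNReal.ofReal ((1 - μ) * ‖x‖ ^ 2)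

/-- `x` is an `ε`-second-order stationary point of the `ρ`-Hessian Lipschitz function `f`:
`‖∇f(x)‖ ≤ ε` and every eigenvalue of the Hessian (hence the smallest one)
is at least `-√(ρ ε)`. -/
def IsSOSP {d : ℕ} (f : EuclideanSpace ℝ (Fin d) → ℝ) (ρ ε : ℝ)
    (x : EuclideanSpace ℝ (Fin d)) : Prop :=
  ‖gradient f x‖ ≤ ε ∧
    ∀ lam : ℝ, Module.End.HasEigenvalue
      (hessian f x : EuclideanSpace ℝ (Fin d) →ₗ[ℝ] EuclideanSpace ℝ (Fin d)) lam →
        -√(ρ * ε) ≤ lam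

/-! ### Compressed SGD with error feedback -/

/-- Parameters of compressed SGD that enter the update rule. -/
structure CompressedSGDParams where
  /-- step size `η` -/
  stepSize : ℝ
  /-- number `I` of iterations for escaping -/
  escapeIters : ℕ
  /-- escaping radius `R` -/
  escapeRadius : ℝ
  /-- whether the compression error is periodically reset to zero -/
  resetError : Bool

/-- State at the start of iteration `t`: the iterate `x_t`, the error `e_t`, the time `t'` of the
last reset and the point `x_{t'}`. -/
structure CompressedSGDState (d : ℕ) where
  x : EuclideanSpace ℝ (Fin d)
  e : EuclideanSpace ℝ (Fin d)
  resetTime : ℕ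
  resetPoint : EuclideanSpace ℝ (Fin d)

namespace CompressedSGD

/-- The initial state: `e_0 = 0`, `t' = 0`, `x_{t'} = x_0`. -/
def initState {d : ℕ} (x₀ : EuclideanSpace ℝ (Fin d)) : CompressedSGDState d where
  x := x₀
  e := 0
  resetTime := 0
  resetPoint := x₀

/-- The reset condition at iteration `t`: `reset_error` is set, and `t - t' > I` or
`‖x_{t'} - (x_t - η e_t)‖ > R`. -/
def ResetTriggered {d : ℕ} (p : CompressedSGDParams) (t : ℕ) (s : CompressedSGDState d) : Prop :=
  p.resetError = true ∧
    (s.resetTime + p.escapeIters < t ∨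
      p.escapeRadius < ‖s.resetPoint - (s.x - p.stepSize • s.e)‖)

open Classical in
/-- If the condition is triggered: `t' ← t`, `x_t ← x_t - η e_t`, `e_t ← 0`. -/
noncomputable def maybeReset {d : ℕ} (p : CompressedSGDParams) (t : ℕ)
    (s : CompressedSGDState d) : CompressedSGDState d :=
  if ResetTriggered p t s then
    { x := s.x - p.stepSize • s.e
      e := 0
      resetTime := t
      resetPoint := s.x - p.stepSize • s.e }
  else s

/-- The gradient step: `g ← C (e + G (x, θ) + ξ, θ')`, `x ← x - η g`,
`e ← e + G (x, θ) + ξ - g`. -/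
noncomputable def gradStep {d : ℕ} {Θ Θ' : Type*} (p : CompressedSGDParams)
    (G : EuclideanSpace ℝ (Fin d) → Θ → EuclideanSpace ℝ (Fin d))
    (C : EuclideanSpace ℝ (Fin d) → Θ' → EuclideanSpace ℝ (Fin d))
    (z : EuclideanSpace ℝ (Fin d) × Θ × Θ') (s : CompressedSGDState d) :
    CompressedSGDState d where
  x := s.x - p.stepSize • C (s.e + G s.x z.2.1 + z.1) z.2.2
  e := s.e + G s.x z.2.1 + z.1 - C (s.e + G s.x z.2.1 + z.1) z.2.2
  resetTime := s.resetTime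
  resetPoint := s.resetPoint

/-- The state at the start of iteration `t`, when iteration `i` draws
`z i = (ξ_i, θ_i, θ'_i)`. -/
noncomputable def state {d : ℕ} {Θ Θ' : Type*} (p : CompressedSGDParams)
    (G : EuclideanSpace ℝ (Fin d) → Θ → EuclideanSpace ℝ (Fin d))
    (C : EuclideanSpace ℝ (Fin d) → Θ' → EuclideanSpace ℝ (Fin d))
    (x₀ : EuclideanSpace ℝ (Fin d)) (z : ℕ → EuclideanSpace ℝ (Fin d) × Θ × Θ') :
    ℕ → CompressedSGDState d
  | 0 => initState x₀
  | t + 1 => gradStep p G C (z t) (maybeReset p t (state p G C x₀ z t))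

/-- The point `x_t` at which the gradient of iteration `t` is taken. When the reset condition is
triggered at iteration `t`, this is the reset point `x_{t'}` with `t' = t`. -/
noncomputable def iterate {d : ℕ} {Θ Θ' : Type*} (p : CompressedSGDParams)
    (G : EuclideanSpace ℝ (Fin d) → Θ → EuclideanSpace ℝ (Fin d))
    (C : EuclideanSpace ℝ (Fin d) → Θ' → EuclideanSpace ℝ (Fin d))
    (x₀ : EuclideanSpace ℝ (Fin d)) (z : ℕ → EuclideanSpace ℝ (Fin d) × Θ × Θ') (t : ℕ) :
    EuclideanSpace ℝ (Fin d) :=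
  (maybeReset p t (state p G C x₀ z t)).x

open Classical in
/-- The iterations `t < T` at which the reset condition is triggered. -/
noncomputable def resetTimes {d : ℕ} {Θ Θ' : Type*} (p : CompressedSGDParams)
    (G : EuclideanSpace ℝ (Fin d) → Θ → EuclideanSpace ℝ (Fin d))
    (C : EuclideanSpace ℝ (Fin d) → Θ' → EuclideanSpace ℝ (Fin d))
    (x₀ : EuclideanSpace ℝ (Fin d)) (z : ℕ → EuclideanSpace ℝ (Fin d) × Θ × Θ') (T : ℕ) :
    Finset ℕ :=
  (Finset.range T).filter (fun t => ResetTriggered p t (state p G C x₀ z t))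

open Classical in
/-- Those reset times whose reset point is an `ε`-SOSP of `f`. -/
noncomputable def sospResetTimes {d : ℕ} {Θ Θ' : Type*} (p : CompressedSGDParams)
    (G : EuclideanSpace ℝ (Fin d) → Θ → EuclideanSpace ℝ (Fin d))
    (C : EuclideanSpace ℝ (Fin d) → Θ' → EuclideanSpace ℝ (Fin d))
    (x₀ : EuclideanSpace ℝ (Fin d)) (z : ℕ → EuclideanSpace ℝ (Fin d) × Θ × Θ') (T : ℕ)
    (f : EuclideanSpace ℝ (Fin d) → ℝ) (ρ ε : ℝ) : Finset ℕ :=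
  (resetTimes p G C x₀ z T).filter (fun t => IsSOSP f ρ ε (iterate p G C x₀ z t))

/-- Additional communication caused by the resets, in transmitted real numbers: each reset sends
the uncompressed `d`-dimensional error vector. -/
noncomputable def resetCommunication {d : ℕ} {Θ Θ' : Type*} (p : CompressedSGDParams)
    (G : EuclideanSpace ℝ (Fin d) → Θ → EuclideanSpace ℝ (Fin d))
    (C : EuclideanSpace ℝ (Fin d) → Θ' → EuclideanSpace ℝ (Fin d))
    (x₀ : EuclideanSpace ℝ (Fin d)) (z : ℕ → EuclideanSpace ℝ (Fin d) × Θ × Θ') (T : ℕ) : ℕ :=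
  ∑ _t ∈ resetTimes p G C x₀ z T, d

end CompressedSGD

/-- The artificial noise: centred isotropic Gaussian on `ℝ^d` with total variance
`E ‖ξ‖² = r ^ 2`, that is, with covariance matrix `(r ^ 2 / d) • 1`. -/
noncomputable def artificialNoise (d : ℕ) (r : ℝ) : Measure (EuclideanSpace ℝ (Fin d)) :=
  multivariateGaussian 0 ((r ^ 2 / (d : ℝ)) • (1 : Matrix (Fin d) (Fin d) ℝ))

/-- `z t = (ξ_t, θ_t, θ'_t)`, `t = 0, 1, …`, is an independent sequence of samples of
`N(0, (r ^ 2 / d) I) ⊗ D ⊗ D'`. -/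
structure IsSampleSequence {Ω : Type*} [MeasurableSpace Ω] (P : Measure Ω) {d : ℕ}
    {Θ Θ' : Type*} [MeasurableSpace Θ] [MeasurableSpace Θ'] (D : Measure Θ) (D' : Measure Θ')
    (r : ℝ) (z : ℕ → Ω → EuclideanSpace ℝ (Fin d) × Θ × Θ') : Prop where
  measurable : ∀ t, Measurable (z t)
  law : ∀ t, P.map (z t) = (artificialNoise d r).prod (D.prod D')
  indep : iIndepFun z P

/-! ### Rates -/

/-- The factor hidden by the `Õ` notation: polynomial in the constants
`L, ρ, fmax, σ, ℓ, 1 / δ` and polylogarithmic in the dimension, the accuracy and the compression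
parameter. -/
noncomputable def hiddenFactor (K : ℝ) (k : ℕ) (fmax L ρ σ ℓ δ : ℝ) (d : ℕ) (ε μ : ℝ) : ℝ :=
  K * (1 + fmax + L + L⁻¹ + ρ + ρ⁻¹ + σ + ℓ + δ⁻¹) ^ k * (1 + Real.log ((d : ℝ) / (ε * μ))) ^ k

/-- `a` and `b` agree up to the factor `A`. -/
def EqUpTo (A a b : ℝ) : Prop := b / A ≤ a ∧ a ≤ A * b

/-- `min (ε² / α) (μ ε / √(1 - μ)) (μ² √ε / ((1 - μ) d))`, written as the reciprocal of the
maximum of the reciprocals, so that for `μ = 1` the last two terms are `+∞` and drop out. -/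
noncomputable def stepScale (α : ℝ) (d : ℕ) (ε μ : ℝ) : ℝ :=
  (max (α / ε ^ 2) (max (√(1 - μ) / (μ * ε)) ((1 - μ) * (d : ℝ) / (μ ^ 2 * √ε))))⁻¹

set_option linter.unusedSectionVars false

/-! ### Chains driven by i.i.d. sequences -/

/-! The shifted iterate y = x − ηe does not see the compression: it moves by −η(∇F(x, θ) + ξ) and is
unchanged by a reset. Compression enters only because the gradient is evaluated at x = y + ηe. The
resets cut a run into epochs of at most I + 1 steps. Each epoch starts with e = 0 and uses samples
independent of its starting point, so it suffices to study one epoch from an arbitrary y₀, frozen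
once it is farther than R from y₀. Every undesirable event of an epoch is charged to S, the expected
sum of the squared gradients met in it.

Budget. The function f(y) + (L²η³/μ)‖e‖² decreases in expectation by (η/4)‖∇f(x)‖² per step, up to
2Lη²χ, where χ bounds the variance of one step. As f varies by at most fmax, this bounds the sum of
S over the whole run (`sum_integral_sq_gradient_le`).

Exit. In N steps y moves by at most the gradient drift plus a martingale, so leaving the ball has
probability at most (6Nη²S + 3Nη²χ)/R² (`measureReal_exit_le`).

Saddle points. Let the Hessian at y₀ have bottom eigenvalue −γ < −√(ρε) with unit eigenvector v. Two
copies of the epoch are run with the same oracle and compressor samples, but with ξ reflected in the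
hyperplane orthogonal to v. Their difference has an explicit Gaussian part along v, amplified by 1 +
ηγ per step. The remainder, caused by variation of the Hessian, oracle noise and compression error,
stays much smaller in mean square if S is small. The Gaussian part outgrows R, so the copies cannot
both stay; having the same law, each leaves with probability at least 1/4. By the exit bound S is
then at least R²/(48Nη²) (`sum_epochGrad_ge_of_negCurvature`).

End points. An end point with large gradient and no negative curvature is unlikely unless S is large
(`measureReal_badEnd_le`). If y₀ has strong negative curvature, it persists throughout the ball and
only an exit can be bad. Otherwise, over the last W steps, W of order 1/(η√(ρε)), the gradient
evolves almost linearly under 1 − ηH. Starting from a time in this window with small expected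
squared gradient, the final gradient is a small remainder plus noise propagated by the operators η(1
− ηH)^k H. The norm of (1 − ηH)^k H decays like 1/(kη) on the positive part of the spectrum, so the
accumulated noise has variance of order ηLχ, however long the window.

Counting. Each reset point is the end of the preceding epoch. If it is not an ε-SOSP, either it has
negative curvature or the preceding epoch ended badly. The budget bounds the expected number of such
resets by a small fraction of T/(I + 1); Markov's inequality and elementary counting give all
conclusions (`run_counts`, `run_succeeds`).

Parameters. All problem constants and the logarithm are bounded by powers of a single 1/y with y ≤
1/6, and each parameter is its rate times a power of y. The exponents are spaced widely enough for
surplus powers of y to absorb every numerical constant. -/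

/-- The trajectory `X₀ = x₀`, `X_{n+1} = h n X_n (z n)`. -/
def chain {α Z : Type*} (h : ℕ → α → Z → α) (x₀ : α) (z : ℕ → Z) : ℕ → α
  | 0 => x₀
  | n + 1 => h n (chain h x₀ z n) (z n)

/-- The parameter in `β` provides joint measurability in the starting point of an epoch and its
samples, which Fubini needs when conditioning on the start. -/
theorem measurable_chain {α β Z : Type*} [MeasurableSpace α] [MeasurableSpace β]
    [MeasurableSpace Z] {h : β → ℕ → α → Z → α}
    (hh : ∀ n, Measurable (fun q : β × α × Z => h q.1 n q.2.1 q.2.2)) {x₀ : β → α}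
    (hx : Measurable x₀) (n : ℕ) :
    Measurable (fun q : β × (ℕ → Z) => chain (h q.1) (x₀ q.1) q.2 n) := by
  induction n with
  | zero => exact hx.comp measurable_fst
  | succ n ih =>
    exact (hh n).comp (measurable_fst.prodMk
      (ih.prodMk ((measurable_pi_apply n).comp measurable_snd)))

/-- `z 0, z 1, …` are independent with law `ν`. -/
structure IsIIDSequence {Ω Z : Type*} [MeasurableSpace Ω] [MeasurableSpace Z] (P : Measure Ω)
    (ν : Measure Z) (z : ℕ → Ω → Z) : Prop where
  measurable : ∀ t, Measurable (z t)
  law : ∀ t, P.map (z t) = ν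
  indep : iIndepFun z P

theorem IsSampleSequence.isIIDSequence {Ω : Type*} [MeasurableSpace Ω] {P : Measure Ω} {d : ℕ}
    {Θ Θ' : Type*} [MeasurableSpace Θ] [MeasurableSpace Θ'] {D : Measure Θ} {D' : Measure Θ'}
    {r : ℝ} {z : ℕ → Ω → EuclideanSpace ℝ (Fin d) × Θ × Θ'} (h : IsSampleSequence P D D' r z) :
    IsIIDSequence P ((artificialNoise d r).prod (D.prod D')) z :=
  ⟨h.measurable, h.law, h.indep⟩

section IID

variable {Ω Z α : Type*} [MeasurableSpace Ω] [MeasurableSpace Z] [MeasurableSpace α]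
  {P : Measure Ω} {ν : Measure Z} {z : ℕ → Ω → Z}

theorem lintegral_indepFun {β : Type*} [MeasurableSpace β] [IsProbabilityMeasure P]
    {X : Ω → α} {Y : Ω → β} (hX : Measurable X) (hY : Measurable Y) (h : IndepFun X Y P)
    {φ : α × β → ℝ≥0∞} (hφ : Measurable φ) :
    ∫⁻ ω, φ (X ω, Y ω) ∂P = ∫⁻ ω, ∫⁻ ω', φ (X ω, Y ω') ∂P ∂P := by
  have h1 := (indepFun_iff_map_prod_eq_prod_map_map hX.aemeasurable hY.aemeasurable).1 h
  have := Measure.isProbabilityMeasure_map (μ := P) hY.aemeasurable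
  rw [← lintegral_map (f := φ) (g := fun ω => (X ω, Y ω)) hφ (hX.prodMk hY), h1,
    lintegral_prod _ hφ.aemeasurable, lintegral_map hφ.lintegral_prod_right' hX]
  refine lintegral_congr fun ω => ?_
  exact lintegral_map (f := fun y => φ (X ω, y)) (hφ.comp measurable_prodMk_left) hY

omit [MeasurableSpace Ω] in
theorem measurable_iSup_comap_eval (z : ℕ → Ω → Z) {S : Set ℕ} {i : ℕ} (hi : i ∈ S) :
    Measurable[⨆ j ∈ S, MeasurableSpace.comap (z j) inferInstance] (z i) := by
  have h1 : Measurable[MeasurableSpace.comap (z i) inferInstance] (z i) :=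
    comap_measurable (z i)
  exact h1.mono (le_iSup₂_of_le (f := fun j (_ : j ∈ S) =>
    MeasurableSpace.comap (z j) inferInstance) i hi le_rfl) le_rfl

theorem IsIIDSequence.indepFun_of_disjoint {β γ : Type*} [MeasurableSpace β] [MeasurableSpace γ]
    (hz : IsIIDSequence P ν z) {S T : Set ℕ} (hST : Disjoint S T) {X : Ω → β} {Y : Ω → γ}
    (hX : Measurable[⨆ j ∈ S, MeasurableSpace.comap (z j) inferInstance] X)
    (hY : Measurable[⨆ j ∈ T, MeasurableSpace.comap (z j) inferInstance] Y) :
    IndepFun X Y P := by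
  have h := indep_iSup_of_disjoint (fun i => (hz.measurable i).comap_le)
    hz.indep.iIndep hST
  rw [IndepFun_iff_Indep]
  exact indep_of_indep_of_le_left (indep_of_indep_of_le_right h hY.comap_le) hX.comap_le

theorem IsIIDSequence.shift (hz : IsIIDSequence P ν z) (t : ℕ) :
    IsIIDSequence P ν (fun k => z (t + k)) :=
  ⟨fun _ => hz.measurable _, fun _ => hz.law _, hz.indep.precomp (add_right_injective t)⟩

theorem IsIIDSequence.comp (hz : IsIIDSequence P ν z) {g : Z → Z} (hg : Measurable g)
    (hν : ν.map g = ν) : IsIIDSequence P ν (fun t ω => g (z t ω)) :=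
  ⟨fun t => hg.comp (hz.measurable t), fun t => by
    rw [← Function.comp_def, ← Measure.map_map hg (hz.measurable t), hz.law, hν],
    hz.indep.comp (fun _ => g) fun _ => hg⟩

variable {h : ℕ → α → Z → α} (hh : ∀ n, Measurable (fun q : α × Z => h n q.1 q.2))
include hh

theorem IsIIDSequence.measurable_chain (hz : IsIIDSequence P ν z) (x₀ : α) (n : ℕ) :
    Measurable (fun ω => chain h x₀ (fun t => z t ω) n) := by
  induction n with
  | zero => exact measurable_const
  | succ n ih => exact (hh n).comp (ih.prodMk (hz.measurable n))

theorem IsIIDSequence.indepFun_chain (hz : IsIIDSequence P ν z) (x₀ : α) (n : ℕ) :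
    IndepFun (fun ω => chain h x₀ (fun t => z t ω) n) (z n) P := by
  refine hz.indepFun_of_disjoint (S := {i | i < n}) (T := {n}) (by simp) ?_
    (measurable_iSup_comap_eval z rfl)
  -- The σ-algebra of the first `n` samples stays fixed while the induction runs over earlier times
  -- `m`.
  suffices H : ∀ m ≤ n, Measurable[⨆ j ∈ {i | i < n}, MeasurableSpace.comap (z j) inferInstance]
      (fun ω => chain h x₀ (fun t => z t ω) m) from H n le_rfl
  intro m hm
  induction m with
  | zero => exact @measurable_const _ _ _ (_) _
  | succ m ih =>
    exact (hh m).comp (@Measurable.prodMk _ _ _ _ _ (_) _ _ (ih (by omega))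
      (measurable_iSup_comap_eval z (S := {i | i < n}) (by simp; omega)))

theorem IsIIDSequence.lintegral_chain_succ [IsProbabilityMeasure P] (hz : IsIIDSequence P ν z)
    (x₀ : α) (n : ℕ) {φ : α → ℝ≥0∞} (hφ : Measurable φ) :
    ∫⁻ ω, φ (chain h x₀ (fun t => z t ω) (n + 1)) ∂P =
      ∫⁻ ω, ∫⁻ b, φ (h n (chain h x₀ (fun t => z t ω) n) b) ∂ν ∂P := by
  have h1 := lintegral_indepFun (hz.measurable_chain hh x₀ n) (hz.measurable n)
    (hz.indepFun_chain hh x₀ n) (φ := fun q => φ (h n q.1 q.2)) (hφ.comp (hh n))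
  simp only [chain]
  rw [h1]
  refine lintegral_congr fun ω => ?_
  rw [← hz.law n]
  exact (lintegral_map (f := fun b => φ (h n (chain h x₀ (fun t => z t ω) n) b))
    (hφ.comp ((hh n).comp measurable_prodMk_left)) (hz.measurable n)).symm

/-- The law of a chain depends only on the law of one sample. This gives the mirrored copy of an
epoch the law of the original. -/
theorem IsIIDSequence.lintegral_chain_congr [IsProbabilityMeasure P] [SFinite ν]
    (hz : IsIIDSequence P ν z) {z' : ℕ → Ω → Z}
    (hz' : IsIIDSequence P ν z') (x₀ : α) (n : ℕ) {φ : α → ℝ≥0∞} (hφ : Measurable φ) :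
    ∫⁻ ω, φ (chain h x₀ (fun t => z t ω) n) ∂P =
      ∫⁻ ω, φ (chain h x₀ (fun t => z' t ω) n) ∂P := by
  induction n generalizing φ with
  | zero => rfl
  | succ n ih =>
    rw [hz.lintegral_chain_succ hh x₀ n hφ, hz'.lintegral_chain_succ hh x₀ n hφ]
    exact ih (φ := fun x => ∫⁻ b, φ (h n x b) ∂ν)
      (Measurable.lintegral_prod_right' (f := fun q : α × Z => φ (h n q.1 q.2)) (hφ.comp (hh n)))

/-- One step of a Lyapunov argument along a chain. -/
theorem IsIIDSequence.integral_chain_succ_le [IsProbabilityMeasure P]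
    (hz : IsIIDSequence P ν z) (x₀ : α) (n : ℕ) {Φ' Φ : α → ℝ} (hΦ' : Measurable Φ')
    (h0' : ∀ x, 0 ≤ Φ' x) (h0 : ∀ x, 0 ≤ Φ x)
    (hint : Integrable (fun ω => Φ (chain h x₀ (fun t => z t ω) n)) P)
    (hstep : ∀ x, ∫⁻ b, ENNReal.ofReal (Φ' (h n x b)) ∂ν ≤ ENNReal.ofReal (Φ x)) :
    Integrable (fun ω => Φ' (chain h x₀ (fun t => z t ω) (n + 1))) P ∧
      ∫ ω, Φ' (chain h x₀ (fun t => z t ω) (n + 1)) ∂P ≤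
        ∫ ω, Φ (chain h x₀ (fun t => z t ω) n) ∂P := by
  -- The step is estimated in [0, ∞], where no integrability of `Φ'` is needed beforehand;
  -- finiteness of the bound then yields it.
  have h1 : ∫⁻ ω, ENNReal.ofReal (Φ' (chain h x₀ (fun t => z t ω) (n + 1))) ∂P ≤
      ENNReal.ofReal (∫ ω, Φ (chain h x₀ (fun t => z t ω) n) ∂P) := by
    rw [hz.lintegral_chain_succ hh x₀ n hΦ'.ennreal_ofReal,
      ofReal_integral_eq_lintegral_ofReal hint (Filter.Eventually.of_forall fun ω => h0 _)]
    exact lintegral_mono fun ω => hstep _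
  have hm : AEStronglyMeasurable (fun ω => Φ' (chain h x₀ (fun t => z t ω) (n + 1))) P :=
    (hΦ'.comp (hz.measurable_chain hh x₀ (n + 1))).aestronglyMeasurable
  refine ⟨⟨hm, ?_⟩, ?_⟩
  · rw [hasFiniteIntegral_iff_ofReal (Filter.Eventually.of_forall fun ω => h0' _)]
    exact h1.trans_lt ENNReal.ofReal_lt_top
  · rw [integral_eq_lintegral_of_nonneg_ae (Filter.Eventually.of_forall fun ω => h0' _) hm]
    exact ENNReal.toReal_le_of_le_ofReal (integral_nonneg fun ω => h0 _) h1

end IID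

/-! ### Regular objectives -/

namespace IsRegularObjective

variable {d : ℕ} {f : EuclideanSpace ℝ (Fin d) → ℝ} {fmax L ρ : ℝ}

theorem hasFDerivAt (hf : IsRegularObjective f fmax L ρ) (x : EuclideanSpace ℝ (Fin d)) :
    HasFDerivAt f (innerSL ℝ (gradient f x)) x :=
  hasGradientAt_iff_hasFDerivAt.1 (hf.differentiable x).hasGradientAt

theorem hasFDerivAt_gradient (hf : IsRegularObjective f fmax L ρ)
    (x : EuclideanSpace ℝ (Fin d)) : HasFDerivAt (gradient f) (hessian f x) x :=
  (hf.differentiable_gradient x).hasFDerivAt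

theorem measurable (hf : IsRegularObjective f fmax L ρ) : Measurable f :=
  hf.differentiable.continuous.measurable

theorem continuous_gradient (hf : IsRegularObjective f fmax L ρ) : Continuous (gradient f) :=
  hf.differentiable_gradient.continuous

theorem measurable_gradient (hf : IsRegularObjective f fmax L ρ) : Measurable (gradient f) :=
  hf.continuous_gradient.measurable

/-- Mean value inequality on the ball around `x` of radius ‖y − x‖, where the gradient differs from
that at `x` by at most L‖y − x‖. The sharper constant L/2 is not needed. -/
theorem abs_sub_sub_inner_le (hf : IsRegularObjective f fmax L ρ) (hL : 0 < L)
    (x y : EuclideanSpace ℝ (Fin d)) :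
    |f y - f x - inner ℝ (gradient f x) (y - x)| ≤ L * ‖y - x‖ ^ 2 := by
  have h := Convex.norm_image_sub_le_of_norm_hasFDerivWithin_le' (𝕜 := ℝ)
    (s := Metric.closedBall x ‖y - x‖) (f := f) (C := L * ‖y - x‖) (x := x) (y := y)
    (f' := fun w => innerSL ℝ (gradient f w)) (φ := innerSL ℝ (gradient f x))
    (fun w _ => (hf.hasFDerivAt w).hasFDerivWithinAt) (fun w hw => by
      rw [← map_sub, innerSL_apply_norm]
      exact (hf.smooth w x).trans (mul_le_mul_of_nonneg_left
        (by simpa [dist_eq_norm] using hw) hL.le))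
    (convex_closedBall _ _) (by simp) (by simp [dist_eq_norm])
  simpa [sq, mul_assoc] using h

/-- The reference point `x₀` is distinct from `x` and `y` because two coupled runs are compared
through the Hessian at their common start. -/
theorem norm_gradient_sub_sub_le (hf : IsRegularObjective f fmax L ρ) (hρ : 0 < ρ)
    {x₀ x y : EuclideanSpace ℝ (Fin d)} {R : ℝ} (hx : ‖x - x₀‖ ≤ R) (hy : ‖y - x₀‖ ≤ R) :
    ‖gradient f y - gradient f x - hessian f x₀ (y - x)‖ ≤ ρ * R * ‖y - x‖ :=
  Convex.norm_image_sub_le_of_norm_hasFDerivWithin_le' (𝕜 := ℝ)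
    (s := Metric.closedBall x₀ R) (f := gradient f)
    (fun w _ => (hf.hasFDerivAt_gradient w).hasFDerivWithinAt) (fun w hw =>
      (hf.lipschitz_hessian w x₀).trans (mul_le_mul_of_nonneg_left
        (by simpa [dist_eq_norm] using hw) hρ.le))
    (convex_closedBall _ _) (by simpa [dist_eq_norm] using hx) (by simpa [dist_eq_norm] using hy)

theorem norm_gradient_sub_sub_le_sq (hf : IsRegularObjective f fmax L ρ) (hρ : 0 < ρ)
    (x y : EuclideanSpace ℝ (Fin d)) :
    ‖gradient f y - gradient f x - hessian f x (y - x)‖ ≤ ρ * ‖y - x‖ ^ 2 := by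
  have := hf.norm_gradient_sub_sub_le hρ (x₀ := x) (x := x) (y := y) (R := ‖y - x‖)
    (by simp) le_rfl
  rwa [sq, ← mul_assoc]

theorem norm_hessian_le (hf : IsRegularObjective f fmax L ρ) (hL : 0 < L)
    (x : EuclideanSpace ℝ (Fin d)) : ‖hessian f x‖ ≤ L :=
  (hf.hasFDerivAt_gradient x).le_of_lip' hL.le (Filter.Eventually.of_forall fun y => hf.smooth y x)

theorem isSymmetric_hessian (hf : IsRegularObjective f fmax L ρ)
    (x : EuclideanSpace ℝ (Fin d)) :
    (hessian f x : EuclideanSpace ℝ (Fin d) →ₗ[ℝ] EuclideanSpace ℝ (Fin d)).IsSymmetric := by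
  intro v w
  have h := second_derivative_symmetric (𝕜 := ℝ) (f := f)
    (f' := fun y => innerSL ℝ (gradient f y)) (x := x)
    (f'' := (innerSL ℝ).comp (hessian f x)) hf.hasFDerivAt
    ((innerSL ℝ).hasFDerivAt.comp x (hf.hasFDerivAt_gradient x)) v w
  simp only [ContinuousLinearMap.comp_apply, innerSL_apply_apply] at h
  rw [ContinuousLinearMap.coe_coe, h, real_inner_comm]

theorem continuous_hessian (hf : IsRegularObjective f fmax L ρ) (hρ : 0 < ρ) :
    Continuous (hessian f) :=
  (LipschitzWith.of_dist_le_mul (K := ⟨ρ, hρ.le⟩) fun x y => by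
    rw [dist_eq_norm, dist_eq_norm]; exact hf.lipschitz_hessian x y).continuous

/-- A gradient step of length 1/(2L) lowers `f` by at least ‖∇f‖²/(4L), and `f` varies by at most
`fmax`. The resulting uniform bound settles the integrability of all gradient terms. -/
theorem norm_gradient_sq_le (hf : IsRegularObjective f fmax L ρ) (hL : 0 < L)
    (x : EuclideanSpace ℝ (Fin d)) : ‖gradient f x‖ ^ 2 ≤ 4 * L * fmax := by
  have h1 := (abs_le.1 (hf.abs_sub_sub_inner_le hL x (x - (2 * L)⁻¹ • gradient f x))).2
  have h2 := (abs_le.1 (hf.bounded (x - (2 * L)⁻¹ • gradient f x) x)).1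
  rw [sub_sub_cancel_left, inner_neg_right, inner_smul_right, real_inner_self_eq_norm_sq,
    norm_neg, norm_smul, mul_pow, Real.norm_of_nonneg (by positivity)] at h1
  have h3 : (2 * L)⁻¹ * ‖gradient f x‖ ^ 2 - L * ((2 * L)⁻¹ ^ 2 * ‖gradient f x‖ ^ 2) ≤ fmax := by
    linarith
  have h4 : (2 * L)⁻¹ * ‖gradient f x‖ ^ 2 - L * ((2 * L)⁻¹ ^ 2 * ‖gradient f x‖ ^ 2) =
      ‖gradient f x‖ ^ 2 / (4 * L) := by field_simp; ring
  rw [h4, div_le_iff₀ (by positivity)] at h3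
  linarith

end IsRegularObjective

/-! ### Negative curvature -/

/-- The quadratic form of the Hessian of `f` at `x` goes below `-κ`. -/
def NegCurvature {d : ℕ} (f : EuclideanSpace ℝ (Fin d) → ℝ) (κ : ℝ)
    (x : EuclideanSpace ℝ (Fin d)) : Prop :=
  ∃ v, inner ℝ (hessian f x v) v < -κ * ‖v‖ ^ 2

theorem IsRegularObjective.measurableSet_negCurvature {d : ℕ}
    {f : EuclideanSpace ℝ (Fin d) → ℝ} {fmax L ρ : ℝ} (hf : IsRegularObjective f fmax L ρ)
    (hρ : 0 < ρ) (κ : ℝ) : MeasurableSet {x | NegCurvature f κ x} := by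
  have h := hf.continuous_hessian hρ
  have : {x | NegCurvature f κ x} = ⋃ v, {x | inner ℝ (hessian f x v) v < -κ * ‖v‖ ^ 2} := by
    ext x; simp [NegCurvature]
  rw [this]
  exact (isOpen_iUnion fun v => isOpen_lt (by fun_prop) continuous_const).measurableSet

/-! ### Diagonalisation of symmetric operators. -/

section Symmetric

variable {d : ℕ} {T : EuclideanSpace ℝ (Fin d) →L[ℝ] EuclideanSpace ℝ (Fin d)}
  (hT : (T : EuclideanSpace ℝ (Fin d) →ₗ[ℝ] EuclideanSpace ℝ (Fin d)).IsSymmetric)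
include hT

/-- A symmetric operator `T` is diagonal in some orthonormal basis. -/
theorem exists_eigenbasis_of_isSymmetric : ∃ (b : OrthonormalBasis (Fin d) ℝ
    (EuclideanSpace ℝ (Fin d))) (lam : Fin d → ℝ), ∀ i, T (b i) = lam i • b i :=
  ⟨hT.eigenvectorBasis (finrank_euclideanSpace_fin), hT.eigenvalues finrank_euclideanSpace_fin,
    fun i => hT.apply_eigenvectorBasis finrank_euclideanSpace_fin i⟩

theorem norm_apply_le_of_eigenbasis {b : OrthonormalBasis (Fin d) ℝ (EuclideanSpace ℝ (Fin d))}
    {lam : Fin d → ℝ} (hb : ∀ i, T (b i) = lam i • b i) {c : ℝ} (hc : ∀ i, |lam i| ≤ c)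
    (hc0 : 0 ≤ c) (x : EuclideanSpace ℝ (Fin d)) : ‖T x‖ ≤ c * ‖x‖ := by
  refine le_of_sq_le_sq ?_ (by positivity)
  rw [mul_pow, ← b.sum_sq_norm_inner_right, ← b.sum_sq_norm_inner_right x, Finset.mul_sum]
  refine Finset.sum_le_sum fun i _ => ?_
  have : inner ℝ (b i) (T x) = lam i * inner ℝ (b i) x := by
    have := hT (b i) x
    simp only [ContinuousLinearMap.coe_coe] at this
    rw [← this, hb, real_inner_smul_left]
  rw [this, norm_mul, mul_pow, Real.norm_eq_abs]
  gcongr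
  exact hc i

end Symmetric

/-! ### Powers of the linearised gradient step 1 − ηH. -/

section Powers

variable {d : ℕ} {H : EuclideanSpace ℝ (Fin d) →L[ℝ] EuclideanSpace ℝ (Fin d)}
  (hH : (H : EuclideanSpace ℝ (Fin d) →ₗ[ℝ] EuclideanSpace ℝ (Fin d)).IsSymmetric)
  {L γ η : ℝ} (hHL : ‖H‖ ≤ L) (hγ : ∀ v, -γ * ‖v‖ ^ 2 ≤ inner ℝ (H v) v)
  (hη : 0 < η) (hηL : η * L ≤ 1) (hγ0 : 0 ≤ γ)

theorem apply_pow_eigenvector {b : EuclideanSpace ℝ (Fin d)} {lam : ℝ} (hb : H b = lam • b)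
    (η : ℝ) (k : ℕ) : ((1 - η • H) ^ k) b = (1 - η * lam) ^ k • b := by
  induction k with
  | zero => simp
  | succ k ih =>
    rw [pow_succ, mul_apply_eq_comp]
    have : (1 - η • H) b = (1 - η * lam) • b := by
      simp [hb, sub_smul, smul_smul]
    rw [this, map_smul, ih, smul_smul, pow_succ, mul_comm]

include hH in
theorem isSymmetric_one_sub_pow (η : ℝ) (k : ℕ) :
    (((1 - η • H) ^ k : EuclideanSpace ℝ (Fin d) →L[ℝ] EuclideanSpace ℝ (Fin d)) :
      EuclideanSpace ℝ (Fin d) →ₗ[ℝ] EuclideanSpace ℝ (Fin d)).IsSymmetric := by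
  have h1 : ∀ v w, inner ℝ ((1 - η • H) v) w = inner ℝ v ((1 - η • H) w) := by
    intro v w
    have := hH v w
    simp only [ContinuousLinearMap.coe_coe] at this
    simp [inner_sub_left, inner_sub_right, real_inner_smul_left, real_inner_smul_right, this]
  induction k with
  | zero => intro v w; simp
  | succ k ih =>
    intro v w
    have h2 := ih ((1 - η • H) v) w
    simp only [ContinuousLinearMap.coe_coe] at h2 ⊢
    rw [pow_succ, mul_apply_eq_comp, h2, h1, ← mul_apply_eq_comp,
      ← pow_succ', ← pow_succ]

include hHL hγ in
theorem eigenvalue_mem_Icc {b : EuclideanSpace ℝ (Fin d)} (hb1 : ‖b‖ = 1) {lam : ℝ}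
    (hb : H b = lam • b) : -γ ≤ lam ∧ lam ≤ L := by
  constructor
  · simpa [hb, real_inner_smul_left, hb1] using hγ b
  · have := H.le_of_opNorm_le hHL b
    rw [hb, norm_smul, hb1, mul_one, mul_one] at this
    exact (le_abs_self _).trans this

include hH hHL hγ hη hηL hγ0 in
theorem norm_one_sub_pow_apply_le (k : ℕ) (x : EuclideanSpace ℝ (Fin d)) :
    ‖((1 - η • H) ^ k) x‖ ≤ (1 + η * γ) ^ k * ‖x‖ := by
  obtain ⟨b, lam, hb⟩ := exists_eigenbasis_of_isSymmetric hH
  refine norm_apply_le_of_eigenbasis (isSymmetric_one_sub_pow hH η k)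
    (fun i => apply_pow_eigenvector (hb i) η k) (fun i => ?_) (by positivity) x
  obtain ⟨h1, h2⟩ := eigenvalue_mem_Icc hHL hγ (b.norm_eq_one i) (hb i)
  rw [abs_pow]
  refine pow_le_pow_left₀ (abs_nonneg _) (abs_le.2 ⟨?_, ?_⟩) k
  · nlinarith
  · nlinarith

theorem mul_one_sub_pow_le {x : ℝ} (h0 : 0 ≤ x) (h1 : x ≤ 1) (k : ℕ) :
    (1 + k * x) * (1 - x) ^ k ≤ 1 := by
  have h := one_add_mul_le_pow (a := x) (by linarith) k
  calc (1 + k * x) * (1 - x) ^ k ≤ (1 + x) ^ k * (1 - x) ^ k := by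
        gcongr
    _ = (1 - x ^ 2) ^ k := by rw [← mul_pow]; ring
    _ ≤ 1 := pow_le_one₀ (by nlinarith) (by nlinarith)

-- On an eigenvalue λ ≥ 0 the quantity λ(1 − ηλ)^k is at most L/(1 + kηL); a negative eigenvalue
-- contributes at most γ(1 + ηγ)^k. The decay in `k` makes the squares of these bounds summable,
-- which controls the gradient noise at the end of an epoch.
include hH hHL hγ hη hηL hγ0 in
theorem norm_one_sub_pow_mul_apply_le (hL : 0 < L) (k : ℕ) (x : EuclideanSpace ℝ (Fin d)) :
    ‖((1 - η • H) ^ k) (H x)‖ ≤ (L / (1 + k * (η * L)) + γ * (1 + η * γ) ^ k) * ‖x‖ := by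
  obtain ⟨b, lam, hb⟩ := exists_eigenbasis_of_isSymmetric hH
  have hsym : (((1 - η • H) ^ k * H : EuclideanSpace ℝ (Fin d) →L[ℝ] EuclideanSpace ℝ (Fin d)) :
      EuclideanSpace ℝ (Fin d) →ₗ[ℝ] EuclideanSpace ℝ (Fin d)).IsSymmetric := by
    intro v w
    have h1 := isSymmetric_one_sub_pow hH η k (H v) w
    have h2 := hH v (((1 - η • H) ^ k) w)
    have h3 : H * (1 - η • H) ^ k = (1 - η • H) ^ k * H :=
      Commute.pow_right (show H * (1 - η • H) = (1 - η • H) * H by ext1 y; simp) k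
    simp only [ContinuousLinearMap.coe_coe] at h1 h2 ⊢
    rw [mul_apply_eq_comp, h1, h2, ← mul_apply_eq_comp, h3]
  refine norm_apply_le_of_eigenbasis hsym (b := b) (lam := fun i => lam i * (1 - η * lam i) ^ k)
    (fun i => ?_) (fun i => ?_) (by positivity) x
  · rw [mul_apply_eq_comp, hb, map_smul, apply_pow_eigenvector (hb i), smul_smul]
  obtain ⟨h1, h2⟩ := eigenvalue_mem_Icc hHL hγ (b.norm_eq_one i) (hb i)
  rw [abs_mul, abs_pow]
  have hle : |1 - η * lam i| = 1 - η * lam i := abs_of_nonneg (by nlinarith)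
  rw [hle]
  rcases le_total 0 (lam i) with h | h
  · have h3 : η * lam i ≤ 1 := by nlinarith
    have h4 := mul_one_sub_pow_le (by positivity : 0 ≤ η * lam i) h3 k
    have h5 : |lam i| * (1 - η * lam i) ^ k ≤ L / (1 + k * (η * L)) := by
      rw [abs_of_nonneg h, le_div_iff₀ (by positivity)]
      -- The map λ ↦ λ/(1 + kηλ) is increasing, so the worst eigenvalue is L.
      have h6 : lam i * (1 + k * (η * L)) ≤ L * (1 + k * (η * lam i)) := by
        nlinarith
      calc lam i * (1 - η * lam i) ^ k * (1 + k * (η * L))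
          = (lam i * (1 + k * (η * L))) * (1 - η * lam i) ^ k := by ring
        _ ≤ (L * (1 + k * (η * lam i))) * (1 - η * lam i) ^ k := by
          apply mul_le_mul_of_nonneg_right h6; exact pow_nonneg (by linarith) k
        _ = L * ((1 + k * (η * lam i)) * (1 - η * lam i) ^ k) := by ring
        _ ≤ L := by nlinarith
    have : 0 ≤ γ * (1 + η * γ) ^ k := by positivity
    linarith
  · have h3 : |lam i| * (1 - η * lam i) ^ k ≤ γ * (1 + η * γ) ^ k := by
      rw [abs_of_nonpos h]
      apply mul_le_mul (by linarith) _ (pow_nonneg (by nlinarith) k) hγ0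
      exact pow_le_pow_left₀ (by nlinarith) (by nlinarith) k
    have : 0 ≤ L / (1 + k * (η * L)) := by positivity
    linarith

end Powers

/-! ### Negative curvature and second-order stationarity. -/

namespace IsRegularObjective

variable {d : ℕ} {f : EuclideanSpace ℝ (Fin d) → ℝ} {fmax L ρ : ℝ}

theorem exists_bottom_eigenvector (hf : IsRegularObjective f fmax L ρ)
    {κ : ℝ} {x : EuclideanSpace ℝ (Fin d)} (h : NegCurvature f κ x) :
    ∃ (γ : ℝ) (v : EuclideanSpace ℝ (Fin d)), κ < γ ∧ ‖v‖ = 1 ∧ hessian f x v = -γ • v ∧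
      ∀ w, -γ * ‖w‖ ^ 2 ≤ inner ℝ (hessian f x w) w := by
  obtain ⟨b, lam, hb⟩ := exists_eigenbasis_of_isSymmetric (hf.isSymmetric_hessian x)
  have key : ∀ w, inner ℝ (hessian f x w) w = ∑ i, lam i * ‖inner ℝ (b i) w‖ ^ 2 := by
    intro w
    rw [← b.sum_inner_mul_inner]
    refine Finset.sum_congr rfl fun i _ => ?_
    have := hf.isSymmetric_hessian x w (b i)
    simp only [ContinuousLinearMap.coe_coe] at this
    rw [this, hb, real_inner_smul_right, real_inner_comm, Real.norm_eq_abs, sq_abs]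
    ring
  obtain ⟨v, hv⟩ := h
  -- In dimension zero the quadratic form vanishes and no negative direction exists, so there is a
  -- smallest eigenvalue.
  have hd : (Finset.univ : Finset (Fin d)).Nonempty := by
    by_contra hne
    rw [Finset.not_nonempty_iff_eq_empty] at hne
    have h2 := b.sum_sq_norm_inner_right v
    rw [hne, Finset.sum_empty] at h2
    rw [key, hne, Finset.sum_empty, ← h2] at hv
    simp at hv
  obtain ⟨i, -, hi⟩ := Finset.exists_min_image Finset.univ lam hd
  have hmin : ∀ w, lam i * ‖w‖ ^ 2 ≤ inner ℝ (hessian f x w) w := by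
    intro w
    rw [key, ← b.sum_sq_norm_inner_right w, Finset.mul_sum]
    exact Finset.sum_le_sum fun j hj => mul_le_mul_of_nonneg_right (hi j hj) (by positivity)
  refine ⟨-lam i, b i, ?_, b.norm_eq_one i, by rw [neg_neg, hb], by simpa using hmin⟩
  have h1 := (hmin v).trans_lt hv
  have h3 : (lam i + κ) * ‖v‖ ^ 2 < 0 := by linarith
  have : lam i + κ < 0 := by
    by_contra hcon
    have : 0 ≤ (lam i + κ) * ‖v‖ ^ 2 := mul_nonneg (by linarith) (by positivity)
    linarith
  linarith

theorem isSOSP_of_not_negCurvature {ε : ℝ}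
    {x : EuclideanSpace ℝ (Fin d)} (h : ¬ NegCurvature f (√(ρ * ε)) x)
    (hg : ‖gradient f x‖ ≤ ε) : IsSOSP f ρ ε x := by
  refine ⟨hg, fun lam hlam => ?_⟩
  obtain ⟨v, hv⟩ := hlam.exists_hasEigenvector
  by_contra hcon
  refine h ⟨v, ?_⟩
  have h1 := hv.apply_eq_smul
  simp only [ContinuousLinearMap.coe_coe] at h1
  rw [h1, real_inner_smul_left, real_inner_self_eq_norm_sq]
  have : 0 < ‖v‖ := norm_pos_iff.2 hv.2
  have : 0 < ‖v‖ ^ 2 := by positivity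
  nlinarith

/-- Used with s = κ: curvature below −2κ at the start of an epoch remains below −κ in the whole ball
when ρR ≤ κ. -/
theorem negCurvature_of_near (hf : IsRegularObjective f fmax L ρ) {κ s : ℝ}
    {x y : EuclideanSpace ℝ (Fin d)} (hxy : ρ * ‖y - x‖ ≤ s)
    (h : NegCurvature f (κ + s) x) : NegCurvature f κ y := by
  obtain ⟨v, hv⟩ := h
  refine ⟨v, ?_⟩
  have h1 : inner ℝ (hessian f y v) v - inner ℝ (hessian f x v) v ≤ s * ‖v‖ ^ 2 := by
    rw [← inner_sub_left, ← sub_apply]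
    calc _ ≤ ‖(hessian f y - hessian f x) v‖ * ‖v‖ := real_inner_le_norm _ _
      _ ≤ (s * ‖v‖) * ‖v‖ := by
        gcongr
        exact ContinuousLinearMap.le_of_opNorm_le _ ((hf.lipschitz_hessian y x).trans hxy) v
      _ = _ := by ring
  linarith

end IsRegularObjective

/-! ### The artificial noise -/

section Gaussian

variable (d : ℕ) (r : ℝ)

instance isGaussian_artificialNoise : IsGaussian (artificialNoise d r) :=
  inferInstanceAs (IsGaussian (multivariateGaussian _ _))

theorem posSemidef_noiseCovariance :
    ((r ^ 2 / (d : ℝ)) • (1 : Matrix (Fin d) (Fin d) ℝ)).PosSemidef :=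
  Matrix.PosSemidef.one.smul (by positivity)

theorem integral_artificialNoise : ∫ x, x ∂(artificialNoise d r) = 0 :=
  integral_id_multivariateGaussian

theorem covarianceBilin_artificialNoise (x y : EuclideanSpace ℝ (Fin d)) :
    covarianceBilin (artificialNoise d r) x y = r ^ 2 / d * inner ℝ x y := by
  rw [artificialNoise, covarianceBilin_multivariateGaussian (posSemidef_noiseCovariance d r),
    Matrix.smul_mulVec, Matrix.one_mulVec, dotProduct_smul, smul_eq_mul, PiLp.inner_apply]
  simp [dotProduct, mul_comm]

theorem variance_inner_artificialNoise (v : EuclideanSpace ℝ (Fin d)) :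
    Var[fun x => inner ℝ v x; artificialNoise d r] = r ^ 2 / d * ‖v‖ ^ 2 := by
  rw [← covariance_self (by fun_prop), ← covarianceBilin_apply_eq_cov IsGaussian.memLp_two_id,
    covarianceBilin_artificialNoise, real_inner_self_eq_norm_sq]

theorem integral_inner_artificialNoise (v : EuclideanSpace ℝ (Fin d)) :
    ∫ x, inner ℝ v x ∂(artificialNoise d r) = 0 := by
  rw [integral_inner IsGaussian.integrable_fun_id v, integral_artificialNoise, inner_zero_right]

theorem map_inner_artificialNoise (v : EuclideanSpace ℝ (Fin d)) :
    (artificialNoise d r).map (fun x => inner ℝ v x) =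
      gaussianReal 0 (r ^ 2 / d * ‖v‖ ^ 2).toNNReal := by
  have h := IsGaussian.map_eq_gaussianReal (μ := artificialNoise d r) (innerSL ℝ v)
  have h1 : ⇑(innerSL ℝ v) = fun x => inner ℝ v x := rfl
  rw [h1, integral_inner_artificialNoise, variance_inner_artificialNoise] at h
  exact h

theorem integral_sq_inner_artificialNoise (v : EuclideanSpace ℝ (Fin d)) :
    ∫ x, (inner ℝ v x) ^ 2 ∂(artificialNoise d r) = r ^ 2 / d * ‖v‖ ^ 2 := by
  rw [← variance_inner_artificialNoise, variance_of_integral_eq_zero (by fun_prop)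
    (integral_inner_artificialNoise d r v)]

theorem integrable_sq_norm_artificialNoise :
    Integrable (fun x => ‖x‖ ^ 2) (artificialNoise d r) :=
  (IsGaussian.memLp_two_id (μ := artificialNoise d r)).integrable_norm_pow (by norm_num)

theorem integral_sq_norm_artificialNoise (hd : 1 ≤ d) :
    ∫ x, ‖x‖ ^ 2 ∂(artificialNoise d r) = r ^ 2 := by
  have h1 : ∀ x : EuclideanSpace ℝ (Fin d), ‖x‖ ^ 2 =
      ∑ i, (inner ℝ (EuclideanSpace.basisFun (Fin d) ℝ i) x) ^ 2 := by
    intro x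
    rw [← (EuclideanSpace.basisFun (Fin d) ℝ).sum_sq_norm_inner_right x]
    simp
  simp_rw [h1]
  rw [integral_finsetSum]
  · simp_rw [integral_sq_inner_artificialNoise]
    have : (d : ℝ) ≠ 0 := by positivity
    simp
    field_simp
  · intro i _
    refine (integrable_sq_norm_artificialNoise d r).mono' (by fun_prop)
      (Filter.Eventually.of_forall fun x => ?_)
    rw [Real.norm_of_nonneg (by positivity), ← sq_abs]
    gcongr
    simpa using abs_real_inner_le_norm (EuclideanSpace.basisFun (Fin d) ℝ i) x

/-- Reflection in the hyperplane orthogonal to `v`. -/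
noncomputable def mirror {d : ℕ} (v : EuclideanSpace ℝ (Fin d)) :
    EuclideanSpace ℝ (Fin d) ≃ₗᵢ[ℝ] EuclideanSpace ℝ (Fin d) :=
  (ℝ ∙ v)ᗮ.reflection

theorem mirror_apply {d : ℕ} {v : EuclideanSpace ℝ (Fin d)} (hv : ‖v‖ = 1)
    (x : EuclideanSpace ℝ (Fin d)) : mirror v x = x - (2 * inner ℝ v x) • v := by
  rw [mirror, Submodule.reflection_orthogonal_apply, Submodule.reflection_singleton_apply, hv]
  simp only [RCLike.ofReal_real_eq_id, id_eq, one_pow, div_one, neg_sub, mul_smul]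
  simp [two_smul]

/-- A Gaussian measure is determined by mean and covariance. Here the mean is zero and the
covariance is a multiple of the inner product, which the adjoint of an orthogonal map preserves. -/
theorem map_mirror_artificialNoise (v : EuclideanSpace ℝ (Fin d)) :
    (artificialNoise d r).map (mirror v) = artificialNoise d r := by
  have h0 : (mirror v : EuclideanSpace ℝ (Fin d) → EuclideanSpace ℝ (Fin d)) =
      ((mirror v).toContinuousLinearEquiv : EuclideanSpace ℝ (Fin d) →L[ℝ]
        EuclideanSpace ℝ (Fin d)) := rfl
  rw [h0]
  apply IsGaussian.ext
  · simp only [id_eq]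
    rw [ContinuousLinearMap.integral_id_map IsGaussian.integrable_id, integral_artificialNoise,
      map_zero]
  · ext x y
    rw [covarianceBilin_map IsGaussian.memLp_two_id, covarianceBilin_artificialNoise,
      covarianceBilin_artificialNoise]
    congr 1
    rw [ContinuousLinearMap.adjoint_inner_left]
    have h1 : ∀ w, ((mirror v).toContinuousLinearEquiv : EuclideanSpace ℝ (Fin d) →L[ℝ]
        EuclideanSpace ℝ (Fin d)) (ContinuousLinearMap.adjoint
        ((mirror v).toContinuousLinearEquiv : EuclideanSpace ℝ (Fin d) →L[ℝ]
        EuclideanSpace ℝ (Fin d)) w) = w := by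
      intro w
      refine ext_inner_right ℝ fun u => ?_
      obtain ⟨u', rfl⟩ := (mirror v).surjective u
      have h2 : ∀ a b, inner ℝ (((mirror v).toContinuousLinearEquiv :
        EuclideanSpace ℝ (Fin d) →L[ℝ] EuclideanSpace ℝ (Fin d)) a) (mirror v b) = inner ℝ a b :=
        fun a b => (mirror v).inner_map_map a b
      rw [h2, ContinuousLinearMap.adjoint_inner_left]
      rfl
    rw [h1]

end Gaussian

/-! ### Centred random vectors -/

/-- `m` has mean zero and `E ‖m‖² ≤ V` under `ν`. -/
structure IsCentered {Z : Type*} [MeasurableSpace Z] {d : ℕ} (ν : Measure Z)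
    (m : Z → EuclideanSpace ℝ (Fin d)) (V : ℝ) : Prop where
  integrable : Integrable m ν
  integral_eq : ∫ b, m b ∂ν = 0
  integrable_sq : Integrable (fun b => ‖m b‖ ^ 2) ν
  sq_le : ∫ b, ‖m b‖ ^ 2 ∂ν ≤ V

namespace IsCentered

variable {Z : Type*} [MeasurableSpace Z] {d : ℕ} {ν : Measure Z}
    {m : Z → EuclideanSpace ℝ (Fin d)} {V : ℝ}

theorem nonneg (h : IsCentered ν m V) : 0 ≤ V :=
  (integral_nonneg fun _ => by positivity).trans h.sq_le

theorem map (h : IsCentered ν m V) (T : EuclideanSpace ℝ (Fin d) →L[ℝ] EuclideanSpace ℝ (Fin d))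
    {c : ℝ} (hT : ∀ x, ‖T x‖ ≤ c * ‖x‖) : IsCentered ν (fun b => T (m b)) (c ^ 2 * V) := by
  have hle : ∀ b, ‖T (m b)‖ ^ 2 ≤ c ^ 2 * ‖m b‖ ^ 2 := fun b => by
    rw [← mul_pow]; exact pow_le_pow_left₀ (norm_nonneg _) (hT _) 2
  have hi : Integrable (fun b => ‖T (m b)‖ ^ 2) ν :=
    (h.integrable_sq.const_mul (c ^ 2)).mono'
      (by have := h.integrable.aestronglyMeasurable
          exact ((T.continuous.comp_aestronglyMeasurable this).norm.pow 2))
      (Filter.Eventually.of_forall fun b => by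
        rw [Real.norm_of_nonneg (by positivity)]; exact hle b)
  refine ⟨T.integrable_comp h.integrable, ?_, hi, ?_⟩
  · rw [T.integral_comp_comm h.integrable, h.integral_eq, map_zero]
  · calc _ ≤ ∫ b, c ^ 2 * ‖m b‖ ^ 2 ∂ν := integral_mono hi (h.integrable_sq.const_mul _) hle
      _ = c ^ 2 * ∫ b, ‖m b‖ ^ 2 ∂ν := integral_const_mul _ _
      _ ≤ _ := mul_le_mul_of_nonneg_left h.sq_le (by positivity)

theorem smul (h : IsCentered ν m V) (c : ℝ) : IsCentered ν (fun b => c • m b) (c ^ 2 * V) := by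
  have := h.map (c • ContinuousLinearMap.id ℝ _) (c := |c|) (by simp [norm_smul])
  simpa using this

theorem integrable_sq_add [IsProbabilityMeasure ν] (h : IsCentered ν m V)
    (a : EuclideanSpace ℝ (Fin d)) : Integrable (fun b => ‖a + m b‖ ^ 2) ν := by
  simp_rw [norm_add_sq_real]
  exact ((integrable_const _).add ((h.integrable.const_inner a).const_mul 2)).add h.integrable_sq

theorem integral_sq_add_le [IsProbabilityMeasure ν] (h : IsCentered ν m V)
    (a : EuclideanSpace ℝ (Fin d)) : ∫ b, ‖a + m b‖ ^ 2 ∂ν ≤ ‖a‖ ^ 2 + V := by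
  simp_rw [norm_add_sq_real]
  have hadd : Integrable (fun b => ‖a‖ ^ 2 + 2 * inner ℝ a (m b)) ν :=
    (integrable_const _).add ((h.integrable.const_inner a).const_mul 2)
  rw [integral_add hadd h.integrable_sq, integral_add (integrable_const _) ((h.integrable.const_inner a).const_mul 2),
    integral_const_mul, integral_inner h.integrable, h.integral_eq]
  simpa using h.sq_le

theorem lintegral_sq_add_le [IsProbabilityMeasure ν] (h : IsCentered ν m V)
    (a : EuclideanSpace ℝ (Fin d)) :
    ∫⁻ b, ENNReal.ofReal (‖a + m b‖ ^ 2) ∂ν ≤ ENNReal.ofReal (‖a‖ ^ 2 + V) := by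
  rw [← ofReal_integral_eq_lintegral_ofReal (h.integrable_sq_add a)
    (Filter.Eventually.of_forall fun b => by positivity)]
  exact ENNReal.ofReal_le_ofReal (h.integral_sq_add_le a)

theorem of_lintegral [IsProbabilityMeasure ν] (hm : Integrable m ν) (h0 : ∫ b, m b ∂ν = 0)
    (hV : 0 ≤ V) (h : ∫⁻ b, ENNReal.ofReal (‖m b‖ ^ 2) ∂ν ≤ ENNReal.ofReal V) :
    IsCentered ν m V := by
  have hms : AEStronglyMeasurable (fun b => ‖m b‖ ^ 2) ν := hm.aestronglyMeasurable.norm.pow 2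
  refine ⟨hm, h0, ⟨hms, ?_⟩, ?_⟩
  · rw [hasFiniteIntegral_iff_ofReal (Filter.Eventually.of_forall fun b => by positivity)]
    exact h.trans_lt ENNReal.ofReal_lt_top
  · rw [integral_eq_lintegral_of_nonneg_ae
      (Filter.Eventually.of_forall fun b => by positivity) hms]
    exact ENNReal.toReal_le_of_le_ofReal hV h

/-- No independence of the two summands is used; this is the origin of the factors 2 in the step
variance 2σ² + 2r². -/
theorem add [IsProbabilityMeasure ν] {m' : Z → EuclideanSpace ℝ (Fin d)} {V' : ℝ}
    (h : IsCentered ν m V) (h' : IsCentered ν m' V') :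
    IsCentered ν (fun b => m b + m' b) (2 * V + 2 * V') := by
  have hle : ∀ b, ‖m b + m' b‖ ^ 2 ≤ 2 * ‖m b‖ ^ 2 + 2 * ‖m' b‖ ^ 2 := fun b => by
    have h1 := norm_add_le (m b) (m' b)
    nlinarith [sq_nonneg (‖m b‖ - ‖m' b‖), norm_nonneg (m b + m' b)]
  have hi2 := (h.integrable_sq.const_mul 2).add (h'.integrable_sq.const_mul 2)
  have hi : Integrable (fun b => ‖m b + m' b‖ ^ 2) ν :=
    hi2.mono' ((h.integrable.add h'.integrable).aestronglyMeasurable.norm.pow 2)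
      (Filter.Eventually.of_forall fun b => by
        rw [Real.norm_of_nonneg (by positivity)]; exact hle b)
  refine ⟨h.integrable.add h'.integrable, ?_, hi, ?_⟩
  · rw [integral_add h.integrable h'.integrable, h.integral_eq, h'.integral_eq, add_zero]
  · refine (integral_mono hi hi2 hle).trans ?_
    simp only [Pi.add_apply]
    rw [integral_add (h.integrable_sq.const_mul 2) (h'.integrable_sq.const_mul 2),
      integral_const_mul, integral_const_mul]
    linarith [h.sq_le, h'.sq_le]

theorem comp {Z' : Type*} [MeasurableSpace Z'] {ν' : Measure Z'} (h : IsCentered ν m V)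
    {g : Z' → Z} (hg : MeasurePreserving g ν' ν) : IsCentered ν' (fun b => m (g b)) V := by
  have h1 := hg.map_eq
  subst h1
  have hm := h.integrable
  refine ⟨hm.comp_measurable hg.measurable, ?_, h.integrable_sq.comp_measurable hg.measurable, ?_⟩
  · rw [← integral_map hg.measurable.aemeasurable hm.aestronglyMeasurable, h.integral_eq]
  · rw [← integral_map (f := fun b => ‖m b‖ ^ 2) hg.measurable.aemeasurable
      h.integrable_sq.aestronglyMeasurable]
    exact h.sq_le

end IsCentered

theorem ofReal_sq_norm {d : ℕ} (x : EuclideanSpace ℝ (Fin d)) :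
    ENNReal.ofReal (‖x‖ ^ 2) = ‖x‖ₑ ^ 2 := by
  rw [ENNReal.ofReal_pow (norm_nonneg _), ofReal_norm]

/-! ### Moments of one step -/

section OneStep

variable {d : ℕ} {Θ Θ' : Type*} [MeasurableSpace Θ] [MeasurableSpace Θ']
  {D : Measure Θ} {D' : Measure Θ'} [IsProbabilityMeasure D] [IsProbabilityMeasure D']
  {f : EuclideanSpace ℝ (Fin d) → ℝ}
  {G : EuclideanSpace ℝ (Fin d) → Θ → EuclideanSpace ℝ (Fin d)}
  {C : EuclideanSpace ℝ (Fin d) → Θ' → EuclideanSpace ℝ (Fin d)}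
  {fmax L ρ σ μ r ℓ : ℝ}

/-- The law of one sample. -/
noncomputable abbrev sampleLaw (d : ℕ) (r : ℝ) (D : Measure Θ) (D' : Measure Θ') :
    Measure (EuclideanSpace ℝ (Fin d) × Θ × Θ') :=
  (artificialNoise d r).prod (D.prod D')

theorem measurePreserving_theta : MeasurePreserving
    (fun b : EuclideanSpace ℝ (Fin d) × Θ × Θ' => b.2.1) (sampleLaw d r D D') D :=
  measurePreserving_fst.comp measurePreserving_snd

theorem IsStochasticGradient.isCentered (hG : IsStochasticGradient f G D σ)
    (x : EuclideanSpace ℝ (Fin d)) : IsCentered D (fun θ => G x θ - gradient f x) (σ ^ 2) := by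
  refine IsCentered.of_lintegral ((hG.unbiased x).1.sub (integrable_const _)) ?_ (sq_nonneg σ) ?_
  · rw [integral_sub (hG.unbiased x).1 (integrable_const _), (hG.unbiased x).2]
    simp
  · simp_rw [ofReal_sq_norm]
    exact hG.variance_le x

/-- The total noise of one stochastic gradient step. -/
theorem IsStochasticGradient.isCentered_noise (hG : IsStochasticGradient f G D σ) (hd : 1 ≤ d)
    (x : EuclideanSpace ℝ (Fin d)) :
    IsCentered (sampleLaw d r D D') (fun b => (G x b.2.1 - gradient f x) + b.1)
      (2 * σ ^ 2 + 2 * r ^ 2) := by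
  have h2 : IsCentered (artificialNoise d r) (fun x => x) (r ^ 2) :=
    ⟨IsGaussian.integrable_id, integral_artificialNoise d r,
      integrable_sq_norm_artificialNoise d r, (integral_sq_norm_artificialNoise d r hd).le⟩
  exact ((hG.isCentered x).comp measurePreserving_theta).add (h2.comp measurePreserving_fst)

/-- A bound for the variance of the difference of the oracle at two points. -/
def OracleDifferenceBound (f : EuclideanSpace ℝ (Fin d) → ℝ)
    (G : EuclideanSpace ℝ (Fin d) → Θ → EuclideanSpace ℝ (Fin d)) (D : Measure Θ)
    (ℓ σ : ℝ) : Prop :=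
  ∀ x y, IsCentered D (fun θ => (G x θ - gradient f x) - (G y θ - gradient f y))
    (4 * ℓ ^ 2 * ‖x - y‖ ^ 2 + 4 * σ ^ 2)

/-- Without a Lipschitz oracle the bound does not vanish as `x` approaches `y`. The artificial noise
must then dominate σ in the single direction of escape, where its variance is only r²/d; hence α =
d. -/
theorem IsStochasticGradient.oracleDifferenceBound (hG : IsStochasticGradient f G D σ) :
    OracleDifferenceBound f G D 0 σ := by
  intro x y
  have h := (hG.isCentered x).add ((hG.isCentered y).smul (-1))
  simp only [neg_smul, one_smul, ← sub_eq_add_neg] at h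
  exact ⟨h.integrable, h.integral_eq, h.integrable_sq, by linarith [h.sq_le]⟩

/-- The gradient inherits the Lipschitz constant ℓ by integration. The variance is now proportional
to ‖x − y‖² and only slightly changes the growth rate of the coupled difference, so α = 1 suffices.
-/
theorem IsStochasticGradient.oracleDifferenceBound_of_lipschitz
    (hG : IsStochasticGradient f G D σ) (hℓ : IsLipschitzStochasticGradient G ℓ) :
    OracleDifferenceBound f G D ℓ 0 := by
  intro x y
  have hgr : ‖gradient f x - gradient f y‖ ≤ ℓ * ‖x - y‖ := by
    rw [← (hG.unbiased x).2, ← (hG.unbiased y).2,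
      ← integral_sub (hG.unbiased x).1 (hG.unbiased y).1]
    refine (norm_integral_le_of_norm_le_const (C := ℓ * ‖x - y‖)
      (Filter.Eventually.of_forall fun θ => hℓ x y θ)).trans ?_
    simp
  have hi : Integrable (fun θ => (G x θ - gradient f x) - (G y θ - gradient f y)) D :=
    (hG.isCentered x).integrable.sub (hG.isCentered y).integrable
  refine IsCentered.of_lintegral hi ?_ (by positivity) ?_
  · rw [integral_sub (hG.isCentered x).integrable (hG.isCentered y).integrable,
      (hG.isCentered x).integral_eq, (hG.isCentered y).integral_eq, sub_zero]
  · calc _ ≤ ∫⁻ θ, ENNReal.ofReal (4 * ℓ ^ 2 * ‖x - y‖ ^ 2 + 4 * 0 ^ 2) ∂D := by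
          refine lintegral_mono fun θ => ENNReal.ofReal_le_ofReal ?_
          have h1 : ‖G x θ - gradient f x - (G y θ - gradient f y)‖ ≤ 2 * (ℓ * ‖x - y‖) := by
            rw [sub_sub_sub_comm]
            refine (norm_sub_le _ _).trans ?_
            linarith [hℓ x y θ]
          calc _ ≤ (2 * (ℓ * ‖x - y‖)) ^ 2 := pow_le_pow_left₀ (norm_nonneg _) h1 2
            _ = _ := by ring
      _ = _ := by simp

theorem lintegral_prod_prod_mono {α β γ : Type*} [MeasurableSpace α] [MeasurableSpace β]
    [MeasurableSpace γ] {κ : Measure α} {κ' : Measure β} {κ'' : Measure γ} [SFinite κ'] [SFinite κ'']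
    {F F' : α × β × γ → ℝ≥0∞} (hF : Measurable F) (hF' : Measurable F')
    (h : ∀ a b, ∫⁻ c, F (a, b, c) ∂κ'' ≤ ∫⁻ c, F' (a, b, c) ∂κ'') :
    ∫⁻ q, F q ∂(κ.prod (κ'.prod κ'')) ≤ ∫⁻ q, F' q ∂(κ.prod (κ'.prod κ'')) := by
  rw [lintegral_prod _ hF.aemeasurable, lintegral_prod _ hF'.aemeasurable]
  refine lintegral_mono fun a => ?_
  rw [lintegral_prod (fun q => F (a, q)) (hF.comp measurable_prodMk_left).aemeasurable,
    lintegral_prod (fun q => F' (a, q)) (hF'.comp measurable_prodMk_left).aemeasurable]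
  exact lintegral_mono fun b => h a b

/-- The compressor is integrated out first, with the compressed vector fixed, and the centred
gradient noise afterwards. -/
theorem IsCompressor.lintegral_error_le (hC : IsCompressor C D' μ) (hμ : μ ≤ 1)
    (hG : IsStochasticGradient f G D σ) (hd : 1 ≤ d) (x e : EuclideanSpace ℝ (Fin d)) :
    ∫⁻ b, ENNReal.ofReal (‖e + G x b.2.1 + b.1 - C (e + G x b.2.1 + b.1) b.2.2‖ ^ 2)
        ∂(sampleLaw d r D D') ≤
      ENNReal.ofReal ((1 - μ) * (‖e + gradient f x‖ ^ 2 + (2 * σ ^ 2 + 2 * r ^ 2))) := by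
  have hGx : Measurable (G x) := hG.measurable.comp measurable_prodMk_left
  have hCm := hC.measurable
  have hmeas : Measurable fun b : EuclideanSpace ℝ (Fin d) × Θ × Θ' =>
      ENNReal.ofReal (‖e + G x b.2.1 + b.1 - C (e + G x b.2.1 + b.1) b.2.2‖ ^ 2) := by
    have : Measurable fun b : EuclideanSpace ℝ (Fin d) × Θ × Θ' => e + G x b.2.1 + b.1 :=
      (measurable_const.add (hGx.comp (measurable_fst.comp measurable_snd))).add measurable_fst
    have h2 := hCm.comp (this.prodMk (measurable_snd.comp measurable_snd))
    exact ((this.sub h2).norm.pow_const 2).ennreal_ofReal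
  have hmeas2 : Measurable fun b : EuclideanSpace ℝ (Fin d) × Θ × Θ' =>
      ENNReal.ofReal ((1 - μ) * ‖e + G x b.2.1 + b.1‖ ^ 2) := by
    have : Measurable fun b : EuclideanSpace ℝ (Fin d) × Θ × Θ' => e + G x b.2.1 + b.1 :=
      (measurable_const.add (hGx.comp (measurable_fst.comp measurable_snd))).add measurable_fst
    exact ((this.norm.pow_const 2).const_mul _).ennreal_ofReal
  calc _ ≤ ∫⁻ b, ENNReal.ofReal ((1 - μ) * ‖e + G x b.2.1 + b.1‖ ^ 2) ∂(sampleLaw d r D D') := by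
        refine lintegral_prod_prod_mono hmeas hmeas2 fun ξ θ => ?_
        simp only [lintegral_const, measure_univ, mul_one]
        simp_rw [ofReal_sq_norm]
        exact hC.compress _
    _ = ENNReal.ofReal (1 - μ) * ∫⁻ b, ENNReal.ofReal (‖e + gradient f x +
          ((G x b.2.1 - gradient f x) + b.1)‖ ^ 2) ∂(sampleLaw d r D D') := by
        rw [← lintegral_const_mul']
        · refine lintegral_congr fun b => ?_
          rw [ENNReal.ofReal_mul (by linarith)]
          congr 4
          abel
        · exact ENNReal.ofReal_ne_top
    _ ≤ ENNReal.ofReal (1 - μ) *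
          ENNReal.ofReal (‖e + gradient f x‖ ^ 2 + (2 * σ ^ 2 + 2 * r ^ 2)) := by
        gcongr
        exact (hG.isCentered_noise hd x).lintegral_sq_add_le _
    _ = _ := by rw [ENNReal.ofReal_mul (by linarith)]

end OneStep

/-! ### Elementary inequalities -/

theorem sq_add_le_young {κ : ℝ} (hκ : 0 < κ) (a b : ℝ) :
    (a + b) ^ 2 ≤ (1 + κ) * a ^ 2 + (1 + κ⁻¹) * b ^ 2 := by
  have h : 2 * a * b ≤ κ * a ^ 2 + κ⁻¹ * b ^ 2 := by
    have h1 : κ * a ^ 2 + κ⁻¹ * b ^ 2 - 2 * a * b = κ⁻¹ * (κ * a - b) ^ 2 := by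
      field_simp; ring
    have : 0 ≤ κ⁻¹ * (κ * a - b) ^ 2 := by positivity
    linarith
  linarith [h, add_sq a b]

theorem sq_norm_add_le_young {d : ℕ} {κ : ℝ} (hκ : 0 < κ) (a b : EuclideanSpace ℝ (Fin d)) :
    ‖a + b‖ ^ 2 ≤ (1 + κ) * ‖a‖ ^ 2 + (1 + κ⁻¹) * ‖b‖ ^ 2 :=
  (pow_le_pow_left₀ (norm_nonneg _) (norm_add_le a b) 2).trans (sq_add_le_young hκ _ _)

/-- Discrete Gronwall inequality: 1 + c ≤ exp c, and each source term is amplified at most by the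
full exponential. -/
theorem gronwall_sum {a c h : ℕ → ℝ} (N : ℕ) (hc : ∀ n < N, 0 ≤ c n) (hh : ∀ n < N, 0 ≤ h n)
    (h0 : 0 ≤ a 0) (ha : ∀ n < N, a (n + 1) ≤ (1 + c n) * a n + h n) :
    a N ≤ Real.exp (∑ n ∈ Finset.range N, c n) * (a 0 + ∑ n ∈ Finset.range N, h n) := by
  induction N with
  | zero => simp
  | succ N ih =>
    have ih' := ih (fun n hn => hc n (by omega)) (fun n hn => hh n (by omega))
      (fun n hn => ha n (by omega))
    have hcN := hc N (by omega)
    have hhN := hh N (by omega)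
    rw [Finset.sum_range_succ, Finset.sum_range_succ, Real.exp_add]
    have h1 : 1 + c N ≤ Real.exp (c N) := by linarith [Real.add_one_le_exp (c N)]
    have hs : 0 ≤ ∑ n ∈ Finset.range N, h n :=
      Finset.sum_nonneg fun n hn => hh n (by have := Finset.mem_range.1 hn; omega)
    have hs' : 0 ≤ ∑ n ∈ Finset.range N, c n :=
      Finset.sum_nonneg fun n hn => hc n (by have := Finset.mem_range.1 hn; omega)
    set X := Real.exp (∑ n ∈ Finset.range N, c n) with hX
    have hX1 : 1 ≤ X := Real.one_le_exp hs'
    have hY1 : 1 ≤ Real.exp (c N) := Real.one_le_exp hcN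
    set S := ∑ n ∈ Finset.range N, h n
    calc a (N + 1) ≤ (1 + c N) * a N + h N := ha N (by omega)
      _ ≤ (1 + c N) * (X * (a 0 + S)) + h N := by gcongr
      _ ≤ Real.exp (c N) * (X * (a 0 + S)) + (X * Real.exp (c N)) * h N := by
          have : 1 * h N ≤ (X * Real.exp (c N)) * h N := by
            apply mul_le_mul_of_nonneg_right _ hhN; nlinarith
          gcongr
          linarith
      _ = _ := by ring

/-! ### One epoch -/

/-- One step of compressed SGD in the coordinates `y = x - η e` and `e`. -/
noncomputable def pairStep {d : ℕ} {Θ Θ' : Type*} (η : ℝ)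
    (G : EuclideanSpace ℝ (Fin d) → Θ → EuclideanSpace ℝ (Fin d))
    (C : EuclideanSpace ℝ (Fin d) → Θ' → EuclideanSpace ℝ (Fin d))
    (s : EuclideanSpace ℝ (Fin d) × EuclideanSpace ℝ (Fin d))
    (b : EuclideanSpace ℝ (Fin d) × Θ × Θ') :
    EuclideanSpace ℝ (Fin d) × EuclideanSpace ℝ (Fin d) :=
  (s.1 - η • (G (s.1 + η • s.2) b.2.1 + b.1),
    s.2 + G (s.1 + η • s.2) b.2.1 + b.1 - C (s.2 + G (s.1 + η • s.2) b.2.1 + b.1) b.2.2)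

/-- One step of an epoch started at `y₀`: the process is frozen once it is farther than `R`
from `y₀`. -/
noncomputable def epochStep {d : ℕ} {Θ Θ' : Type*} (η R : ℝ)
    (G : EuclideanSpace ℝ (Fin d) → Θ → EuclideanSpace ℝ (Fin d))
    (C : EuclideanSpace ℝ (Fin d) → Θ' → EuclideanSpace ℝ (Fin d))
    (y₀ : EuclideanSpace ℝ (Fin d)) (_ : ℕ)
    (s : EuclideanSpace ℝ (Fin d) × EuclideanSpace ℝ (Fin d))
    (b : EuclideanSpace ℝ (Fin d) × Θ × Θ') :
    EuclideanSpace ℝ (Fin d) × EuclideanSpace ℝ (Fin d) :=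
  if ‖s.1 - y₀‖ ≤ R then pairStep η G C s b else s

/-- The state `(y, e)` after `n` steps of an epoch started at `y₀`. -/
noncomputable def epoch {d : ℕ} {Θ Θ' : Type*} (η R : ℝ)
    (G : EuclideanSpace ℝ (Fin d) → Θ → EuclideanSpace ℝ (Fin d))
    (C : EuclideanSpace ℝ (Fin d) → Θ' → EuclideanSpace ℝ (Fin d))
    (y₀ : EuclideanSpace ℝ (Fin d)) (z : ℕ → EuclideanSpace ℝ (Fin d) × Θ × Θ') (n : ℕ) :
    EuclideanSpace ℝ (Fin d) × EuclideanSpace ℝ (Fin d) :=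
  chain (epochStep η R G C y₀) (y₀, 0) z n

/-- Indicator of being within `R` of `y₀`. -/
noncomputable def near {d : ℕ} (R : ℝ) (y₀ : EuclideanSpace ℝ (Fin d))
    (s : EuclideanSpace ℝ (Fin d) × EuclideanSpace ℝ (Fin d)) : ℝ :=
  if ‖s.1 - y₀‖ ≤ R then 1 else 0

/-- Squared gradient at `x = y + η e` while the epoch lasts. -/
noncomputable def gradTerm {d : ℕ} (f : EuclideanSpace ℝ (Fin d) → ℝ) (η R : ℝ)
    (y₀ : EuclideanSpace ℝ (Fin d))
    (s : EuclideanSpace ℝ (Fin d) × EuclideanSpace ℝ (Fin d)) : ℝ :=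
  near R y₀ s * ‖gradient f (s.1 + η • s.2)‖ ^ 2

/-- Squared compression error while the epoch lasts. -/
noncomputable def errTerm {d : ℕ} (R : ℝ) (y₀ : EuclideanSpace ℝ (Fin d))
    (s : EuclideanSpace ℝ (Fin d) × EuclideanSpace ℝ (Fin d)) : ℝ :=
  near R y₀ s * ‖s.2‖ ^ 2

/-- The standing assumptions on compressed SGD; `χ` bounds the variance of one step. -/
structure SGDSetting {d : ℕ} {Ω Θ Θ' : Type*} [MeasurableSpace Ω] [MeasurableSpace Θ]
    [MeasurableSpace Θ'] (P : Measure Ω) (D : Measure Θ) (D' : Measure Θ')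
    (f : EuclideanSpace ℝ (Fin d) → ℝ)
    (G : EuclideanSpace ℝ (Fin d) → Θ → EuclideanSpace ℝ (Fin d))
    (C : EuclideanSpace ℝ (Fin d) → Θ' → EuclideanSpace ℝ (Fin d))
    (z : ℕ → Ω → EuclideanSpace ℝ (Fin d) × Θ × Θ') (fmax L ρ σ μ η r χ : ℝ) : Prop where
  objective : IsRegularObjective f fmax L ρ
  oracle : IsStochasticGradient f G D σ
  compressor : IsCompressor C D' μ
  samples : IsIIDSequence P (sampleLaw d r D D') z
  dim_pos : 1 ≤ d
  L_pos : 0 < L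
  ρ_pos : 0 < ρ
  μ_pos : 0 < μ
  μ_le : μ ≤ 1
  η_pos : 0 < η
  noise_le : 2 * σ ^ 2 + 2 * r ^ 2 ≤ χ

section Near

variable {d : ℕ} (R : ℝ) (y₀ : EuclideanSpace ℝ (Fin d))
  (s : EuclideanSpace ℝ (Fin d) × EuclideanSpace ℝ (Fin d))

theorem near_nonneg : 0 ≤ near R y₀ s := by unfold near; split_ifs <;> norm_num
theorem near_le_one : near R y₀ s ≤ 1 := by unfold near; split_ifs <;> norm_num

theorem measurable_near : Measurable fun q : EuclideanSpace ℝ (Fin d) ×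
    (EuclideanSpace ℝ (Fin d) × EuclideanSpace ℝ (Fin d)) => near R q.1 q.2 :=
  Measurable.ite (measurableSet_le (by fun_prop) measurable_const)
    measurable_const measurable_const

theorem gradTerm_nonneg (f : EuclideanSpace ℝ (Fin d) → ℝ) (η : ℝ) : 0 ≤ gradTerm f η R y₀ s :=
  mul_nonneg (near_nonneg R y₀ s) (by positivity)

theorem errTerm_nonneg : 0 ≤ errTerm R y₀ s :=
  mul_nonneg (near_nonneg R y₀ s) (by positivity)

theorem measurable_errTerm : Measurable (errTerm R y₀) :=
  ((measurable_near R).comp measurable_prodMk_left).mul (by fun_prop)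

theorem measurable_gradTerm {f : EuclideanSpace ℝ (Fin d) → ℝ} (hf : Measurable (gradient f))
    (η : ℝ) : Measurable fun q : EuclideanSpace ℝ (Fin d) ×
    (EuclideanSpace ℝ (Fin d) × EuclideanSpace ℝ (Fin d)) => gradTerm f η R q.1 q.2 :=
  (measurable_near R).mul ((hf.comp (by fun_prop)).norm.pow_const 2)

end Near

theorem measurable_pairStep {d : ℕ} {Θ Θ' : Type*} [MeasurableSpace Θ] [MeasurableSpace Θ']
    {G : EuclideanSpace ℝ (Fin d) → Θ → EuclideanSpace ℝ (Fin d)}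
    {C : EuclideanSpace ℝ (Fin d) → Θ' → EuclideanSpace ℝ (Fin d)}
    (hG : Measurable (fun p : EuclideanSpace ℝ (Fin d) × Θ => G p.1 p.2))
    (hC : Measurable (fun p : EuclideanSpace ℝ (Fin d) × Θ' => C p.1 p.2)) (η : ℝ) :
    Measurable (fun q : (EuclideanSpace ℝ (Fin d) × EuclideanSpace ℝ (Fin d)) ×
      (EuclideanSpace ℝ (Fin d) × Θ × Θ') => pairStep η G C q.1 q.2) := by
  have h1 : Measurable (fun q : (EuclideanSpace ℝ (Fin d) × EuclideanSpace ℝ (Fin d)) ×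
      (EuclideanSpace ℝ (Fin d) × Θ × Θ') => G (q.1.1 + η • q.1.2) q.2.2.1) :=
    hG.comp (Measurable.prodMk (by fun_prop) (by fun_prop))
  have h2 : Measurable (fun q : (EuclideanSpace ℝ (Fin d) × EuclideanSpace ℝ (Fin d)) ×
      (EuclideanSpace ℝ (Fin d) × Θ × Θ') =>
        q.1.2 + G (q.1.1 + η • q.1.2) q.2.2.1 + q.2.1) := by fun_prop
  have h3 := hC.comp (h2.prodMk (show Measurable (fun q : (EuclideanSpace ℝ (Fin d) ×
    EuclideanSpace ℝ (Fin d)) × (EuclideanSpace ℝ (Fin d) × Θ × Θ') => q.2.2.2) by fun_prop))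
  exact Measurable.prodMk (by fun_prop) (h2.sub h3)

theorem measurable_epochStep {d : ℕ} {Θ Θ' : Type*} [MeasurableSpace Θ] [MeasurableSpace Θ']
    {G : EuclideanSpace ℝ (Fin d) → Θ → EuclideanSpace ℝ (Fin d)}
    {C : EuclideanSpace ℝ (Fin d) → Θ' → EuclideanSpace ℝ (Fin d)}
    (hG : Measurable (fun p : EuclideanSpace ℝ (Fin d) × Θ => G p.1 p.2))
    (hC : Measurable (fun p : EuclideanSpace ℝ (Fin d) × Θ' => C p.1 p.2)) (η R : ℝ) (n : ℕ) :
    Measurable (fun q : EuclideanSpace ℝ (Fin d) ×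
      (EuclideanSpace ℝ (Fin d) × EuclideanSpace ℝ (Fin d)) ×
      (EuclideanSpace ℝ (Fin d) × Θ × Θ') => epochStep η R G C q.1 n q.2.1 q.2.2) :=
  Measurable.ite (measurableSet_le (by fun_prop) measurable_const)
    ((measurable_pairStep hG hC η).comp measurable_snd) (by fun_prop)

theorem measurable_epoch {d : ℕ} {Θ Θ' : Type*} [MeasurableSpace Θ] [MeasurableSpace Θ']
    {G : EuclideanSpace ℝ (Fin d) → Θ → EuclideanSpace ℝ (Fin d)}
    {C : EuclideanSpace ℝ (Fin d) → Θ' → EuclideanSpace ℝ (Fin d)}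
    (hG : Measurable (fun p : EuclideanSpace ℝ (Fin d) × Θ => G p.1 p.2))
    (hC : Measurable (fun p : EuclideanSpace ℝ (Fin d) × Θ' => C p.1 p.2)) (η R : ℝ) (n : ℕ) :
    Measurable (fun q : EuclideanSpace ℝ (Fin d) × (ℕ → EuclideanSpace ℝ (Fin d) × Θ × Θ') =>
      epoch η R G C q.1 q.2 n) :=
  measurable_chain (h := epochStep η R G C) (measurable_epochStep hG hC η R)
    (x₀ := fun y => (y, 0)) (by fun_prop) n

/-! ### Compression error, displacement and exit probability of one epoch. -/

namespace SGDSetting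

variable {d : ℕ} {Ω Θ Θ' : Type*} [MeasurableSpace Ω] [MeasurableSpace Θ]
    [MeasurableSpace Θ'] {P : Measure Ω} {D : Measure Θ} {D' : Measure Θ'}
    [IsProbabilityMeasure P] [IsProbabilityMeasure D] [IsProbabilityMeasure D']
    {f : EuclideanSpace ℝ (Fin d) → ℝ}
    {G : EuclideanSpace ℝ (Fin d) → Θ → EuclideanSpace ℝ (Fin d)}
    {C : EuclideanSpace ℝ (Fin d) → Θ' → EuclideanSpace ℝ (Fin d)}
    {z : ℕ → Ω → EuclideanSpace ℝ (Fin d) × Θ × Θ'} {fmax L ρ σ μ η r χ : ℝ}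
    (hS : SGDSetting P D D' f G C z fmax L ρ σ μ η r χ)
include hS

theorem isCentered_noise (x : EuclideanSpace ℝ (Fin d)) : IsCentered (sampleLaw d r D D')
    (fun b => (G x b.2.1 - gradient f x) + b.1) χ := by
  have h := hS.oracle.isCentered_noise (r := r) (D' := D') hS.dim_pos x
  exact ⟨h.integrable, h.integral_eq, h.integrable_sq, h.sq_le.trans hS.noise_le⟩

theorem χ_nonneg : 0 ≤ χ := (hS.isCentered_noise 0).nonneg

omit [IsProbabilityMeasure P] [IsProbabilityMeasure D] [IsProbabilityMeasure D'] in
theorem measurable_epochStep (R : ℝ) (y₀ : EuclideanSpace ℝ (Fin d)) (n : ℕ) :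
    Measurable (fun q : (EuclideanSpace ℝ (Fin d) × EuclideanSpace ℝ (Fin d)) ×
      (EuclideanSpace ℝ (Fin d) × Θ × Θ') => epochStep η R G C y₀ n q.1 q.2) :=
  Measurable.ite (measurableSet_le (by fun_prop) measurable_const)
    (measurable_pairStep hS.oracle.measurable hS.compressor.measurable η) measurable_fst

omit [IsProbabilityMeasure P] [IsProbabilityMeasure D] [IsProbabilityMeasure D'] in
theorem measurable_epoch_omega (R : ℝ) (y₀ : EuclideanSpace ℝ (Fin d)) (n : ℕ) :
    Measurable (fun ω => epoch η R G C y₀ (fun t => z t ω) n) :=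
  hS.samples.measurable_chain (hS.measurable_epochStep R y₀) _ _

theorem integral_epoch_succ_le {R : ℝ} (y₀ : EuclideanSpace ℝ (Fin d)) (n : ℕ)
    {Φ' Φ : EuclideanSpace ℝ (Fin d) × EuclideanSpace ℝ (Fin d) → ℝ} (hΦ' : Measurable Φ')
    (h0' : ∀ s, 0 ≤ Φ' s) (h0 : ∀ s, 0 ≤ Φ s)
    (hint : Integrable (fun ω => Φ (epoch η R G C y₀ (fun t => z t ω) n)) P)
    (hstep : ∀ s, ∫⁻ b, ENNReal.ofReal (Φ' (epochStep η R G C y₀ n s b)) ∂(sampleLaw d r D D') ≤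
      ENNReal.ofReal (Φ s)) :
    Integrable (fun ω => Φ' (epoch η R G C y₀ (fun t => z t ω) (n + 1))) P ∧
      ∫ ω, Φ' (epoch η R G C y₀ (fun t => z t ω) (n + 1)) ∂P ≤
        ∫ ω, Φ (epoch η R G C y₀ (fun t => z t ω) n) ∂P :=
  hS.samples.integral_chain_succ_le (hS.measurable_epochStep R y₀) (y₀, 0) n hΦ' h0' h0 hint hstep

/-- Expected squared gradient of step `n` of the epoch. -/
noncomputable def _root_.epochGrad (P : Measure Ω)
    (f : EuclideanSpace ℝ (Fin d) → ℝ)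
    (G : EuclideanSpace ℝ (Fin d) → Θ → EuclideanSpace ℝ (Fin d))
    (C : EuclideanSpace ℝ (Fin d) → Θ' → EuclideanSpace ℝ (Fin d))
    (z : ℕ → Ω → EuclideanSpace ℝ (Fin d) × Θ × Θ') (η R : ℝ)
    (y₀ : EuclideanSpace ℝ (Fin d)) (n : ℕ) : ℝ :=
  ∫ ω, gradTerm f η R y₀ (epoch η R G C y₀ (fun t => z t ω) n) ∂P

/-- Expected squared compression error at step `n` of the epoch. -/
noncomputable def _root_.epochErr (P : Measure Ω)
    (G : EuclideanSpace ℝ (Fin d) → Θ → EuclideanSpace ℝ (Fin d))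
    (C : EuclideanSpace ℝ (Fin d) → Θ' → EuclideanSpace ℝ (Fin d))
    (z : ℕ → Ω → EuclideanSpace ℝ (Fin d) × Θ × Θ') (η R : ℝ)
    (y₀ : EuclideanSpace ℝ (Fin d)) (n : ℕ) : ℝ :=
  ∫ ω, errTerm R y₀ (epoch η R G C y₀ (fun t => z t ω) n) ∂P

omit [IsProbabilityMeasure D] [IsProbabilityMeasure D'] in
theorem integrable_gradTerm (R : ℝ) (y₀ : EuclideanSpace ℝ (Fin d)) (n : ℕ) :
    Integrable (fun ω => gradTerm f η R y₀ (epoch η R G C y₀ (fun t => z t ω) n)) P := by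
  refine (integrable_const (4 * L * fmax)).mono' ?_ (Filter.Eventually.of_forall fun ω => ?_)
  · exact (((measurable_gradTerm R hS.objective.measurable_gradient η).comp
      measurable_prodMk_left).comp (hS.measurable_epoch_omega R y₀ n)).aestronglyMeasurable
  · rw [Real.norm_of_nonneg (gradTerm_nonneg _ _ _ _ _)]
    have h1 := hS.objective.norm_gradient_sq_le hS.L_pos
      ((epoch η R G C y₀ (fun t => z t ω) n).1 + η • (epoch η R G C y₀ (fun t => z t ω) n).2)
    unfold gradTerm
    have h2 := near_le_one R y₀ (epoch η R G C y₀ (fun t => z t ω) n)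
    have h3 := near_nonneg R y₀ (epoch η R G C y₀ (fun t => z t ω) n)
    nlinarith [sq_nonneg ‖gradient f ((epoch η R G C y₀ (fun t => z t ω) n).1 +
      η • (epoch η R G C y₀ (fun t => z t ω) n).2)‖]

omit hS [IsProbabilityMeasure P] [IsProbabilityMeasure D] [IsProbabilityMeasure D'] in
theorem _root_.epochGrad_nonneg (R : ℝ) (y₀ : EuclideanSpace ℝ (Fin d)) (n : ℕ) :
    0 ≤ epochGrad P f G C z η R y₀ n := integral_nonneg fun _ => gradTerm_nonneg _ _ _ _ _

omit hS [IsProbabilityMeasure P] [IsProbabilityMeasure D] [IsProbabilityMeasure D'] in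
theorem _root_.epochErr_nonneg (R : ℝ) (y₀ : EuclideanSpace ℝ (Fin d)) (n : ℕ) :
    0 ≤ epochErr P G C z η R y₀ n := integral_nonneg fun _ => errTerm_nonneg _ _ _

-- Young's inequality with weight μ/2 gives up half of the contraction, from 1 − μ to 1 − μ/2, at
-- the price of a factor 3/μ on the gradient.
omit hS [IsProbabilityMeasure P] in
theorem compress_young (hμ0 : 0 < μ) (hμ1 : μ ≤ 1) (e g : EuclideanSpace ℝ (Fin d)) (χ : ℝ) :
    (1 - μ) * (‖e + g‖ ^ 2 + χ) ≤
      (1 - μ / 2) * ‖e‖ ^ 2 + ((1 - μ) * (3 / μ) * ‖g‖ ^ 2 + (1 - μ) * χ) := by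
  have h := sq_norm_add_le_young (κ := μ / 2) (by positivity) e g
  have h1 : (1 - μ) * (1 + μ / 2) ≤ 1 - μ / 2 := by nlinarith
  have h2 : 1 + (μ / 2)⁻¹ ≤ 3 / μ := by
    have h5 : (μ / 2)⁻¹ = 2 / μ := by rw [inv_div]
    rw [h5, show (1 : ℝ) = μ / μ by rw [div_self hμ0.ne'], ← add_div]
    gcongr; linarith
  have h3 : 0 ≤ 1 - μ := by linarith
  have h4 : (1 + (μ / 2)⁻¹) * ‖g‖ ^ 2 ≤ 3 / μ * ‖g‖ ^ 2 := by gcongr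
  have h6 : (1 - μ) * ((1 + μ / 2) * ‖e‖ ^ 2) ≤ (1 - μ / 2) * ‖e‖ ^ 2 := by
    rw [← mul_assoc]; gcongr
  nlinarith

theorem epochErr_succ (R : ℝ) (y₀ : EuclideanSpace ℝ (Fin d)) (n : ℕ) :
    Integrable (fun ω => errTerm R y₀ (epoch η R G C y₀ (fun t => z t ω) n)) P ∧
    epochErr P G C z η R y₀ (n + 1) ≤ (1 - μ / 2) * epochErr P G C z η R y₀ n +
      ((1 - μ) * (3 / μ) * epochGrad P f G C z η R y₀ n + (1 - μ) * χ) := by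
  have hμ0 := hS.μ_pos
  have hμ1 := hS.μ_le
  have hχ := hS.χ_nonneg
  -- Integrability at `n + 1` comes out of the same estimate as the recursion, so both are derived
  -- from integrability at `n` and the induction is run afterwards.
  have hfin : ∀ n, Integrable (fun ω => errTerm R y₀ (epoch η R G C y₀ (fun t => z t ω) n)) P →
      Integrable (fun ω => errTerm R y₀ (epoch η R G C y₀ (fun t => z t ω) (n + 1))) P ∧
      epochErr P G C z η R y₀ (n + 1) ≤ (1 - μ / 2) * epochErr P G C z η R y₀ n +
      ((1 - μ) * (3 / μ) * epochGrad P f G C z η R y₀ n + (1 - μ) * χ) := by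
    intro n hn
    have hi2 : Integrable (fun ω => (1 - μ) * (3 / μ) *
        gradTerm f η R y₀ (epoch η R G C y₀ (fun t => z t ω) n) + (1 - μ) * χ) P :=
      ((hS.integrable_gradTerm R y₀ n).const_mul _).add (integrable_const _)
    have key := hS.integral_epoch_succ_le (R := R) y₀ n
      (Φ' := errTerm R y₀) (Φ := fun s => (1 - μ / 2) * errTerm R y₀ s +
        ((1 - μ) * (3 / μ) * gradTerm f η R y₀ s + (1 - μ) * χ))
      (measurable_errTerm R y₀) (errTerm_nonneg R y₀) (fun s => ?_)
      ((hn.const_mul _).add hi2) (fun s => ?_)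
    · refine ⟨key.1, key.2.trans_eq ?_⟩
      unfold epochErr epochGrad
      rw [← integral_const_mul, ← integral_const_mul]
      rw [integral_add (hn.const_mul _) hi2, integral_add
        ((hS.integrable_gradTerm R y₀ n).const_mul _) (integrable_const _)]
      simp
    · have := errTerm_nonneg R y₀ s
      have := gradTerm_nonneg R y₀ s f η
      have : 0 ≤ 1 - μ / 2 := by linarith
      have : 0 ≤ 1 - μ := by linarith
      positivity
    · by_cases hs : ‖s.1 - y₀‖ ≤ R
      · simp only [epochStep, if_pos hs]
        have hn1 : near R y₀ s = 1 := by simp [near, hs]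
        calc _ ≤ ∫⁻ b, ENNReal.ofReal (‖s.2 + G (s.1 + η • s.2) b.2.1 + b.1 -
              C (s.2 + G (s.1 + η • s.2) b.2.1 + b.1) b.2.2‖ ^ 2) ∂(sampleLaw d r D D') := by
              refine lintegral_mono fun b => ENNReal.ofReal_le_ofReal ?_
              exact mul_le_of_le_one_left (by positivity) (near_le_one _ _ _)
          _ ≤ _ := hS.compressor.lintegral_error_le hμ1 hS.oracle hS.dim_pos _ _
          _ ≤ _ := by
              refine ENNReal.ofReal_le_ofReal ?_
              simp only [errTerm, gradTerm, hn1, one_mul]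
              refine (mul_le_mul_of_nonneg_left (add_le_add_right hS.noise_le _)
                (by linarith)).trans ?_
              exact compress_young hμ0 hμ1 _ _ _
      · have h1 : ∀ b, errTerm R y₀ (epochStep η R G C y₀ n s b) = 0 := by
          intro b; simp [epochStep, hs, errTerm, near]
        simp [h1]
  have hint : ∀ n, Integrable
      (fun ω => errTerm R y₀ (epoch η R G C y₀ (fun t => z t ω) n)) P := by
    intro n
    induction n with
    | zero => exact integrable_const (errTerm R y₀ (y₀, 0))
    | succ n ih => exact (hfin n ih).1
  exact ⟨hint n, (hfin n (hint n)).2⟩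

/-- The contraction is summed against nonincreasing weights: `w = 1` serves the end-point estimate
and `w n = (1 + ηγ)^(−n)` the coupling. The gradient terms may stay unweighted because they are
controlled by S. -/
theorem sum_epochErr_le (R : ℝ) (y₀ : EuclideanSpace ℝ (Fin d)) (N : ℕ) {w : ℕ → ℝ}
    (hw0 : ∀ n, 0 ≤ w n) (hw1 : ∀ n, w n ≤ 1) (hw : ∀ n, w (n + 1) ≤ w n) :
    ∑ n ∈ Finset.range N, w n * epochErr P G C z η R y₀ n ≤ 2 * (1 - μ) / μ ^ 2 *
      (3 * ∑ n ∈ Finset.range N, epochGrad P f G C z η R y₀ n +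
        μ * (χ * ∑ n ∈ Finset.range N, w n)) := by
  have hμ0 := hS.μ_pos
  have hμ1 := hS.μ_le
  have hχ := hS.χ_nonneg
  have hμ : 0 ≤ 1 - μ := by linarith
  -- Keeping the current error on the left makes the sum telescope; monotone weights allow `w (N +
  -- 1)` to be replaced by `w N`.
  have h : ∀ N, w N * epochErr P G C z η R y₀ N +
      μ / 2 * ∑ n ∈ Finset.range N, w n * epochErr P G C z η R y₀ n ≤
      (1 - μ) * (3 / μ) * ∑ n ∈ Finset.range N, epochGrad P f G C z η R y₀ n +
        (1 - μ) * χ * ∑ n ∈ Finset.range N, w n := by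
    intro N
    induction N with
    | zero =>
      have : epochErr P G C z η R y₀ 0 = 0 := by
        simp [epochErr, epoch, chain, errTerm]
      simp [this]
    | succ N ih =>
      simp only [Finset.sum_range_succ]
      have h1 := (hS.epochErr_succ R y₀ N).2
      have h2 : w (N + 1) * epochErr P G C z η R y₀ (N + 1) ≤
          w N * epochErr P G C z η R y₀ (N + 1) :=
        mul_le_mul_of_nonneg_right (hw N) (epochErr_nonneg _ _ _)
      have h3 := mul_le_mul_of_nonneg_left h1 (hw0 N)
      have h4 : w N * ((1 - μ) * (3 / μ) * epochGrad P f G C z η R y₀ N) ≤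
          (1 - μ) * (3 / μ) * epochGrad P f G C z η R y₀ N :=
        mul_le_of_le_one_left (mul_nonneg (by positivity) (epochGrad_nonneg _ _ _)) (hw1 N)
      linarith
  have h1 := h N
  have h2 : 0 ≤ w N * epochErr P G C z η R y₀ N := mul_nonneg (hw0 N) (epochErr_nonneg _ _ _)
  have h3 : μ / 2 * ∑ n ∈ Finset.range N, w n * epochErr P G C z η R y₀ n ≤
      (1 - μ) * (3 / μ) * ∑ n ∈ Finset.range N, epochGrad P f G C z η R y₀ n +
        (1 - μ) * χ * ∑ n ∈ Finset.range N, w n := by linarith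
  have h4 := mul_le_mul_of_nonneg_left h3 (by positivity : 0 ≤ 2 / μ)
  calc _ = 2 / μ * (μ / 2 * ∑ n ∈ Finset.range N, w n * epochErr P G C z η R y₀ n) := by
        field_simp
    _ ≤ _ := h4
    _ = _ := by field_simp

/-- The centred noise adds η²χ per step to the mean squared distance. The drift is split off by
Young's inequality with weight 1/N, whose compounded factor over `N` steps is at most e ≤ 3. -/
theorem integral_sq_dist_le {R : ℝ} (y₀ : EuclideanSpace ℝ (Fin d)) {N : ℕ} (hN : 1 ≤ N) :
    Integrable (fun ω => ‖(epoch η R G C y₀ (fun t => z t ω) N).1 - y₀‖ ^ 2) P ∧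
    ∫ ω, ‖(epoch η R G C y₀ (fun t => z t ω) N).1 - y₀‖ ^ 2 ∂P ≤
      6 * N * η ^ 2 * ∑ n ∈ Finset.range N, epochGrad P f G C z η R y₀ n + 3 * N * η ^ 2 * χ := by
  have hη := hS.η_pos
  have hχ := hS.χ_nonneg
  have hN' : (1 : ℝ) ≤ N := by exact_mod_cast hN
  have hfin : ∀ n, Integrable
        (fun ω => ‖(epoch η R G C y₀ (fun t => z t ω) n).1 - y₀‖ ^ 2) P →
      Integrable (fun ω => ‖(epoch η R G C y₀ (fun t => z t ω) (n + 1)).1 - y₀‖ ^ 2) P ∧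
      ∫ ω, ‖(epoch η R G C y₀ (fun t => z t ω) (n + 1)).1 - y₀‖ ^ 2 ∂P ≤
      (1 + (N : ℝ)⁻¹) * ∫ ω, ‖(epoch η R G C y₀ (fun t => z t ω) n).1 - y₀‖ ^ 2 ∂P +
        ((1 + N) * η ^ 2 * epochGrad P f G C z η R y₀ n + η ^ 2 * χ) := by
    intro n hn
    have hi2 : Integrable (fun ω => (1 + N) * η ^ 2 *
        gradTerm f η R y₀ (epoch η R G C y₀ (fun t => z t ω) n) + η ^ 2 * χ) P :=
      ((hS.integrable_gradTerm R y₀ n).const_mul _).add (integrable_const _)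
    have key := hS.integral_epoch_succ_le (R := R) y₀ n
      (Φ' := fun s => ‖s.1 - y₀‖ ^ 2) (Φ := fun s => (1 + (N : ℝ)⁻¹) * ‖s.1 - y₀‖ ^ 2 +
        ((1 + N) * η ^ 2 * gradTerm f η R y₀ s + η ^ 2 * χ))
      (by fun_prop) (fun s => by positivity) (fun s => ?_)
      ((hn.const_mul _).add hi2) (fun s => ?_)
    · refine ⟨key.1, key.2.trans_eq ?_⟩
      unfold epochGrad
      rw [← integral_const_mul, ← integral_const_mul]
      rw [integral_add (hn.const_mul _) hi2, integral_add
        ((hS.integrable_gradTerm R y₀ n).const_mul _) (integrable_const _)]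
      simp
    · have := gradTerm_nonneg R y₀ s f η
      positivity
    · by_cases hs : ‖s.1 - y₀‖ ≤ R
      · simp only [epochStep, if_pos hs, pairStep]
        have hn1 : near R y₀ s = 1 := by simp [near, hs]
        have h1 := ((hS.isCentered_noise (s.1 + η • s.2)).smul (-η)).lintegral_sq_add_le
          ((s.1 - y₀) + -(η • gradient f (s.1 + η • s.2)))
        have h2 : ∀ b : EuclideanSpace ℝ (Fin d) × Θ × Θ',
            s.1 - η • (G (s.1 + η • s.2) b.2.1 + b.1) - y₀ =
            ((s.1 - y₀) + -(η • gradient f (s.1 + η • s.2))) +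
              (-η) • ((G (s.1 + η • s.2) b.2.1 - gradient f (s.1 + η • s.2)) + b.1) := by
          intro b; module
        simp_rw [h2]
        refine h1.trans (ENNReal.ofReal_le_ofReal ?_)
        have h3 := sq_norm_add_le_young (κ := (N : ℝ)⁻¹) (by positivity) (s.1 - y₀)
          (-(η • gradient f (s.1 + η • s.2)))
        rw [norm_neg, norm_smul, Real.norm_of_nonneg hη.le, mul_pow, inv_inv] at h3
        simp only [gradTerm, hn1, one_mul]
        linarith
      · have h1 : ∀ b, epochStep η R G C y₀ n s b = s := by
          intro b; simp [epochStep, hs]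
        simp only [h1, lintegral_const, measure_univ, mul_one]
        refine ENNReal.ofReal_le_ofReal ?_
        have := gradTerm_nonneg R y₀ s f η
        have : 0 ≤ (N : ℝ)⁻¹ * ‖s.1 - y₀‖ ^ 2 := by positivity
        have : 0 ≤ ((1 + N) * η ^ 2 * gradTerm f η R y₀ s + η ^ 2 * χ) := by positivity
        linarith
  have hint : ∀ n, Integrable
      (fun ω => ‖(epoch η R G C y₀ (fun t => z t ω) n).1 - y₀‖ ^ 2) P := by
    intro n
    induction n with
    | zero => exact integrable_const (‖y₀ - y₀‖ ^ 2)
    | succ n ih => exact (hfin n ih).1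
  refine ⟨hint N, ?_⟩
  have hg := gronwall_sum
    (a := fun n => ∫ ω, ‖(epoch η R G C y₀ (fun t => z t ω) n).1 - y₀‖ ^ 2 ∂P)
    (c := fun _ => (N : ℝ)⁻¹)
    (h := fun n => (1 + N) * η ^ 2 * epochGrad P f G C z η R y₀ n + η ^ 2 * χ) N
    (fun _ _ => by positivity) (fun n _ => add_nonneg
      (mul_nonneg (by positivity) (epochGrad_nonneg _ _ _)) (by positivity))
    (integral_nonneg fun _ => by positivity) (fun n _ => (hfin n (hint n)).2)
  have h0 : ∫ ω, ‖(epoch η R G C y₀ (fun t => z t ω) 0).1 - y₀‖ ^ 2 ∂P = 0 := by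
    simp [epoch, chain]
  simp only [h0, Finset.sum_const, Finset.card_range, nsmul_eq_mul, zero_add,
    Finset.sum_add_distrib, ← Finset.mul_sum] at hg
  rw [mul_inv_cancel₀ (by positivity)] at hg
  refine hg.trans ?_
  have he : Real.exp 1 ≤ 3 := by linarith [Real.exp_one_lt_d9]
  have hsum : 0 ≤ ∑ n ∈ Finset.range N, epochGrad P f G C z η R y₀ n :=
    Finset.sum_nonneg fun _ _ => epochGrad_nonneg _ _ _
  have h5 : (1 + N) * η ^ 2 * ∑ n ∈ Finset.range N, epochGrad P f G C z η R y₀ n ≤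
      2 * N * η ^ 2 * ∑ n ∈ Finset.range N, epochGrad P f G C z η R y₀ n := by
    gcongr; linarith
  calc _ ≤ 3 * (2 * N * η ^ 2 * ∑ n ∈ Finset.range N, epochGrad P f G C z η R y₀ n +
        N * (η ^ 2 * χ)) := by
        apply mul_le_mul he _ (by positivity) (by norm_num)
        linarith
    _ = _ := by ring

/-- Leaving the ball of radius `R` within an epoch costs a large sum of squared gradients. -/
theorem measureReal_exit_le {R : ℝ} (hR : 0 < R) (y₀ : EuclideanSpace ℝ (Fin d)) {N : ℕ}
    (hN : 1 ≤ N) :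
    P.real {ω | R < ‖(epoch η R G C y₀ (fun t => z t ω) N).1 - y₀‖} ≤
      (6 * N * η ^ 2 * ∑ n ∈ Finset.range N, epochGrad P f G C z η R y₀ n +
        3 * N * η ^ 2 * χ) / R ^ 2 := by
  obtain ⟨h1, h2⟩ := hS.integral_sq_dist_le (R := R) y₀ hN
  -- Markov's inequality at time `N` covers exits at all earlier times, because the process is
  -- frozen once it has left the ball.
  have h3 := mul_meas_ge_le_integral_of_nonneg (μ := P)
    (f := fun ω => ‖(epoch η R G C y₀ (fun t => z t ω) N).1 - y₀‖ ^ 2)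
    (Filter.Eventually.of_forall fun _ => by positivity) h1 (R ^ 2)
  rw [le_div_iff₀ (by positivity), mul_comm]
  refine le_trans (mul_le_mul_of_nonneg_left (measureReal_mono ?_) (by positivity))
    (h3.trans h2)
  intro ω hω
  exact pow_le_pow_left₀ hR.le (le_of_lt hω) 2

end SGDSetting

/-! ### Gaussian anti-concentration -/

theorem gaussianReal_Icc_le {v : NNReal} (hv : v ≠ 0) (t : ℝ) (ht : 0 ≤ t) :
    (gaussianReal 0 v).real (Set.Icc (-t) t) ≤ 2 * t * (√(2 * Real.pi * v))⁻¹ := by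
  have h1 : gaussianReal 0 v (Set.Icc (-t) t) ≤
      ENNReal.ofReal (2 * t * (√(2 * Real.pi * v))⁻¹) := by
    rw [gaussianReal_apply 0 hv]
    calc _ ≤ ∫⁻ _ in Set.Icc (-t) t, ENNReal.ofReal ((√(2 * Real.pi * v))⁻¹) := by
          refine lintegral_mono fun x => ENNReal.ofReal_le_ofReal ?_
          rw [gaussianPDFReal]
          refine mul_le_of_le_one_right (by positivity) (Real.exp_le_one_iff.2 ?_)
          rw [neg_div, neg_nonpos]
          positivity
      _ = _ := by
          rw [lintegral_const, Measure.restrict_apply_univ, Real.volume_Icc,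
            ← ENNReal.ofReal_mul (by positivity)]
          congr 1; ring
  exact ENNReal.toReal_le_of_le_ofReal (by positivity) h1

/-- Linear recursion driven by one Gaussian coordinate. -/
noncomputable def gaussStep {d : ℕ} {Ξ : Type*} (a c : ℝ) (v : EuclideanSpace ℝ (Fin d)) (_ : ℕ)
    (p : ℝ) (b : EuclideanSpace ℝ (Fin d) × Ξ) : ℝ :=
  a * p - c * inner ℝ v b.1

/-- Each step scales the current value and adds an independent centred Gaussian, so the law stays
Gaussian and variances obey v ↦ a²v + c²r²/d. -/
theorem map_chain_gaussStep {d : ℕ} {Ω Ξ : Type*} [MeasurableSpace Ω] [MeasurableSpace Ξ]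
    {P : Measure Ω} [IsProbabilityMeasure P] {κ : Measure Ξ} [IsProbabilityMeasure κ] {r : ℝ}
    {z : ℕ → Ω → EuclideanSpace ℝ (Fin d) × Ξ}
    (hz : IsIIDSequence P ((artificialNoise d r).prod κ) z) (a c : ℝ)
    {v : EuclideanSpace ℝ (Fin d)} (hv : ‖v‖ = 1) (n : ℕ) :
    P.map (fun ω => chain (gaussStep a c v) 0 (fun t => z t ω) n) =
      gaussianReal 0 (∑ k ∈ Finset.range n, (a ^ 2) ^ k * (c ^ 2 * (r ^ 2 / d))).toNNReal := by
  have hh : ∀ n, Measurable (fun q : ℝ × (EuclideanSpace ℝ (Fin d) × Ξ) =>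
      gaussStep a c v n q.1 q.2) := by
    intro n; unfold gaussStep; fun_prop
  induction n with
  | zero => simp [chain]
  | succ n ih =>
    have hm := hz.measurable_chain hh (0 : ℝ) n
    have hX : P.map (fun ω => a * chain (gaussStep a c v) 0 (fun t => z t ω) n) =
        gaussianReal 0 (NNReal.mk (a ^ 2) (sq_nonneg a) *
          (∑ k ∈ Finset.range n, (a ^ 2) ^ k * (c ^ 2 * (r ^ 2 / d))).toNNReal) := by
      have := Measure.map_map (μ := P) (g := fun x : ℝ => a * x) (by fun_prop) hm
      rw [Function.comp_def] at this
      rw [← this, ih, gaussianReal_map_const_mul, mul_zero]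
    have hY : P.map (fun ω => -c * inner ℝ v (z n ω).1) =
        gaussianReal 0 (NNReal.mk (c ^ 2) (sq_nonneg c) * (r ^ 2 / d).toNNReal) := by
      have h1 := Measure.map_map (μ := P) (g := fun b : EuclideanSpace ℝ (Fin d) × Ξ =>
        -c * inner ℝ v b.1) (by fun_prop) (hz.measurable n)
      rw [Function.comp_def] at h1
      rw [← h1, hz.law n]
      have h2 := Measure.map_map (μ := (artificialNoise d r).prod κ)
        (g := fun x : EuclideanSpace ℝ (Fin d) => -c * inner ℝ v x)
        (f := Prod.fst) (by fun_prop) measurable_fst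
      rw [Function.comp_def] at h2
      rw [← h2, (measurePreserving_fst (μ := artificialNoise d r) (ν := κ)).map_eq]
      have h3 := Measure.map_map (μ := artificialNoise d r) (g := fun x : ℝ => -c * x)
        (f := fun x => inner ℝ v x) (by fun_prop) (by fun_prop)
      rw [Function.comp_def] at h3
      rw [← h3, map_inner_artificialNoise, hv, gaussianReal_map_const_mul, mul_zero]
      congr 2
      · ext; simp
      · simp
    have hind := ((hz.indepFun_chain hh (0 : ℝ) n).comp (φ := fun x : ℝ => a * x)
      (ψ := fun b : EuclideanSpace ℝ (Fin d) × Ξ => -c * inner ℝ v b.1)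
      (by fun_prop) (by fun_prop))
    have hsum := gaussianReal_add_gaussianReal_of_indepFun hind hX hY
    have hfun : (fun ω => chain (gaussStep a c v) 0 (fun t => z t ω) (n + 1)) =
        ((fun x : ℝ => a * x) ∘ fun ω => chain (gaussStep a c v) 0 (fun t => z t ω) n) +
        ((fun b : EuclideanSpace ℝ (Fin d) × Ξ => -c * inner ℝ v b.1) ∘ z n) := by
      ext ω; simp [chain, gaussStep, sub_eq_add_neg]
    rw [hfun, hsum, add_zero]
    congr 1
    have hs : 0 ≤ ∑ k ∈ Finset.range n, (a ^ 2) ^ k * (c ^ 2 * (r ^ 2 / d)) :=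
      Finset.sum_nonneg fun _ _ => by positivity
    ext
    rw [NNReal.coe_add, NNReal.coe_mul, NNReal.coe_mul, Real.coe_toNNReal _ hs,
      Real.coe_toNNReal _ (by positivity),
      Real.coe_toNNReal _ (Finset.sum_nonneg fun _ _ => by positivity),
      Finset.sum_range_succ', Finset.mul_sum]
    simp only [NNReal.coe_mk, pow_zero, one_mul, pow_succ]
    congr 1
    exact Finset.sum_congr rfl fun k _ => by ring

/-! ### Mirror coupling -/

/-- The sample with its Gaussian part reflected. -/
noncomputable def mirrorSample {d : ℕ} {Ξ : Type*} (v : EuclideanSpace ℝ (Fin d))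
    (b : EuclideanSpace ℝ (Fin d) × Ξ) : EuclideanSpace ℝ (Fin d) × Ξ :=
  (mirror v b.1, b.2)

theorem measurable_mirrorSample {d : ℕ} {Ξ : Type*} [MeasurableSpace Ξ]
    (v : EuclideanSpace ℝ (Fin d)) :
    Measurable (mirrorSample v : EuclideanSpace ℝ (Fin d) × Ξ → _) :=
  ((mirror v).continuous.measurable.comp measurable_fst).prodMk measurable_snd

theorem map_mirrorSample {d : ℕ} {Θ Θ' : Type*} [MeasurableSpace Θ] [MeasurableSpace Θ']
    {D : Measure Θ} {D' : Measure Θ'} [IsProbabilityMeasure D] [IsProbabilityMeasure D'] (r : ℝ)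
    (v : EuclideanSpace ℝ (Fin d)) :
    (sampleLaw d r D D').map (mirrorSample v) = sampleLaw d r D D' := by
  have h1 : MeasurePreserving (mirror v) (artificialNoise d r) (artificialNoise d r) :=
    ⟨(mirror v).continuous.measurable, map_mirror_artificialNoise d r v⟩
  exact (h1.prod (MeasurePreserving.id (D.prod D'))).map_eq

/-- Two epochs driven by mirrored noises, together with the Gaussian part of their difference. -/
noncomputable def coupledStep {d : ℕ} {Θ Θ' : Type*} (η R a : ℝ)
    (G : EuclideanSpace ℝ (Fin d) → Θ → EuclideanSpace ℝ (Fin d))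
    (C : EuclideanSpace ℝ (Fin d) → Θ' → EuclideanSpace ℝ (Fin d))
    (y₀ v : EuclideanSpace ℝ (Fin d)) (n : ℕ)
    (c : ((EuclideanSpace ℝ (Fin d) × EuclideanSpace ℝ (Fin d)) ×
      (EuclideanSpace ℝ (Fin d) × EuclideanSpace ℝ (Fin d))) × ℝ)
    (b : EuclideanSpace ℝ (Fin d) × Θ × Θ') :
    ((EuclideanSpace ℝ (Fin d) × EuclideanSpace ℝ (Fin d)) ×
      (EuclideanSpace ℝ (Fin d) × EuclideanSpace ℝ (Fin d))) × ℝ :=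
  ((epochStep η R G C y₀ n c.1.1 b, epochStep η R G C y₀ n c.1.2 (mirrorSample v b)),
    gaussStep a (2 * η) v n c.2 b)

theorem chain_coupledStep {d : ℕ} {Θ Θ' : Type*} (η R a : ℝ)
    (G : EuclideanSpace ℝ (Fin d) → Θ → EuclideanSpace ℝ (Fin d))
    (C : EuclideanSpace ℝ (Fin d) → Θ' → EuclideanSpace ℝ (Fin d))
    (y₀ v : EuclideanSpace ℝ (Fin d)) (z : ℕ → EuclideanSpace ℝ (Fin d) × Θ × Θ') (n : ℕ) :
    chain (coupledStep η R a G C y₀ v) (((y₀, 0), (y₀, 0)), 0) z n =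
      ((epoch η R G C y₀ z n, epoch η R G C y₀ (fun t => mirrorSample v (z t)) n),
        chain (gaussStep a (2 * η) v) 0 z n) := by
  induction n with
  | zero => rfl
  | succ n ih => simp only [chain, ih, coupledStep, epoch]

/-- Squared deviation of the difference of the two epochs from its Gaussian part. -/
noncomputable def couplingTerm {d : ℕ} (R : ℝ) (y₀ v : EuclideanSpace ℝ (Fin d))
    (c : ((EuclideanSpace ℝ (Fin d) × EuclideanSpace ℝ (Fin d)) ×
      (EuclideanSpace ℝ (Fin d) × EuclideanSpace ℝ (Fin d))) × ℝ) : ℝ :=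
  near R y₀ c.1.1 * near R y₀ c.1.2 * ‖c.1.1.1 - c.1.2.1 - c.2 • v‖ ^ 2

/-- Cauchy–Schwarz with weights 1, k₁, k₂. -/
theorem sq_add_add_le_young {k₁ k₂ : ℝ} (h1 : 0 < k₁) (h2 : 0 < k₂) (a b c : ℝ) :
    (a + b + c) ^ 2 ≤ (1 + k₁ + k₂) * (a ^ 2 + b ^ 2 / k₁ + c ^ 2 / k₂) := by
  have : (1 + k₁ + k₂) * (a ^ 2 + b ^ 2 / k₁ + c ^ 2 / k₂) - (a + b + c) ^ 2 =
      (k₁ * a - b) ^ 2 / k₁ + (k₂ * a - c) ^ 2 / k₂ + (k₂ * b - k₁ * c) ^ 2 / (k₁ * k₂) := by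
    field_simp; ring
  have : 0 ≤ (k₁ * a - b) ^ 2 / k₁ + (k₂ * a - c) ^ 2 / k₂ +
    (k₂ * b - k₁ * c) ^ 2 / (k₁ * k₂) := by positivity
  linarith

/-- Here `q` is the size of the deviation from the Gaussian part `p`, `w` the distance of the two
runs, and `X` the distance of the points where their gradients are taken. The weight `k₁` pays for
the variation of the Hessian and `k₂` for the compression errors, so only 1 + k₁ + k₂ multiplies the
exponentially growing term. -/
theorem coupling_recursion_bound {A q p w e e' X η ρ R L ℓ₀ σ₀ k₁ k₂ γ : ℝ} (hA0 : 0 ≤ A)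
    (hX0 : 0 ≤ X)
    (hA : A ≤ (1 + η * γ) * q + η * (ρ * R) * w + η ^ 2 * L * (e + e'))
    (hw : w ^ 2 ≤ 2 * (q ^ 2 + p ^ 2)) (hX : X ≤ w + η * e + η * e')
    (hk1 : 0 < k₁) (hk1' : k₁ ≤ 1) (hk2 : 0 < k₂) (hk2' : k₂ ≤ 1) :
    A ^ 2 + (-η) ^ 2 * (4 * ℓ₀ ^ 2 * X ^ 2 + 4 * σ₀ ^ 2) ≤
      (1 + k₁ + k₂) * (1 + η * γ) ^ 2 * q ^ 2 +
        ((6 * η ^ 2 * ρ ^ 2 * R ^ 2 / k₁ + 24 * ℓ₀ ^ 2 * η ^ 2) * (q ^ 2 + p ^ 2) +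
          ((6 * η ^ 4 * L ^ 2 / k₂ + 12 * ℓ₀ ^ 2 * η ^ 4) * (e ^ 2 + e' ^ 2) +
            4 * σ₀ ^ 2 * η ^ 2)) := by
  have hA2 := (pow_le_pow_left₀ hA0 hA 2).trans (sq_add_add_le_young hk1 hk2 _ _ _)
  have h3le : 1 + k₁ + k₂ ≤ 3 := by linarith
  have hee : (e + e') ^ 2 ≤ 2 * (e ^ 2 + e' ^ 2) := by nlinarith [sq_nonneg (e - e')]
  have hB : (1 + k₁ + k₂) * ((η * (ρ * R) * w) ^ 2 / k₁) ≤
      6 * η ^ 2 * ρ ^ 2 * R ^ 2 / k₁ * (q ^ 2 + p ^ 2) := by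
    calc _ ≤ 3 * ((η * (ρ * R) * w) ^ 2 / k₁) := by gcongr
      _ = 3 * η ^ 2 * ρ ^ 2 * R ^ 2 / k₁ * w ^ 2 := by ring
      _ ≤ 3 * η ^ 2 * ρ ^ 2 * R ^ 2 / k₁ * (2 * (q ^ 2 + p ^ 2)) := by gcongr
      _ = _ := by ring
  have hC : (1 + k₁ + k₂) * ((η ^ 2 * L * (e + e')) ^ 2 / k₂) ≤
      6 * η ^ 4 * L ^ 2 / k₂ * (e ^ 2 + e' ^ 2) := by
    calc _ ≤ 3 * ((η ^ 2 * L * (e + e')) ^ 2 / k₂) := by gcongr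
      _ = 3 * η ^ 4 * L ^ 2 / k₂ * (e + e') ^ 2 := by ring
      _ ≤ 3 * η ^ 4 * L ^ 2 / k₂ * (2 * (e ^ 2 + e' ^ 2)) := by gcongr
      _ = _ := by ring
  have hX2 : X ^ 2 ≤ 6 * (q ^ 2 + p ^ 2) + 3 * η ^ 2 * (e ^ 2 + e' ^ 2) := by
    have h5 := (pow_le_pow_left₀ hX0 hX 2).trans
      (sq_add_add_le_young one_pos one_pos _ _ _)
    calc _ ≤ _ := h5
      _ = 3 * w ^ 2 + 3 * η ^ 2 * (e ^ 2 + e' ^ 2) := by ring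
      _ ≤ _ := by linarith
  have hVV : (-η) ^ 2 * (4 * ℓ₀ ^ 2 * X ^ 2 + 4 * σ₀ ^ 2) ≤
      24 * ℓ₀ ^ 2 * η ^ 2 * (q ^ 2 + p ^ 2) + 12 * ℓ₀ ^ 2 * η ^ 4 * (e ^ 2 + e' ^ 2) +
        4 * σ₀ ^ 2 * η ^ 2 := by
    have := mul_le_mul_of_nonneg_left hX2 (by positivity : 0 ≤ 4 * ℓ₀ ^ 2 * η ^ 2)
    linarith
  linarith

/-! ### One step of the mirrored pair. -/

namespace SGDSetting

variable {d : ℕ} {Ω Θ Θ' : Type*} [MeasurableSpace Ω] [MeasurableSpace Θ]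
    [MeasurableSpace Θ'] {P : Measure Ω} {D : Measure Θ} {D' : Measure Θ'}
    [IsProbabilityMeasure P] [IsProbabilityMeasure D] [IsProbabilityMeasure D']
    {f : EuclideanSpace ℝ (Fin d) → ℝ}
    {G : EuclideanSpace ℝ (Fin d) → Θ → EuclideanSpace ℝ (Fin d)}
    {C : EuclideanSpace ℝ (Fin d) → Θ' → EuclideanSpace ℝ (Fin d)}
    {z : ℕ → Ω → EuclideanSpace ℝ (Fin d) × Θ × Θ'} {fmax L ρ σ μ η r χ : ℝ}
    (hS : SGDSetting P D D' f G C z fmax L ρ σ μ η r χ)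
include hS

theorem mirror (v : EuclideanSpace ℝ (Fin d)) : SGDSetting P D D' f G C
    (fun t ω => mirrorSample v (z t ω)) fmax L ρ σ μ η r χ :=
  { hS with samples := hS.samples.comp (measurable_mirrorSample v) (map_mirrorSample r v) }

theorem integral_epoch_congr {z' : ℕ → Ω → EuclideanSpace ℝ (Fin d) × Θ × Θ'}
    (hS' : SGDSetting P D D' f G C z' fmax L ρ σ μ η r χ) {R : ℝ}
    (y₀ : EuclideanSpace ℝ (Fin d)) (n : ℕ)
    {Φ : EuclideanSpace ℝ (Fin d) × EuclideanSpace ℝ (Fin d) → ℝ} (hΦ : Measurable Φ)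
    (h0 : ∀ s, 0 ≤ Φ s) :
    ∫ ω, Φ (epoch η R G C y₀ (fun t => z t ω) n) ∂P =
      ∫ ω, Φ (epoch η R G C y₀ (fun t => z' t ω) n) ∂P := by
  rw [integral_eq_lintegral_of_nonneg_ae (Filter.Eventually.of_forall fun _ => h0 _)
      (hΦ.comp (hS.measurable_epoch_omega R y₀ n)).aestronglyMeasurable,
    integral_eq_lintegral_of_nonneg_ae (Filter.Eventually.of_forall fun _ => h0 _)
      (hΦ.comp (hS'.measurable_epoch_omega R y₀ n)).aestronglyMeasurable]
  congr 1
  exact hS.samples.lintegral_chain_congr (hS.measurable_epochStep R y₀) hS'.samples (y₀, 0) n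
    hΦ.ennreal_ofReal

theorem measurable_coupledStep (R a : ℝ) (y₀ v : EuclideanSpace ℝ (Fin d)) (n : ℕ) :
    Measurable (fun q : (((EuclideanSpace ℝ (Fin d) × EuclideanSpace ℝ (Fin d)) ×
      (EuclideanSpace ℝ (Fin d) × EuclideanSpace ℝ (Fin d))) × ℝ) ×
      (EuclideanSpace ℝ (Fin d) × Θ × Θ') => coupledStep η R a G C y₀ v n q.1 q.2) := by
  have h := hS.measurable_epochStep R y₀ n
  simp only [coupledStep]
  refine Measurable.prodMk (Measurable.prodMk ?_ ?_) ?_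
  · have hf : Measurable (fun q : (((EuclideanSpace ℝ (Fin d) × EuclideanSpace ℝ (Fin d)) ×
      (EuclideanSpace ℝ (Fin d) × EuclideanSpace ℝ (Fin d))) × ℝ) ×
      (EuclideanSpace ℝ (Fin d) × Θ × Θ') => (q.1.1.1, q.2)) := by fun_prop
    have h2 := h.comp hf
    exact h2
  · have hm := measurable_mirrorSample (Ξ := Θ × Θ') v
    have hf : Measurable (fun q : (((EuclideanSpace ℝ (Fin d) × EuclideanSpace ℝ (Fin d)) ×
      (EuclideanSpace ℝ (Fin d) × EuclideanSpace ℝ (Fin d))) × ℝ) ×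
      (EuclideanSpace ℝ (Fin d) × Θ × Θ') => (q.1.1.2, mirrorSample v q.2)) := by fun_prop
    have h2 := h.comp hf
    exact h2
  · unfold gaussStep; fun_prop

/-- One step of the coupled difference. -/
theorem lintegral_couplingTerm_le {R ℓ₀ σ₀ : ℝ}
    (hV : OracleDifferenceBound f G D ℓ₀ σ₀)
    {y₀ v : EuclideanSpace ℝ (Fin d)} {γ : ℝ} (hγ0 : 0 ≤ γ) (hv : ‖v‖ = 1)
    (hHv : hessian f y₀ v = -γ • v)
    (hHγ : ∀ w, -γ * ‖w‖ ^ 2 ≤ inner ℝ (hessian f y₀ w) w) (hηL : η * L ≤ 1)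
    {k₁ k₂ : ℝ} (hk1 : 0 < k₁) (hk1' : k₁ ≤ 1) (hk2 : 0 < k₂) (hk2' : k₂ ≤ 1) (n : ℕ)
    (c : ((EuclideanSpace ℝ (Fin d) × EuclideanSpace ℝ (Fin d)) ×
      (EuclideanSpace ℝ (Fin d) × EuclideanSpace ℝ (Fin d))) × ℝ) :
    ∫⁻ b, ENNReal.ofReal (couplingTerm R y₀ v
        (coupledStep η R (1 + η * γ) G C y₀ v n c b)) ∂(sampleLaw d r D D') ≤
      ENNReal.ofReal ((1 + k₁ + k₂) * (1 + η * γ) ^ 2 * couplingTerm R y₀ v c +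
        ((6 * η ^ 2 * ρ ^ 2 * R ^ 2 / k₁ + 24 * ℓ₀ ^ 2 * η ^ 2) *
            (couplingTerm R y₀ v c + c.2 ^ 2) +
          ((6 * η ^ 4 * L ^ 2 / k₂ + 12 * ℓ₀ ^ 2 * η ^ 4) *
            (errTerm R y₀ c.1.1 + errTerm R y₀ c.1.2) + 4 * σ₀ ^ 2 * η ^ 2))) := by
  obtain ⟨⟨⟨y, e⟩, ⟨y', e'⟩⟩, p⟩ := c
  have hη := hS.η_pos
  have hL := hS.L_pos
  have hρ := hS.ρ_pos
  by_cases h1 : ‖y - y₀‖ ≤ R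
  swap
  · have : ∀ b, couplingTerm R y₀ v
        (coupledStep η R (1 + η * γ) G C y₀ v n (((y, e), (y', e')), p) b) = 0 := by
      intro b; simp [couplingTerm, coupledStep, epochStep, near, h1]
    simp [this]
  by_cases h2 : ‖y' - y₀‖ ≤ R
  swap
  · have : ∀ b, couplingTerm R y₀ v
        (coupledStep η R (1 + η * γ) G C y₀ v n (((y, e), (y', e')), p) b) = 0 := by
      intro b; simp [couplingTerm, coupledStep, epochStep, near, h2]
    simp [this]
  set q : EuclideanSpace ℝ (Fin d) := y - y' - p • v with hq
  set x := y + η • e with hx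
  set x' := y' + η • e' with hx'
  set H := hessian f y₀ with hH
  -- `A` is the mean of the next deviation given the current state.
  set A : EuclideanSpace ℝ (Fin d) := y - y' - ((1 + η * γ) * p) • v -
    η • (gradient f x - gradient f x') with hA
  have hcen := (((hV x x').comp (measurePreserving_theta (d := d) (r := r) (D := D)
    (D' := D'))).smul (-η)).lintegral_sq_add_le A
  have hstep : ∀ b : EuclideanSpace ℝ (Fin d) × Θ × Θ', couplingTerm R y₀ v
        (coupledStep η R (1 + η * γ) G C y₀ v n (((y, e), (y', e')), p) b) ≤
      ‖A + (-η) • ((G x b.2.1 - gradient f x) - (G x' b.2.1 - gradient f x'))‖ ^ 2 := by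
    intro b
    -- The reflected noises differ by 2⟨v, ξ⟩v, exactly the increment subtracted by `gaussStep`.
    -- Both copies use the same θ, so the oracle noise enters only through its difference at the two
    -- points.
    have h3 : A + (-η) • ((G x b.2.1 - gradient f x) - (G x' b.2.1 - gradient f x')) =
        y - η • (G x b.2.1 + b.1) - (y' - η • (G x' b.2.1 + _root_.mirror v b.1)) -
          ((1 + η * γ) * p - 2 * η * inner ℝ v b.1) • v := by
      rw [mirror_apply hv]
      module
    rw [h3]
    simp only [couplingTerm, coupledStep, epochStep, if_pos h1, if_pos h2, pairStep, gaussStep,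
      mirrorSample]
    refine mul_le_of_le_one_left (by positivity) ?_
    exact mul_le_one₀ (near_le_one _ _ _) (near_nonneg _ _ _) (near_le_one _ _ _)
  refine (lintegral_mono fun b => ENNReal.ofReal_le_ofReal (hstep b)).trans
    (hcen.trans (ENNReal.ofReal_le_ofReal ?_))
  have hn1 : near R y₀ (y, e) = 1 := by simp [near, h1]
  have hn2 : near R y₀ (y', e') = 1 := by simp [near, h2]
  simp only [couplingTerm, errTerm, hn1, hn2, one_mul]
  rw [← hq]
  have hw : y - y' = q + p • v := by rw [hq]; abel
  have hwn : ‖y - y'‖ ≤ ‖q‖ + |p| := by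
    rw [hw]; refine (norm_add_le _ _).trans_eq ?_
    rw [norm_smul, hv, mul_one, Real.norm_eq_abs]
  have hwsq : ‖y - y'‖ ^ 2 ≤ 2 * (‖q‖ ^ 2 + p ^ 2) := by
    have := pow_le_pow_left₀ (norm_nonneg _) hwn 2
    nlinarith [sq_nonneg (‖q‖ - |p|), sq_abs p]
  -- Since Hv = −γv, the linearised step maps p•v to (1 + ηγ)p•v and the Gaussian part cancels. What
  -- remains is the propagated deviation, the variation of the Hessian, and the shifts caused by the
  -- compression errors.
  have hAdec : A = (1 - η • H) q + (-η) • (gradient f y - gradient f y' - H (y - y')) +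
      (-η) • ((gradient f x - gradient f y) - (gradient f x' - gradient f y')) := by
    have h3 : H q = H (y - y') + (p * γ) • v := by
      rw [hq, map_sub H (y - y'), map_smul, hHv]; module
    simp only [_root_.sub_apply, one_apply_eq_self, FunLike.coe_smul, Pi.smul_apply]
    rw [h3, hA, hq]
    module
  have hb1 : ‖(1 - η • H) q‖ ≤ (1 + η * γ) * ‖q‖ := by
    simpa using norm_one_sub_pow_apply_le (hS.objective.isSymmetric_hessian y₀)
      (hS.objective.norm_hessian_le hL y₀) hHγ hη hηL hγ0 1 q
  have hb2 : ‖(-η) • (gradient f y - gradient f y' - H (y - y'))‖ ≤ η * (ρ * R) * ‖y - y'‖ := by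
    rw [norm_smul, norm_neg, Real.norm_of_nonneg hη.le, mul_assoc]
    exact mul_le_mul_of_nonneg_left (hS.objective.norm_gradient_sub_sub_le hρ h2 h1) hη.le
  have hb3 : ‖(-η) • ((gradient f x - gradient f y) - (gradient f x' - gradient f y'))‖ ≤
      η ^ 2 * L * (‖e‖ + ‖e'‖) := by
    rw [norm_smul, norm_neg, Real.norm_of_nonneg hη.le]
    have h3 := hS.objective.smooth x y
    have h4 := hS.objective.smooth x' y'
    rw [hx, add_sub_cancel_left, norm_smul, Real.norm_of_nonneg hη.le] at h3
    rw [hx', add_sub_cancel_left, norm_smul, Real.norm_of_nonneg hη.le] at h4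
    have h5 := norm_sub_le (gradient f x - gradient f y) (gradient f x' - gradient f y')
    calc _ ≤ η * (L * (η * ‖e‖) + L * (η * ‖e'‖)) := by
          apply mul_le_mul_of_nonneg_left _ hη.le
          linarith
      _ = _ := by ring
  clear_value x x' q A H
  have hAn : ‖A‖ ≤ (1 + η * γ) * ‖q‖ + η * (ρ * R) * ‖y - y'‖ + η ^ 2 * L * (‖e‖ + ‖e'‖) := by
    rw [hAdec]
    refine (norm_add_le _ _).trans (add_le_add ((norm_add_le _ _).trans (add_le_add hb1 hb2)) hb3)
  have hxx : ‖x - x'‖ ≤ ‖y - y'‖ + η * ‖e‖ + η * ‖e'‖ := by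
    have : x - x' = (y - y') + η • e - η • e' := by rw [hx, hx']; abel
    rw [this]
    refine (norm_sub_le _ _).trans (add_le_add ((norm_add_le _ _).trans (add_le_add le_rfl ?_)) ?_)
    all_goals rw [norm_smul, Real.norm_of_nonneg hη.le]
  exact coupling_recursion_bound (norm_nonneg A) (norm_nonneg (x - x')) hAn hwsq hxx
    hk1 hk1' hk2 hk2'

end SGDSetting

/-! ### Escaping from saddle points -/

theorem mul_sum_geom_inv {x : ℝ} (hx : 0 < x) (n : ℕ) :
    x * ∑ k ∈ Finset.range n, ((1 + x)⁻¹) ^ k = (1 + x) * (1 - ((1 + x)⁻¹) ^ n) := by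
  induction n with
  | zero => simp
  | succ n ih =>
    rw [Finset.sum_range_succ, mul_add, ih, pow_succ]
    field_simp
    ring

theorem mul_sum_geom_inv_sq {x : ℝ} (hx : 0 < x) (n : ℕ) :
    (2 * x + x ^ 2) * ∑ k ∈ Finset.range n, (((1 + x)⁻¹) ^ (k + 1)) ^ 2 =
      1 - (((1 + x)⁻¹) ^ n) ^ 2 := by
  have hw : (1 + x)⁻¹ * (1 + x) = 1 := inv_mul_cancel₀ (by positivity)
  induction n with
  | zero => simp
  | succ n ih =>
    rw [Finset.sum_range_succ, mul_add, ih, pow_succ]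
    linear_combination (((1 + x)⁻¹) ^ n) ^ 2 * ((1 + x)⁻¹ * (1 + x) + 1) * hw

/-- After n ≥ 1/x steps (1 + x)^n ≥ 2 by Bernoulli, so the geometric sum has nearly reached its
limit. Thus the normalised Gaussian variance is at least a constant times its limiting size. -/
theorem one_div_eight_le_mul_sum {x : ℝ} (hx : 0 < x) (hx1 : x ≤ 1) {n : ℕ} (hn : 1 ≤ n * x) :
    1 / 8 ≤ x * ∑ k ∈ Finset.range n, (((1 + x)⁻¹) ^ (k + 1)) ^ 2 := by
  have h := mul_sum_geom_inv_sq hx n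
  set S := ∑ k ∈ Finset.range n, (((1 + x)⁻¹) ^ (k + 1)) ^ 2
  have hS : 0 ≤ S := Finset.sum_nonneg fun _ _ => by positivity
  have h1 : 2 ≤ (1 + x) ^ n := by
    have := one_add_mul_le_pow (a := x) (by linarith) n
    linarith
  have h2 : ((1 + x)⁻¹) ^ n ≤ 1 / 2 := by
    rw [inv_pow, ← one_div]
    exact one_div_le_one_div_of_le (by norm_num) h1
  have h3 : 0 ≤ ((1 + x)⁻¹) ^ n := by positivity
  have h4 : (((1 + x)⁻¹) ^ n) ^ 2 ≤ 1 / 4 := by nlinarith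
  have h5 : (2 * x + x ^ 2) * S ≤ 3 * (x * S) := by nlinarith [mul_nonneg hx.le hS]
  linarith

namespace SGDSetting

variable {d : ℕ} {Ω Θ Θ' : Type*} [MeasurableSpace Ω] [MeasurableSpace Θ]
    [MeasurableSpace Θ'] {P : Measure Ω} {D : Measure Θ} {D' : Measure Θ'}
    [IsProbabilityMeasure P] [IsProbabilityMeasure D] [IsProbabilityMeasure D']
    {f : EuclideanSpace ℝ (Fin d) → ℝ}
    {G : EuclideanSpace ℝ (Fin d) → Θ → EuclideanSpace ℝ (Fin d)}
    {C : EuclideanSpace ℝ (Fin d) → Θ' → EuclideanSpace ℝ (Fin d)}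
    {z : ℕ → Ω → EuclideanSpace ℝ (Fin d) × Θ × Θ'} {fmax L ρ σ μ η r χ : ℝ}
    (hS : SGDSetting P D D' f G C z fmax L ρ σ μ η r χ)
include hS

/-- Variance of the Gaussian part of the coupled difference after `n` steps. -/
noncomputable def _root_.gaussVar (a c : ℝ) (n : ℕ) : ℝ :=
  ∑ k ∈ Finset.range n, (a ^ 2) ^ k * c

omit hS in
theorem _root_.gaussVar_succ (a c : ℝ) (n : ℕ) : gaussVar a c (n + 1) = a ^ 2 * gaussVar a c n + c := by
  unfold gaussVar
  rw [Finset.sum_range_succ', Finset.mul_sum]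
  congr 1
  · exact Finset.sum_congr rfl fun _ _ => by ring
  · simp

omit hS in
theorem _root_.gaussVar_nonneg {a c : ℝ} (hc : 0 ≤ c) (n : ℕ) : 0 ≤ gaussVar a c n :=
  Finset.sum_nonneg fun _ _ => by positivity

-- Dividing by a^(2n) turns the variance into a partial sum of nonnegative terms, hence monotone in
-- `n`. The coupled recursion is solved in this normalisation.
omit hS in
theorem _root_.inv_pow_sq_mul_gaussVar {a : ℝ} (ha : 0 < a) (c : ℝ) (n : ℕ) :
    ((a⁻¹) ^ n) ^ 2 * gaussVar a c n = c * ∑ k ∈ Finset.range n, ((a⁻¹) ^ (k + 1)) ^ 2 := by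
  induction n with
  | zero => simp [gaussVar]
  | succ n ih =>
    rw [gaussVar_succ, Finset.sum_range_succ, mul_add, mul_add, ← ih, pow_succ]
    linear_combination ((a⁻¹) ^ n) ^ 2 * gaussVar a c n * (a⁻¹ * a + 1) * inv_mul_cancel₀ ha.ne'

theorem integral_sq_gauss {a : ℝ} {v : EuclideanSpace ℝ (Fin d)} (hv : ‖v‖ = 1) (n : ℕ) :
    Integrable (fun ω => (chain (gaussStep a (2 * η) v) 0 (fun t => z t ω) n) ^ 2) P ∧
    ∫ ω, (chain (gaussStep a (2 * η) v) 0 (fun t => z t ω) n) ^ 2 ∂P =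
      gaussVar a ((2 * η) ^ 2 * (r ^ 2 / d)) n := by
  have hm : Measurable (fun ω => chain (gaussStep a (2 * η) v) 0 (fun t => z t ω) n) :=
    hS.samples.measurable_chain (fun n => by unfold gaussStep; fun_prop) _ _
  have hlaw := map_chain_gaussStep hS.samples a (2 * η) hv n
  have hb : 0 ≤ gaussVar a ((2 * η) ^ 2 * (r ^ 2 / d)) n := gaussVar_nonneg (by positivity) n
  have hvar : Var[fun x => x; gaussianReal 0
      (∑ k ∈ Finset.range n, (a ^ 2) ^ k * ((2 * η) ^ 2 * (r ^ 2 / d))).toNNReal] =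
      gaussVar a ((2 * η) ^ 2 * (r ^ 2 / d)) n := by
    rw [variance_fun_id_gaussianReal]
    exact Real.coe_toNNReal _ hb
  constructor
  · have h1 : Integrable (fun x : ℝ => x ^ 2) (P.map (fun ω =>
        chain (gaussStep a (2 * η) v) 0 (fun t => z t ω) n)) := by
      rw [hlaw]
      have h2 := IsGaussian.memLp_two_id (μ := gaussianReal 0 (∑ k ∈ Finset.range n, (a ^ 2) ^ k * ((2 * η) ^ 2 * (r ^ 2 / d))).toNNReal)
      exact h2.integrable_sq
    exact h1.comp_measurable hm
  · rw [← integral_map (f := fun x : ℝ => x ^ 2) hm.aemeasurable (by fun_prop), hlaw, ← hvar,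
      variance_of_integral_eq_zero (by fun_prop) integral_id_gaussianReal]

omit hS in
theorem _root_.measurable_near_left (R : ℝ) (y₀ : EuclideanSpace ℝ (Fin d)) :
    Measurable (near R y₀) := by
  unfold near
  exact Measurable.ite (measurableSet_le (by fun_prop) (by fun_prop)) measurable_const
    measurable_const

omit hS in
theorem _root_.measurable_couplingTerm (R : ℝ) (y₀ v : EuclideanSpace ℝ (Fin d)) :
    Measurable (couplingTerm R y₀ v) := by
  have h1 := measurable_near_left R y₀
  generalize hF : near R y₀ = F at h1
  have h2 : Measurable fun c : ((EuclideanSpace ℝ (Fin d) × EuclideanSpace ℝ (Fin d)) ×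
      (EuclideanSpace ℝ (Fin d) × EuclideanSpace ℝ (Fin d))) × ℝ =>
      F c.1.1 * F c.1.2 * ‖c.1.1.1 - c.1.2.1 - c.2 • v‖ ^ 2 := by fun_prop
  rw [← hF] at h2
  exact h2

omit hS in
theorem _root_.couplingTerm_nonneg (R : ℝ) (y₀ v : EuclideanSpace ℝ (Fin d)) (c) :
    0 ≤ couplingTerm R y₀ v c :=
  mul_nonneg (mul_nonneg (near_nonneg _ _ _) (near_nonneg _ _ _)) (by positivity)

omit hS in
theorem _root_.integral_affine {Q p e e' : Ω → ℝ} (hQ : Integrable Q P) (hp : Integrable p P)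
    (he : Integrable e P) (he' : Integrable e' P) (K A B c : ℝ) :
    Integrable (fun ω => K * Q ω + (A * (Q ω + p ω) + (B * (e ω + e' ω) + c))) P ∧
    ∫ ω, K * Q ω + (A * (Q ω + p ω) + (B * (e ω + e' ω) + c)) ∂P =
      K * ∫ ω, Q ω ∂P + (A * (∫ ω, Q ω ∂P + ∫ ω, p ω ∂P) +
        (B * (∫ ω, e ω ∂P + ∫ ω, e' ω ∂P) + c)) := by
  have h1 : Integrable (fun ω => K * Q ω) P := hQ.const_mul K
  have h2 : Integrable (fun ω => A * (Q ω + p ω)) P := (hQ.add hp).const_mul A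
  have h3 : Integrable (fun ω => B * (e ω + e' ω)) P := (he.add he').const_mul B
  have h4 : Integrable (fun ω => B * (e ω + e' ω) + c) P := h3.add (integrable_const c)
  have h5 : Integrable (fun ω => A * (Q ω + p ω) + (B * (e ω + e' ω) + c)) P := h2.add h4
  refine ⟨h1.add h5, ?_⟩
  rw [integral_add h1 h5, integral_add h2 h4, integral_add h3 (integrable_const c),
    integral_const_mul, integral_const_mul, integral_const_mul, integral_add hQ hp,
    integral_add he he']
  simp

/-- The weight `k₂` may depend on `n`, because it will be chosen geometrically decaying. -/
theorem integral_couplingTerm_succ_le {R : ℝ} {ℓ₀ σ₀ : ℝ}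
    (hV : OracleDifferenceBound f G D ℓ₀ σ₀)
    {y₀ v : EuclideanSpace ℝ (Fin d)} {γ : ℝ} (hγ0 : 0 < γ) (hv : ‖v‖ = 1)
    (hHv : hessian f y₀ v = -γ • v)
    (hHγ : ∀ w, -γ * ‖w‖ ^ 2 ≤ inner ℝ (hessian f y₀ w) w) (hηL : η * L ≤ 1)
    {k₁ : ℝ} (hk1 : 0 < k₁) (hk1' : k₁ ≤ 1)
    {k₂ : ℕ → ℝ} (hk2 : ∀ n, 0 < k₂ n) (hk2' : ∀ n, k₂ n ≤ 1) (n : ℕ) :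
    Integrable (fun ω => couplingTerm R y₀ v
      (chain (coupledStep η R (1 + η * γ) G C y₀ v) (((y₀, 0), (y₀, 0)), 0)
        (fun t => z t ω) n)) P ∧
    ∫ ω, couplingTerm R y₀ v (chain (coupledStep η R (1 + η * γ) G C y₀ v)
        (((y₀, 0), (y₀, 0)), 0) (fun t => z t ω) (n + 1)) ∂P ≤
      (1 + k₁ + k₂ n) * (1 + η * γ) ^ 2 *
        ∫ ω, couplingTerm R y₀ v (chain (coupledStep η R (1 + η * γ) G C y₀ v)
          (((y₀, 0), (y₀, 0)), 0) (fun t => z t ω) n) ∂P +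
      ((6 * η ^ 2 * ρ ^ 2 * R ^ 2 / k₁ + 24 * ℓ₀ ^ 2 * η ^ 2) *
          (∫ ω, couplingTerm R y₀ v (chain (coupledStep η R (1 + η * γ) G C y₀ v)
            (((y₀, 0), (y₀, 0)), 0) (fun t => z t ω) n) ∂P +
            gaussVar (1 + η * γ) ((2 * η) ^ 2 * (r ^ 2 / d)) n) +
        ((6 * η ^ 4 * L ^ 2 / k₂ n + 12 * ℓ₀ ^ 2 * η ^ 4) *
          (2 * epochErr P G C z η R y₀ n) + 4 * σ₀ ^ 2 * η ^ 2)) := by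
  set X : ℕ → Ω → _ := fun n ω => chain (coupledStep η R (1 + η * γ) G C y₀ v)
    (((y₀, 0), (y₀, 0)), 0) (fun t => z t ω) n with hX
  have hS' := hS.mirror v
  have hη := hS.η_pos
  have hQ0 := couplingTerm_nonneg R y₀ v
  have hQm := measurable_couplingTerm R y₀ v
  have hp : ∀ n ω, (X n ω).2 = chain (gaussStep (1 + η * γ) (2 * η) v) 0 (fun t => z t ω) n :=
    fun n ω => by rw [hX]; simp only [chain_coupledStep]
  have h1 : ∀ n ω, (X n ω).1.1 = epoch η R G C y₀ (fun t => z t ω) n :=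
    fun n ω => by rw [hX]; simp only [chain_coupledStep]
  have h2 : ∀ n ω, (X n ω).1.2 = epoch η R G C y₀ (fun t => mirrorSample v (z t ω)) n :=
    fun n ω => by rw [hX]; simp only [chain_coupledStep]
  have hip : ∀ n, Integrable (fun ω => (X n ω).2 ^ 2) P := fun n => by
    simp only [hp]; exact (hS.integral_sq_gauss hv n).1
  have hi1 : ∀ n, Integrable (fun ω => errTerm R y₀ (X n ω).1.1) P := fun n => by
    simp only [h1]; exact (hS.epochErr_succ R y₀ n).1
  have hi2 : ∀ n, Integrable (fun ω => errTerm R y₀ (X n ω).1.2) P := fun n => by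
    simp only [h2]; exact (hS'.epochErr_succ R y₀ n).1
  set A := 6 * η ^ 2 * ρ ^ 2 * R ^ 2 / k₁ + 24 * ℓ₀ ^ 2 * η ^ 2 with hA
  have hA0 : 0 ≤ A := by positivity
  have hfin : ∀ n, Integrable (fun ω => couplingTerm R y₀ v (X n ω)) P →
      Integrable (fun ω => couplingTerm R y₀ v (X (n + 1) ω)) P ∧
      ∫ ω, couplingTerm R y₀ v (X (n + 1) ω) ∂P ≤
      (1 + k₁ + k₂ n) * (1 + η * γ) ^ 2 * ∫ ω, couplingTerm R y₀ v (X n ω) ∂P +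
      (A * (∫ ω, couplingTerm R y₀ v (X n ω) ∂P + ∫ ω, (X n ω).2 ^ 2 ∂P) +
      ((6 * η ^ 4 * L ^ 2 / k₂ n + 12 * ℓ₀ ^ 2 * η ^ 4) *
        (∫ ω, errTerm R y₀ (X n ω).1.1 ∂P + ∫ ω, errTerm R y₀ (X n ω).1.2 ∂P) +
        4 * σ₀ ^ 2 * η ^ 2)) := by
    intro n hn
    have hB0 : 0 ≤ 6 * η ^ 4 * L ^ 2 / k₂ n + 12 * ℓ₀ ^ 2 * η ^ 4 := by
      have := hk2 n; positivity
    set B := 6 * η ^ 4 * L ^ 2 / k₂ n + 12 * ℓ₀ ^ 2 * η ^ 4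
    have hK0 : 0 ≤ (1 + k₁ + k₂ n) * (1 + η * γ) ^ 2 := by have := hk2 n; positivity
    set K := (1 + k₁ + k₂ n) * (1 + η * γ) ^ 2
    have haff := integral_affine hn (hip n) (hi1 n) (hi2 n) K A B (4 * σ₀ ^ 2 * η ^ 2)
    have key := hS.samples.integral_chain_succ_le
      (hS.measurable_coupledStep R (1 + η * γ) y₀ v) (((y₀, 0), (y₀, 0)), 0) n
      (Φ' := couplingTerm R y₀ v) (Φ := fun c => K * couplingTerm R y₀ v c +
        (A * (couplingTerm R y₀ v c + c.2 ^ 2) +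
          (B * (errTerm R y₀ c.1.1 + errTerm R y₀ c.1.2) + 4 * σ₀ ^ 2 * η ^ 2)))
      hQm hQ0 (fun c => ?_) ?_
      (fun c => hS.lintegral_couplingTerm_le hV hγ0.le hv hHv hHγ hηL hk1 hk1' (hk2 n) (hk2' n) n c)
    · exact ⟨key.1, key.2.trans_eq haff.2⟩
    · have := hQ0 c
      have := errTerm_nonneg R y₀ c.1.1
      have := errTerm_nonneg R y₀ c.1.2
      positivity
    · exact haff.1
  have hint : ∀ n, Integrable (fun ω => couplingTerm R y₀ v (X n ω)) P := by
    intro n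
    induction n with
    | zero => exact integrable_const (couplingTerm R y₀ v (((y₀, 0), (y₀, 0)), 0))
    | succ n ih => exact (hfin n ih).1
  refine ⟨hint n, ?_⟩
  have hmain := (hfin n (hint n)).2
  have e1 : ∫ ω, (X n ω).2 ^ 2 ∂P = gaussVar (1 + η * γ) ((2 * η) ^ 2 * (r ^ 2 / d)) n := by
    simp only [hp]; exact (hS.integral_sq_gauss hv n).2
  have e2 : ∫ ω, errTerm R y₀ (X n ω).1.1 ∂P = epochErr P G C z η R y₀ n := by
    simp only [h1]; rfl
  -- The mirrored epoch has the same law as the original one, so its expected compression error is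
  -- the same.
  have e3 : ∫ ω, errTerm R y₀ (X n ω).1.2 ∂P = epochErr P G C z η R y₀ n := by
    simp only [h2]
    exact (hS.integral_epoch_congr hS' y₀ n (measurable_errTerm R y₀) (errTerm_nonneg R y₀)).symm
  rw [e1, e2, e3, ← two_mul] at hmain
  exact hmain

end SGDSetting

/-- After division by (1 + x)^(2n), Gronwall applies with rates 1/N, x(1 + x)^(−n) and `cN`. Their
sums stay bounded even though Nx may be large, which is why the weight of the compression error
decays. Its reciprocal costs only one factor (1 + x)^n, as `hBK` records, leaving a geometrically
weighted sum of errors. -/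
theorem coupling_gronwall {Q e B : ℕ → ℝ} {x c cN s K : ℝ} {N : ℕ} (hx : 0 < x) (hx1 : x ≤ 1)
    (hN : 1 ≤ N) (hc : 0 ≤ c) (hcN : 0 ≤ cN) (hs : 0 ≤ s) (hQ0 : Q 0 = 0) (hQ : ∀ n, 0 ≤ Q n)
    (he : ∀ n, 0 ≤ e n) (hB : ∀ n, 0 ≤ B n)
    (hBK : ∀ n, (((1 + x)⁻¹) ^ n) ^ 2 * B n ≤ ((1 + x)⁻¹) ^ n * K)
    (hrec : ∀ n < N, Q (n + 1) ≤ (1 + 1 / N + x * ((1 + x)⁻¹) ^ n) * (1 + x) ^ 2 * Q n +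
      (cN * (Q n + gaussVar (1 + x) c n) + (B n * e n + s)))
    (h1 : N * cN ≤ 1 / 40000) (h2 : s ≤ c / 40000)
    (h3 : K * ∑ n ∈ Finset.range N, ((1 + x)⁻¹) ^ n * e n ≤
      (((1 + x)⁻¹) ^ N) ^ 2 * gaussVar (1 + x) c N / 40000) :
    160 * Q N ≤ gaussVar (1 + x) c N := by
  set u : ℝ := (1 + x)⁻¹ with hu
  have ha : 0 < 1 + x := by linarith
  have hu0 : 0 < u := by positivity
  have hu1 : u ≤ 1 := by rw [hu]; exact inv_le_one_of_one_le₀ (by linarith)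
  have hua : u * (1 + x) = 1 := inv_mul_cancel₀ ha.ne'
  clear_value u
  set b := fun n => gaussVar (1 + x) c n with hb
  have hbn : ∀ n, (u ^ n) ^ 2 * b n = c * ∑ k ∈ Finset.range n, (u ^ (k + 1)) ^ 2 := by
    intro n
    have := inv_pow_sq_mul_gaussVar ha c n
    rw [← hu] at this; exact this
  have hmono : ∀ n ≤ N, (u ^ n) ^ 2 * b n ≤ (u ^ N) ^ 2 * b N := by
    intro n hn
    rw [hbn, hbn]
    exact mul_le_mul_of_nonneg_left (Finset.sum_le_sum_of_subset_of_nonneg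
      (Finset.range_mono hn) fun _ _ _ => by positivity) hc
  set Pt := (u ^ N) ^ 2 * b N with hPt
  have hPt0 : 0 ≤ Pt := mul_nonneg (by positivity) (gaussVar_nonneg hc N)
  have hsumw : x * ∑ n ∈ Finset.range N, u ^ n ≤ 2 := by
    have := mul_sum_geom_inv hx N
    rw [← hu] at this
    rw [this]
    have : 0 < u ^ N := by positivity
    nlinarith
  have hN0 : (0 : ℝ) < N := by exact_mod_cast hN
  have hstep : ∀ n < N, (u ^ (n + 1)) ^ 2 * Q (n + 1) ≤
      (1 + (1 / N + x * u ^ n + cN)) * ((u ^ n) ^ 2 * Q n) +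
        (cN * Pt + u ^ n * K * e n + s * (u ^ (n + 1)) ^ 2) := by
    intro n hn
    have hw : 0 < u ^ n := by positivity
    have hw2 : (u ^ (n + 1)) ^ 2 * (1 + x) ^ 2 = (u ^ n) ^ 2 := by
      rw [pow_succ]; linear_combination (u ^ n) ^ 2 * (u * (1 + x) + 1) * hua
    have hle : (u ^ (n + 1)) ^ 2 ≤ (u ^ n) ^ 2 :=
      pow_le_pow_left₀ (by positivity) (pow_le_pow_of_le_one hu0.le hu1 (Nat.le_succ n)) 2
    have hm := mul_le_mul_of_nonneg_left (hrec n hn) (by positivity : 0 ≤ (u ^ (n + 1)) ^ 2)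
    have hb0 : 0 ≤ b n := gaussVar_nonneg hc n
    have t1 : (u ^ (n + 1)) ^ 2 * (cN * Q n) ≤ (u ^ n) ^ 2 * (cN * Q n) :=
      mul_le_mul_of_nonneg_right hle (mul_nonneg hcN (hQ n))
    have t2 : (u ^ (n + 1)) ^ 2 * (cN * b n) ≤ cN * Pt := by
      have := mul_le_mul_of_nonneg_right hle (mul_nonneg hcN hb0)
      have := mul_le_mul_of_nonneg_left (hmono n hn.le) hcN
      linarith
    have t3 : (u ^ (n + 1)) ^ 2 * (B n * e n) ≤ u ^ n * K * e n := by
      have := mul_le_mul_of_nonneg_right hle (mul_nonneg (hB n) (he n))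
      have := mul_le_mul_of_nonneg_right (hBK n) (he n)
      linarith
    have t4 : (u ^ (n + 1)) ^ 2 * ((1 + 1 / N + x * u ^ n) * (1 + x) ^ 2 * Q n) =
      (1 + 1 / N + x * u ^ n) * ((u ^ n) ^ 2 * Q n) := by rw [← hw2]; ring
    linarith
  have hK : ∀ n, 0 ≤ u ^ n * K * e n := fun n =>
    mul_nonneg ((mul_nonneg (by positivity) (hB n)).trans (hBK n)) (he n)
  have hg := gronwall_sum (a := fun n => (u ^ n) ^ 2 * Q n)
    (c := fun n => 1 / N + x * u ^ n + cN)
    (h := fun n => cN * Pt + u ^ n * K * e n + s * (u ^ (n + 1)) ^ 2) N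
    (fun n _ => by positivity) (fun n _ => by have := hK n; positivity) (by simp [hQ0]) hstep
  -- The three rates sum to at most 1, 2 and 1/40000.
  have hcs : ∑ n ∈ Finset.range N, (1 / (N : ℝ) + x * u ^ n + cN) ≤ 4 := by
    rw [Finset.sum_add_distrib, Finset.sum_add_distrib, ← Finset.mul_sum, Finset.sum_const,
      Finset.sum_const, Finset.card_range, nsmul_eq_mul, nsmul_eq_mul, mul_one_div_cancel hN0.ne']
    linarith
  have hhs : ∑ n ∈ Finset.range N, (cN * Pt + u ^ n * K * e n + s * (u ^ (n + 1)) ^ 2) ≤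
      3 * Pt / 40000 := by
    rw [Finset.sum_add_distrib, Finset.sum_add_distrib, ← Finset.mul_sum _ _ s, Finset.sum_const,
      Finset.card_range, nsmul_eq_mul]
    have t1 : N * (cN * Pt) ≤ 1 / 40000 * Pt := by
      rw [← mul_assoc]; exact mul_le_mul_of_nonneg_right h1 hPt0
    have t2 : ∑ n ∈ Finset.range N, u ^ n * K * e n ≤ Pt / 40000 := by
      refine le_trans (le_of_eq ?_) h3
      rw [Finset.mul_sum]; exact Finset.sum_congr rfl fun _ _ => by ring
    have t3 : s * ∑ n ∈ Finset.range N, (u ^ (n + 1)) ^ 2 ≤ Pt / 40000 := by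
      rw [hPt, hbn]
      have := mul_le_mul_of_nonneg_right h2 (Finset.sum_nonneg fun (n : ℕ) (_ : n ∈ Finset.range N) =>
        (by positivity : 0 ≤ (u ^ (n + 1)) ^ 2))
      linarith
    linarith
  have hexp : Real.exp (∑ n ∈ Finset.range N, (1 / (N : ℝ) + x * u ^ n + cN)) ≤ 81 := by
    refine (Real.exp_le_exp.2 hcs).trans ?_
    have h := Real.exp_one_lt_d9
    have h' : Real.exp 4 = Real.exp 1 ^ 4 := by rw [← Real.exp_nat_mul]; norm_num
    rw [h']
    calc Real.exp 1 ^ 4 ≤ 3 ^ 4 := pow_le_pow_left₀ (Real.exp_pos 1).le (by linarith) 4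
      _ = 81 := by norm_num
  have hsum0 : 0 ≤ ∑ n ∈ Finset.range N, (cN * Pt + u ^ n * K * e n + s * (u ^ (n + 1)) ^ 2) :=
    Finset.sum_nonneg fun n _ => by have := hK n; positivity
  -- The amplification is at most e⁴ ≤ 81 and the three sources are each at most Pt/40000;
  -- 81·3/40000 is below 1/160.
  have hfin : (u ^ N) ^ 2 * Q N ≤ 81 * (3 * Pt / 40000) := by
    refine hg.trans ?_
    simp only [hQ0, mul_zero, zero_add]
    exact mul_le_mul hexp hhs hsum0 (by norm_num)
  have hw : 0 < (u ^ N) ^ 2 := by positivity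
  have : (u ^ N) ^ 2 * (160 * Q N) ≤ (u ^ N) ^ 2 * b N := by linarith
  exact le_of_mul_le_mul_left this hw

/-! ### Escape with constant probability. -/

namespace SGDSetting

variable {d : ℕ} {Ω Θ Θ' : Type*} [MeasurableSpace Ω] [MeasurableSpace Θ]
    [MeasurableSpace Θ'] {P : Measure Ω} {D : Measure Θ} {D' : Measure Θ'}
    [IsProbabilityMeasure P] [IsProbabilityMeasure D] [IsProbabilityMeasure D']
    {f : EuclideanSpace ℝ (Fin d) → ℝ}
    {G : EuclideanSpace ℝ (Fin d) → Θ → EuclideanSpace ℝ (Fin d)}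
    {C : EuclideanSpace ℝ (Fin d) → Θ' → EuclideanSpace ℝ (Fin d)}
    {z : ℕ → Ω → EuclideanSpace ℝ (Fin d) × Θ × Θ'} {fmax L ρ σ μ η r χ : ℝ}
    (hS : SGDSetting P D D' f G C z fmax L ρ σ μ η r χ)
include hS

/-- The compression error is driven by the full variance χ, whereas the Gaussian signal along `v`
has variance only r²/d per step. The comparison `hη` of the two forces the third term μ²√ε/((1 −
μ)d) of the step size. -/
theorem weighted_err_le {R : ℝ} (y₀ : EuclideanSpace ℝ (Fin d)) {ℓ₀ γ : ℝ} {N : ℕ}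
    (hγ0 : 0 < γ) (hx1 : η * γ ≤ 1) (hNx : 1 ≤ N * (η * γ)) (hr : 0 < r)
    (hSg : 3 * (∑ n ∈ Finset.range N, epochGrad P f G C z η R y₀ n) * (η * γ) ≤ χ)
    (hη : 5760000 * (L ^ 2 + 2 * ℓ₀ ^ 2) * (1 - μ) * η * χ ≤ μ ^ 2 * γ * (r ^ 2 / d)) :
    (6 * η ^ 3 * L ^ 2 / γ + 12 * ℓ₀ ^ 2 * η ^ 4) *
        ∑ n ∈ Finset.range N, ((1 + η * γ)⁻¹) ^ n * (2 * epochErr P G C z η R y₀ n) ≤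
      (((1 + η * γ)⁻¹) ^ N) ^ 2 * gaussVar (1 + η * γ) ((2 * η) ^ 2 * (r ^ 2 / d)) N / 40000 := by
  have hη0 := hS.η_pos
  have hμ0 := hS.μ_pos
  have hμ1 := hS.μ_le
  have hx : 0 < η * γ := by positivity
  have hd : (0 : ℝ) < d := by exact_mod_cast hS.dim_pos
  have hχ := hS.χ_nonneg
  have hu1 : (1 + η * γ)⁻¹ ≤ 1 := inv_le_one_of_one_le₀ (by linarith)
  have hu0 : 0 < (1 + η * γ)⁻¹ := by positivity
  have h1 := hS.sum_epochErr_le R y₀ N (w := fun n => ((1 + η * γ)⁻¹) ^ n)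
    (fun n => by positivity) (fun n => pow_le_one₀ hu0.le hu1)
    (fun n => pow_le_pow_of_le_one hu0.le hu1 (Nat.le_succ n))
  have hsw : η * γ * ∑ n ∈ Finset.range N, ((1 + η * γ)⁻¹) ^ n ≤ 2 := by
    rw [mul_sum_geom_inv hx N]
    have : 0 < (1 + η * γ)⁻¹ ^ N := by positivity
    nlinarith
  have h8 := one_div_eight_le_mul_sum hx hx1 hNx
  rw [inv_pow_sq_mul_gaussVar (by linarith)]
  have e2 : ∑ n ∈ Finset.range N, ((1 + η * γ)⁻¹) ^ n * (2 * epochErr P G C z η R y₀ n) =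
      2 * ∑ n ∈ Finset.range N, ((1 + η * γ)⁻¹) ^ n * epochErr P G C z η R y₀ n := by
    rw [Finset.mul_sum]; exact Finset.sum_congr rfl fun _ _ => by ring
  rw [e2]
  set Z := ∑ n ∈ Finset.range N, ((1 + η * γ)⁻¹) ^ n * epochErr P G C z η R y₀ n
  set V := ∑ k ∈ Finset.range N, ((1 + η * γ)⁻¹ ^ (k + 1)) ^ 2
  set Wt := ∑ n ∈ Finset.range N, ((1 + η * γ)⁻¹) ^ n
  set Sg := ∑ n ∈ Finset.range N, epochGrad P f G C z η R y₀ n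
  have hWt : 0 ≤ Wt := Finset.sum_nonneg fun _ _ => by positivity
  clear_value Z V Wt Sg
  have hq : 0 < r ^ 2 / d := by positivity
  set q := r ^ 2 / (d : ℝ)
  clear_value q
  set x := η * γ with hxdef
  -- The gradients contribute at most χ by `hSg`; the noise contributes at most 2χ because the
  -- weights sum to at most 2/x.
  have hZ : Z * x ≤ 2 * (1 - μ) / μ ^ 2 * (3 * χ) := by
    have t1 : μ * (χ * Wt) * x ≤ 2 * χ := by
      have e1 : μ * (χ * Wt) * x = μ * (χ * (x * Wt)) := by ring
      rw [e1]
      have := mul_le_mul_of_nonneg_left hsw hχ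
      have h0 : 0 ≤ χ * (x * Wt) := by positivity
      nlinarith
    have t2 : (3 * Sg + μ * (χ * Wt)) * x ≤ 3 * χ := by linarith
    have h0 : 0 ≤ 2 * (1 - μ) / μ ^ 2 := div_nonneg (by linarith) (by positivity)
    calc Z * x ≤ (2 * (1 - μ) / μ ^ 2 * (3 * Sg + μ * (χ * Wt))) * x :=
          mul_le_mul_of_nonneg_right h1 hx.le
      _ = 2 * (1 - μ) / μ ^ 2 * ((3 * Sg + μ * (χ * Wt)) * x) := by ring
      _ ≤ _ := mul_le_mul_of_nonneg_left t2 h0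
  have hK : (6 * η ^ 3 * L ^ 2 / γ + 12 * ℓ₀ ^ 2 * η ^ 4) * γ ≤
      6 * (L ^ 2 + 2 * ℓ₀ ^ 2) * η ^ 3 := by
    have e1 : (6 * η ^ 3 * L ^ 2 / γ + 12 * ℓ₀ ^ 2 * η ^ 4) * γ =
      6 * η ^ 3 * L ^ 2 + 12 * ℓ₀ ^ 2 * η ^ 3 * x := by rw [hxdef]; field_simp
    rw [e1]
    have : 12 * ℓ₀ ^ 2 * η ^ 3 * x ≤ 12 * ℓ₀ ^ 2 * η ^ 3 * 1 :=
      mul_le_mul_of_nonneg_left hx1 (by positivity)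
    linarith
  have hK0 : 0 ≤ 6 * η ^ 3 * L ^ 2 / γ + 12 * ℓ₀ ^ 2 * η ^ 4 := by positivity
  set K := 6 * η ^ 3 * L ^ 2 / γ + 12 * ℓ₀ ^ 2 * η ^ 4
  clear_value K
  have hη' : (L ^ 2 + 2 * ℓ₀ ^ 2) * (2 * (1 - μ) / μ ^ 2 * (3 * χ)) * η ≤ γ * q / 960000 := by
    have e1 : (L ^ 2 + 2 * ℓ₀ ^ 2) * (2 * (1 - μ) / μ ^ 2 * (3 * χ)) * η =
      (5760000 * (L ^ 2 + 2 * ℓ₀ ^ 2) * (1 - μ) * η * χ) / (μ ^ 2 * 960000) := by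
      field_simp; ring
    rw [e1, div_le_iff₀ (by positivity)]
    linarith
  have hcomb : (K * γ) * (Z * x) ≤ 6 * η ^ 2 * (γ * q / 960000) := by
    have h0 : 0 ≤ 2 * (1 - μ) / μ ^ 2 * (3 * χ) :=
      mul_nonneg (div_nonneg (by linarith) (by positivity)) (by positivity)
    calc (K * γ) * (Z * x) ≤ (K * γ) * (2 * (1 - μ) / μ ^ 2 * (3 * χ)) :=
          mul_le_mul_of_nonneg_left hZ (by positivity)
      _ ≤ (6 * (L ^ 2 + 2 * ℓ₀ ^ 2) * η ^ 3) * (2 * (1 - μ) / μ ^ 2 * (3 * χ)) :=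
          mul_le_mul_of_nonneg_right hK h0
      _ = 6 * η ^ 2 * ((L ^ 2 + 2 * ℓ₀ ^ 2) * (2 * (1 - μ) / μ ^ 2 * (3 * χ)) * η) := by ring
      _ ≤ _ := mul_le_mul_of_nonneg_left hη' (by positivity)
  have hV : 4 * η ^ 2 * q / 8 * γ ≤ 4 * η ^ 2 * q * (x * V) * γ := by
    have := mul_le_mul_of_nonneg_left h8 (by positivity : 0 ≤ 4 * η ^ 2 * q * γ)
    linarith
  have hpos : 0 < x * γ := by positivity
  refine le_of_mul_le_mul_right ?_ hpos
  have e3 : K * (2 * Z) * (x * γ) = 2 * ((K * γ) * (Z * x)) := by ring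
  have e4 : (2 * η) ^ 2 * q * V / 40000 * (x * γ) = 4 * η ^ 2 * q * (x * V) * γ / 40000 := by ring
  rw [e3, e4]
  linarith

theorem coupling_le {R : ℝ} {ℓ₀ σ₀ : ℝ} (hV : OracleDifferenceBound f G D ℓ₀ σ₀)
    {y₀ v : EuclideanSpace ℝ (Fin d)} {γ : ℝ} (hγ0 : 0 < γ) (hv : ‖v‖ = 1)
    (hHv : hessian f y₀ v = -γ • v)
    (hHγ : ∀ w, -γ * ‖w‖ ^ 2 ≤ inner ℝ (hessian f y₀ w) w) (hηL : η * L ≤ 1)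
    {N : ℕ} (hN : 1 ≤ N) (hx1 : η * γ ≤ 1) (hNx : 1 ≤ N * (η * γ)) (hr : 0 < r)
    (hSg : 3 * (∑ n ∈ Finset.range N, epochGrad P f G C z η R y₀ n) * (η * γ) ≤ χ)
    (hη : 5760000 * (L ^ 2 + 2 * ℓ₀ ^ 2) * (1 - μ) * η * χ ≤ μ ^ 2 * γ * (r ^ 2 / d))
    (hcN : N * (6 * N * η ^ 2 * ρ ^ 2 * R ^ 2 + 24 * ℓ₀ ^ 2 * η ^ 2) ≤ 1 / 40000)
    (hσ : σ₀ ^ 2 ≤ r ^ 2 / d / 40000) :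
    160 * ∫ ω, couplingTerm R y₀ v (chain (coupledStep η R (1 + η * γ) G C y₀ v)
        (((y₀, 0), (y₀, 0)), 0) (fun t => z t ω) N) ∂P ≤
      gaussVar (1 + η * γ) ((2 * η) ^ 2 * (r ^ 2 / d)) N := by
  have hη0 := hS.η_pos
  have hx : 0 < η * γ := by positivity
  have hN0 : (0 : ℝ) < N := by exact_mod_cast hN
  have hd : (0 : ℝ) < d := by exact_mod_cast hS.dim_pos
  have hu1 : (1 + η * γ)⁻¹ ≤ 1 := inv_le_one_of_one_le₀ (by linarith)
  have hu0 : 0 < (1 + η * γ)⁻¹ := by positivity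
  -- The weight used below for the compression error; the Hessian variation receives weight 1/N.
  have hk2 : ∀ n : ℕ, 0 < η * γ * ((1 + η * γ)⁻¹) ^ n := fun n => by positivity
  have hk2' : ∀ n : ℕ, η * γ * ((1 + η * γ)⁻¹) ^ n ≤ 1 := fun n =>
    mul_le_one₀ hx1 (by positivity) (pow_le_one₀ hu0.le hu1)
  refine coupling_gronwall (Q := fun n => ∫ ω, couplingTerm R y₀ v
    (chain (coupledStep η R (1 + η * γ) G C y₀ v) (((y₀, 0), (y₀, 0)), 0) (fun t => z t ω) n) ∂P)
    (e := fun n => 2 * epochErr P G C z η R y₀ n)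
    (B := fun n => 6 * η ^ 4 * L ^ 2 / (η * γ * ((1 + η * γ)⁻¹) ^ n) + 12 * ℓ₀ ^ 2 * η ^ 4)
    (cN := 6 * N * η ^ 2 * ρ ^ 2 * R ^ 2 + 24 * ℓ₀ ^ 2 * η ^ 2) (s := 4 * σ₀ ^ 2 * η ^ 2)
    (K := 6 * η ^ 3 * L ^ 2 / γ + 12 * ℓ₀ ^ 2 * η ^ 4)
    hx hx1 hN (by positivity) (by positivity) (by positivity) ?_ ?_ ?_ ?_ ?_ ?_ hcN ?_ ?_
  · simp [chain, couplingTerm]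
  · exact fun n => integral_nonneg fun _ => couplingTerm_nonneg _ _ _ _
  · exact fun n => mul_nonneg (by norm_num) (epochErr_nonneg R y₀ n)
  · intro n; have := hk2 n; positivity
  · intro n
    have hw : 0 < (1 + η * γ)⁻¹ ^ n := by positivity
    have hw1 : (1 + η * γ)⁻¹ ^ n ≤ 1 := pow_le_one₀ hu0.le hu1
    set w := (1 + η * γ)⁻¹ ^ n
    clear_value w
    have e1 : w ^ 2 * (6 * η ^ 4 * L ^ 2 / (η * γ * w) + 12 * ℓ₀ ^ 2 * η ^ 4) =
      w * (6 * η ^ 3 * L ^ 2 / γ) + w * (w * (12 * ℓ₀ ^ 2 * η ^ 4)) := by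
      field_simp
    rw [e1, mul_add]
    have := mul_le_mul_of_nonneg_right hw1 (by positivity : 0 ≤ 12 * ℓ₀ ^ 2 * η ^ 4)
    have := mul_le_mul_of_nonneg_left this hw.le
    linarith
  · intro n _
    have h := (hS.integral_couplingTerm_succ_le (R := R) hV hγ0 hv hHv hHγ hηL (k₁ := 1 / N)
      (by positivity) (by rw [div_le_one hN0]; exact_mod_cast hN) hk2 hk2' n).2
    have e1 : 6 * η ^ 2 * ρ ^ 2 * R ^ 2 / (1 / (N : ℝ)) = 6 * N * η ^ 2 * ρ ^ 2 * R ^ 2 := by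
      field_simp
    rw [e1] at h
    exact h
  · have := mul_le_mul_of_nonneg_left hσ (by positivity : 0 ≤ 4 * η ^ 2)
    linarith
  · exact hS.weighted_err_le y₀ hγ0 hx1 hNx hr hSg hη

omit hS in
theorem _root_.gaussVar_mono {a a' c : ℝ} (ha : 0 ≤ a) (h : a ≤ a') (hc : 0 ≤ c) (n : ℕ) :
    gaussVar a c n ≤ gaussVar a' c n :=
  Finset.sum_le_sum fun _ _ => mul_le_mul_of_nonneg_right
    (pow_le_pow_left₀ (by positivity) (pow_le_pow_left₀ ha h 2) _) hc

/-- Bounding the density by its peak, a centred Gaussian is within half a standard deviation of zero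
with probability at most 1/√(2π) ≤ 2/5. -/
theorem prob_gauss_le {a : ℝ} {v : EuclideanSpace ℝ (Fin d)} (hv : ‖v‖ = 1) (n : ℕ)
    (hb : 0 < gaussVar a ((2 * η) ^ 2 * (r ^ 2 / d)) n) :
    P.real {ω | |chain (gaussStep a (2 * η) v) 0 (fun t => z t ω) n| ≤
      √(gaussVar a ((2 * η) ^ 2 * (r ^ 2 / d)) n) / 2} ≤ 2 / 5 := by
  have hm : Measurable (fun ω => chain (gaussStep a (2 * η) v) 0 (fun t => z t ω) n) :=
    hS.samples.measurable_chain (fun n => by unfold gaussStep; fun_prop) _ _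
  have hlaw := map_chain_gaussStep hS.samples a (2 * η) hv n
  set b := gaussVar a ((2 * η) ^ 2 * (r ^ 2 / d)) n with hbdef
  have e1 : {ω | |chain (gaussStep a (2 * η) v) 0 (fun t => z t ω) n| ≤ √b / 2} =
      (fun ω => chain (gaussStep a (2 * η) v) 0 (fun t => z t ω) n) ⁻¹'
        Set.Icc (-(√b / 2)) (√b / 2) := by
    ext ω; simp [abs_le]
  rw [e1, ← map_measureReal_apply hm measurableSet_Icc, hlaw]
  have hbc : ∑ k ∈ Finset.range n, (a ^ 2) ^ k * ((2 * η) ^ 2 * (r ^ 2 / d)) = b := rfl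
  rw [hbc]
  have h := gaussianReal_Icc_le (v := b.toNNReal) (by simpa using hb) (√b / 2) (by positivity)
  rw [Real.coe_toNNReal _ hb.le, Real.sqrt_mul (by positivity)] at h
  refine h.trans ?_
  have h5 : (5 / 2 : ℝ) ≤ √(2 * Real.pi) := by
    apply Real.le_sqrt_of_sq_le
    have := Real.pi_gt_d2
    norm_num; linarith
  have hsb : 0 < √b := Real.sqrt_pos.2 hb
  rw [← div_eq_mul_inv, div_le_iff₀ (by positivity)]
  have := mul_le_mul_of_nonneg_right h5 hsb.le
  linarith

-- If both runs stay within R, they are at most 2R ≤ √b/4 apart. When |p| > √b/2, the deviation from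
-- the Gaussian part is then at least √b/4, its square at least b/16.
omit hS in
theorem _root_.near_mul_near_le {R b : ℝ} (hb : 0 < b) (hbR : 64 * R ^ 2 ≤ b)
    (y₀ v : EuclideanSpace ℝ (Fin d)) (hv : ‖v‖ = 1)
    (s s' : EuclideanSpace ℝ (Fin d) × EuclideanSpace ℝ (Fin d)) (p : ℝ) :
    near R y₀ s * near R y₀ s' ≤ 16 / b * couplingTerm R y₀ v ((s, s'), p) +
      (if |p| ≤ √b / 2 then 1 else 0) := by
  have hQ := couplingTerm_nonneg R y₀ v ((s, s'), p)
  by_cases hp : |p| ≤ √b / 2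
  · rw [if_pos hp]
    have h1 := mul_le_one₀ (near_le_one R y₀ s) (near_nonneg R y₀ s') (near_le_one R y₀ s')
    have : 0 ≤ 16 / b * couplingTerm R y₀ v ((s, s'), p) := by positivity
    linarith
  · rw [if_neg hp, add_zero]
    unfold couplingTerm near
    split_ifs with h1 h2 h2
    · have hsb : 0 < √b := Real.sqrt_pos.2 hb
      have h3 : 8 * R ≤ √b := Real.le_sqrt_of_sq_le (by linarith [mul_pow 8 R 2])
      have h4 : ‖s.1 - s'.1‖ ≤ 2 * R := by
        have : s.1 - s'.1 = (s.1 - y₀) - (s'.1 - y₀) := by abel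
        rw [this]
        linarith [norm_sub_le (s.1 - y₀) (s'.1 - y₀)]
      have h5 : |p| ≤ ‖s.1 - s'.1‖ + ‖s.1 - s'.1 - p • v‖ := by
        have : p • v = (s.1 - s'.1) - (s.1 - s'.1 - p • v) := by abel
        have h6 : ‖p • v‖ = |p| := by rw [norm_smul, hv, mul_one, Real.norm_eq_abs]
        rw [← h6]; nth_rewrite 1 [this]; exact norm_sub_le _ _
      have h7 : √b / 4 ≤ ‖s.1 - s'.1 - p • v‖ := by linarith
      have h8 : (√b / 4) ^ 2 ≤ ‖s.1 - s'.1 - p • v‖ ^ 2 := pow_le_pow_left₀ (by positivity) h7 2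
      rw [div_pow, Real.sq_sqrt hb.le] at h8
      simp only [one_mul]
      rw [div_mul_eq_mul_div, le_div_iff₀ hb]
      linarith
    all_goals simp

/-- Both copies stay with probability at most 1/10 + 2/5 = 1/2. They have the same staying
probability, hence 2·P(stay) ≤ 1 + 1/2. -/
theorem half_exit {R : ℝ} (hR : 0 < R) {y₀ v : EuclideanSpace ℝ (Fin d)} (hv : ‖v‖ = 1)
    {a : ℝ} {N : ℕ}
    (hint : Integrable (fun ω => couplingTerm R y₀ v
      (chain (coupledStep η R a G C y₀ v) (((y₀, 0), (y₀, 0)), 0) (fun t => z t ω) N)) P)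
    (hQ : 160 * ∫ ω, couplingTerm R y₀ v (chain (coupledStep η R a G C y₀ v)
        (((y₀, 0), (y₀, 0)), 0) (fun t => z t ω) N) ∂P ≤
      gaussVar a ((2 * η) ^ 2 * (r ^ 2 / d)) N)
    (hbR : 64 * R ^ 2 ≤ gaussVar a ((2 * η) ^ 2 * (r ^ 2 / d)) N) :
    ∫ ω, near R y₀ (epoch η R G C y₀ (fun t => z t ω) N) ∂P ≤ 3 / 4 := by
  set b := gaussVar a ((2 * η) ^ 2 * (r ^ 2 / d)) N with hbdef
  have hb : 0 < b := lt_of_lt_of_le (by positivity) hbR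
  have hgp := hS.prob_gauss_le hv N hb
  have hS' := hS.mirror v
  have hnm := measurable_near_left R y₀
  have hm1 : Measurable fun ω => near R y₀ (epoch η R G C y₀ (fun t => z t ω) N) :=
    hnm.comp (hS.measurable_epoch_omega R y₀ N)
  have hm2 : Measurable fun ω => near R y₀
      (epoch η R G C y₀ (fun t => mirrorSample v (z t ω)) N) :=
    hnm.comp (hS'.measurable_epoch_omega R y₀ N)
  have hbd : ∀ s, ‖near R y₀ s‖ ≤ 1 := fun s => by
    rw [Real.norm_of_nonneg (near_nonneg _ _ _)]; exact near_le_one _ _ _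
  have hi1 : Integrable (fun ω => near R y₀ (epoch η R G C y₀ (fun t => z t ω) N)) P :=
    Integrable.of_bound hm1.aestronglyMeasurable 1 (.of_forall fun _ => hbd _)
  have hi2 : Integrable (fun ω => near R y₀
      (epoch η R G C y₀ (fun t => mirrorSample v (z t ω)) N)) P :=
    Integrable.of_bound hm2.aestronglyMeasurable 1 (.of_forall fun _ => hbd _)
  have heq := hS.integral_epoch_congr hS' (R := R) y₀ N hnm (near_nonneg R y₀)
  simp only [chain_coupledStep] at hint hQ
  have hpm : Measurable (fun ω => chain (gaussStep a (2 * η) v) 0 (fun t => z t ω) N) :=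
    hS.samples.measurable_chain (fun n => by unfold gaussStep; fun_prop) _ _
  set p := fun ω => chain (gaussStep a (2 * η) v) 0 (fun t => z t ω) N with hp
  have hset : MeasurableSet {ω | |p ω| ≤ √b / 2} :=
    measurableSet_le (by fun_prop) measurable_const
  have hi3 : Integrable (fun ω => if |p ω| ≤ √b / 2 then (1 : ℝ) else 0) P :=
    Integrable.of_bound (Measurable.ite hset measurable_const
      measurable_const).aestronglyMeasurable 1 (.of_forall fun _ => by split_ifs <;> norm_num)
  have e3 : ∫ ω, (if |p ω| ≤ √b / 2 then (1 : ℝ) else 0) ∂P = P.real {ω | |p ω| ≤ √b / 2} := by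
    rw [← integral_indicator_one hset]; rfl
  have hpt : ∀ ω, near R y₀ (epoch η R G C y₀ (fun t => z t ω) N) +
      near R y₀ (epoch η R G C y₀ (fun t => mirrorSample v (z t ω)) N) ≤
      1 + (16 / b * couplingTerm R y₀ v ((epoch η R G C y₀ (fun t => z t ω) N,
        epoch η R G C y₀ (fun t => mirrorSample v (z t ω)) N), p ω) +
        (if |p ω| ≤ √b / 2 then (1 : ℝ) else 0)) := by
    intro ω
    have h1 := near_mul_near_le hb hbR y₀ v hv (epoch η R G C y₀ (fun t => z t ω) N)
      (epoch η R G C y₀ (fun t => mirrorSample v (z t ω)) N) (p ω)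
    have h2 := near_le_one R y₀ (epoch η R G C y₀ (fun t => z t ω) N)
    have h3 := near_le_one R y₀ (epoch η R G C y₀ (fun t => mirrorSample v (z t ω)) N)
    -- For indicators a and a', (1 − a)(1 − a') ≥ 0 gives a + a' ≤ 1 + aa'.
    nlinarith [mul_nonneg (sub_nonneg.2 h2) (sub_nonneg.2 h3)]
  have hi4 := hint.const_mul (16 / b)
  have hmain := integral_mono (hi1.add hi2) ((integrable_const (1 : ℝ)).add (hi4.add hi3)) hpt
  rw [integral_add' hi1 hi2, integral_add' (integrable_const _) (hi4.add hi3),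
    integral_add' hi4 hi3, integral_const_mul, e3, ← heq] at hmain
  simp only [integral_const, probReal_univ, one_smul] at hmain
  have hQ' : 16 / b * ∫ ω, couplingTerm R y₀ v ((epoch η R G C y₀ (fun t => z t ω) N,
        epoch η R G C y₀ (fun t => mirrorSample v (z t ω)) N), p ω) ∂P ≤ 1 / 10 := by
    rw [div_mul_eq_mul_div, div_le_iff₀ hb]; linarith
  linarith

/-- A starting point with a direction of negative curvature is left with constant probability,
and this is paid for by the squared gradients met on the way. -/
theorem sum_epochGrad_ge_of_negCurvature {R : ℝ} (hR : 0 < R) {ℓ₀ σ₀ : ℝ}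
    (hV : OracleDifferenceBound f G D ℓ₀ σ₀) {y₀ : EuclideanSpace ℝ (Fin d)} {κ : ℝ}
    (hκ : 0 < κ) (hneg : NegCurvature f κ y₀) (hηL : η * L ≤ 1) {N : ℕ} (hN : 1 ≤ N)
    (hNx : 1 ≤ N * (η * κ)) (hr : 0 < r) (hRχ : R ^ 2 * L ≤ 16 * N * η * χ)
    (hη : 5760000 * (L ^ 2 + 2 * ℓ₀ ^ 2) * (1 - μ) * η * χ ≤ μ ^ 2 * κ * (r ^ 2 / d))
    (hcN : N * (6 * N * η ^ 2 * ρ ^ 2 * R ^ 2 + 24 * ℓ₀ ^ 2 * η ^ 2) ≤ 1 / 40000)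
    (hσ : σ₀ ^ 2 ≤ r ^ 2 / d / 40000) (hχR : 24 * N * η ^ 2 * χ ≤ R ^ 2)
    (hbR : 64 * R ^ 2 ≤ gaussVar (1 + η * κ) ((2 * η) ^ 2 * (r ^ 2 / d)) N) :
    R ^ 2 / (48 * N * η ^ 2) ≤ ∑ n ∈ Finset.range N, epochGrad P f G C z η R y₀ n := by
  have hη0 := hS.η_pos
  have hN0 : (0 : ℝ) < N := by exact_mod_cast hN
  have hd : (0 : ℝ) < d := by exact_mod_cast hS.dim_pos
  -- A small sum of gradients makes the coupling effective and forces an exit with probability at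
  -- least 1/4; the exit bound then contradicts the smallness of the sum.
  by_contra hlt
  push Not at hlt
  -- The bottom eigenvalue −γ itself is used, not only the threshold −κ, so that 1 + ηγ is the
  -- largest growth factor of the linearised step.
  obtain ⟨γ, v, hγκ, hv, hHv, hHγ⟩ := hS.objective.exists_bottom_eigenvector hneg
  have hγ0 : 0 < γ := hκ.trans hγκ
  have hγL : γ ≤ L := by
    have h1 := hS.objective.norm_hessian_le hS.L_pos y₀
    have h2 := (hessian f y₀).le_opNorm v
    rw [hHv, norm_smul, hv, mul_one, mul_one, norm_neg, Real.norm_of_nonneg hγ0.le] at h2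
    linarith
  have hx : η * κ ≤ η * γ := mul_le_mul_of_nonneg_left hγκ.le hη0.le
  have hx1 : η * γ ≤ 1 := (mul_le_mul_of_nonneg_left hγL hη0.le).trans hηL
  have hNx' : 1 ≤ N * (η * γ) := hNx.trans (mul_le_mul_of_nonneg_left hx hN0.le)
  have hSnn : 0 ≤ ∑ n ∈ Finset.range N, epochGrad P f G C z η R y₀ n :=
    Finset.sum_nonneg fun n _ => epochGrad_nonneg R y₀ n
  have hexit := hS.measureReal_exit_le hR y₀ hN
  set Sg := ∑ n ∈ Finset.range N, epochGrad P f G C z η R y₀ n with hSgdef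
  rw [lt_div_iff₀ (by positivity)] at hlt
  have hSg : 3 * Sg * (η * γ) ≤ χ := by
    have h1 : 3 * Sg * (η * γ) ≤ 3 * Sg * (η * L) :=
      mul_le_mul_of_nonneg_left (mul_le_mul_of_nonneg_left hγL hη0.le) (by positivity)
    have h2 := mul_le_mul_of_nonneg_right hlt.le hS.L_pos.le
    have h3 : (3 * Sg * (η * L)) * (16 * N * η) ≤ χ * (16 * N * η) := by linarith
    exact h1.trans (le_of_mul_le_mul_right h3 (by positivity))
  have hη' : 5760000 * (L ^ 2 + 2 * ℓ₀ ^ 2) * (1 - μ) * η * χ ≤ μ ^ 2 * γ * (r ^ 2 / d) := by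
    refine hη.trans ?_
    have := hS.μ_pos
    gcongr
  have hQ := hS.coupling_le hV hγ0 hv hHv hHγ hηL hN hx1 hNx' hr hSg hη' hcN hσ
  have hbR' := hbR.trans (gaussVar_mono (by positivity) (by linarith : 1 + η * κ ≤ 1 + η * γ)
    (by positivity : 0 ≤ (2 * η) ^ 2 * (r ^ 2 / d)) N)
  have hint := (hS.integral_couplingTerm_succ_le (R := R) hV hγ0 hv hHv hHγ hηL (k₁ := 1)
    one_pos le_rfl (k₂ := fun _ => 1) (fun _ => one_pos) (fun _ => le_rfl) N).1
  have hhalf := hS.half_exit hR hv hint hQ hbR'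
  have hset : MeasurableSet {ω | R < ‖(epoch η R G C y₀ (fun t => z t ω) N).1 - y₀‖} :=
    measurableSet_lt measurable_const
      (((hS.measurable_epoch_omega R y₀ N).fst.sub measurable_const).norm)
  have e1 : ∫ ω, near R y₀ (epoch η R G C y₀ (fun t => z t ω) N) ∂P =
      1 - P.real {ω | R < ‖(epoch η R G C y₀ (fun t => z t ω) N).1 - y₀‖} := by
    rw [← probReal_compl_eq_one_sub hset, ← integral_indicator_one hset.compl]
    refine integral_congr_ae (.of_forall fun ω => ?_)
    simp only [near, Set.indicator_apply, Set.mem_compl_iff, Set.mem_ofPred_eq, not_lt,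
      Pi.one_apply]
  rw [e1] at hhalf
  -- The gradient part of the exit bound is below 1/8 by `hlt`, and the noise part is at most 1/8 by
  -- `hχR`.
  have h4 := (by linarith : (1 / 4 : ℝ) ≤ P.real {ω | R < ‖(epoch η R G C y₀
    (fun t => z t ω) N).1 - y₀‖}).trans hexit
  rw [le_div_iff₀ (by positivity)] at h4
  linarith

end SGDSetting

/-! ### The end point of an epoch -/

/-- Each term is at most (1 + u)(1/(1 + ku) − 1/(1 + (k + 1)u)), so the sum telescopes. -/
theorem sum_div_one_add_mul_sq_le {u : ℝ} (hu : 0 ≤ u) (n : ℕ) :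
    ∑ k ∈ Finset.range n, u / (1 + k * u) ^ 2 ≤ (1 + u) * (1 - 1 / (1 + n * u)) := by
  induction n with
  | zero => simp
  | succ n ih =>
    rw [Finset.sum_range_succ]
    have h1 : 0 < 1 + n * u := by positivity
    have h2 : 0 < 1 + (n + 1) * u := by positivity
    have h3 : u / (1 + n * u) ^ 2 ≤ (1 + u) * (1 / (1 + n * u) - 1 / (1 + (n + 1) * u)) := by
      have e : (1 + u) * (1 / (1 + n * u) - 1 / (1 + (n + 1) * u)) =
          u * (1 + u) / ((1 + n * u) * (1 + (n + 1) * u)) := by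
        field_simp; ring
      rw [e, div_le_div_iff₀ (by positivity) (by positivity)]
      have : 1 + (n + 1) * u ≤ (1 + u) * (1 + n * u) := by nlinarith [mul_nonneg hu hu]
      have := mul_le_mul_of_nonneg_left this (by positivity : 0 ≤ u * (1 + n * u))
      linarith
    push_cast
    linarith

/-- The decaying part sums to O(ηL) for every `W`. The constant part contributes O(Wη²γ²), which is
O(ηγ) because Wηγ ≤ 1. -/
theorem sum_drift_bound_le {η L γ : ℝ} {W : ℕ} (hη : 0 < η) (hL : 0 < L) (hηL : η * L ≤ 1)
    (hγ : 0 ≤ γ) (hW : W * (η * γ) ≤ 1) :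
    ∑ k ∈ Finset.range W, η ^ 2 * (L / (1 + k * (η * L)) + 9 / 2 * γ) ^ 2 ≤
      η * (4 * L + 41 * γ) := by
  have hu : 0 < η * L := by positivity
  have h1 := sum_div_one_add_mul_sq_le hu.le W
  have h2 : (1 + η * L) * (1 - 1 / (1 + W * (η * L))) ≤ 2 := by
    have h3 : 0 < 1 / (1 + W * (η * L)) := by positivity
    nlinarith
  have h4 : ∀ k ∈ Finset.range W, η ^ 2 * (L / (1 + k * (η * L)) + 9 / 2 * γ) ^ 2 ≤
      2 * (η * L) * ((η * L) / (1 + k * (η * L)) ^ 2) + 81 / 2 * (η * γ) ^ 2 := by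
    intro k _
    have h5 : (L / (1 + k * (η * L)) + 9 / 2 * γ) ^ 2 ≤
        2 * (L / (1 + k * (η * L))) ^ 2 + 2 * (9 / 2 * γ) ^ 2 := by
      nlinarith [sq_nonneg (L / (1 + k * (η * L)) - 9 / 2 * γ)]
    have h6 := mul_le_mul_of_nonneg_left h5 (by positivity : 0 ≤ η ^ 2)
    refine h6.trans (le_of_eq ?_)
    rw [div_pow]
    have : (1 + k * (η * L)) ≠ 0 := by positivity
    field_simp
    ring
  refine (Finset.sum_le_sum h4).trans ?_
  rw [Finset.sum_add_distrib, ← Finset.mul_sum, Finset.sum_const, Finset.card_range, nsmul_eq_mul]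
  have h7 := mul_le_mul_of_nonneg_left (h1.trans h2) (by positivity : 0 ≤ 2 * (η * L))
  have h8 := mul_le_mul_of_nonneg_right hW (by positivity : 0 ≤ 81 / 2 * (η * γ))
  have h9 : 0 ≤ η * γ := by positivity
  have e : (W : ℝ) * (81 / 2 * (η * γ) ^ 2) = W * (η * γ) * (81 / 2 * (η * γ)) := by ring
  rw [e]
  linarith

theorem one_add_pow_le_three {x : ℝ} (hx : 0 ≤ x) {k W : ℕ} (hk : k ≤ W) (hW : W * x ≤ 1) :
    (1 + x) ^ k ≤ 3 := by
  have h1 : (1 + x) ^ k ≤ Real.exp x ^ k :=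
    pow_le_pow_left₀ (by linarith) (by linarith [Real.add_one_le_exp x]) k
  rw [← Real.exp_nat_mul] at h1
  have h2 : (k : ℝ) * x ≤ 1 :=
    (mul_le_mul_of_nonneg_right (by exact_mod_cast hk) hx).trans hW
  have h3 := Real.exp_le_exp.2 h2
  have h4 := Real.exp_one_lt_d9
  linarith

theorem le_young {q : ℝ} (hq : 0 < q) (a : ℝ) : a ≤ q / 2 + a ^ 2 / (2 * q) := by
  have : q / 2 + a ^ 2 / (2 * q) - a = (a - q) ^ 2 / (2 * q) := by field_simp; ring
  have h : 0 ≤ (a - q) ^ 2 / (2 * q) := by positivity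
  linarith

/-- One step of an epoch, together with the accumulated noise `m`, propagated by `T`. -/
noncomputable def driftStep {d : ℕ} {Θ Θ' : Type*} (η R : ℝ)
    (f : EuclideanSpace ℝ (Fin d) → ℝ)
    (G : EuclideanSpace ℝ (Fin d) → Θ → EuclideanSpace ℝ (Fin d))
    (C : EuclideanSpace ℝ (Fin d) → Θ' → EuclideanSpace ℝ (Fin d))
    (y₀ : EuclideanSpace ℝ (Fin d))
    (T : ℕ → EuclideanSpace ℝ (Fin d) →L[ℝ] EuclideanSpace ℝ (Fin d)) (n : ℕ)
    (c : (EuclideanSpace ℝ (Fin d) × EuclideanSpace ℝ (Fin d)) × EuclideanSpace ℝ (Fin d))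
    (b : EuclideanSpace ℝ (Fin d) × Θ × Θ') :
    (EuclideanSpace ℝ (Fin d) × EuclideanSpace ℝ (Fin d)) × EuclideanSpace ℝ (Fin d) :=
  (epochStep η R G C y₀ n c.1 b,
    if ‖c.1.1 - y₀‖ ≤ R then c.2 - η • T n (hessian f c.1.1
      ((G (c.1.1 + η • c.1.2) b.2.1 - gradient f (c.1.1 + η • c.1.2)) + b.1)) else c.2)

theorem chain_driftStep_fst {d : ℕ} {Θ Θ' : Type*} (η R : ℝ)
    (f : EuclideanSpace ℝ (Fin d) → ℝ)
    (G : EuclideanSpace ℝ (Fin d) → Θ → EuclideanSpace ℝ (Fin d))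
    (C : EuclideanSpace ℝ (Fin d) → Θ' → EuclideanSpace ℝ (Fin d))
    (y₀ : EuclideanSpace ℝ (Fin d))
    (T : ℕ → EuclideanSpace ℝ (Fin d) →L[ℝ] EuclideanSpace ℝ (Fin d))
    (z : ℕ → EuclideanSpace ℝ (Fin d) × Θ × Θ') (n : ℕ) :
    (chain (driftStep η R f G C y₀ T) ((y₀, 0), 0) z n).1 = epoch η R G C y₀ z n := by
  induction n with
  | zero => rfl
  | succ n ih =>
    simp only [chain, driftStep]
    rw [ih]; rfl

theorem chain_driftStep_snd_eq_zero {d : ℕ} {Θ Θ' : Type*} (η R : ℝ)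
    (f : EuclideanSpace ℝ (Fin d) → ℝ)
    (G : EuclideanSpace ℝ (Fin d) → Θ → EuclideanSpace ℝ (Fin d))
    (C : EuclideanSpace ℝ (Fin d) → Θ' → EuclideanSpace ℝ (Fin d))
    (y₀ : EuclideanSpace ℝ (Fin d))
    {T : ℕ → EuclideanSpace ℝ (Fin d) →L[ℝ] EuclideanSpace ℝ (Fin d)}
    (z : ℕ → EuclideanSpace ℝ (Fin d) × Θ × Θ') {n : ℕ} (hT : ∀ k < n, T k = 0) :
    (chain (driftStep η R f G C y₀ T) ((y₀, 0), 0) z n).2 = 0 := by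
  induction n with
  | zero => rfl
  | succ n ih =>
    have h1 := ih fun k hk => hT k (hk.trans n.lt_succ_self)
    simp only [chain, driftStep, hT n n.lt_succ_self, h1]
    simp

/-- The deterministic part of a step of the propagated gradient. -/
theorem IsRegularObjective.norm_propagated_gradient_le {d : ℕ}
    {f : EuclideanSpace ℝ (Fin d) → ℝ} {fmax L ρ : ℝ} (hf : IsRegularObjective f fmax L ρ)
    (hL : 0 < L) (hρ : 0 < ρ) {η R : ℝ} (hη : 0 < η)
    {M : EuclideanSpace ℝ (Fin d) →L[ℝ] EuclideanSpace ℝ (Fin d)} (hM : ∀ u, ‖M u‖ ≤ 3 * ‖u‖)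
    {y₀ y : EuclideanSpace ℝ (Fin d)} (hy : ‖y - y₀‖ ≤ R) (e m ν : EuclideanSpace ℝ (Fin d)) :
    ‖M (gradient f (y - η • (gradient f (y + η • e) + ν))) - (m - η • M (hessian f y ν))‖ ≤
      ‖M (gradient f y - η • hessian f y₀ (gradient f y)) - m‖ + 3 * η ^ 2 * L ^ 2 * ‖e‖ +
        3 * η * (ρ * R) * ‖gradient f (y + η • e)‖ +
        3 * ρ * η ^ 2 * ‖gradient f (y + η • e) + ν‖ ^ 2 := by
  set x := y + η • e with hx
  set y' := y - η • (gradient f x + ν) with hy'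
  have hd : y' - y = -(η • (gradient f x + ν)) := by rw [hy']; abel
  -- Expansion of ∇f along the step. The term linear in the noise is moved into the accumulated
  -- noise and ∇f(y) is propagated by 1 − ηH. The remaining errors come from the gradient being
  -- taken at x rather than y, from the Hessian being frozen at y₀, and from the second-order Taylor
  -- remainder.
  have e1 : M (gradient f y') - (m - η • M (hessian f y ν)) =
      (M (gradient f y - η • hessian f y₀ (gradient f y)) - m) +
      η • M (hessian f y₀ (gradient f y - gradient f x)) +
      η • M ((hessian f y₀ - hessian f y) (gradient f x)) +
      M (gradient f y' - gradient f y - hessian f y (y' - y)) := by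
    rw [hd]
    simp only [map_sub, map_add, map_neg, map_smul, sub_apply, smul_add]
    module
  rw [e1]
  have hHL := hf.norm_hessian_le hL y₀
  have t1 : ‖η • M (hessian f y₀ (gradient f y - gradient f x))‖ ≤ 3 * η ^ 2 * L ^ 2 * ‖e‖ := by
    have h1 := (hessian f y₀).le_of_opNorm_le hHL (gradient f y - gradient f x)
    have h2 := hf.smooth y x
    have h3 : ‖y - x‖ = η * ‖e‖ := by
      rw [hx, sub_add_cancel_left, norm_neg, norm_smul, Real.norm_of_nonneg hη.le]
    rw [h3] at h2
    rw [norm_smul, Real.norm_of_nonneg hη.le]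
    calc η * ‖M (hessian f y₀ (gradient f y - gradient f x))‖ ≤
        η * (3 * (L * (L * (η * ‖e‖)))) := by
          gcongr
          refine (hM _).trans ?_
          gcongr
          exact h1.trans (mul_le_mul_of_nonneg_left h2 hL.le)
      _ = _ := by ring
  have t2 : ‖η • M ((hessian f y₀ - hessian f y) (gradient f x))‖ ≤
      3 * η * (ρ * R) * ‖gradient f x‖ := by
    have h1 : ‖hessian f y₀ - hessian f y‖ ≤ ρ * R := by
      refine (hf.lipschitz_hessian y₀ y).trans ?_
      rw [norm_sub_rev]; exact mul_le_mul_of_nonneg_left hy hρ.le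
    have h2 := (hessian f y₀ - hessian f y).le_of_opNorm_le h1 (gradient f x)
    rw [norm_smul, Real.norm_of_nonneg hη.le]
    calc η * ‖M ((hessian f y₀ - hessian f y) (gradient f x))‖ ≤
        η * (3 * (ρ * R * ‖gradient f x‖)) := by
          gcongr
          refine (hM _).trans ?_
          gcongr
      _ = _ := by ring
  have t3 : ‖M (gradient f y' - gradient f y - hessian f y (y' - y))‖ ≤
      3 * ρ * η ^ 2 * ‖gradient f x + ν‖ ^ 2 := by
    have h1 := hf.norm_gradient_sub_sub_le_sq hρ y y'
    have h3 : ‖y' - y‖ ^ 2 = η ^ 2 * ‖gradient f x + ν‖ ^ 2 := by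
      rw [hd, norm_neg, norm_smul, Real.norm_of_nonneg hη.le, mul_pow]
    rw [h3] at h1
    have := hM (gradient f y' - gradient f y - hessian f y (y' - y))
    linarith
  have h1 := norm_add_le ((M (gradient f y - η • hessian f y₀ (gradient f y)) - m) +
      η • M (hessian f y₀ (gradient f y - gradient f x)) +
      η • M ((hessian f y₀ - hessian f y) (gradient f x)))
      (M (gradient f y' - gradient f y - hessian f y (y' - y)))
  have h2 := norm_add_le ((M (gradient f y - η • hessian f y₀ (gradient f y)) - m) +
      η • M (hessian f y₀ (gradient f y - gradient f x)))
      (η • M ((hessian f y₀ - hessian f y) (gradient f x)))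
  have h3 := norm_add_le (M (gradient f y - η • hessian f y₀ (gradient f y)) - m)
      (η • M (hessian f y₀ (gradient f y - gradient f x)))
  linarith

namespace SGDSetting

variable {d : ℕ} {Ω Θ Θ' : Type*} [MeasurableSpace Ω] [MeasurableSpace Θ]
    [MeasurableSpace Θ'] {P : Measure Ω} {D : Measure Θ} {D' : Measure Θ'}
    [IsProbabilityMeasure P] [IsProbabilityMeasure D] [IsProbabilityMeasure D']
    {f : EuclideanSpace ℝ (Fin d) → ℝ}
    {G : EuclideanSpace ℝ (Fin d) → Θ → EuclideanSpace ℝ (Fin d)}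
    {C : EuclideanSpace ℝ (Fin d) → Θ' → EuclideanSpace ℝ (Fin d)}
    {z : ℕ → Ω → EuclideanSpace ℝ (Fin d) × Θ × Θ'} {fmax L ρ σ μ η r χ : ℝ}
    (hS : SGDSetting P D D' f G C z fmax L ρ σ μ η r χ)
include hS

theorem measurable_driftStep (R : ℝ) (y₀ : EuclideanSpace ℝ (Fin d))
    (T : ℕ → EuclideanSpace ℝ (Fin d) →L[ℝ] EuclideanSpace ℝ (Fin d)) (n : ℕ) :
    Measurable (fun q : ((EuclideanSpace ℝ (Fin d) × EuclideanSpace ℝ (Fin d)) ×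
      EuclideanSpace ℝ (Fin d)) × (EuclideanSpace ℝ (Fin d) × Θ × Θ') =>
      driftStep η R f G C y₀ T n q.1 q.2) := by
  have h1 := (hS.measurable_epochStep R y₀ n).comp
    (((measurable_fst.comp measurable_fst).prodMk measurable_snd) :
      Measurable fun q : ((EuclideanSpace ℝ (Fin d) × EuclideanSpace ℝ (Fin d)) ×
      EuclideanSpace ℝ (Fin d)) × (EuclideanSpace ℝ (Fin d) × Θ × Θ') => (q.1.1, q.2))
  have hx : Measurable fun q : ((EuclideanSpace ℝ (Fin d) × EuclideanSpace ℝ (Fin d)) ×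
      EuclideanSpace ℝ (Fin d)) × (EuclideanSpace ℝ (Fin d) × Θ × Θ') =>
      q.1.1.1 + η • q.1.1.2 := by fun_prop
  have hθ : Measurable fun q : ((EuclideanSpace ℝ (Fin d) × EuclideanSpace ℝ (Fin d)) ×
      EuclideanSpace ℝ (Fin d)) × (EuclideanSpace ℝ (Fin d) × Θ × Θ') => q.2.2.1 := by fun_prop
  have hG := hS.oracle.measurable.comp (hx.prodMk hθ)
  have hg := hS.objective.measurable_gradient.comp hx
  have hξ : Measurable fun q : ((EuclideanSpace ℝ (Fin d) × EuclideanSpace ℝ (Fin d)) ×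
      EuclideanSpace ℝ (Fin d)) × (EuclideanSpace ℝ (Fin d) × Θ × Θ') => q.2.1 := by fun_prop
  have hy : Measurable fun q : ((EuclideanSpace ℝ (Fin d) × EuclideanSpace ℝ (Fin d)) ×
      EuclideanSpace ℝ (Fin d)) × (EuclideanSpace ℝ (Fin d) × Θ × Θ') => q.1.1.1 := by fun_prop
  have hc : Continuous fun p : EuclideanSpace ℝ (Fin d) × EuclideanSpace ℝ (Fin d) =>
      T n (hessian f p.1 p.2) :=
    (T n).continuous.comp
      (((hS.objective.continuous_hessian hS.ρ_pos).comp continuous_fst).clm_apply continuous_snd)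
  have hH := hc.measurable.comp (hy.prodMk ((hG.sub hg).add hξ))
  have hm : Measurable fun q : ((EuclideanSpace ℝ (Fin d) × EuclideanSpace ℝ (Fin d)) ×
      EuclideanSpace ℝ (Fin d)) × (EuclideanSpace ℝ (Fin d) × Θ × Θ') => q.1.2 := by fun_prop
  have hset : MeasurableSet {q : ((EuclideanSpace ℝ (Fin d) × EuclideanSpace ℝ (Fin d)) ×
      EuclideanSpace ℝ (Fin d)) × (EuclideanSpace ℝ (Fin d) × Θ × Θ') | ‖q.1.1.1 - y₀‖ ≤ R} :=
    measurableSet_le (by fun_prop) measurable_const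
  refine h1.prodMk (Measurable.ite hset ?_ hm)
  exact hm.sub (hH.const_smul η)

/-- Given the past the increments are centred, so their mean squares add without cross terms. -/
theorem integral_sq_drift_le {R : ℝ} (y₀ : EuclideanSpace ℝ (Fin d))
    {T : ℕ → EuclideanSpace ℝ (Fin d) →L[ℝ] EuclideanSpace ℝ (Fin d)} {β : ℕ → ℝ}
    (hβ : ∀ n y u, ‖y - y₀‖ ≤ R → ‖T n (hessian f y u)‖ ≤ β n * ‖u‖) (n : ℕ) :
    Integrable (fun ω => ‖(chain (driftStep η R f G C y₀ T) ((y₀, 0), 0)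
      (fun t => z t ω) n).2‖ ^ 2) P ∧
    ∫ ω, ‖(chain (driftStep η R f G C y₀ T) ((y₀, 0), 0) (fun t => z t ω) n).2‖ ^ 2 ∂P ≤
      χ * ∑ k ∈ Finset.range n, η ^ 2 * β k ^ 2 := by
  have hη := hS.η_pos
  have hχ := hS.χ_nonneg
  induction n with
  | zero => simp [chain]
  | succ n ih =>
    have key := hS.samples.integral_chain_succ_le (hS.measurable_driftStep R y₀ T)
      ((y₀, 0), 0) n (Φ' := fun c => ‖c.2‖ ^ 2)
      (Φ := fun c => ‖c.2‖ ^ 2 + χ * (η ^ 2 * β n ^ 2))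
      (by fun_prop) (fun c => by positivity) (fun c => by positivity)
      (ih.1.add (integrable_const _)) (fun c => ?_)
    · refine ⟨key.1, key.2.trans ?_⟩
      rw [integral_add ih.1 (integrable_const _), Finset.sum_range_succ, mul_add]
      simp only [integral_const, probReal_univ, one_smul]
      linarith [ih.2]
    · simp only [driftStep]
      split_ifs with hc
      · have h1 := ((hS.isCentered_noise (c.1.1 + η • c.1.2)).map
          ((-η) • (T n).comp (hessian f c.1.1)) (c := η * β n) (fun u => by
            rw [smul_apply, norm_smul, norm_neg, Real.norm_of_nonneg hη.le,
              mul_assoc]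
            exact mul_le_mul_of_nonneg_left (hβ n _ u hc) hη.le)).lintegral_sq_add_le c.2
        refine le_trans (le_of_eq ?_) (h1.trans_eq ?_)
        · refine lintegral_congr fun b => ?_
          rw [smul_apply, neg_smul, ← sub_eq_add_neg]
          rfl
        · congr 1; ring
      · rw [lintegral_const]
        simp only [measure_univ, mul_one]
        exact ENNReal.ofReal_le_ofReal (le_add_of_nonneg_right (by positivity))

end SGDSetting

/-! ### The gradient at the end of an epoch: remainder plus accumulated noise. -/

namespace SGDSetting

variable {d : ℕ} {Ω Θ Θ' : Type*} [MeasurableSpace Ω] [MeasurableSpace Θ]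
    [MeasurableSpace Θ'] {P : Measure Ω} {D : Measure Θ} {D' : Measure Θ'}
    [IsProbabilityMeasure P] [IsProbabilityMeasure D] [IsProbabilityMeasure D']
    {f : EuclideanSpace ℝ (Fin d) → ℝ}
    {G : EuclideanSpace ℝ (Fin d) → Θ → EuclideanSpace ℝ (Fin d)}
    {C : EuclideanSpace ℝ (Fin d) → Θ' → EuclideanSpace ℝ (Fin d)}
    {z : ℕ → Ω → EuclideanSpace ℝ (Fin d) × Θ × Θ'} {fmax L ρ σ μ η r χ : ℝ}
    (hS : SGDSetting P D D' f G C z fmax L ρ σ μ η r χ)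
include hS

theorem integrable_near_mul_norm {R : ℝ} (y₀ : EuclideanSpace ℝ (Fin d))
    {T : ℕ → EuclideanSpace ℝ (Fin d) →L[ℝ] EuclideanSpace ℝ (Fin d)} {n : ℕ}
    (M : EuclideanSpace ℝ (Fin d) →L[ℝ] EuclideanSpace ℝ (Fin d))
    (hm : Integrable (fun ω => ‖(chain (driftStep η R f G C y₀ T) ((y₀, 0), 0)
      (fun t => z t ω) n).2‖ ^ 2) P) :
    Integrable (fun ω => near R y₀ (chain (driftStep η R f G C y₀ T) ((y₀, 0), 0)
        (fun t => z t ω) n).1 *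
      ‖M (gradient f (chain (driftStep η R f G C y₀ T) ((y₀, 0), 0) (fun t => z t ω) n).1.1) -
        (chain (driftStep η R f G C y₀ T) ((y₀, 0), 0) (fun t => z t ω) n).2‖) P := by
  have hX := hS.samples.measurable_chain (hS.measurable_driftStep R y₀ T) ((y₀, 0), 0) n
  set X := fun ω => chain (driftStep η R f G C y₀ T) ((y₀, 0), 0) (fun t => z t ω) n
  have h1 : Measurable fun ω => near R y₀ (X ω).1 := (measurable_near_left R y₀).comp hX.fst
  have h2 : Measurable fun ω => M (gradient f (X ω).1.1) :=
    M.continuous.measurable.comp (hS.objective.measurable_gradient.comp hX.fst.fst)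
  have h3 : Measurable fun ω => (X ω).2 := hX.snd
  refine Integrable.mono' (((integrable_const (‖M‖ * (1 + 4 * L * fmax) + 1)).add hm))
    (h1.mul (h2.sub h3).norm).aestronglyMeasurable (.of_forall fun ω => ?_)
  rw [Real.norm_of_nonneg (mul_nonneg (near_nonneg _ _ _) (norm_nonneg _))]
  have t1 := mul_le_of_le_one_left (norm_nonneg (M (gradient f (X ω).1.1) - (X ω).2))
    (near_le_one R y₀ (X ω).1)
  have t2 := norm_sub_le (M (gradient f (X ω).1.1)) (X ω).2
  have t3 := M.le_opNorm (gradient f (X ω).1.1)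
  have t4 := hS.objective.norm_gradient_sq_le hS.L_pos (X ω).1.1
  have t5 : ‖gradient f (X ω).1.1‖ ≤ 1 + 4 * L * fmax := by
    nlinarith [sq_nonneg (‖gradient f (X ω).1.1‖ - 1)]
  have t6 := mul_le_mul_of_nonneg_left t5 (norm_nonneg M)
  have t7 : ‖(X ω).2‖ ≤ 1 + ‖(X ω).2‖ ^ 2 := by nlinarith [sq_nonneg (‖(X ω).2‖ - 1)]
  simp only [Pi.add_apply]
  change _ ≤ ‖M‖ * (1 + 4 * L * fmax) + 1 + ‖(X ω).2‖ ^ 2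
  linarith

omit hS in
theorem _root_.integral_affine_three {F e g : Ω → ℝ} (hF : Integrable F P) (he : Integrable e P)
    (hg : Integrable g P) (A B c : ℝ) :
    Integrable (fun ω => F ω + (c + (A * e ω + B * g ω))) P ∧
    ∫ ω, F ω + (c + (A * e ω + B * g ω)) ∂P =
      ∫ ω, F ω ∂P + (c + (A * ∫ ω, e ω ∂P + B * ∫ ω, g ω ∂P)) := by
  have h1 : Integrable (fun ω => A * e ω) P := he.const_mul A
  have h2 : Integrable (fun ω => B * g ω) P := hg.const_mul B
  have h3 : Integrable (fun ω => A * e ω + B * g ω) P := h1.add h2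
  have h4 : Integrable (fun ω => c + (A * e ω + B * g ω)) P := (integrable_const c).add h3
  refine ⟨hF.add h4, ?_⟩
  rw [integral_add hF h4, integral_add (integrable_const c) h3, integral_add h1 h2,
    integral_const_mul, integral_const_mul]
  simp

/-- Growth of the part of the propagated gradient that is not explained by the noise. -/
theorem integral_rest_succ_le {R : ℝ} (hR : 0 ≤ R) (y₀ : EuclideanSpace ℝ (Fin d))
    {T : ℕ → EuclideanSpace ℝ (Fin d) →L[ℝ] EuclideanSpace ℝ (Fin d)} {n : ℕ}
    {M M' : EuclideanSpace ℝ (Fin d) →L[ℝ] EuclideanSpace ℝ (Fin d)} (hT : T n = M)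
    (hM : ∀ u, ‖M u‖ ≤ 3 * ‖u‖) (hM' : ∀ u, M' u = M (u - η • hessian f y₀ u)) {q w : ℝ}
    (hq : 0 < q) (hw : 0 < w)
    (hm : Integrable (fun ω => ‖(chain (driftStep η R f G C y₀ T) ((y₀, 0), 0)
      (fun t => z t ω) n).2‖ ^ 2) P) :
    ∫ ω, near R y₀ (chain (driftStep η R f G C y₀ T) ((y₀, 0), 0) (fun t => z t ω) (n + 1)).1 *
      ‖M (gradient f (chain (driftStep η R f G C y₀ T) ((y₀, 0), 0)
          (fun t => z t ω) (n + 1)).1.1) -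
        (chain (driftStep η R f G C y₀ T) ((y₀, 0), 0) (fun t => z t ω) (n + 1)).2‖ ∂P ≤
    ∫ ω, near R y₀ (chain (driftStep η R f G C y₀ T) ((y₀, 0), 0) (fun t => z t ω) n).1 *
      ‖M' (gradient f (chain (driftStep η R f G C y₀ T) ((y₀, 0), 0) (fun t => z t ω) n).1.1) -
        (chain (driftStep η R f G C y₀ T) ((y₀, 0), 0) (fun t => z t ω) n).2‖ ∂P +
      ((q / w + 3 * η * (ρ * R) * (q / 2) + 3 * ρ * η ^ 2 * χ) +
        (9 / 4 * w * η ^ 4 * L ^ 4 / q * epochErr P G C z η R y₀ n +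
          (3 * η * (ρ * R) / (2 * q) + 3 * ρ * η ^ 2) * epochGrad P f G C z η R y₀ n)) := by
  have hη := hS.η_pos
  have hρ := hS.ρ_pos
  have hχ := hS.χ_nonneg
  have hI := hS.integrable_near_mul_norm (R := R) y₀ M' hm
  have hfst : ∀ ω, (chain (driftStep η R f G C y₀ T) ((y₀, 0), 0) (fun t => z t ω) n).1 =
      epoch η R G C y₀ (fun t => z t ω) n := fun ω => chain_driftStep_fst _ _ _ _ _ _ _ _ _
  have he : Integrable (fun ω => errTerm R y₀ (chain (driftStep η R f G C y₀ T) ((y₀, 0), 0)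
      (fun t => z t ω) n).1) P := by
    simp only [hfst]; exact (hS.epochErr_succ R y₀ n).1
  have hg : Integrable (fun ω => gradTerm f η R y₀ (chain (driftStep η R f G C y₀ T)
      ((y₀, 0), 0) (fun t => z t ω) n).1) P := by
    simp only [hfst]; exact hS.integrable_gradTerm R y₀ n
  have e1 : ∫ ω, errTerm R y₀ (chain (driftStep η R f G C y₀ T) ((y₀, 0), 0)
      (fun t => z t ω) n).1 ∂P = epochErr P G C z η R y₀ n := by simp only [hfst]; rfl
  have e2 : ∫ ω, gradTerm f η R y₀ (chain (driftStep η R f G C y₀ T) ((y₀, 0), 0)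
      (fun t => z t ω) n).1 ∂P = epochGrad P f G C z η R y₀ n := by simp only [hfst]; rfl
  have haff := integral_affine_three hI he hg (9 / 4 * w * η ^ 4 * L ^ 4 / q)
    (3 * η * (ρ * R) / (2 * q) + 3 * ρ * η ^ 2)
    (q / w + 3 * η * (ρ * R) * (q / 2) + 3 * ρ * η ^ 2 * χ)
  rw [← e1, ← e2, ← haff.2]
  refine (hS.samples.integral_chain_succ_le (hS.measurable_driftStep R y₀ T) ((y₀, 0), 0) n
    (Φ' := fun c => near R y₀ c.1 * ‖M (gradient f c.1.1) - c.2‖)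
    (Φ := fun c => near R y₀ c.1 * ‖M' (gradient f c.1.1) - c.2‖ +
      ((q / w + 3 * η * (ρ * R) * (q / 2) + 3 * ρ * η ^ 2 * χ) +
        (9 / 4 * w * η ^ 4 * L ^ 4 / q * errTerm R y₀ c.1 +
          (3 * η * (ρ * R) / (2 * q) + 3 * ρ * η ^ 2) * gradTerm f η R y₀ c.1)))
    ?_ (fun c => mul_nonneg (near_nonneg _ _ _) (norm_nonneg _)) (fun c => ?_) haff.1
    (fun c => ?_)).2
  · have h1 := measurable_near_left R y₀
    generalize near R y₀ = F at h1
    have h2 := hS.objective.measurable_gradient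
    generalize gradient f = g at h2
    fun_prop
  · have := near_nonneg R y₀ c.1
    have := errTerm_nonneg R y₀ c.1
    have := gradTerm_nonneg R y₀ c.1 f η
    positivity
  · by_cases hc : ‖c.1.1 - y₀‖ ≤ R
    · have hn : near R y₀ c.1 = 1 := by simp [near, hc]
      set x := c.1.1 + η • c.1.2 with hx
      set A := ‖M' (gradient f c.1.1) - c.2‖ + 3 * η ^ 2 * L ^ 2 * ‖c.1.2‖ +
        3 * η * (ρ * R) * ‖gradient f x‖ with hA
      have hA0 : 0 ≤ A := by positivity
      have hpt : ∀ b : EuclideanSpace ℝ (Fin d) × Θ × Θ',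
          near R y₀ (driftStep η R f G C y₀ T n c b).1 *
            ‖M (gradient f (driftStep η R f G C y₀ T n c b).1.1) -
              (driftStep η R f G C y₀ T n c b).2‖ ≤
          A + 3 * ρ * η ^ 2 * ‖gradient f x + ((G x b.2.1 - gradient f x) + b.1)‖ ^ 2 := by
        intro b
        refine (mul_le_of_le_one_left (norm_nonneg _) (near_le_one _ _ _)).trans ?_
        have h := hS.objective.norm_propagated_gradient_le hS.L_pos hρ hη hM hc c.1.2 c.2
          ((G x b.2.1 - gradient f x) + b.1)
        simp only [driftStep, epochStep, if_pos hc, pairStep, hT]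
        rw [← hM', ← hx] at h
        have e3 : gradient f x + ((G x b.2.1 - gradient f x) + b.1) = G x b.2.1 + b.1 := by abel
        rw [e3] at h ⊢
        exact h
      have hnoise := (hS.isCentered_noise x).lintegral_sq_add_le (gradient f x)
      calc _ ≤ ∫⁻ b, (ENNReal.ofReal A + ENNReal.ofReal (3 * ρ * η ^ 2) *
            ENNReal.ofReal (‖gradient f x + ((G x b.2.1 - gradient f x) + b.1)‖ ^ 2))
              ∂(sampleLaw d r D D') := by
            refine lintegral_mono fun b => (ENNReal.ofReal_le_ofReal (hpt b)).trans_eq ?_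
            rw [ENNReal.ofReal_add hA0 (by positivity), ENNReal.ofReal_mul (by positivity)]
        _ = ENNReal.ofReal A + ENNReal.ofReal (3 * ρ * η ^ 2) *
            ∫⁻ b, ENNReal.ofReal (‖gradient f x + ((G x b.2.1 - gradient f x) + b.1)‖ ^ 2)
              ∂(sampleLaw d r D D') := by
            rw [lintegral_add_left measurable_const, lintegral_const, measure_univ, mul_one,
              lintegral_const_mul' _ _ ENNReal.ofReal_ne_top]
        _ ≤ ENNReal.ofReal A + ENNReal.ofReal (3 * ρ * η ^ 2) *
            ENNReal.ofReal (‖gradient f x‖ ^ 2 + χ) := by gcongr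
        _ = ENNReal.ofReal (A + 3 * ρ * η ^ 2 * (‖gradient f x‖ ^ 2 + χ)) := by
            rw [← ENNReal.ofReal_mul (by positivity), ← ENNReal.ofReal_add hA0 (by positivity)]
        _ ≤ _ := ENNReal.ofReal_le_ofReal ?_
      simp only [errTerm, gradTerm, hn, one_mul, ← hx]
      -- The level 2q/w makes the constant part q/w, hence at most `q` in total over a window of `w`
      -- steps.
      have y1 := le_young (by positivity : 0 < 2 * q / w) (3 * η ^ 2 * L ^ 2 * ‖c.1.2‖)
      have y2 := mul_le_mul_of_nonneg_left (le_young hq ‖gradient f x‖)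
        (by positivity : 0 ≤ 3 * η * (ρ * R))
      have e4 : 2 * q / w / 2 + (3 * η ^ 2 * L ^ 2 * ‖c.1.2‖) ^ 2 / (2 * (2 * q / w)) =
          q / w + 9 / 4 * w * η ^ 4 * L ^ 4 / q * ‖c.1.2‖ ^ 2 := by field_simp; ring
      have e5 : 3 * η * (ρ * R) * (q / 2 + ‖gradient f x‖ ^ 2 / (2 * q)) =
          3 * η * (ρ * R) * (q / 2) + 3 * η * (ρ * R) / (2 * q) * ‖gradient f x‖ ^ 2 := by ring
      rw [e4] at y1
      rw [e5] at y2
      rw [hA]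
      linarith
    · have hz : ∀ b : EuclideanSpace ℝ (Fin d) × Θ × Θ',
          near R y₀ (driftStep η R f G C y₀ T n c b).1 *
            ‖M (gradient f (driftStep η R f G C y₀ T n c b).1.1) -
              (driftStep η R f G C y₀ T n c b).2‖ = 0 := by
        intro b
        simp only [driftStep, epochStep, if_neg hc, near, zero_mul]
      simp only [hz, ENNReal.ofReal_zero, lintegral_zero]
      exact bot_le

/-- At the beginning of the window no noise has been accumulated yet. Young's inequality at level
`q` trades the first moment of the gradient for the squared quantities that the budget controls. -/
theorem integral_propagated_start_le {R : ℝ} (y₀ : EuclideanSpace ℝ (Fin d)) (n : ℕ)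
    {M : EuclideanSpace ℝ (Fin d) →L[ℝ] EuclideanSpace ℝ (Fin d)} (hM : ∀ u, ‖M u‖ ≤ 3 * ‖u‖)
    {q : ℝ} (hq : 0 < q) :
    ∫ ω, near R y₀ (epoch η R G C y₀ (fun t => z t ω) n) *
      ‖M (gradient f (epoch η R G C y₀ (fun t => z t ω) n).1)‖ ∂P ≤
    3 / 2 * q + 3 / q * (epochGrad P f G C z η R y₀ n +
      L ^ 2 * η ^ 2 * epochErr P G C z η R y₀ n) := by
  have hη := hS.η_pos
  have hL := hS.L_pos
  have he := (hS.epochErr_succ R y₀ n).1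
  have hg := hS.integrable_gradTerm R y₀ n
  have haff := integral_affine_three (integrable_const (0 : ℝ)) he hg
    (3 / q * (L ^ 2 * η ^ 2)) (3 / q) (3 / 2 * q)
  have e1 : 3 / 2 * q + 3 / q * (epochGrad P f G C z η R y₀ n +
      L ^ 2 * η ^ 2 * epochErr P G C z η R y₀ n) = ∫ _, (0 : ℝ) ∂P + (3 / 2 * q +
      (3 / q * (L ^ 2 * η ^ 2) * epochErr P G C z η R y₀ n +
        3 / q * epochGrad P f G C z η R y₀ n)) := by
    rw [integral_zero]; ring
  rw [e1]
  refine (integral_mono_of_nonneg (.of_forall fun ω => mul_nonneg (near_nonneg _ _ _)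
    (norm_nonneg _)) haff.1 (.of_forall fun ω => ?_)).trans_eq haff.2
  simp only [errTerm, gradTerm, near]
  set s := epoch η R G C y₀ (fun t => z t ω) n
  split_ifs with hs
  · have h1 := hM (gradient f s.1)
    have h2 := hS.objective.smooth s.1 (s.1 + η • s.2)
    rw [sub_add_cancel_left, norm_neg, norm_smul, Real.norm_of_nonneg hη.le] at h2
    have h3 : ‖gradient f s.1‖ ≤ ‖gradient f (s.1 + η • s.2)‖ + L * (η * ‖s.2‖) := by
      have := norm_sub_norm_le (gradient f s.1) (gradient f (s.1 + η • s.2))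
      linarith
    have h4 := le_young hq (‖gradient f (s.1 + η • s.2)‖ + L * (η * ‖s.2‖))
    have h5 : (‖gradient f (s.1 + η • s.2)‖ + L * (η * ‖s.2‖)) ^ 2 / (2 * q) ≤
        1 / q * (‖gradient f (s.1 + η • s.2)‖ ^ 2 + L ^ 2 * η ^ 2 * ‖s.2‖ ^ 2) := by
      rw [div_le_iff₀ (by positivity)]
      have e : 1 / q * (‖gradient f (s.1 + η • s.2)‖ ^ 2 + L ^ 2 * η ^ 2 * ‖s.2‖ ^ 2) * (2 * q) =
        2 * (‖gradient f (s.1 + η • s.2)‖ ^ 2 + (L * (η * ‖s.2‖)) ^ 2) := by field_simp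
      rw [e]
      nlinarith [sq_nonneg (‖gradient f (s.1 + η • s.2)‖ - L * (η * ‖s.2‖))]
    have e2 : 3 / q * (L ^ 2 * η ^ 2) * (1 * ‖s.2‖ ^ 2) +
      3 / q * (1 * ‖gradient f (s.1 + η • s.2)‖ ^ 2) =
      3 * (1 / q * (‖gradient f (s.1 + η • s.2)‖ ^ 2 + L ^ 2 * η ^ 2 * ‖s.2‖ ^ 2)) := by ring
    rw [e2]
    linarith
  · simp; positivity

end SGDSetting

theorem sum_reflect_window {W N : ℕ} (hWN : W ≤ N) (b : ℕ → ℝ) :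
    ∑ n ∈ Finset.range N, (if N - 1 - n < W then b (N - 1 - n) else 0) =
      ∑ k ∈ Finset.range W, b k := by
  rw [Finset.sum_range_reflect (fun k => if k < W then b k else 0) N,
    ← Finset.sum_subset (Finset.range_mono hWN) (fun k _ hk => if_neg (by simpa using hk))]
  exact Finset.sum_congr rfl fun k hk => if_pos (Finset.mem_range.1 hk)

/-- Averaging over the last `W` steps; the sum over the whole epoch is an upper bound for the sum
over the window. -/
theorem exists_mem_window_le {W N : ℕ} (hW : 1 ≤ W) (hWN : W ≤ N) {a : ℕ → ℝ}
    (ha : ∀ n, 0 ≤ a n) :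
    ∃ s, N - W ≤ s ∧ s < N ∧ a s ≤ 1 / W * ∑ n ∈ Finset.range N, a n := by
  have hW0 : (0 : ℝ) < W := by exact_mod_cast hW
  obtain ⟨s, hs, h⟩ := Finset.exists_le_of_sum_le (s := Finset.Ico (N - W) N) (f := a)
    (g := fun _ => 1 / W * ∑ n ∈ Finset.range N, a n) (by simp; omega) (by
      rw [Finset.sum_const, Nat.card_Ico, nsmul_eq_mul, Nat.sub_sub_self hWN, ← mul_assoc,
        mul_one_div_cancel hW0.ne', one_mul, Finset.range_eq_Ico]
      exact Finset.sum_le_sum_of_subset_of_nonneg (Finset.Ico_subset_Ico_left (Nat.zero_le _))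
        fun _ _ _ => ha _)
  rw [Finset.mem_Ico] at hs
  exact ⟨s, hs.1, hs.2, h⟩

theorem sum_Ico_affine_le {s N W : ℕ} (hsW : N - W ≤ s) (hW : W ≤ N) {A₀ A₁ A₂ : ℝ} (h0 : 0 ≤ A₀)
    (h1 : 0 ≤ A₁) (h2 : 0 ≤ A₂) {e g : ℕ → ℝ} (he : ∀ n, 0 ≤ e n) (hg : ∀ n, 0 ≤ g n) :
    ∑ n ∈ Finset.Ico s N, (A₀ + (A₁ * e n + A₂ * g n)) ≤
      W * A₀ + (A₁ * ∑ n ∈ Finset.range N, e n + A₂ * ∑ n ∈ Finset.range N, g n) := by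
  rw [Finset.sum_add_distrib, Finset.sum_add_distrib, ← Finset.mul_sum, ← Finset.mul_sum,
    Finset.sum_const, Nat.card_Ico, nsmul_eq_mul, Finset.range_eq_Ico]
  have hcard : ((N - s : ℕ) : ℝ) ≤ W := by exact_mod_cast (by omega : N - s ≤ W)
  have hsub : Finset.Ico s N ⊆ Finset.Ico 0 N := Finset.Ico_subset_Ico_left (Nat.zero_le _)
  gcongr
  · exact fun i _ _ => he i
  · exact fun i _ _ => hg i

namespace SGDSetting

variable {d : ℕ} {Ω Θ Θ' : Type*} [MeasurableSpace Ω] [MeasurableSpace Θ]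
    [MeasurableSpace Θ'] {P : Measure Ω} {D : Measure Θ} {D' : Measure Θ'}
    [IsProbabilityMeasure P] [IsProbabilityMeasure D] [IsProbabilityMeasure D']
    {f : EuclideanSpace ℝ (Fin d) → ℝ}
    {G : EuclideanSpace ℝ (Fin d) → Θ → EuclideanSpace ℝ (Fin d)}
    {C : EuclideanSpace ℝ (Fin d) → Θ' → EuclideanSpace ℝ (Fin d)}
    {z : ℕ → Ω → EuclideanSpace ℝ (Fin d) × Θ × Θ'} {fmax L ρ σ μ η r χ : ℝ}
    (hS : SGDSetting P D D' f G C z fmax L ρ σ μ η r χ)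
include hS

/-- Along the last `W` steps of an epoch started at a point without strong negative curvature, the
gradient splits into a small part and accumulated noise `m`. -/
theorem exists_gradient_decomposition {R κ : ℝ} (hR : 0 < R) (hκ : 0 < κ) (hRκ : ρ * R ≤ κ)
    (hηL : η * L ≤ 1) {y₀ : EuclideanSpace ℝ (Fin d)} (hneg : ¬ NegCurvature f (2 * κ) y₀)
    {N W : ℕ} (hW : 1 ≤ W) (hWN : W ≤ N) (hWκ : W * (η * (2 * κ)) ≤ 1) {q : ℝ} (hq : 0 < q) :
    ∃ T : ℕ → EuclideanSpace ℝ (Fin d) →L[ℝ] EuclideanSpace ℝ (Fin d),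
      (Integrable (fun ω => ‖(chain (driftStep η R f G C y₀ T) ((y₀, 0), 0)
        (fun t => z t ω) N).2‖ ^ 2) P ∧
      ∫ ω, ‖(chain (driftStep η R f G C y₀ T) ((y₀, 0), 0) (fun t => z t ω) N).2‖ ^ 2 ∂P ≤
        χ * (η * (4 * L + 82 * κ))) ∧
      (Integrable (fun ω => near R y₀ (epoch η R G C y₀ (fun t => z t ω) N) *
        ‖gradient f (epoch η R G C y₀ (fun t => z t ω) N).1 -
          (chain (driftStep η R f G C y₀ T) ((y₀, 0), 0) (fun t => z t ω) N).2‖) P ∧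
      ∫ ω, near R y₀ (epoch η R G C y₀ (fun t => z t ω) N) *
        ‖gradient f (epoch η R G C y₀ (fun t => z t ω) N).1 -
          (chain (driftStep η R f G C y₀ T) ((y₀, 0), 0) (fun t => z t ω) N).2‖ ∂P ≤
        4 * q + 3 / (q * W) * (∑ n ∈ Finset.range N, epochGrad P f G C z η R y₀ n +
            L ^ 2 * η ^ 2 * ∑ n ∈ Finset.range N, epochErr P G C z η R y₀ n) +
          9 / 4 * W * η ^ 4 * L ^ 4 / q * ∑ n ∈ Finset.range N, epochErr P G C z η R y₀ n +
          (3 * η * κ / (2 * q) + 3 * ρ * η ^ 2) *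
            ∑ n ∈ Finset.range N, epochGrad P f G C z η R y₀ n + 3 * ρ * η ^ 2 * W * χ) := by
  have hη := hS.η_pos
  have hL := hS.L_pos
  have hρ := hS.ρ_pos
  have hχ := hS.χ_nonneg
  have hW0 : (0 : ℝ) < W := by exact_mod_cast hW
  -- The starting time of the linearisation is deterministic, since it is selected through
  -- expectations. The window is short enough that 1 − ηH amplifies by at most 3 until the end.
  obtain ⟨s₀, hs1, hs2, hs3⟩ := exists_mem_window_le hW hWN
    (a := fun n => epochGrad P f G C z η R y₀ n + L ^ 2 * η ^ 2 * epochErr P G C z η R y₀ n)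
    (fun n => add_nonneg (epochGrad_nonneg _ _ _)
      (mul_nonneg (by positivity) (epochErr_nonneg _ _ _)))
  rw [Finset.sum_add_distrib, ← Finset.mul_sum] at hs3
  set H := hessian f y₀ with hH
  have hsym := hS.objective.isSymmetric_hessian y₀
  have hHL := hS.objective.norm_hessian_le hL y₀
  have hHγ : ∀ v, -(2 * κ) * ‖v‖ ^ 2 ≤ inner ℝ (H v) v := by
    simpa [NegCurvature, not_exists, not_lt] using hneg
  set M : ℕ → EuclideanSpace ℝ (Fin d) →L[ℝ] EuclideanSpace ℝ (Fin d) :=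
    fun k => (1 - η • H) ^ k with hMdef
  have ha : ∀ k ≤ W, (1 + η * (2 * κ)) ^ k ≤ 3 := fun k hk =>
    one_add_pow_le_three (by positivity) hk hWκ
  have hM : ∀ k ≤ W, ∀ u, ‖M k u‖ ≤ 3 * ‖u‖ := fun k hk u =>
    (norm_one_sub_pow_apply_le hsym hHL hHγ hη hηL (by positivity) k u).trans
      (mul_le_mul_of_nonneg_right (ha k hk) (norm_nonneg _))
  have hMH : ∀ k ≤ W, ∀ u, ‖M k (H u)‖ ≤ (L / (1 + k * (η * L)) + 6 * κ) * ‖u‖ := fun k hk u =>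
    (norm_one_sub_pow_mul_apply_le hsym hHL hHγ hη hηL (by positivity) hL k u).trans
      (mul_le_mul_of_nonneg_right (by
        have := mul_le_mul_of_nonneg_left (ha k hk) (by positivity : 0 ≤ 2 * κ)
        linarith) (norm_nonneg _))
  have hMs : ∀ k u, M (k + 1) u = M k (u - η • H u) := fun k u => by
    simp only [hMdef, pow_succ]; rfl
  have hM0 : ∀ u, M 0 u = u := fun u => by simp [hMdef]
  clear_value M
  -- Noise entering at step `n` is propagated through the remaining N − 1 − n steps; noise before
  -- `s₀` is discarded.
  set T : ℕ → EuclideanSpace ℝ (Fin d) →L[ℝ] EuclideanSpace ℝ (Fin d) :=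
    fun n => if s₀ ≤ n ∧ n < N then M (N - 1 - n) else 0 with hT
  -- Of 9/2·(2κ) = 9κ, a part 6κ comes from the negative eigenvalues (2κ times 3) and 3κ from
  -- replacing the Hessian at y by that at y₀.
  set β : ℕ → ℝ := fun n => if N - 1 - n < W then
    L / (1 + (N - 1 - n : ℕ) * (η * L)) + 9 / 2 * (2 * κ) else 0 with hβ
  have hβT : ∀ n y u, ‖y - y₀‖ ≤ R → ‖T n (hessian f y u)‖ ≤ β n * ‖u‖ := by
    intro n y u hy
    simp only [hT, hβ]
    by_cases hn : s₀ ≤ n ∧ n < N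
    · have hk : N - 1 - n < W := by omega
      rw [if_pos hn, if_pos hk]
      set k := N - 1 - n
      have h1 := hMH k hk.le u
      have h2 : ‖M k ((hessian f y - H) u)‖ ≤ 3 * (κ * ‖u‖) := by
        refine (hM k hk.le _).trans (mul_le_mul_of_nonneg_left ?_ (by norm_num))
        refine (hessian f y - H).le_of_opNorm_le ?_ u
        exact (hS.objective.lipschitz_hessian y y₀).trans
          ((mul_le_mul_of_nonneg_left hy hρ.le).trans hRκ)
      have e : M k (hessian f y u) = M k (H u) + M k ((hessian f y - H) u) := by
        rw [← map_add]; congr 1; simp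
      rw [e]
      refine (norm_add_le _ _).trans ?_
      linarith
    · rw [if_neg hn]
      simp only [zero_apply, norm_zero]
      split_ifs <;> positivity
  have hdrift := fun n => hS.integral_sq_drift_le (R := R) y₀ hβT n
  refine ⟨T, ⟨(hdrift N).1, (hdrift N).2.trans (mul_le_mul_of_nonneg_left ?_ hχ)⟩, ?_⟩
  · have h1 : ∀ n, η ^ 2 * β n ^ 2 = if N - 1 - n < W then η ^ 2 *
        (L / (1 + (N - 1 - n : ℕ) * (η * L)) + 9 / 2 * (2 * κ)) ^ 2 else 0 := by
      intro n; simp only [hβ]; split_ifs <;> simp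
    simp only [h1]
    rw [sum_reflect_window hWN (fun k => η ^ 2 * (L / (1 + k * (η * L)) + 9 / 2 * (2 * κ)) ^ 2)]
    refine (sum_drift_bound_le hη hL hηL (by positivity) hWκ).trans (le_of_eq ?_)
    ring
  have hfst : ∀ n ω, (chain (driftStep η R f G C y₀ T) ((y₀, 0), 0) (fun t => z t ω) n).1 =
      epoch η R G C y₀ (fun t => z t ω) n := fun n ω => chain_driftStep_fst _ _ _ _ _ _ _ _ _
  -- Expected size of the current gradient, propagated to time `N`, minus the noise accumulated so
  -- far, as long as the epoch has not left the ball. At n = N it is the claimed remainder.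
  set F : ℕ → ℝ := fun n => ∫ ω, near R y₀ (chain (driftStep η R f G C y₀ T) ((y₀, 0), 0)
      (fun t => z t ω) n).1 * ‖M (N - n) (gradient f (chain (driftStep η R f G C y₀ T)
        ((y₀, 0), 0) (fun t => z t ω) n).1.1) -
        (chain (driftStep η R f G C y₀ T) ((y₀, 0), 0) (fun t => z t ω) n).2‖ ∂P with hF
  set A₀ := q / W + 3 * η * (ρ * R) * (q / 2) + 3 * ρ * η ^ 2 * χ with hA0
  set A₁ := 9 / 4 * W * η ^ 4 * L ^ 4 / q with hA1
  set A₂ := 3 * η * (ρ * R) / (2 * q) + 3 * ρ * η ^ 2 with hA2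
  have hA0' : 0 ≤ A₀ := by positivity
  have hA1' : 0 ≤ A₁ := by positivity
  have hA2' : 0 ≤ A₂ := by positivity
  have hstep : ∀ n, s₀ ≤ n → n < N → F (n + 1) ≤ F n +
      (A₀ + (A₁ * epochErr P G C z η R y₀ n + A₂ * epochGrad P f G C z η R y₀ n)) := by
    intro n hn1 hn2
    have e1 : N - n = N - (n + 1) + 1 := by omega
    refine hS.integral_rest_succ_le hR.le y₀ (n := n) (M := M (N - (n + 1))) (M' := M (N - n)) ?_
      (hM _ (by omega)) (fun u => by rw [e1, hMs]) hq hW0 (hdrift n).1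
    simp only [hT]
    rw [if_pos ⟨hn1, hn2⟩]
    congr 1
    omega
  have hsum : ∀ n, s₀ ≤ n → n ≤ N → F n ≤ F s₀ + ∑ k ∈ Finset.Ico s₀ n,
      (A₀ + (A₁ * epochErr P G C z η R y₀ k + A₂ * epochGrad P f G C z η R y₀ k)) := by
    intro n hn
    induction n, hn using Nat.le_induction with
    | base => intro _; simp
    | succ n hn ih =>
      intro hnN
      rw [Finset.sum_Ico_succ_top hn]
      have := ih (by omega)
      have := hstep n hn (by omega)
      linarith
  have hFs : F s₀ ≤ 3 / 2 * q + 3 / q * (epochGrad P f G C z η R y₀ s₀ +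
      L ^ 2 * η ^ 2 * epochErr P G C z η R y₀ s₀) := by
    have hz : ∀ ω, (chain (driftStep η R f G C y₀ T) ((y₀, 0), 0) (fun t => z t ω) s₀).2 = 0 :=
      fun ω => chain_driftStep_snd_eq_zero _ _ _ _ _ _ _ fun k hk => by
        simp only [hT]; rw [if_neg (by omega)]
    simp only [hF, hz, sub_zero, hfst]
    exact hS.integral_propagated_start_le y₀ s₀ (hM _ (by omega)) hq
  have hIN := hS.integrable_near_mul_norm (R := R) y₀ (M 0) (hdrift N).1
  simp only [hM0, hfst] at hIN
  refine ⟨hIN, ?_⟩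
  have hFN : F N = ∫ ω, near R y₀ (epoch η R G C y₀ (fun t => z t ω) N) *
        ‖gradient f (epoch η R G C y₀ (fun t => z t ω) N).1 -
          (chain (driftStep η R f G C y₀ T) ((y₀, 0), 0) (fun t => z t ω) N).2‖ ∂P := by
    simp only [hF, Nat.sub_self, hM0, hfst]
  rw [← hFN]
  have h1 := hsum N hs2.le le_rfl
  have h2 := sum_Ico_affine_le hs1 hWN hA0' hA1' hA2'
    (e := fun n => epochErr P G C z η R y₀ n) (g := fun n => epochGrad P f G C z η R y₀ n)
    (fun n => epochErr_nonneg _ _ _) (fun n => epochGrad_nonneg _ _ _)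
  have hSe : 0 ≤ ∑ n ∈ Finset.range N, epochErr P G C z η R y₀ n :=
    Finset.sum_nonneg fun n _ => epochErr_nonneg _ _ _
  have hSg : 0 ≤ ∑ n ∈ Finset.range N, epochGrad P f G C z η R y₀ n :=
    Finset.sum_nonneg fun n _ => epochGrad_nonneg _ _ _
  have h3 := mul_le_mul_of_nonneg_left hs3 (by positivity : 0 ≤ 3 / q)
  set Se := ∑ n ∈ Finset.range N, epochErr P G C z η R y₀ n
  set Sg := ∑ n ∈ Finset.range N, epochGrad P f G C z η R y₀ n
  have h4 : W * A₀ ≤ q + 3 / 4 * q + 3 * ρ * η ^ 2 * W * χ := by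
    have e1 : W * A₀ = q + (W * (η * (2 * (ρ * R)))) * (3 / 4 * q) + 3 * ρ * η ^ 2 * W * χ := by
      rw [hA0]; field_simp; ring
    have h5 : W * (η * (2 * (ρ * R))) ≤ 1 := le_trans (by gcongr) hWκ
    rw [e1]
    have := mul_le_mul_of_nonneg_right h5 (by positivity : 0 ≤ 3 / 4 * q)
    linarith
  have h5 : A₂ * Sg ≤ (3 * η * κ / (2 * q) + 3 * ρ * η ^ 2) * Sg := by
    apply mul_le_mul_of_nonneg_right _ hSg
    rw [hA2]
    gcongr
  have e6 : 3 / q * (1 / W * (Sg + L ^ 2 * η ^ 2 * Se)) =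
      3 / (q * W) * (Sg + L ^ 2 * η ^ 2 * Se) := by field_simp
  rw [e6] at h3
  linarith

/-- The curvature threshold at the start is 2κ and at the end κ; the gap is the variation of the
Hessian across the ball, ρR ≤ κ. -/
theorem measureReal_badEnd_le {R κ ε : ℝ} (hR : 0 < R) (hκ : 0 < κ) (hRκ : ρ * R ≤ κ)
    (hηL : η * L ≤ 1) (y₀ : EuclideanSpace ℝ (Fin d)) {N W : ℕ} (hW : 1 ≤ W) (hWN : W ≤ N)
    (hWκ : W * (η * (2 * κ)) ≤ 1) (hε : 0 < ε) {q : ℝ} (hq : 0 < q) :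
    P.real {ω | R < ‖(epoch η R G C y₀ (fun t => z t ω) N).1 - y₀‖ ∨
      (ε < ‖gradient f (epoch η R G C y₀ (fun t => z t ω) N).1‖ ∧
        ¬ NegCurvature f κ (epoch η R G C y₀ (fun t => z t ω) N).1)} ≤
    (6 * N * η ^ 2 * ∑ n ∈ Finset.range N, epochGrad P f G C z η R y₀ n + 3 * N * η ^ 2 * χ) /
        R ^ 2 +
      2 / ε * (4 * q + 3 / (q * W) * (∑ n ∈ Finset.range N, epochGrad P f G C z η R y₀ n +
            L ^ 2 * η ^ 2 * ∑ n ∈ Finset.range N, epochErr P G C z η R y₀ n) +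
          9 / 4 * W * η ^ 4 * L ^ 4 / q * ∑ n ∈ Finset.range N, epochErr P G C z η R y₀ n +
          (3 * η * κ / (2 * q) + 3 * ρ * η ^ 2) *
            ∑ n ∈ Finset.range N, epochGrad P f G C z η R y₀ n + 3 * ρ * η ^ 2 * W * χ) +
      4 / ε ^ 2 * (χ * (η * (4 * L + 82 * κ))) := by
  have hη := hS.η_pos
  have hL := hS.L_pos
  have hρ := hS.ρ_pos
  have hχ := hS.χ_nonneg
  have hexit := hS.measureReal_exit_le hR y₀ (hW.trans hWN)
  have hSe : 0 ≤ ∑ n ∈ Finset.range N, epochErr P G C z η R y₀ n :=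
    Finset.sum_nonneg fun n _ => epochErr_nonneg _ _ _
  have hSg : 0 ≤ ∑ n ∈ Finset.range N, epochGrad P f G C z η R y₀ n :=
    Finset.sum_nonneg fun n _ => epochGrad_nonneg _ _ _
  -- Strong negative curvature at the start persists in the ball, so only an exit is bad.
  by_cases hneg : NegCurvature f (2 * κ) y₀
  · have hsub : {ω | R < ‖(epoch η R G C y₀ (fun t => z t ω) N).1 - y₀‖ ∨
      (ε < ‖gradient f (epoch η R G C y₀ (fun t => z t ω) N).1‖ ∧
        ¬ NegCurvature f κ (epoch η R G C y₀ (fun t => z t ω) N).1)} ⊆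
        {ω | R < ‖(epoch η R G C y₀ (fun t => z t ω) N).1 - y₀‖} := by
      rintro ω (h | h)
      · exact h
      · change R < _
        by_contra hlt
        push Not at hlt
        refine h.2 (hS.objective.negCurvature_of_near (s := κ) (x := y₀)
          ((mul_le_mul_of_nonneg_left hlt hρ.le).trans hRκ) ?_)
        rwa [← two_mul]
    refine (measureReal_mono hsub).trans (hexit.trans ?_)
    rw [add_assoc]
    exact le_add_of_nonneg_right (by positivity)
  · obtain ⟨T, ⟨hm1, hm2⟩, hr1, hr2⟩ := hS.exists_gradient_decomposition hR hκ hRκ hηL hneg hW hWN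
      hWκ hq
    set m := fun ω => (chain (driftStep η R f G C y₀ T) ((y₀, 0), 0) (fun t => z t ω) N).2
    -- A large end gradient without exit requires the remainder or the accumulated noise to exceed
    -- ε/2; Markov's inequality is applied to the first moment of the former and the second moment
    -- of the latter.
    have hsub : {ω | R < ‖(epoch η R G C y₀ (fun t => z t ω) N).1 - y₀‖ ∨
      (ε < ‖gradient f (epoch η R G C y₀ (fun t => z t ω) N).1‖ ∧
        ¬ NegCurvature f κ (epoch η R G C y₀ (fun t => z t ω) N).1)} ⊆
        ({ω | R < ‖(epoch η R G C y₀ (fun t => z t ω) N).1 - y₀‖} ∪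
        {ω | ε / 2 ≤ near R y₀ (epoch η R G C y₀ (fun t => z t ω) N) *
          ‖gradient f (epoch η R G C y₀ (fun t => z t ω) N).1 - m ω‖}) ∪
        {ω | (ε / 2) ^ 2 ≤ ‖m ω‖ ^ 2} := by
      rintro ω h
      by_cases hlt : R < ‖(epoch η R G C y₀ (fun t => z t ω) N).1 - y₀‖
      · exact Or.inl (Or.inl hlt)
      · have hg := (h.resolve_left hlt).1
        by_cases hmω : ε / 2 ≤ ‖m ω‖
        · exact Or.inr (pow_le_pow_left₀ (by positivity) hmω 2)
        · refine Or.inl (Or.inr ?_)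
          have hn : near R y₀ (epoch η R G C y₀ (fun t => z t ω) N) = 1 := by
            simp only [near]; rw [if_pos (not_lt.1 hlt)]
          change ε / 2 ≤ _ * _
          rw [hn, one_mul]
          have := norm_sub_norm_le (gradient f (epoch η R G C y₀ (fun t => z t ω) N).1) (m ω)
          linarith
    have h1 := mul_meas_ge_le_integral_of_nonneg (.of_forall fun ω =>
      mul_nonneg (near_nonneg _ _ _) (norm_nonneg _)) hr1 (ε / 2)
    have h2 := mul_meas_ge_le_integral_of_nonneg (.of_forall fun ω => by positivity) hm1
      ((ε / 2) ^ 2)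
    have h3 := (h1.trans hr2)
    have h4 := (h2.trans hm2)
    have h5 := measureReal_mono hsub (μ := P)
    have h6 := h5.trans ((measureReal_union_le _ _).trans
      (add_le_add_left (measureReal_union_le _ _) _))
    refine h6.trans ?_
    have hε2 : (0 : ℝ) < (ε / 2) ^ 2 := by positivity
    refine add_le_add (add_le_add hexit ?_) ?_
    · rw [div_mul_eq_mul_div, le_div_iff₀ hε]
      linarith
    · rw [div_mul_eq_mul_div, le_div_iff₀ (by positivity)]
      linarith

end SGDSetting

/-! ### Decomposition of a run into epochs -/

section Runs

variable {d : ℕ} {Θ Θ' : Type*}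

/-- The reset condition in the coordinates `((y, e), (t', x_{t'}))`. -/
def ResetDue (R : ℝ) (I t : ℕ) (c : (EuclideanSpace ℝ (Fin d) × EuclideanSpace ℝ (Fin d)) ×
    (ℕ × EuclideanSpace ℝ (Fin d))) : Prop :=
  c.2.1 + I < t ∨ R < ‖c.2.2 - c.1.1‖

open Classical in
/-- The reset in the coordinates `((y, e), (t', x_{t'}))`. -/
noncomputable def resetTuple (R : ℝ) (I t : ℕ)
    (c : (EuclideanSpace ℝ (Fin d) × EuclideanSpace ℝ (Fin d)) ×
      (ℕ × EuclideanSpace ℝ (Fin d))) :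
    (EuclideanSpace ℝ (Fin d) × EuclideanSpace ℝ (Fin d)) × (ℕ × EuclideanSpace ℝ (Fin d)) :=
  if ResetDue R I t c then ((c.1.1, 0), (t, c.1.1)) else c

/-- One iteration of compressed SGD in the coordinates `((y, e), (t', x_{t'}))`. -/
noncomputable def tupleStep (η R : ℝ) (I : ℕ)
    (G : EuclideanSpace ℝ (Fin d) → Θ → EuclideanSpace ℝ (Fin d))
    (C : EuclideanSpace ℝ (Fin d) → Θ' → EuclideanSpace ℝ (Fin d)) (t : ℕ)
    (c : (EuclideanSpace ℝ (Fin d) × EuclideanSpace ℝ (Fin d)) ×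
      (ℕ × EuclideanSpace ℝ (Fin d)))
    (b : EuclideanSpace ℝ (Fin d) × Θ × Θ') :
    (EuclideanSpace ℝ (Fin d) × EuclideanSpace ℝ (Fin d)) × (ℕ × EuclideanSpace ℝ (Fin d)) :=
  (pairStep η G C (resetTuple R I t c).1 b, (resetTuple R I t c).2)

/-- The state of compressed SGD in the coordinates `((y, e), (t', x_{t'}))`. -/
noncomputable def tuple (η R : ℝ) (I : ℕ)
    (G : EuclideanSpace ℝ (Fin d) → Θ → EuclideanSpace ℝ (Fin d))
    (C : EuclideanSpace ℝ (Fin d) → Θ' → EuclideanSpace ℝ (Fin d))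
    (x₀ : EuclideanSpace ℝ (Fin d)) (z : ℕ → EuclideanSpace ℝ (Fin d) × Θ × Θ') (t : ℕ) :
    (EuclideanSpace ℝ (Fin d) × EuclideanSpace ℝ (Fin d)) × (ℕ × EuclideanSpace ℝ (Fin d)) :=
  chain (tupleStep η R I G C) ((x₀, 0), (0, x₀)) z t

/-- The state of compressed SGD with coordinates `((y, e), (t', x_{t'}))`. -/
noncomputable def tupleState (η : ℝ)
    (c : (EuclideanSpace ℝ (Fin d) × EuclideanSpace ℝ (Fin d)) ×
      (ℕ × EuclideanSpace ℝ (Fin d))) : CompressedSGDState d where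
  x := c.1.1 + η • c.1.2
  e := c.1.2
  resetTime := c.2.1
  resetPoint := c.2.2

theorem resetTriggered_tupleState {p : CompressedSGDParams} (hp : p.resetError = true) (t : ℕ)
    (c : (EuclideanSpace ℝ (Fin d) × EuclideanSpace ℝ (Fin d)) ×
      (ℕ × EuclideanSpace ℝ (Fin d))) :
    CompressedSGD.ResetTriggered p t (tupleState p.stepSize c) ↔
      ResetDue p.escapeRadius p.escapeIters t c := by
  simp [CompressedSGD.ResetTriggered, ResetDue, tupleState, hp]

theorem maybeReset_tupleState {p : CompressedSGDParams} (hp : p.resetError = true) (t : ℕ)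
    (c : (EuclideanSpace ℝ (Fin d) × EuclideanSpace ℝ (Fin d)) ×
      (ℕ × EuclideanSpace ℝ (Fin d))) :
    CompressedSGD.maybeReset p t (tupleState p.stepSize c) =
      tupleState p.stepSize (resetTuple p.escapeRadius p.escapeIters t c) := by
  by_cases h : ResetDue p.escapeRadius p.escapeIters t c
  · rw [CompressedSGD.maybeReset, if_pos ((resetTriggered_tupleState hp t c).2 h), resetTuple,
      if_pos h]
    simp [tupleState]
  · rw [CompressedSGD.maybeReset, if_neg (mt (resetTriggered_tupleState hp t c).1 h), resetTuple,
      if_neg h]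

/-- In the coordinates (y, e) a reset changes only e and the record of the last reset, and the run
becomes a `chain` to which the tools for i.i.d. sequences apply. -/
theorem state_eq_tupleState {p : CompressedSGDParams} (hp : p.resetError = true)
    (G : EuclideanSpace ℝ (Fin d) → Θ → EuclideanSpace ℝ (Fin d))
    (C : EuclideanSpace ℝ (Fin d) → Θ' → EuclideanSpace ℝ (Fin d))
    (x₀ : EuclideanSpace ℝ (Fin d)) (z : ℕ → EuclideanSpace ℝ (Fin d) × Θ × Θ') (t : ℕ) :
    CompressedSGD.state p G C x₀ z t =
      tupleState p.stepSize (tuple p.stepSize p.escapeRadius p.escapeIters G C x₀ z t) := by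
  induction t with
  | zero => simp [CompressedSGD.state, CompressedSGD.initState, tupleState, tuple, chain]
  | succ t ih =>
    have h : tuple p.stepSize p.escapeRadius p.escapeIters G C x₀ z (t + 1) =
      tupleStep p.stepSize p.escapeRadius p.escapeIters G C t
        (tuple p.stepSize p.escapeRadius p.escapeIters G C x₀ z t) (z t) := rfl
    rw [CompressedSGD.state, ih, maybeReset_tupleState hp, h]
    simp only [CompressedSGD.gradStep, tupleState, tupleStep, pairStep, CompressedSGDState.mk.injEq,
      and_self, and_true]
    module

variable {η R : ℝ} {I : ℕ} {G : EuclideanSpace ℝ (Fin d) → Θ → EuclideanSpace ℝ (Fin d)}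
    {C : EuclideanSpace ℝ (Fin d) → Θ' → EuclideanSpace ℝ (Fin d)}
    {x₀ : EuclideanSpace ℝ (Fin d)} {z : ℕ → EuclideanSpace ℝ (Fin d) × Θ × Θ'}

theorem tuple_succ (t : ℕ) : tuple η R I G C x₀ z (t + 1) =
    tupleStep η R I G C t (tuple η R I G C x₀ z t) (z t) := rfl

theorem epoch_succ (y₀ : EuclideanSpace ℝ (Fin d)) (n : ℕ) :
    epoch η R G C y₀ z (n + 1) = epochStep η R G C y₀ n (epoch η R G C y₀ z n) (z n) := rfl

theorem epoch_frozen {y₀ : EuclideanSpace ℝ (Fin d)} {j : ℕ}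
    (h : R < ‖(epoch η R G C y₀ z j).1 - y₀‖) {k : ℕ} (hk : j ≤ k) :
    epoch η R G C y₀ z k = epoch η R G C y₀ z j := by
  induction k, hk using Nat.le_induction with
  | base => rfl
  | succ k hk ih =>
    rw [epoch_succ, ih, epochStep, if_neg (not_le.2 h)]

/-- An epoch begins at iteration `t`. -/
def IsStart (η R : ℝ) (I : ℕ) (G : EuclideanSpace ℝ (Fin d) → Θ → EuclideanSpace ℝ (Fin d))
    (C : EuclideanSpace ℝ (Fin d) → Θ' → EuclideanSpace ℝ (Fin d))
    (x₀ : EuclideanSpace ℝ (Fin d)) (z : ℕ → EuclideanSpace ℝ (Fin d) × Θ × Θ') (t : ℕ) : Prop :=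
  t = 0 ∨ ResetDue R I t (tuple η R I G C x₀ z t)

/-- The epoch that starts at iteration `s` if `s` is a start. -/
noncomputable def epochFrom (η R : ℝ) (I : ℕ)
    (G : EuclideanSpace ℝ (Fin d) → Θ → EuclideanSpace ℝ (Fin d))
    (C : EuclideanSpace ℝ (Fin d) → Θ' → EuclideanSpace ℝ (Fin d))
    (x₀ : EuclideanSpace ℝ (Fin d)) (z : ℕ → EuclideanSpace ℝ (Fin d) × Θ × Θ') (s k : ℕ) :
    EuclideanSpace ℝ (Fin d) × EuclideanSpace ℝ (Fin d) :=
  epoch η R G C (tuple η R I G C x₀ z s).1.1 (fun j => z (s + j)) k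

theorem epochFrom_zero (s : ℕ) :
    epochFrom η R I G C x₀ z s 0 = ((tuple η R I G C x₀ z s).1.1, 0) := rfl

theorem epochFrom_succ_of_near {s k : ℕ} (h : ‖(epochFrom η R I G C x₀ z s k).1 -
    (tuple η R I G C x₀ z s).1.1‖ ≤ R) :
    epochFrom η R I G C x₀ z s (k + 1) =
      pairStep η G C (epochFrom η R I G C x₀ z s k) (z (s + k)) := by
  unfold epochFrom at h ⊢
  rw [epoch_succ, epochStep, if_pos h]

theorem not_resetDue_zero (hR : 0 < R) : ¬ ResetDue R I 0 (tuple η R I G C x₀ z 0) := by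
  simp [ResetDue, tuple, chain, hR.le]

theorem resetTuple_of_isStart (hR : 0 < R) {t : ℕ} (h : IsStart η R I G C x₀ z t) :
    resetTuple R I t (tuple η R I G C x₀ z t) =
      (((tuple η R I G C x₀ z t).1.1, 0), (t, (tuple η R I G C x₀ z t).1.1)) := by
  rcases h with rfl | h
  · rw [resetTuple, if_neg (not_resetDue_zero hR)]; rfl
  · rw [resetTuple, if_pos h]

/-- At every time the state is that of the epoch started at the last reset. -/
theorem tuple_eq_epochFrom (hR : 0 < R) (t : ℕ) :
    ∃ s, (tuple η R I G C x₀ z t).2 = (s, (tuple η R I G C x₀ z s).1.1) ∧ s ≤ t ∧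
      IsStart η R I G C x₀ z s ∧ t ≤ s + (I + 1) ∧ (0 < t → s < t) ∧
      (tuple η R I G C x₀ z t).1 = epochFrom η R I G C x₀ z s (t - s) := by
  induction t with
  | zero => exact ⟨0, rfl, le_rfl, Or.inl rfl, by omega, by omega, rfl⟩
  | succ t ih =>
    obtain ⟨s, h1, h2, h3, h4, h5, h6⟩ := ih
    by_cases hr : IsStart η R I G C x₀ z t
    · refine ⟨t, ?_, by omega, hr, by omega, by omega, ?_⟩
      · rw [tuple_succ, tupleStep, resetTuple_of_isStart hR hr]
      · rw [tuple_succ, tupleStep, resetTuple_of_isStart hR hr, Nat.add_sub_cancel_left,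
          epochFrom_succ_of_near (by simp [epochFrom_zero, hR.le]), epochFrom_zero]
        rfl
    · have hr' : ¬ ResetDue R I t (tuple η R I G C x₀ z t) := fun h => hr (Or.inr h)
      have e1 : resetTuple R I t (tuple η R I G C x₀ z t) = tuple η R I G C x₀ z t := by
        rw [resetTuple, if_neg hr']
      have hr2 := hr'
      simp only [ResetDue, h1, h6, not_or, not_lt] at hr2
      refine ⟨s, ?_, by omega, h3, by omega, by omega, ?_⟩
      · rw [tuple_succ, tupleStep, e1, h1]
      · rw [tuple_succ, tupleStep, e1, Nat.sub_add_comm h2, epochFrom_succ_of_near, h6,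
          Nat.add_sub_cancel' h2]
        rw [norm_sub_rev]; exact hr2.2

/-- While an epoch lasts, the state after the (absent) reset is that of the epoch. -/
theorem resetTuple_eq_epochFrom (hR : 0 < R) {s : ℕ} (hs : IsStart η R I G C x₀ z s) {k : ℕ}
    (hk : k ≤ I) (hn : ‖(epochFrom η R I G C x₀ z s k).1 - (tuple η R I G C x₀ z s).1.1‖ ≤ R) :
    resetTuple R I (s + k) (tuple η R I G C x₀ z (s + k)) =
      (epochFrom η R I G C x₀ z s k, (s, (tuple η R I G C x₀ z s).1.1)) := by
  induction k with
  | zero => exact resetTuple_of_isStart hR hs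
  | succ k ih =>
    have hn' : ‖(epochFrom η R I G C x₀ z s k).1 - (tuple η R I G C x₀ z s).1.1‖ ≤ R := by
      by_contra hlt
      rw [not_le] at hlt
      have := epoch_frozen hlt (Nat.le_succ k)
      rw [epochFrom, this] at hn
      exact absurd hn (not_le.2 hlt)
    have h := ih (by omega) hn'
    have e : tuple η R I G C x₀ z (s + (k + 1)) =
        (epochFrom η R I G C x₀ z s (k + 1), (s, (tuple η R I G C x₀ z s).1.1)) := by
      rw [← add_assoc, tuple_succ, tupleStep, h, epochFrom_succ_of_near hn']
    rw [e, resetTuple, if_neg]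
    simp only [ResetDue, not_or, not_lt]
    exact ⟨by omega, by rw [norm_sub_rev]; exact hn⟩

/-- The reset point is the end point of the preceding epoch. -/
theorem epochFrom_end_of_resetDue (hR : 0 < R) {t : ℕ}
    (ht : ResetDue R I t (tuple η R I G C x₀ z t)) :
    ∃ s < t, (tuple η R I G C x₀ z t).2.1 = s ∧ IsStart η R I G C x₀ z s ∧
      (epochFrom η R I G C x₀ z s (I + 1)).1 = (tuple η R I G C x₀ z t).1.1 ∧
      (t = s + (I + 1) ∨ R < ‖(epochFrom η R I G C x₀ z s (I + 1)).1 -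
        (tuple η R I G C x₀ z s).1.1‖) := by
  obtain ⟨s, h1, h2, h3, h4, h5, h6⟩ := tuple_eq_epochFrom (η := η) (I := I) (G := G) (C := C)
    (x₀ := x₀) (z := z) hR t
  have ht0 : 0 < t := by
    rcases Nat.eq_zero_or_pos t with rfl | h
    · exact absurd ht (not_resetDue_zero hR)
    · exact h
  refine ⟨s, h5 ht0, by rw [h1], h3, ?_⟩
  by_cases hlt : R < ‖(epochFrom η R I G C x₀ z s (t - s)).1 - (tuple η R I G C x₀ z s).1.1‖
  · have := epoch_frozen hlt (by omega : t - s ≤ I + 1)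
    have e : epochFrom η R I G C x₀ z s (I + 1) = epochFrom η R I G C x₀ z s (t - s) := this
    rw [e, h6]
    exact ⟨rfl, Or.inr hlt⟩
  · rw [ResetDue, h1, h6, norm_sub_rev] at ht
    have := ht.resolve_right hlt
    have e : t - s = I + 1 := by simp only at this; omega
    rw [h6, e]
    exact ⟨rfl, Or.inl (by omega)⟩

theorem resetTime_mono (hR : 0 < R) {t t' : ℕ} (h : t ≤ t') :
    (tuple η R I G C x₀ z t).2.1 ≤ (tuple η R I G C x₀ z t').2.1 := by
  induction t', h using Nat.le_induction with
  | base => rfl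
  | succ t' _ ih =>
    refine ih.trans ?_
    obtain ⟨s, h1, h2, -⟩ := tuple_eq_epochFrom (η := η) (I := I) (G := G) (C := C)
      (x₀ := x₀) (z := z) hR t'
    rw [tuple_succ, tupleStep, resetTuple]
    split_ifs
    · rw [h1]; exact h2
    · rfl

/-- Consequently different resets end different epochs, which makes the map from a reset to the
start of the epoch it ends injective. -/
theorem resetTime_lt_of_lt (hR : 0 < R) {t t' : ℕ} (h : t < t')
    (ht : ResetDue R I t (tuple η R I G C x₀ z t)) :
    (tuple η R I G C x₀ z t).2.1 < (tuple η R I G C x₀ z t').2.1 := by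
  obtain ⟨s, hs, h1, -⟩ := epochFrom_end_of_resetDue hR ht
  have h2 := resetTime_mono (η := η) (I := I) (G := G) (C := C) (x₀ := x₀) (z := z) hR h
  rw [tuple_succ, tupleStep, resetTuple, if_pos ht] at h2
  simp only at h2
  omega

open Classical in
/-- The squared gradients met during the epochs are squared gradients of the run. -/
theorem sum_epochFrom_gradTerm_le (hR : 0 < R) (f : EuclideanSpace ℝ (Fin d) → ℝ) (T : ℕ) :
    ∑ s ∈ Finset.range T, (if IsStart η R I G C x₀ z s then
      ∑ k ∈ Finset.range (I + 1), gradTerm f η R (tuple η R I G C x₀ z s).1.1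
        (epochFrom η R I G C x₀ z s k) else 0) ≤
    ∑ t ∈ Finset.range (T + (I + 1)), ‖gradient f
      ((resetTuple R I t (tuple η R I G C x₀ z t)).1.1 +
        η • (resetTuple R I t (tuple η R I G C x₀ z t)).1.2)‖ ^ 2 := by
  set X := fun t => resetTuple R I t (tuple η R I G C x₀ z t) with hX
  set g := fun t => ‖gradient f ((X t).1.1 + η • (X t).1.2)‖ ^ 2 with hg
  have hg0 : ∀ t, 0 ≤ g t := fun t => by positivity
  -- Every iteration belongs to the single epoch named by its reset time. Summing over starts and
  -- exchanging the sums therefore counts each gradient at most once.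
  have h1 : ∀ s ∈ Finset.range T, (if IsStart η R I G C x₀ z s then
      ∑ k ∈ Finset.range (I + 1), gradTerm f η R (tuple η R I G C x₀ z s).1.1
        (epochFrom η R I G C x₀ z s k) else 0) ≤
      ∑ t ∈ Finset.range (T + (I + 1)), if (X t).2.1 = s then g t else 0 := by
    intro s hs
    rw [Finset.mem_range] at hs
    split_ifs with hst
    · have h2 : ∀ k ∈ Finset.range (I + 1), gradTerm f η R (tuple η R I G C x₀ z s).1.1
          (epochFrom η R I G C x₀ z s k) ≤ if (X (s + k)).2.1 = s then g (s + k) else 0 := by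
        intro k hk
        rw [Finset.mem_range] at hk
        unfold gradTerm near
        split_ifs with hn hx hx
        · have := resetTuple_eq_epochFrom hR hst (by omega : k ≤ I) hn
          simp only [hg, hX, this, one_mul, le_refl]
        · have := resetTuple_eq_epochFrom hR hst (by omega : k ≤ I) hn
          exact absurd (by simp only [hX, this]) hx
        · simpa using hg0 _
        · simp
      refine (Finset.sum_le_sum h2).trans ?_
      have h3 := Finset.sum_Ico_eq_sum_range (fun t => if (X t).2.1 = s then g t else 0) s
        (s + (I + 1))
      rw [Nat.add_sub_cancel_left] at h3
      rw [← h3, Finset.range_eq_Ico]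
      exact Finset.sum_le_sum_of_subset_of_nonneg
        (Finset.Ico_subset_Ico (Nat.zero_le _) (by omega))
        fun t _ _ => by split_ifs; exacts [hg0 t, le_rfl]
    · exact Finset.sum_nonneg fun t _ => by split_ifs; exacts [hg0 t, le_rfl]
  refine (Finset.sum_le_sum h1).trans ?_
  rw [Finset.sum_comm]
  refine Finset.sum_le_sum fun t _ => ?_
  rw [Finset.sum_ite_eq]
  split_ifs
  exacts [le_rfl, hg0 t]

-- Both counts are compared with the time of the last reset. A reset moves it forward by at most I +
-- 1, as t' + I < t first holds at t = t' + I + 1, and by exactly I + 1 when the epoch has full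
-- length.
open Classical in
theorem card_reset_bounds (hR : 0 < R) (T : ℕ) :
    T ≤ (((Finset.range T).filter fun t => ResetDue R I t (tuple η R I G C x₀ z t)).card + 1) *
      (I + 1) ∧
    ((Finset.range T).filter fun t => ResetDue R I t (tuple η R I G C x₀ z t) ∧
      t = (tuple η R I G C x₀ z t).2.1 + (I + 1)).card * (I + 1) ≤ T := by
  have h : ∀ T, (tuple η R I G C x₀ z T).2.1 ≤
      ((Finset.range T).filter fun t => ResetDue R I t (tuple η R I G C x₀ z t)).card * (I + 1) ∧
      ((Finset.range T).filter fun t => ResetDue R I t (tuple η R I G C x₀ z t) ∧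
      t = (tuple η R I G C x₀ z t).2.1 + (I + 1)).card * (I + 1) ≤
        (tuple η R I G C x₀ z T).2.1 := by
    intro T
    induction T with
    | zero =>
      refine ⟨by simp [tuple, chain], ?_⟩
      rw [Finset.range_zero, Finset.filter_empty, Finset.card_empty, zero_mul]
      exact Nat.zero_le _
    | succ T ih =>
      obtain ⟨s, h1, h2, -, h4, -⟩ := tuple_eq_epochFrom (η := η) (I := I) (G := G) (C := C)
        (x₀ := x₀) (z := z) hR T
      have hs : (tuple η R I G C x₀ z T).2.1 = s := by rw [h1]
      rw [Finset.range_add_one, Finset.filter_insert, Finset.filter_insert, tuple_succ, tupleStep,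
        resetTuple]
      rw [hs] at ih ⊢
      by_cases hr : ResetDue R I T (tuple η R I G C x₀ z T)
      · simp only [hr, if_true, true_and]
        rw [Finset.card_insert_of_notMem (by simp), add_mul]
        constructor
        · omega
        · split_ifs with ht
          · rw [Finset.card_insert_of_notMem (by simp), add_mul]; omega
          · omega
      · simp only [hr, if_false, false_and, hs]
        exact ih
  obtain ⟨s, h1, h2, -, h4, -⟩ := tuple_eq_epochFrom (η := η) (I := I) (G := G) (C := C)
    (x₀ := x₀) (z := z) hR T
  have hs : (tuple η R I G C x₀ z T).2.1 = s := by rw [h1]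
  have := h T
  rw [hs] at this
  refine ⟨?_, this.2.trans h2⟩
  rw [add_mul]; omega

end Runs

/-! ### Counting resets by starts with negative curvature and by bad ends. -/

section Counting

variable {d : ℕ} {Θ Θ' : Type*} {η R : ℝ} {I : ℕ}
    {G : EuclideanSpace ℝ (Fin d) → Θ → EuclideanSpace ℝ (Fin d)}
    {C : EuclideanSpace ℝ (Fin d) → Θ' → EuclideanSpace ℝ (Fin d)}
    {x₀ : EuclideanSpace ℝ (Fin d)} {z : ℕ → EuclideanSpace ℝ (Fin d) × Θ × Θ'}

/-- The epoch from `y₀` to `y` has travelled far, or ended at a point which has a large gradient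
but no direction of negative curvature. -/
def BadEnd (f : EuclideanSpace ℝ (Fin d) → ℝ) (R κ ε : ℝ) (y₀ y : EuclideanSpace ℝ (Fin d)) :
    Prop :=
  R < ‖y - y₀‖ ∨ (ε < ‖gradient f y‖ ∧ ¬ NegCurvature f κ y)

-- Each reset is assigned to the start of the epoch it ends. An epoch shorter than I + 1 steps must
-- have left the ball.
open Classical in
theorem card_bad_reset_le (hR : 0 < R) (f : EuclideanSpace ℝ (Fin d) → ℝ) (κ ε : ℝ) (T : ℕ) :
    ((Finset.range T).filter fun t => ResetDue R I t (tuple η R I G C x₀ z t) ∧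
      (t ≠ (tuple η R I G C x₀ z t).2.1 + (I + 1) ∨
        (ε < ‖gradient f (tuple η R I G C x₀ z t).1.1‖ ∧
          ¬ NegCurvature f κ (tuple η R I G C x₀ z t).1.1))).card ≤
    ((Finset.range T).filter fun s => IsStart η R I G C x₀ z s ∧
      BadEnd f R κ ε (tuple η R I G C x₀ z s).1.1
        (epochFrom η R I G C x₀ z s (I + 1)).1).card := by
  refine Finset.card_le_card_of_injOn (fun t => (tuple η R I G C x₀ z t).2.1) ?_ ?_
  · intro t ht
    simp only [Finset.coe_filter, Finset.mem_range, Set.mem_ofPred_eq] at ht ⊢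
    obtain ⟨s, hs, h1, h2, h3, h4⟩ := epochFrom_end_of_resetDue hR ht.2.1
    rw [h1]
    refine ⟨hs.trans ht.1, h2, ?_⟩
    rcases ht.2.2 with h | h
    · exact Or.inl (h4.resolve_left (by rw [← h1]; exact h))
    · rw [BadEnd, h3]; exact Or.inr h
  · intro t ht t' ht' heq
    simp only [Finset.coe_filter, Set.mem_ofPred_eq] at ht ht' heq
    rcases lt_trichotomy t t' with h | h | h
    · exact absurd heq (resetTime_lt_of_lt hR h ht.2.1).ne
    · exact h
    · exact absurd heq (resetTime_lt_of_lt hR h ht'.2.1).ne'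

open Classical in
/-- The resets are counted by starts of negative curvature and epochs with a bad end. -/
theorem run_counts (hR : 0 < R) {f : EuclideanSpace ℝ (Fin d) → ℝ} {ρ ε : ℝ} {p : CompressedSGDParams}
    (hp : p = { stepSize := η, escapeIters := I, escapeRadius := R, resetError := true })
    (T : ℕ) {n a b g st : ℕ}
    (hn : n = (CompressedSGD.resetTimes p G C x₀ z T).card)
    (hg : g = (CompressedSGD.sospResetTimes p G C x₀ z T f ρ ε).card)
    (ha : a = ((Finset.range T).filter fun s => IsStart η R I G C x₀ z s ∧
      NegCurvature f (√(ρ * ε)) (tuple η R I G C x₀ z s).1.1).card)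
    (hb : b = ((Finset.range T).filter fun s => IsStart η R I G C x₀ z s ∧
      BadEnd f R (√(ρ * ε)) ε (tuple η R I G C x₀ z s).1.1
        (epochFrom η R I G C x₀ z s (I + 1)).1).card)
    (hst : st = ((Finset.range T).filter fun s => IsStart η R I G C x₀ z s).card) :
    T ≤ (n + 1) * (I + 1) ∧ n ≤ g + a + b ∧ st ≤ n + 1 ∧ ∃ m, n ≤ b + m ∧ m * (I + 1) ≤ T := by
  have hpe : p.resetError = true := by rw [hp]
  have e1 : CompressedSGD.resetTimes p G C x₀ z T =
      (Finset.range T).filter fun t => ResetDue R I t (tuple η R I G C x₀ z t) := by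
    unfold CompressedSGD.resetTimes
    refine Finset.filter_congr fun t _ => ?_
    rw [state_eq_tupleState hpe, resetTriggered_tupleState hpe, hp]
  have e2 : CompressedSGD.sospResetTimes p G C x₀ z T f ρ ε =
      (Finset.range T).filter fun t => ResetDue R I t (tuple η R I G C x₀ z t) ∧
        IsSOSP f ρ ε (tuple η R I G C x₀ z t).1.1 := by
    unfold CompressedSGD.sospResetTimes
    rw [e1, Finset.filter_filter]
    refine Finset.filter_congr fun t _ => and_congr_right fun ht => ?_
    rw [CompressedSGD.iterate, state_eq_tupleState hpe, maybeReset_tupleState hpe, hp]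
    simp only [resetTuple, if_pos ht, tupleState, smul_zero, add_zero]
  have hbad := card_bad_reset_le (η := η) (I := I) (G := G) (C := C) (x₀ := x₀) (z := z) hR f
    (√(ρ * ε)) ε T
  rw [← hb] at hbad
  have hc := card_reset_bounds (η := η) (I := I) (G := G) (C := C) (x₀ := x₀) (z := z) hR T
  rw [e1] at hn
  rw [e2] at hg
  rw [← hn] at hc
  refine ⟨hc.1, ?_, ?_, _, ?_, hc.2⟩
  -- Trichotomy at a reset point: negative curvature, where it counts as the start of the next
  -- epoch; small gradient, where it is an ε-SOSP; or a bad end of the preceding epoch.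
  · refine le_trans ?_ (add_le_add (add_le_add hg.ge ha.ge) hbad)
    rw [hn]
    refine le_trans (Finset.card_le_card ?_) ((Finset.card_union_le _ _).trans
      (Nat.add_le_add_right (Finset.card_union_le _ _) _))
    intro t ht
    simp only [Finset.mem_union, Finset.mem_filter] at ht ⊢
    by_cases h1 : NegCurvature f (√(ρ * ε)) (tuple η R I G C x₀ z t).1.1
    · exact Or.inl (Or.inr ⟨ht.1, Or.inr ht.2, h1⟩)
    · by_cases h2 : ‖gradient f (tuple η R I G C x₀ z t).1.1‖ ≤ ε
      · exact Or.inl (Or.inl ⟨ht.1, ht.2, IsRegularObjective.isSOSP_of_not_negCurvature h1 h2⟩)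
      · exact Or.inr ⟨ht.1, ht.2, Or.inr ⟨not_le.1 h2, h1⟩⟩
  -- The extra start is iteration 0, which begins an epoch without a reset.
  · rw [hst, hn]
    refine le_trans (Finset.card_le_card (t := insert 0 ((Finset.range T).filter fun t =>
      ResetDue R I t (tuple η R I G C x₀ z t))) ?_) (Finset.card_insert_le _ _)
    intro t ht
    simp only [Finset.mem_insert, Finset.mem_filter] at ht ⊢
    exact ht.2.imp id fun h => ⟨ht.1, h⟩
  · refine le_trans ?_ (add_le_add_left hbad _)
    rw [hn]
    refine le_trans (Finset.card_le_card ?_) (Finset.card_union_le _ _)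
    intro t ht
    simp only [Finset.mem_union, Finset.mem_filter] at ht ⊢
    by_cases h : t = (tuple η R I G C x₀ z t).2.1 + (I + 1)
    · exact Or.inr ⟨ht.1, ht.2, h⟩
    · exact Or.inl ⟨ht.1, ht.2, Or.inl h⟩

end Counting

/-! ### Conditioning on the past -/

theorem IsIIDSequence.indepFun_chain_future {Ω Z α : Type*} [MeasurableSpace Ω]
    [MeasurableSpace Z] [MeasurableSpace α] {P : Measure Ω} {ν : Measure Z} {z : ℕ → Ω → Z}
    {h : ℕ → α → Z → α} (hh : ∀ n, Measurable (fun q : α × Z => h n q.1 q.2))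
    (hz : IsIIDSequence P ν z) (x₀ : α) (n : ℕ) :
    IndepFun (fun ω => chain h x₀ (fun t => z t ω) n) (fun ω (k : ℕ) => z (n + k) ω) P := by
  refine hz.indepFun_of_disjoint (S := {i | i < n}) (T := {i | n ≤ i}) ?_ ?_ ?_
  · rw [Set.disjoint_left]; intro i hi hi'; simp at hi hi'; omega
  · suffices H : ∀ m ≤ n, Measurable[⨆ j ∈ {i | i < n}, MeasurableSpace.comap (z j) inferInstance]
        (fun ω => chain h x₀ (fun t => z t ω) m) from H n le_rfl
    intro m hm
    induction m with
    | zero => exact @measurable_const _ _ _ (_) _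
    | succ m ih =>
      exact (hh m).comp (@Measurable.prodMk _ _ _ _ _ (_) _ _ (ih (by omega))
        (measurable_iSup_comap_eval z (S := {i | i < n}) (by simp; omega)))
  · exact @measurable_pi_lambda _ _ _ (_) _ _ fun k =>
      measurable_iSup_comap_eval z (S := {i | n ≤ i}) (by simp)

/-- Fubini for the joint law of independent variables, the form in which conditioning on the past is
used. -/
theorem integral_indepFun_of_bounded {Ω α β : Type*} [MeasurableSpace Ω] [MeasurableSpace α]
    [MeasurableSpace β] {P : Measure Ω} [IsProbabilityMeasure P] {X : Ω → α} {Y : Ω → β}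
    (hX : Measurable X) (hY : Measurable Y) (h : IndepFun X Y P) {φ : α × β → ℝ}
    (hφ : Measurable φ) {B : ℝ} (hB : ∀ q, |φ q| ≤ B) :
    Integrable (fun ω => φ (X ω, Y ω)) P ∧ Integrable (fun ω => ∫ ω', φ (X ω, Y ω') ∂P) P ∧
      ∫ ω, φ (X ω, Y ω) ∂P = ∫ ω, ∫ ω', φ (X ω, Y ω') ∂P ∂P := by
  have hpX : IsProbabilityMeasure (P.map X) := Measure.isProbabilityMeasure_map hX.aemeasurable
  have hpY : IsProbabilityMeasure (P.map Y) := Measure.isProbabilityMeasure_map hY.aemeasurable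
  have hlaw := (indepFun_iff_map_prod_eq_prod_map_map hX.aemeasurable hY.aemeasurable).1 h
  have hint : Integrable φ ((P.map X).prod (P.map Y)) :=
    Integrable.of_bound hφ.aestronglyMeasurable B (.of_forall hB)
  have e1 : ∀ x, ∫ ω', φ (x, Y ω') ∂P = ∫ y, φ (x, y) ∂(P.map Y) := fun x =>
    (integral_map (f := fun y => φ (x, y)) hY.aemeasurable
      (hφ.comp measurable_prodMk_left).aestronglyMeasurable).symm
  have hm : StronglyMeasurable fun x => ∫ y, φ (x, y) ∂(P.map Y) :=
    hφ.stronglyMeasurable.integral_prod_right'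
  have hint2 := hint.integral_prod_left
  simp only [e1]
  refine ⟨?_, hint2.comp_measurable hX, ?_⟩
  · rw [← hlaw] at hint
    exact hint.comp_measurable (hX.prodMk hY)
  · rw [← integral_map (f := φ) (φ := fun ω => (X ω, Y ω)) (hX.prodMk hY).aemeasurable
      hφ.aestronglyMeasurable, hlaw, integral_prod _ hint,
      integral_map hX.aemeasurable hm.aestronglyMeasurable]

section

variable {d : ℕ} {Θ Θ' : Type*} [MeasurableSpace Θ] [MeasurableSpace Θ'] {η R : ℝ} {I : ℕ}
    {G : EuclideanSpace ℝ (Fin d) → Θ → EuclideanSpace ℝ (Fin d)}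
    {C : EuclideanSpace ℝ (Fin d) → Θ' → EuclideanSpace ℝ (Fin d)}

theorem measurableSet_resetDue (R : ℝ) (I t : ℕ) : MeasurableSet
    {c : (EuclideanSpace ℝ (Fin d) × EuclideanSpace ℝ (Fin d)) ×
      (ℕ × EuclideanSpace ℝ (Fin d)) | ResetDue R I t c} := by
  have h1 : Measurable fun c : (EuclideanSpace ℝ (Fin d) × EuclideanSpace ℝ (Fin d)) ×
      (ℕ × EuclideanSpace ℝ (Fin d)) => c.2.1 := by fun_prop
  have h2 : Measurable fun c : (EuclideanSpace ℝ (Fin d) × EuclideanSpace ℝ (Fin d)) ×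
      (ℕ × EuclideanSpace ℝ (Fin d)) => ‖c.2.2 - c.1.1‖ := by fun_prop
  exact (h1 (MeasurableSet.of_discrete (s := {n | n + I < t}))).union
    (measurableSet_lt measurable_const h2)

theorem measurable_resetTuple (R : ℝ) (I t : ℕ) :
    Measurable (resetTuple (d := d) R I t) :=
  Measurable.ite (measurableSet_resetDue R I t) (by fun_prop) measurable_id

theorem measurable_tupleStep
    (hG : Measurable (fun p : EuclideanSpace ℝ (Fin d) × Θ => G p.1 p.2))
    (hC : Measurable (fun p : EuclideanSpace ℝ (Fin d) × Θ' => C p.1 p.2)) (η R : ℝ) (I t : ℕ) :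
    Measurable (fun q : ((EuclideanSpace ℝ (Fin d) × EuclideanSpace ℝ (Fin d)) ×
      (ℕ × EuclideanSpace ℝ (Fin d))) × (EuclideanSpace ℝ (Fin d) × Θ × Θ') =>
      tupleStep η R I G C t q.1 q.2) := by
  have hf : Measurable fun q : ((EuclideanSpace ℝ (Fin d) × EuclideanSpace ℝ (Fin d)) ×
      (ℕ × EuclideanSpace ℝ (Fin d))) × (EuclideanSpace ℝ (Fin d) × Θ × Θ') => q.1 :=
    measurable_fst
  have h1 := (measurable_resetTuple (d := d) R I t).comp hf
  exact ((measurable_pairStep hG hC η).comp (h1.fst.prodMk measurable_snd)).prodMk h1.snd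

end

namespace SGDSetting

variable {d : ℕ} {Ω Θ Θ' : Type*} [MeasurableSpace Ω] [MeasurableSpace Θ]
    [MeasurableSpace Θ'] {P : Measure Ω} {D : Measure Θ} {D' : Measure Θ'}
    [IsProbabilityMeasure P] [IsProbabilityMeasure D] [IsProbabilityMeasure D']
    {f : EuclideanSpace ℝ (Fin d) → ℝ}
    {G : EuclideanSpace ℝ (Fin d) → Θ → EuclideanSpace ℝ (Fin d)}
    {C : EuclideanSpace ℝ (Fin d) → Θ' → EuclideanSpace ℝ (Fin d)}
    {z : ℕ → Ω → EuclideanSpace ℝ (Fin d) × Θ × Θ'} {fmax L ρ σ μ η r χ : ℝ}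
    (hS : SGDSetting P D D' f G C z fmax L ρ σ μ η r χ)
include hS

/-- Restarting at deterministic times is enough: a sum over all t with the indicator that an epoch
starts at t replaces any use of stopping times. -/
theorem shift (t : ℕ) : SGDSetting P D D' f G C (fun k => z (t + k)) fmax L ρ σ μ η r χ :=
  { hS with samples := hS.samples.shift t }

theorem measurable_tuple (R : ℝ) (I : ℕ) (x₀ : EuclideanSpace ℝ (Fin d)) (t : ℕ) :
    Measurable fun ω => tuple η R I G C x₀ (fun t => z t ω) t :=
  hS.samples.measurable_chain
    (measurable_tupleStep hS.oracle.measurable hS.compressor.measurable η R I) _ t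

theorem indepFun_tuple (R : ℝ) (I : ℕ) (x₀ : EuclideanSpace ℝ (Fin d)) (t : ℕ) :
    IndepFun (fun ω => tuple η R I G C x₀ (fun t => z t ω) t)
      (fun ω (k : ℕ) => z (t + k) ω) P :=
  hS.samples.indepFun_chain_future
    (measurable_tupleStep hS.oracle.measurable hS.compressor.measurable η R I) _ t

theorem measurableSet_badEnd (R κ ε : ℝ) : MeasurableSet
    {q : EuclideanSpace ℝ (Fin d) × EuclideanSpace ℝ (Fin d) | BadEnd f R κ ε q.1 q.2} := by
  have h1 : MeasurableSet {q : EuclideanSpace ℝ (Fin d) × EuclideanSpace ℝ (Fin d) |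
      R < ‖q.2 - q.1‖} := measurableSet_lt measurable_const (by fun_prop)
  have h2 : MeasurableSet {q : EuclideanSpace ℝ (Fin d) × EuclideanSpace ℝ (Fin d) |
      ε < ‖gradient f q.2‖} := measurableSet_lt measurable_const
    (hS.objective.measurable_gradient.comp measurable_snd).norm
  have hs : Measurable fun q : EuclideanSpace ℝ (Fin d) × EuclideanSpace ℝ (Fin d) => q.2 :=
    measurable_snd
  have h3 := hs (hS.objective.measurableSet_negCurvature hS.ρ_pos κ)
  exact h1.union (h2.inter h3.compl)

theorem measurableSet_isStart (R : ℝ) (I : ℕ) (x₀ : EuclideanSpace ℝ (Fin d)) (t : ℕ) :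
    MeasurableSet {ω | IsStart η R I G C x₀ (fun t => z t ω) t} := by
  have h1 := hS.measurable_tuple R I x₀ t (measurableSet_resetDue R I t)
  exact (MeasurableSet.const (t = 0)).union h1

open Classical in
/-- Expectations over an epoch started at iteration `t` are computed by conditioning on the
past. -/
theorem integral_isStart (R : ℝ) (I : ℕ) (x₀ : EuclideanSpace ℝ (Fin d)) (t : ℕ)
    {Ψ : EuclideanSpace ℝ (Fin d) × (ℕ → EuclideanSpace ℝ (Fin d) × Θ × Θ') → ℝ}
    (hΨ : Measurable Ψ) {B : ℝ} (hB : ∀ q, |Ψ q| ≤ B) :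
    Integrable (fun ω => if IsStart η R I G C x₀ (fun t => z t ω) t then
        Ψ ((tuple η R I G C x₀ (fun t => z t ω) t).1.1, fun k => z (t + k) ω) else 0) P ∧
    Integrable (fun ω => if IsStart η R I G C x₀ (fun t => z t ω) t then
        ∫ ω', Ψ ((tuple η R I G C x₀ (fun t => z t ω) t).1.1, fun k => z (t + k) ω') ∂P else 0) P ∧
    ∫ ω, (if IsStart η R I G C x₀ (fun t => z t ω) t then
        Ψ ((tuple η R I G C x₀ (fun t => z t ω) t).1.1, fun k => z (t + k) ω) else 0) ∂P =
    ∫ ω, (if IsStart η R I G C x₀ (fun t => z t ω) t then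
        ∫ ω', Ψ ((tuple η R I G C x₀ (fun t => z t ω) t).1.1, fun k => z (t + k) ω') ∂P
          else 0) ∂P := by
  have hset : MeasurableSet {q : ((EuclideanSpace ℝ (Fin d) × EuclideanSpace ℝ (Fin d)) ×
      (ℕ × EuclideanSpace ℝ (Fin d))) × (ℕ → EuclideanSpace ℝ (Fin d) × Θ × Θ') |
      t = 0 ∨ ResetDue R I t q.1} :=
    (MeasurableSet.const (t = 0)).union (measurable_fst (measurableSet_resetDue R I t))
  have hm : Measurable fun q : ((EuclideanSpace ℝ (Fin d) × EuclideanSpace ℝ (Fin d)) ×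
      (ℕ × EuclideanSpace ℝ (Fin d))) × (ℕ → EuclideanSpace ℝ (Fin d) × Θ × Θ') =>
      Ψ (q.1.1.1, q.2) :=
    hΨ.comp (by fun_prop)
  have hB0 : 0 ≤ B := (abs_nonneg _).trans (hB (0, fun _ => z 0 (Classical.choice
    (nonempty_of_isProbabilityMeasure P))))
  have h := integral_indepFun_of_bounded (hS.measurable_tuple R I x₀ t)
    (measurable_pi_lambda _ fun k => hS.samples.measurable (t + k))
    (hS.indepFun_tuple R I x₀ t)
    (φ := fun q => if t = 0 ∨ ResetDue R I t q.1 then Ψ (q.1.1.1, q.2) else 0)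
    (Measurable.ite hset hm measurable_const) (B := B)
    (fun q => by split_ifs; exacts [hB _, by simpa using hB0])
  have e : ∀ ω, (∫ ω', (if t = 0 ∨ ResetDue R I t (tuple η R I G C x₀ (fun t => z t ω) t) then
        Ψ ((tuple η R I G C x₀ (fun t => z t ω) t).1.1, fun k => z (t + k) ω') else 0) ∂P) =
      if t = 0 ∨ ResetDue R I t (tuple η R I G C x₀ (fun t => z t ω) t) then
        ∫ ω', Ψ ((tuple η R I G C x₀ (fun t => z t ω) t).1.1, fun k => z (t + k) ω') ∂P else 0 := by
    intro ω; split_ifs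
    · rfl
    · simp
  simp only [e] at h
  convert h <;> exact Iff.rfl

theorem abs_gradTerm_le (R : ℝ) (y₀ : EuclideanSpace ℝ (Fin d)) (s) :
    |gradTerm f η R y₀ s| ≤ 4 * L * fmax := by
  rw [abs_of_nonneg (gradTerm_nonneg R y₀ s f η)]
  exact (mul_le_of_le_one_left (by positivity) (near_le_one R y₀ s)).trans
    (hS.objective.norm_gradient_sq_le hS.L_pos _)

open Classical in
/-- The squared gradients of the epoch that starts at iteration `t`, or `0` if none does. -/
noncomputable def _root_.startCost (f : EuclideanSpace ℝ (Fin d) → ℝ) (η R : ℝ) (I : ℕ)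
    (G : EuclideanSpace ℝ (Fin d) → Θ → EuclideanSpace ℝ (Fin d))
    (C : EuclideanSpace ℝ (Fin d) → Θ' → EuclideanSpace ℝ (Fin d))
    (x₀ : EuclideanSpace ℝ (Fin d)) (z : ℕ → EuclideanSpace ℝ (Fin d) × Θ × Θ') (t : ℕ) : ℝ :=
  if IsStart η R I G C x₀ z t then
    ∑ k ∈ Finset.range (I + 1), gradTerm f η R (tuple η R I G C x₀ z t).1.1
      (epochFrom η R I G C x₀ z t k) else 0

theorem integral_ite_one {E : Set Ω} [DecidablePred (· ∈ E)] (hE : MeasurableSet E) :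
    Integrable (fun ω => if ω ∈ E then (1 : ℝ) else 0) P ∧
    ∫ ω, (if ω ∈ E then (1 : ℝ) else 0) ∂P = P.real E := by
  have e : (fun ω => if ω ∈ E then (1 : ℝ) else 0) = E.indicator 1 := by
    funext ω
    rw [Set.indicator_apply]
    rfl
  rw [e]
  exact ⟨(integrable_const (1 : ℝ)).indicator hE, integral_indicator_one hE⟩

theorem measurable_gradTerm_comp {α : Type*} [MeasurableSpace α] (R : ℝ)
    {u : α → EuclideanSpace ℝ (Fin d)}
    {v : α → EuclideanSpace ℝ (Fin d) × EuclideanSpace ℝ (Fin d)} (hu : Measurable u)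
    (hv : Measurable v) : Measurable fun q => gradTerm f η R (u q) (v q) := by
  have h := hu.prodMk hv
  have h3 := measurable_gradTerm R hS.objective.measurable_gradient η
  have h4 := h3.comp h
  simp only [Function.comp_def] at h4
  exact h4

theorem measurable_sum_gradTerm (R : ℝ) (n : ℕ) :
    Measurable fun q : EuclideanSpace ℝ (Fin d) ×
      (ℕ → EuclideanSpace ℝ (Fin d) × Θ × Θ') => ∑ k ∈ Finset.range n,
        gradTerm f η R q.1 (epoch η R G C q.1 q.2 k) := by
  refine Finset.measurable_sum _ fun k _ => ?_
  exact hS.measurable_gradTerm_comp R measurable_fst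
    (measurable_epoch hS.oracle.measurable hS.compressor.measurable η R k)

open Classical in
theorem integral_startCost (R : ℝ) (I : ℕ) (x₀ : EuclideanSpace ℝ (Fin d)) (t : ℕ) :
    Integrable (fun ω => startCost f η R I G C x₀ (fun t => z t ω) t) P ∧
    Integrable (fun ω => if IsStart η R I G C x₀ (fun t => z t ω) t then
      ∑ k ∈ Finset.range (I + 1), epochGrad P f G C (fun k => z (t + k)) η R
        (tuple η R I G C x₀ (fun t => z t ω) t).1.1 k else 0) P ∧
    ∫ ω, startCost f η R I G C x₀ (fun t => z t ω) t ∂P =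
    ∫ ω, (if IsStart η R I G C x₀ (fun t => z t ω) t then
      ∑ k ∈ Finset.range (I + 1), epochGrad P f G C (fun k => z (t + k)) η R
        (tuple η R I G C x₀ (fun t => z t ω) t).1.1 k else 0) ∂P := by
  have hb1 : ∀ q : EuclideanSpace ℝ (Fin d) × (ℕ → EuclideanSpace ℝ (Fin d) × Θ × Θ'),
      |∑ k ∈ Finset.range (I + 1), gradTerm f η R q.1 (epoch η R G C q.1 q.2 k)| ≤
        ∑ _k ∈ Finset.range (I + 1), 4 * L * fmax := fun q =>
    (Finset.abs_sum_le_sum_abs _ _).trans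
      (Finset.sum_le_sum fun k _ => hS.abs_gradTerm_le R _ _)
  have h1 := hS.integral_isStart R I x₀ t (hS.measurable_sum_gradTerm R (I + 1)) hb1
  have e1 : ∀ y, ∫ ω', ∑ k ∈ Finset.range (I + 1),
      gradTerm f η R y (epoch η R G C y (fun k => z (t + k) ω') k) ∂P =
      ∑ k ∈ Finset.range (I + 1), epochGrad P f G C (fun k => z (t + k)) η R y k := by
    intro y
    rw [integral_finsetSum _ fun k _ => (hS.shift t).integrable_gradTerm R y k]
    rfl
  simp only [e1] at h1
  exact h1

theorem measurableSet_start_badEnd (R κ ε : ℝ) (I : ℕ) (x₀ : EuclideanSpace ℝ (Fin d)) (t : ℕ) :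
    MeasurableSet {ω | IsStart η R I G C x₀ (fun t => z t ω) t ∧
      BadEnd f R κ ε (tuple η R I G C x₀ (fun t => z t ω) t).1.1
        (epochFrom η R I G C x₀ (fun t => z t ω) t (I + 1)).1} := by
  have h1 := (hS.measurable_tuple R I x₀ t).fst.fst.prodMk
      (measurable_pi_lambda _ fun k => hS.samples.measurable (t + k))
  have hep := measurable_epoch hS.oracle.measurable hS.compressor.measurable η R (I + 1)
  have h2 := hep.comp h1
  simp only [Function.comp_def] at h2
  have h3 := (hS.measurable_tuple R I x₀ t).fst.fst.prodMk h2.fst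
  exact (hS.measurableSet_isStart R I x₀ t).inter (h3 (hS.measurableSet_badEnd R κ ε))

theorem measurableSet_start_negCurvature (R κ : ℝ) (I : ℕ) (x₀ : EuclideanSpace ℝ (Fin d))
    (t : ℕ) : MeasurableSet {ω | IsStart η R I G C x₀ (fun t => z t ω) t ∧
      NegCurvature f κ (tuple η R I G C x₀ (fun t => z t ω) t).1.1} :=
  (hS.measurableSet_isStart R I x₀ t).inter ((hS.measurable_tuple R I x₀ t).fst.fst
      (hS.objective.measurableSet_negCurvature hS.ρ_pos κ))

open Classical in
theorem integral_start_badEnd (R κ ε : ℝ) (I : ℕ) (x₀ : EuclideanSpace ℝ (Fin d)) (t : ℕ) :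
    Integrable (fun ω => if IsStart η R I G C x₀ (fun t => z t ω) t then
      P.real {ω' | BadEnd f R κ ε (tuple η R I G C x₀ (fun t => z t ω) t).1.1
        (epoch η R G C (tuple η R I G C x₀ (fun t => z t ω) t).1.1
          (fun k => z (t + k) ω') (I + 1)).1} else 0) P ∧
    P.real {ω | IsStart η R I G C x₀ (fun t => z t ω) t ∧
      BadEnd f R κ ε (tuple η R I G C x₀ (fun t => z t ω) t).1.1
        (epochFrom η R I G C x₀ (fun t => z t ω) t (I + 1)).1} =
    ∫ ω, (if IsStart η R I G C x₀ (fun t => z t ω) t then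
      P.real {ω' | BadEnd f R κ ε (tuple η R I G C x₀ (fun t => z t ω) t).1.1
        (epoch η R G C (tuple η R I G C x₀ (fun t => z t ω) t).1.1
          (fun k => z (t + k) ω') (I + 1)).1} else 0) ∂P := by
  have hep : Measurable fun q : EuclideanSpace ℝ (Fin d) ×
      (ℕ → EuclideanSpace ℝ (Fin d) × Θ × Θ') => epoch η R G C q.1 q.2 (I + 1) :=
    measurable_epoch hS.oracle.measurable hS.compressor.measurable η R (I + 1)
  have hset : MeasurableSet {q : EuclideanSpace ℝ (Fin d) ×
      (ℕ → EuclideanSpace ℝ (Fin d) × Θ × Θ') |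
        BadEnd f R κ ε q.1 (epoch η R G C q.1 q.2 (I + 1)).1} :=
    (measurable_fst.prodMk hep.fst) (hS.measurableSet_badEnd R κ ε)
  have hm2 : Measurable fun q : EuclideanSpace ℝ (Fin d) ×
      (ℕ → EuclideanSpace ℝ (Fin d) × Θ × Θ') =>
        if BadEnd f R κ ε q.1 (epoch η R G C q.1 q.2 (I + 1)).1 then (1 : ℝ) else 0 :=
    Measurable.ite hset measurable_const measurable_const
  have h2 := hS.integral_isStart R I x₀ t hm2 (B := 1) (fun q => by split_ifs <;> simp)
  have e2 : ∀ y, ∫ ω', (if BadEnd f R κ ε y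
      (epoch η R G C y (fun k => z (t + k) ω') (I + 1)).1 then (1 : ℝ) else 0) ∂P =
      P.real {ω | BadEnd f R κ ε y (epoch η R G C y (fun k => z (t + k) ω) (I + 1)).1} := by
    intro y
    have hy : MeasurableSet {ω | BadEnd f R κ ε y
        (epoch η R G C y (fun k => z (t + k) ω) (I + 1)).1} :=
      (measurable_const.prodMk ((hS.shift t).measurable_epoch_omega R y (I + 1)).fst)
        (hS.measurableSet_badEnd R κ ε)
    exact (hS.integral_ite_one hy).2
  simp only [e2] at h2
  refine ⟨h2.2.1, ?_⟩
  rw [← h2.2.2, ← (hS.integral_ite_one (hS.measurableSet_start_badEnd R κ ε I x₀ t)).2]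
  refine integral_congr_ae (.of_forall fun ω => ?_)
  simp only [Set.mem_ofPred_eq, ite_and]
  rfl

/-- Negative curvature at the start of an epoch is paid for by squared gradients. -/
theorem start_negCurvature_cost {R κ s : ℝ} {I : ℕ}
    (hneg : ∀ t y, NegCurvature f κ y → s ≤ ∑ k ∈ Finset.range (I + 1),
      epochGrad P f G C (fun k => z (t + k)) η R y k)
    (x₀ : EuclideanSpace ℝ (Fin d)) (t : ℕ) :
    s * P.real {ω | IsStart η R I G C x₀ (fun t => z t ω) t ∧
      NegCurvature f κ (tuple η R I G C x₀ (fun t => z t ω) t).1.1} ≤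
      ∫ ω, startCost f η R I G C x₀ (fun t => z t ω) t ∂P := by
  classical
  have h1 := hS.integral_startCost R I x₀ t
  have h2 := hS.integral_ite_one (hS.measurableSet_start_negCurvature R κ I x₀ t)
  rw [h1.2.2, ← h2.2, ← integral_const_mul]
  refine integral_mono (h2.1.const_mul s) h1.2.1 fun ω => ?_
  simp only [Set.mem_ofPred_eq]
  by_cases hs : IsStart η R I G C x₀ (fun t => z t ω) t
  · rw [if_pos hs]
    by_cases hn : NegCurvature f κ (tuple η R I G C x₀ (fun t => z t ω) t).1.1
    · rw [if_pos ⟨hs, hn⟩, mul_one]; exact hneg t _ hn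
    · rw [if_neg (fun h => hn h.2), mul_zero]
      exact Finset.sum_nonneg fun k _ => epochGrad_nonneg _ _ _
  · rw [if_neg hs, if_neg (fun h => hs h.1), mul_zero]

/-- A bad end of an epoch is paid for by squared gradients, up to a small probability. -/
theorem start_badEnd_cost {R κ ε c τ : ℝ} {I : ℕ}
    (hbad : ∀ t y, P.real {ω | BadEnd f R κ ε y
      (epoch η R G C y (fun k => z (t + k) ω) (I + 1)).1} ≤
        c * ∑ k ∈ Finset.range (I + 1), epochGrad P f G C (fun k => z (t + k)) η R y k + τ)
    (x₀ : EuclideanSpace ℝ (Fin d)) (t : ℕ) :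
    P.real {ω | IsStart η R I G C x₀ (fun t => z t ω) t ∧
      BadEnd f R κ ε (tuple η R I G C x₀ (fun t => z t ω) t).1.1
        (epochFrom η R I G C x₀ (fun t => z t ω) t (I + 1)).1} ≤
      c * ∫ ω, startCost f η R I G C x₀ (fun t => z t ω) t ∂P +
      τ * P.real {ω | IsStart η R I G C x₀ (fun t => z t ω) t} := by
  classical
  have h1 := hS.integral_startCost R I x₀ t
  have h2 := hS.integral_start_badEnd R κ ε I x₀ t
  have h3 := hS.integral_ite_one (hS.measurableSet_isStart R I x₀ t)
  rw [h1.2.2, h2.2, ← h3.2, ← integral_const_mul, ← integral_const_mul,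
    ← integral_add (h1.2.1.const_mul c) (h3.1.const_mul τ)]
  refine integral_mono h2.1 ((h1.2.1.const_mul c).add (h3.1.const_mul τ)) fun ω => ?_
  simp only [Set.mem_ofPred_eq]
  by_cases hs : IsStart η R I G C x₀ (fun t => z t ω) t
  · simp only [if_pos hs, mul_one]; exact hbad t _
  · simp only [if_neg hs, mul_zero, add_zero, le_refl]

end SGDSetting

/-! ### Descent along the whole run -/

/-- The weight L²η³/μ is chosen so that the contraction μ/2 of the error exactly absorbs L²η³E/2,
the loss from evaluating the gradient at x instead of y. The two gradient errors cost η/8 each,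
leaving η/4 of the gain η/2. -/
theorem descent_bound {F p g E χ L η μ : ℝ} (hL : 0 < L) (hη : 0 < η) (hμ : 0 < μ)
    (hμ1 : μ ≤ 1) (hχ : 0 ≤ χ) (hηL : 8 * (η * L) ≤ 1)
    (hημ : 24 * (L ^ 2 * η ^ 2) * (1 - μ) ≤ μ ^ 2)
    (hp : g ^ 2 / 2 - L ^ 2 * η ^ 2 * E / 2 ≤ p) :
    F - η * p + L * η ^ 2 * (g ^ 2 + χ) + L ^ 2 * η ^ 3 / μ *
        ((1 - μ / 2) * E + ((1 - μ) * (3 / μ) * g ^ 2 + (1 - μ) * χ)) ≤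
      F + L ^ 2 * η ^ 3 / μ * E - η / 4 * g ^ 2 + 2 * L * η ^ 2 * χ := by
  have h1 := mul_le_mul_of_nonneg_left hp hη.le
  have h2 : L ^ 2 * η ^ 3 / μ * ((1 - μ / 2) * E) =
      L ^ 2 * η ^ 3 / μ * E - η * (L ^ 2 * η ^ 2 * E / 2) := by field_simp
  have h3 : L ^ 2 * η ^ 3 / μ * ((1 - μ) * (3 / μ) * g ^ 2) ≤ η / 8 * g ^ 2 := by
    have e : L ^ 2 * η ^ 3 / μ * ((1 - μ) * (3 / μ) * g ^ 2) =
        (24 * (L ^ 2 * η ^ 2) * (1 - μ)) / μ ^ 2 * (η / 8 * g ^ 2) := by field_simp; ring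
    rw [e]
    exact mul_le_of_le_one_left (by positivity) ((div_le_one (by positivity)).2 hημ)
  have h4 : L ^ 2 * η ^ 3 / μ * ((1 - μ) * χ) ≤ L * η ^ 2 * χ := by
    have h5 : L * η * (1 - μ) ≤ μ := by
      have h0 : 0 ≤ L * η * (1 - μ) := mul_nonneg (by positivity) (by linarith)
      have h6 : (L * η * (1 - μ)) ^ 2 ≤ μ ^ 2 := by
        have : (L * η * (1 - μ)) ^ 2 = L ^ 2 * η ^ 2 * (1 - μ) * (1 - μ) := by ring
        rw [this]
        have h7 : 0 ≤ L ^ 2 * η ^ 2 * (1 - μ) := mul_nonneg (by positivity) (by linarith)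
        have := mul_le_of_le_one_right h7 (by linarith : 1 - μ ≤ 1)
        linarith
      exact (pow_le_pow_iff_left₀ h0 hμ.le two_ne_zero).1 h6
    have e : L ^ 2 * η ^ 3 / μ * ((1 - μ) * χ) = (L * η * (1 - μ)) / μ * (L * η ^ 2 * χ) := by
      field_simp
    rw [e]
    exact mul_le_of_le_one_left (by positivity) ((div_le_one hμ).2 h5)
  have h8 : L * η ^ 2 * g ^ 2 ≤ η / 8 * g ^ 2 := by
    have : L * η ^ 2 * g ^ 2 = (8 * (η * L)) * (η / 8 * g ^ 2) := by ring
    rw [this]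
    exact mul_le_of_le_one_left (by positivity) hηL
  linarith

namespace SGDSetting

variable {d : ℕ} {Ω Θ Θ' : Type*} [MeasurableSpace Ω] [MeasurableSpace Θ]
    [MeasurableSpace Θ'] {P : Measure Ω} {D : Measure Θ} {D' : Measure Θ'}
    [IsProbabilityMeasure P] [IsProbabilityMeasure D] [IsProbabilityMeasure D']
    {f : EuclideanSpace ℝ (Fin d) → ℝ}
    {G : EuclideanSpace ℝ (Fin d) → Θ → EuclideanSpace ℝ (Fin d)}
    {C : EuclideanSpace ℝ (Fin d) → Θ' → EuclideanSpace ℝ (Fin d)}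
    {z : ℕ → Ω → EuclideanSpace ℝ (Fin d) × Θ × Θ'} {fmax L ρ σ μ η r χ : ℝ}
    (hS : SGDSetting P D D' f G C z fmax L ρ σ μ η r χ)
include hS

/-- The objective at `y`, measured from a lower bound, plus the weighted compression error. -/
noncomputable def _root_.lyapunov (f : EuclideanSpace ℝ (Fin d) → ℝ) (m c : ℝ)
    (s : EuclideanSpace ℝ (Fin d) × EuclideanSpace ℝ (Fin d)) : ℝ :=
  f s.1 - m + c * ‖s.2‖ ^ 2

theorem lintegral_objective_le {m : ℝ} (hm : ∀ x, m ≤ f x) (y x : EuclideanSpace ℝ (Fin d)) :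
    0 ≤ f y - m - η * inner ℝ (gradient f y) (gradient f x) +
      L * η ^ 2 * (‖gradient f x‖ ^ 2 + χ) ∧
    ∫⁻ b : EuclideanSpace ℝ (Fin d) × Θ × Θ', ENNReal.ofReal
      (f (y - η • (gradient f x + ((G x b.2.1 - gradient f x) + b.1))) - m)
        ∂(sampleLaw d r D D') ≤
      ENNReal.ofReal (f y - m - η * inner ℝ (gradient f y) (gradient f x) +
        L * η ^ 2 * (‖gradient f x‖ ^ 2 + χ)) := by
  have hη := hS.η_pos
  have hL := hS.L_pos
  have hν := hS.isCentered_noise x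
  set ν : EuclideanSpace ℝ (Fin d) × Θ × Θ' → EuclideanSpace ℝ (Fin d) :=
    fun b => (G x b.2.1 - gradient f x) + b.1
  have hpt : ∀ b, f (y - η • (gradient f x + ν b)) - m ≤
      (f y - m - η * inner ℝ (gradient f y) (gradient f x)) +
        ((-η) * inner ℝ (gradient f y) (ν b) + L * η ^ 2 * ‖gradient f x + ν b‖ ^ 2) := by
    intro b
    have h := (abs_le.1 (hS.objective.abs_sub_sub_inner_le hL y
      (y - η • (gradient f x + ν b)))).2
    rw [sub_sub_cancel_left, inner_neg_right, inner_smul_right, inner_add_right, norm_neg,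
      norm_smul, Real.norm_of_nonneg hη.le, mul_pow] at h
    linarith
  have hi1 : Integrable (fun b => (-η) * inner ℝ (gradient f y) (ν b)) (sampleLaw d r D D') :=
    (hν.integrable.const_inner (gradient f y)).const_mul _
  have hi2 : Integrable (fun b => L * η ^ 2 * ‖gradient f x + ν b‖ ^ 2) (sampleLaw d r D D') :=
    (hν.integrable_sq_add (gradient f x)).const_mul _
  have hi3 : Integrable (fun b => (-η) * inner ℝ (gradient f y) (ν b) +
      L * η ^ 2 * ‖gradient f x + ν b‖ ^ 2) (sampleLaw d r D D') := hi1.add hi2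
  have hi4 := (integrable_const (μ := sampleLaw d r D D')
    (f y - m - η * inner ℝ (gradient f y) (gradient f x))).add hi3
  have hval : ∫ b, (f y - m - η * inner ℝ (gradient f y) (gradient f x)) +
        ((-η) * inner ℝ (gradient f y) (ν b) + L * η ^ 2 * ‖gradient f x + ν b‖ ^ 2)
          ∂(sampleLaw d r D D') ≤
      f y - m - η * inner ℝ (gradient f y) (gradient f x) +
        L * η ^ 2 * (‖gradient f x‖ ^ 2 + χ) := by
    rw [integral_add (integrable_const _) hi3, integral_add hi1 hi2, integral_const_mul,
      integral_const_mul, integral_inner hν.integrable, hν.integral_eq, inner_zero_right]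
    simp only [integral_const, probReal_univ, one_smul, mul_zero, zero_add]
    have := mul_le_mul_of_nonneg_left (hν.integral_sq_add_le (gradient f x))
      (by positivity : 0 ≤ L * η ^ 2)
    linarith
  have hnn : ∀ b, 0 ≤ (f y - m - η * inner ℝ (gradient f y) (gradient f x)) +
        ((-η) * inner ℝ (gradient f y) (ν b) + L * η ^ 2 * ‖gradient f x + ν b‖ ^ 2) :=
    fun b => (sub_nonneg.2 (hm _)).trans (hpt b)
  refine ⟨(integral_nonneg hnn).trans hval, ?_⟩
  calc _ ≤ ∫⁻ b, ENNReal.ofReal ((f y - m - η * inner ℝ (gradient f y) (gradient f x)) +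
        ((-η) * inner ℝ (gradient f y) (ν b) + L * η ^ 2 * ‖gradient f x + ν b‖ ^ 2))
          ∂(sampleLaw d r D D') := lintegral_mono fun b => ENNReal.ofReal_le_ofReal (hpt b)
    _ = ENNReal.ofReal (∫ b, (f y - m - η * inner ℝ (gradient f y) (gradient f x)) +
        ((-η) * inner ℝ (gradient f y) (ν b) + L * η ^ 2 * ‖gradient f x + ν b‖ ^ 2)
          ∂(sampleLaw d r D D')) :=
        (ofReal_integral_eq_lintegral_ofReal hi4 (.of_forall hnn)).symm
    _ ≤ _ := ENNReal.ofReal_le_ofReal hval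

theorem lintegral_lyapunov_le (hηL : 8 * (η * L) ≤ 1)
    (hημ : 24 * (L ^ 2 * η ^ 2) * (1 - μ) ≤ μ ^ 2) {m : ℝ} (hm : ∀ x, m ≤ f x)
    (s : EuclideanSpace ℝ (Fin d) × EuclideanSpace ℝ (Fin d)) :
    0 ≤ lyapunov f m (L ^ 2 * η ^ 3 / μ) s - η / 4 * ‖gradient f (s.1 + η • s.2)‖ ^ 2 +
      2 * L * η ^ 2 * χ ∧
    ∫⁻ b, ENNReal.ofReal (lyapunov f m (L ^ 2 * η ^ 3 / μ) (pairStep η G C s b))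
        ∂(sampleLaw d r D D') ≤
      ENNReal.ofReal (lyapunov f m (L ^ 2 * η ^ 3 / μ) s -
        η / 4 * ‖gradient f (s.1 + η • s.2)‖ ^ 2 + 2 * L * η ^ 2 * χ) := by
  have hη := hS.η_pos
  have hL := hS.L_pos
  have hμ := hS.μ_pos
  have hμ1 := hS.μ_le
  have hχ := hS.χ_nonneg
  set x := s.1 + η • s.2 with hx
  set c := L ^ 2 * η ^ 3 / μ with hc
  have hc0 : 0 ≤ c := by positivity
  have hobj := hS.lintegral_objective_le hm s.1 x
  have herr := hS.compressor.lintegral_error_le hμ1 (r := r) hS.oracle hS.dim_pos x s.2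
  have hcy := compress_young hμ hμ1 s.2 (gradient f x) χ
  have hnoise := mul_le_mul_of_nonneg_left hS.noise_le (by linarith : 0 ≤ 1 - μ)
  have hp : ‖gradient f x‖ ^ 2 / 2 - L ^ 2 * η ^ 2 * ‖s.2‖ ^ 2 / 2 ≤
      inner ℝ (gradient f s.1) (gradient f x) := by
    have h1 := norm_sub_sq_real (gradient f s.1) (gradient f x)
    have h2 := hS.objective.smooth s.1 x
    rw [hx, sub_add_cancel_left, norm_neg, norm_smul, Real.norm_of_nonneg hη.le, ← hx] at h2
    have h3 := pow_le_pow_left₀ (norm_nonneg _) h2 2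
    have h4 : (L * (η * ‖s.2‖)) ^ 2 = L ^ 2 * η ^ 2 * ‖s.2‖ ^ 2 := by ring
    have h5 := sq_nonneg ‖gradient f s.1‖
    linarith
  have hb := descent_bound (F := f s.1 - m) (E := ‖s.2‖ ^ 2) hL hη hμ hμ1 hχ hηL hημ hp
  rw [← hc] at hb
  set a := f s.1 - m - η * inner ℝ (gradient f s.1) (gradient f x) +
    L * η ^ 2 * (‖gradient f x‖ ^ 2 + χ)
  set b' := (1 - μ / 2) * ‖s.2‖ ^ 2 + ((1 - μ) * (3 / μ) * ‖gradient f x‖ ^ 2 + (1 - μ) * χ)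
  have hb0 : 0 ≤ b' := (mul_nonneg (by linarith) (by positivity)).trans hcy
  have hfin : a + c * b' ≤ lyapunov f m c s - η / 4 * ‖gradient f x‖ ^ 2 + 2 * L * η ^ 2 * χ :=
    hb
  refine ⟨(add_nonneg hobj.1 (mul_nonneg hc0 hb0)).trans hfin, ?_⟩
  have hmeas : Measurable fun b : EuclideanSpace ℝ (Fin d) × Θ × Θ' =>
      ENNReal.ofReal (f (s.1 - η • (gradient f x + ((G x b.2.1 - gradient f x) + b.1))) - m) := by
    have h1 : Measurable fun b : EuclideanSpace ℝ (Fin d) × Θ × Θ' => G x b.2.1 :=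
      hS.oracle.measurable.comp (measurable_const.prodMk (by fun_prop))
    have h2 := hS.objective.measurable
    exact ((h2.comp (measurable_const.sub ((measurable_const.add
      ((h1.sub measurable_const).add measurable_fst)).const_smul η))).sub
        measurable_const).ennreal_ofReal
  have hsplit : ∀ b, ENNReal.ofReal (lyapunov f m c (pairStep η G C s b)) =
      ENNReal.ofReal (f (s.1 - η • (gradient f x + ((G x b.2.1 - gradient f x) + b.1))) - m) +
      ENNReal.ofReal c *
        ENNReal.ofReal (‖s.2 + G x b.2.1 + b.1 - C (s.2 + G x b.2.1 + b.1) b.2.2‖ ^ 2) := by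
    intro b
    rw [← ENNReal.ofReal_mul hc0, ← ENNReal.ofReal_add (sub_nonneg.2 (hm _)) (by positivity)]
    have e : gradient f x + ((G x b.2.1 - gradient f x) + b.1) = G x b.2.1 + b.1 := by abel
    rw [e]
    rfl
  calc _ = ∫⁻ b, ENNReal.ofReal
        (f (s.1 - η • (gradient f x + ((G x b.2.1 - gradient f x) + b.1))) - m)
          ∂(sampleLaw d r D D') + ENNReal.ofReal c * ∫⁻ b, ENNReal.ofReal
        (‖s.2 + G x b.2.1 + b.1 - C (s.2 + G x b.2.1 + b.1) b.2.2‖ ^ 2)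
          ∂(sampleLaw d r D D') := by
        simp only [hsplit]
        rw [lintegral_add_left hmeas, lintegral_const_mul' _ _ ENNReal.ofReal_ne_top]
    _ ≤ ENNReal.ofReal a + ENNReal.ofReal c * ENNReal.ofReal b' := by
        gcongr
        · exact hobj.2
        · exact herr.trans (ENNReal.ofReal_le_ofReal (le_trans (by linarith) hcy))
    _ = ENNReal.ofReal (a + c * b') := by
        rw [← ENNReal.ofReal_mul hc0, ← ENNReal.ofReal_add hobj.1 (mul_nonneg hc0 hb0)]
    _ ≤ _ := ENNReal.ofReal_le_ofReal hfin

/-- The expected sum of squared gradients along the run. -/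
theorem sum_integral_sq_gradient_le (hηL : 8 * (η * L) ≤ 1)
    (hημ : 24 * (L ^ 2 * η ^ 2) * (1 - μ) ≤ μ ^ 2) (R : ℝ) (I : ℕ)
    (x₀ : EuclideanSpace ℝ (Fin d)) (n : ℕ) :
    (∀ t, Integrable (fun ω => ‖gradient f
      ((resetTuple R I t (tuple η R I G C x₀ (fun t => z t ω) t)).1.1 +
        η • (resetTuple R I t (tuple η R I G C x₀ (fun t => z t ω) t)).1.2)‖ ^ 2) P) ∧
    η / 4 * ∑ t ∈ Finset.range n, ∫ ω, ‖gradient f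
      ((resetTuple R I t (tuple η R I G C x₀ (fun t => z t ω) t)).1.1 +
        η • (resetTuple R I t (tuple η R I G C x₀ (fun t => z t ω) t)).1.2)‖ ^ 2 ∂P ≤
      fmax + n * (2 * L * η ^ 2 * χ) := by
  have hη := hS.η_pos
  have hL := hS.L_pos
  have hμ := hS.μ_pos
  set X : ℕ → Ω → _ := fun t ω => tuple η R I G C x₀ (fun t => z t ω) t with hX
  set Z : ℕ → Ω → _ := fun t ω => resetTuple R I t (X t ω) with hZ
  have hXm : ∀ t, Measurable (X t) := hS.measurable_tuple R I x₀
  have hZm : ∀ t, Measurable (Z t) := fun t => (measurable_resetTuple R I t).comp (hXm t)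
  have hgm : ∀ t, Measurable fun ω => ‖gradient f ((Z t ω).1.1 + η • (Z t ω).1.2)‖ ^ 2 :=
    fun t => ((hS.objective.measurable_gradient.comp
      ((hZm t).fst.fst.add ((hZm t).fst.snd.const_smul η))).norm).pow_const 2
  have hgi : ∀ t, Integrable (fun ω => ‖gradient f ((Z t ω).1.1 + η • (Z t ω).1.2)‖ ^ 2) P :=
    fun t => Integrable.of_bound (hgm t).aestronglyMeasurable (4 * L * fmax)
      (.of_forall fun ω => by
        rw [Real.norm_of_nonneg (by positivity)]
        exact hS.objective.norm_gradient_sq_le hL _)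
  refine ⟨hgi, ?_⟩
  -- Measured from this lower bound, the Lyapunov function is nonnegative and starts at exactly
  -- `fmax`.
  have hm : ∀ x, f x₀ - fmax ≤ f x := fun x => by
    have := (abs_le.1 (hS.objective.bounded x₀ x)).2; linarith
  set c := L ^ 2 * η ^ 3 / μ with hc
  have hc0 : 0 ≤ c := by positivity
  set V := lyapunov f (f x₀ - fmax) c with hV
  have hV0 : ∀ s, 0 ≤ V s := fun s =>
    add_nonneg (sub_nonneg.2 (hm _)) (mul_nonneg hc0 (by positivity))
  have hVm : Measurable V := by
    have := hS.objective.measurable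
    exact ((this.comp measurable_fst).sub measurable_const).add
      ((measurable_snd.norm.pow_const 2).const_mul c)
  -- A reset can only lower the Lyapunov function: y is unchanged and e becomes 0.
  have hVr : ∀ t ω, V (Z t ω).1 ≤ V (X t ω).1 := by
    intro t ω
    simp only [hZ, resetTuple]
    split_ifs
    · simp only [hV, lyapunov, norm_zero]
      have : 0 ≤ c * ‖(X t ω).1.2‖ ^ 2 := by positivity
      linarith
    · rfl
  have hstep : ∀ t, Integrable (fun ω => V (X t ω).1) P →
      Integrable (fun ω => V (X (t + 1) ω).1) P ∧
      ∫ ω, V (X (t + 1) ω).1 ∂P ≤ ∫ ω, V (X t ω).1 ∂P -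
        η / 4 * ∫ ω, ‖gradient f ((Z t ω).1.1 + η • (Z t ω).1.2)‖ ^ 2 ∂P +
          2 * L * η ^ 2 * χ := by
    intro t ht
    have hZi : Integrable (fun ω => V (Z t ω).1) P := by
      refine ht.mono' (hVm.comp (hZm t).fst).aestronglyMeasurable (.of_forall fun ω => ?_)
      rw [Real.norm_of_nonneg (hV0 _)]
      exact hVr t ω
    have hi1 : Integrable (fun ω => V (Z t ω).1 -
        η / 4 * ‖gradient f ((Z t ω).1.1 + η • (Z t ω).1.2)‖ ^ 2) P :=
      hZi.sub ((hgi t).const_mul _)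
    have key := hS.samples.integral_chain_succ_le
      (measurable_tupleStep hS.oracle.measurable hS.compressor.measurable η R I)
      ((x₀, 0), (0, x₀)) t (Φ' := fun c => V c.1)
      (Φ := fun c => V (resetTuple R I t c).1 - η / 4 * ‖gradient f ((resetTuple R I t c).1.1 +
        η • (resetTuple R I t c).1.2)‖ ^ 2 + 2 * L * η ^ 2 * χ)
      (hVm.comp measurable_fst) (fun c => hV0 _)
      (fun c => (hS.lintegral_lyapunov_le hηL hημ hm (resetTuple R I t c).1).1)
      (hi1.add (integrable_const _))
      (fun c => (hS.lintegral_lyapunov_le hηL hημ hm (resetTuple R I t c).1).2)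
    refine ⟨key.1, key.2.trans ?_⟩
    change ∫ ω, V (Z t ω).1 - η / 4 * ‖gradient f ((Z t ω).1.1 + η • (Z t ω).1.2)‖ ^ 2 +
      2 * L * η ^ 2 * χ ∂P ≤ _
    rw [integral_add hi1 (integrable_const _), integral_sub hZi ((hgi t).const_mul _),
      integral_const_mul]
    simp only [integral_const, probReal_univ, one_smul]
    have := integral_mono hZi ht (hVr t)
    linarith
  have hint : ∀ t, Integrable (fun ω => V (X t ω).1) P := by
    intro t
    induction t with
    | zero => exact integrable_const (V (x₀, 0))
    | succ t ih => exact (hstep t ih).1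
  have hsum : ∫ ω, V (X n ω).1 ∂P + η / 4 * ∑ t ∈ Finset.range n,
      ∫ ω, ‖gradient f ((Z t ω).1.1 + η • (Z t ω).1.2)‖ ^ 2 ∂P ≤
      fmax + n * (2 * L * η ^ 2 * χ) := by
    induction n with
    | zero =>
      have : ∀ ω, V (X 0 ω).1 = fmax := fun ω => by
        simp [hX, tuple, chain, hV, lyapunov]
      simp [this]
    | succ n ih =>
      rw [Finset.sum_range_succ]
      have := (hstep n (hint n)).2
      push_cast
      linarith
  have : 0 ≤ ∫ ω, V (X n ω).1 ∂P := integral_nonneg fun ω => hV0 _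
  linarith

end SGDSetting

/-! ### Most reset points are second-order stationary -/

open Classical in
theorem integral_card_filter {Ω : Type*} [MeasurableSpace Ω] {P : Measure Ω}
    [IsProbabilityMeasure P] {A : ℕ → Set Ω} (hA : ∀ t, MeasurableSet (A t)) (T : ℕ) :
    Integrable (fun ω => (((Finset.range T).filter fun t => ω ∈ A t).card : ℝ)) P ∧
    ∫ ω, (((Finset.range T).filter fun t => ω ∈ A t).card : ℝ) ∂P =
      ∑ t ∈ Finset.range T, P.real (A t) := by
  have e : (fun ω => (((Finset.range T).filter fun t => ω ∈ A t).card : ℝ)) =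
      fun ω => ∑ t ∈ Finset.range T, (A t).indicator (1 : Ω → ℝ) ω := by
    funext ω
    rw [Finset.card_filter]
    push_cast
    exact Finset.sum_congr rfl fun t _ => by rw [Set.indicator_apply]; rfl
  have hi : ∀ t ∈ Finset.range T, Integrable (fun ω => (A t).indicator (1 : Ω → ℝ) ω) P :=
    fun t _ => (integrable_const (1 : ℝ)).indicator (hA t)
  rw [e]
  refine ⟨integrable_finsetSum _ hi, ?_⟩
  rw [integral_finsetSum _ hi]
  exact Finset.sum_congr rfl fun t _ => integral_indicator_one (hA t)

/-- The counts of a run with few costly epochs. -/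
theorem counts_conclude {T n a b g m N : ℕ} (hT : T ≤ (n + 1) * N) (hg : n ≤ g + a + b)
    (hm : n ≤ b + m) (hmN : m * N ≤ T) (hNT : 8 * N ≤ T) (hN : 0 < N)
    (hab : 4 * N * (a + b) < T) : 0 < n ∧ n ≤ 2 * g ∧ n * N ≤ 2 * T := by
  have h1 : 7 < n + 1 ∨ n + 1 ≤ 7 := lt_or_ge _ _
  -- Otherwise n + 1 ≤ 2(a + b), and T ≤ (n + 1)N would be below T/2.
  have h2 : 2 * (a + b) ≤ n := by
    by_contra! h
    have h3 : (n + 1) * N ≤ 2 * (a + b) * N := Nat.mul_le_mul_right _ h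
    nlinarith
  refine ⟨?_, by omega, ?_⟩
  · rcases h1 with h | h
    · omega
    · have := Nat.mul_le_mul_right N h
      omega
  · have := Nat.mul_le_mul_right N hm
    nlinarith

namespace SGDSetting

variable {d : ℕ} {Ω Θ Θ' : Type*} [MeasurableSpace Ω] [MeasurableSpace Θ]
    [MeasurableSpace Θ'] {P : Measure Ω} {D : Measure Θ} {D' : Measure Θ'}
    [IsProbabilityMeasure P] [IsProbabilityMeasure D] [IsProbabilityMeasure D']
    {f : EuclideanSpace ℝ (Fin d) → ℝ}
    {G : EuclideanSpace ℝ (Fin d) → Θ → EuclideanSpace ℝ (Fin d)}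
    {C : EuclideanSpace ℝ (Fin d) → Θ' → EuclideanSpace ℝ (Fin d)}
    {z : ℕ → Ω → EuclideanSpace ℝ (Fin d) × Θ × Θ'} {fmax L ρ σ μ η r χ : ℝ}
    (hS : SGDSetting P D D' f G C z fmax L ρ σ μ η r χ)
include hS

/-- An epoch started before `T` may run past it, so the descent estimate is applied over T + (I + 1)
iterations. -/
theorem sum_integral_startCost_le (hηL : 8 * (η * L) ≤ 1)
    (hημ : 24 * (L ^ 2 * η ^ 2) * (1 - μ) ≤ μ ^ 2) {R : ℝ} (hR : 0 < R) (I T : ℕ)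
    (x₀ : EuclideanSpace ℝ (Fin d)) :
    ∑ t ∈ Finset.range T, ∫ ω, startCost f η R I G C x₀ (fun t => z t ω) t ∂P ≤
      4 / η * (fmax + (T + (I + 1)) * (2 * L * η ^ 2 * χ)) := by
  have hη := hS.η_pos
  have h := hS.sum_integral_sq_gradient_le hηL hημ R I x₀ (T + (I + 1))
  rw [← integral_finsetSum _ fun t _ => (hS.integral_startCost R I x₀ t).1]
  rw [← integral_finsetSum _ fun t _ => h.1 t] at h
  refine (integral_mono (integrable_finsetSum _ fun t _ => (hS.integral_startCost R I x₀ t).1)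
    (integrable_finsetSum _ fun t _ => h.1 t)
    fun ω => sum_epochFrom_gradTerm_le hR f T).trans ?_
  have h2 := h.2
  push_cast at h2
  rw [div_mul_eq_mul_div, le_div_iff₀ hη]
  linarith

open Classical in
/-- With probability at least `1 - δ`, at least half of the reset points are stationary and
resets are rare. -/
theorem run_succeeds (hηL : 8 * (η * L) ≤ 1) (hημ : 24 * (L ^ 2 * η ^ 2) * (1 - μ) ≤ μ ^ 2)
    {R ε s c τ δ : ℝ} {I T : ℕ} (hR : 0 < R) (hs : 0 < s) (hc : 0 ≤ c) (hτ0 : 0 ≤ τ)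
    (hτ : τ ≤ 1 / 2)
    (hneg : ∀ t y, NegCurvature f (√(ρ * ε)) y → s ≤ ∑ k ∈ Finset.range (I + 1),
      epochGrad P f G C (fun k => z (t + k)) η R y k)
    (hbad : ∀ t y, P.real {ω | BadEnd f R (√(ρ * ε)) ε y
      (epoch η R G C y (fun k => z (t + k) ω) (I + 1)).1} ≤
        c * ∑ k ∈ Finset.range (I + 1), epochGrad P f G C (fun k => z (t + k)) η R y k + τ)
    (hNT : 8 * (I + 1) ≤ T) {Gb : ℝ}
    (hGb : 4 / η * (fmax + (T + (I + 1)) * (2 * L * η ^ 2 * χ)) ≤ Gb)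
    (hδ : 4 * ((I : ℝ) + 1) * (Gb / s + 2 * (c * Gb + τ * (T / (I + 1) + 1))) ≤ δ * T)
    {p : CompressedSGDParams}
    (hp : p = { stepSize := η, escapeIters := I, escapeRadius := R, resetError := true })
    (x₀ : EuclideanSpace ℝ (Fin d)) :
    ENNReal.ofReal (1 - δ) ≤ P {ω |
      0 < (CompressedSGD.resetTimes p G C x₀ (fun t => z t ω) T).card ∧
      (CompressedSGD.resetTimes p G C x₀ (fun t => z t ω) T).card ≤
        2 * (CompressedSGD.sospResetTimes p G C x₀ (fun t => z t ω) T f ρ ε).card ∧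
      (CompressedSGD.resetTimes p G C x₀ (fun t => z t ω) T).card * (I + 1) ≤ 2 * T} := by
  have hJ := (hS.sum_integral_startCost_le hηL hημ hR I T x₀).trans hGb
  obtain ⟨A, hAd⟩ : ∃ A : ℕ → Set Ω, A = fun t => {ω |
      IsStart η R I G C x₀ (fun t => z t ω) t ∧
      NegCurvature f (√(ρ * ε)) (tuple η R I G C x₀ (fun t => z t ω) t).1.1} := ⟨_, rfl⟩
  obtain ⟨B, hBd⟩ : ∃ B : ℕ → Set Ω, B = fun t => {ω |
      IsStart η R I G C x₀ (fun t => z t ω) t ∧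
      BadEnd f R (√(ρ * ε)) ε (tuple η R I G C x₀ (fun t => z t ω) t).1.1
        (epochFrom η R I G C x₀ (fun t => z t ω) t (I + 1)).1} := ⟨_, rfl⟩
  obtain ⟨S, hSd⟩ : ∃ S : ℕ → Set Ω, S = fun t => {ω |
      IsStart η R I G C x₀ (fun t => z t ω) t} := ⟨_, rfl⟩
  have hA := integral_card_filter (P := P) (A := A)
    (by rw [hAd]; exact hS.measurableSet_start_negCurvature R (√(ρ * ε)) I x₀) T
  have hB := integral_card_filter (P := P) (A := B)
    (by rw [hBd]; exact hS.measurableSet_start_badEnd R (√(ρ * ε)) ε I x₀) T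
  have hC := integral_card_filter (P := P) (A := S)
    (by rw [hSd]; exact hS.measurableSet_isStart R I x₀) T
  have hA1 : s * ∑ t ∈ Finset.range T, P.real (A t) ≤ Gb := by
    rw [Finset.mul_sum, hAd]
    exact (Finset.sum_le_sum fun t _ => hS.start_negCurvature_cost hneg x₀ t).trans hJ
  have hB1 : ∑ t ∈ Finset.range T, P.real (B t) ≤
      c * Gb + τ * ∑ t ∈ Finset.range T, P.real (S t) := by
    rw [hBd, hSd]
    refine (Finset.sum_le_sum fun t _ => hS.start_badEnd_cost hbad x₀ t).trans ?_
    rw [Finset.sum_add_distrib, ← Finset.mul_sum, ← Finset.mul_sum]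
    have := mul_le_mul_of_nonneg_left hJ hc
    linarith
  rw [← hA.2] at hA1
  rw [← hB.2, ← hC.2] at hB1
  set a : Ω → ℕ := fun ω => ((Finset.range T).filter fun t => ω ∈ A t).card with ha
  set b : Ω → ℕ := fun ω => ((Finset.range T).filter fun t => ω ∈ B t).card with hb
  set st : Ω → ℕ := fun ω => ((Finset.range T).filter fun t => ω ∈ S t).card with hst
  have hcnt := fun ω => run_counts (G := G) (C := C) (x₀ := x₀) (z := fun t => z t ω) hR (f := f) (ρ := ρ) (ε := ε)
    hp T (a := a ω) (b := b ω) (st := st ω) rfl rfl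
    (by rw [ha, hAd]; simp only [Set.mem_ofPred_eq])
    (by rw [hb, hBd]; simp only [Set.mem_ofPred_eq])
    (by rw [hst, hSd]; simp only [Set.mem_ofPred_eq])
  have hai : Integrable (fun ω => (a ω : ℝ)) P := hA.1
  have hbi : Integrable (fun ω => (b ω : ℝ)) P := hB.1
  have hsi : Integrable (fun ω => (st ω : ℝ)) P := hC.1
  have hN : (0 : ℝ) < (I : ℝ) + 1 := by positivity
  -- Starts exceed resets by at most one, and resets are at most the bad ends plus the full-length
  -- epochs, of which at most T/(I + 1) fit.
  have hst1 : ∫ ω, (st ω : ℝ) ∂P ≤ ∫ ω, (b ω : ℝ) ∂P + (T / ((I : ℝ) + 1) + 1) := by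
    have hi : Integrable (fun ω => (b ω : ℝ) + (T / ((I : ℝ) + 1) + 1)) P :=
      hbi.add (integrable_const _)
    refine (integral_mono hsi hi fun ω => ?_).trans (le_of_eq ?_)
    · obtain ⟨-, -, h3, m, h4, h5⟩ := hcnt ω
      have h6 : (m : ℝ) ≤ T / ((I : ℝ) + 1) := by
        rw [le_div_iff₀ hN]; exact_mod_cast h5
      have h7 : (st ω : ℝ) ≤ b ω + m + 1 := by exact_mod_cast h3.trans (by omega)
      simp only
      linarith
    · rw [integral_add hbi (integrable_const _)]
      simp
  have hb0 : 0 ≤ ∫ ω, (b ω : ℝ) ∂P := integral_nonneg fun ω => by positivity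
  -- The bound for the bad ends contains τ times their own expectation through the number of starts;
  -- τ ≤ 1/2 lets it be absorbed.
  have hb2 : ∫ ω, (b ω : ℝ) ∂P ≤ 2 * (c * Gb + τ * (T / (I + 1) + 1)) := by
    have h1 := mul_le_mul_of_nonneg_left hst1 hτ0
    have h2 := mul_le_mul_of_nonneg_right hτ hb0
    have h3 : ∫ ω, (b ω : ℝ) ∂P ≤ c * Gb + τ * ∫ ω, (st ω : ℝ) ∂P := hB1
    linarith
  have ha2 : ∫ ω, (a ω : ℝ) ∂P ≤ Gb / s := by
    rw [le_div_iff₀ hs, mul_comm]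
    exact hA1
  have hTpos : (0 : ℝ) < T := by
    have : 0 < T := by omega
    exact_mod_cast this
  have hmk := mul_meas_ge_le_integral_of_nonneg (μ := P)
    (f := fun ω => 4 * ((I : ℝ) + 1) * ((a ω : ℝ) + b ω))
    (.of_forall fun ω => by positivity) ((hai.add hbi).const_mul _) (T : ℝ)
  rw [integral_const_mul, integral_add hai hbi] at hmk
  have hbadset : P.real {ω | (T : ℝ) ≤ 4 * ((I : ℝ) + 1) * ((a ω : ℝ) + b ω)} ≤ δ := by
    have h1 := mul_le_mul_of_nonneg_left (add_le_add ha2 hb2)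
      (by positivity : 0 ≤ 4 * ((I : ℝ) + 1))
    have h2 : T * P.real {ω | (T : ℝ) ≤ 4 * ((I : ℝ) + 1) * ((a ω : ℝ) + b ω)} ≤ T * δ := by
      refine hmk.trans (h1.trans (hδ.trans (le_of_eq (mul_comm _ _))))
    exact le_of_mul_le_mul_left h2 hTpos
  set bad := {ω | (T : ℝ) ≤ 4 * ((I : ℝ) + 1) * ((a ω : ℝ) + b ω)} with hbads
  have h1 : (1 : ℝ≥0∞) ≤ P badᶜ + P bad := by
    rw [← measure_univ (μ := P), ← Set.compl_union_self bad]
    exact measure_union_le _ _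
  have h2 : P bad ≤ ENNReal.ofReal δ := by
    rw [← ENNReal.ofReal_toReal (measure_ne_top P bad)]
    exact ENNReal.ofReal_le_ofReal hbadset
  have hδ0 : 0 ≤ δ := measureReal_nonneg.trans hbadset
  have h3 : ENNReal.ofReal (1 - δ) ≤ P badᶜ := by
    rw [ENNReal.ofReal_sub _ hδ0, ENNReal.ofReal_one]
    exact tsub_le_iff_right.2 (h1.trans (by gcongr))
  refine h3.trans (measure_mono fun ω hω => ?_)
  obtain ⟨c1, c2, c3, m, c4, c5⟩ := hcnt ω
  have hlt : 4 * (I + 1) * (a ω + b ω) < T := by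
    have : ¬ ((T : ℝ) ≤ 4 * ((I : ℝ) + 1) * ((a ω : ℝ) + b ω)) := hω
    exact_mod_cast not_le.1 this
  exact counts_conclude c1 c2 c4 c5 hNT (by omega) hlt

end SGDSetting

/-! ### Choice of the parameters -/

/-- Step size `η`, noise level `r` and noise variance `χ`, tuned to the accuracy `s ^ 2`; the
number `y` is the inverse of a common bound on the problem constants and their inverses. -/
structure Tuned (y s L ρ fmax σ δ d μ α η r κ χ : ℝ) : Prop where
  y_pos : 0 < y
  y_le : y ≤ 1 / 6
  s_pos : 0 < s
  s_le : s ≤ 1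
  L_nonneg : 0 ≤ L
  L_le : L * y ≤ 1
  ρ_nonneg : 0 ≤ ρ
  ρ_le : ρ * y ≤ 1
  fmax_le : fmax * y ≤ 1
  σ_nonneg : 0 ≤ σ
  σ_le : σ * y ≤ 1
  le_δ : y ≤ δ
  one_le_d : 1 ≤ d
  μ_pos : 0 < μ
  μ_le : μ ≤ 1
  one_le_α : 1 ≤ α
  η_pos : 0 < η
  η_le : η * α ≤ y ^ 80 * s ^ 4
  η_sqrt_le : η * √(1 - μ) ≤ y ^ 80 * (μ * s ^ 2)
  η_dim_le : η * ((1 - μ) * d) ≤ y ^ 80 * (μ ^ 2 * s)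
  noise_eq : r ^ 2 * η = y ^ 60 * s ^ 4
  κ_ge : y * s ≤ κ
  κ_le : κ * y ≤ s
  χ_eq : χ = 2 * σ ^ 2 + 2 * r ^ 2

/-- Because y ≤ 1/6, numerical constants are absorbed by surplus powers of `y`. -/
theorem mul_pow_le_one {y : ℝ} (hy : 0 < y) (hy6 : y ≤ 1 / 6) {c : ℝ} (k : ℕ) (hc : c ≤ 6 ^ k) :
    c * y ^ k ≤ 1 := by
  calc c * y ^ k ≤ 6 ^ k * (1 / 6) ^ k := by gcongr
    _ = 1 := by rw [← mul_pow]; norm_num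

theorem pow_mul_le_gaussVar {a c : ℝ} (hc : 0 ≤ c) (n : ℕ) :
    (a ^ 2) ^ n * c ≤ gaussVar a c (n + 1) :=
  Finset.single_le_sum (f := fun k => (a ^ 2) ^ k * c) (fun k _ => by positivity)
    (Finset.self_mem_range_succ n)

/-- From exp(x/2)(1 − x/2) ≤ 1 ≤ (1 + x)(1 − x/2) for 0 ≤ x ≤ 1. -/
theorem exp_mul_le_one_add_sq_pow {x : ℝ} (hx : 0 ≤ x) (hx1 : x ≤ 1) (n : ℕ) :
    Real.exp (n * x) ≤ ((1 + x) ^ 2) ^ n := by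
  rw [Real.exp_nat_mul]
  refine pow_le_pow_left₀ (Real.exp_pos _).le ?_ n
  have h1 := Real.add_one_le_exp (-(x / 2))
  have h2 : Real.exp (x / 2) * (1 - x / 2) ≤ 1 := by
    calc Real.exp (x / 2) * (1 - x / 2) ≤ Real.exp (x / 2) * Real.exp (-(x / 2)) :=
          mul_le_mul_of_nonneg_left (by linarith) (Real.exp_pos _).le
      _ = 1 := by rw [← Real.exp_add]; simp
  have h3 : Real.exp (x / 2) ≤ 1 + x := by
    have h4 : 1 ≤ (1 + x) * (1 - x / 2) := by nlinarith
    exact le_of_mul_le_mul_right (h2.trans h4) (by linarith)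
  calc Real.exp x = Real.exp (x / 2) ^ 2 := by rw [← Real.exp_nat_mul]; congr 1; push_cast; ring
    _ ≤ _ := pow_le_pow_left₀ (Real.exp_pos _).le h3 2

/-! ### Tuned parameters meet the conditions of the descent and escape arguments. -/

namespace Tuned

variable {y s L ρ fmax σ δ d μ α η r κ χ : ℝ}
  (h : Tuned y s L ρ fmax σ δ d μ α η r κ χ)
include h

theorem y_lt_one : y < 1 := by have := h.y_le; linarith

theorem η_le' : η ≤ y ^ 80 * s ^ 4 :=
  (le_mul_of_one_le_right h.η_pos.le h.one_le_α).trans h.η_le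

theorem η_le_y : η ≤ y ^ 80 :=
  h.η_le'.trans (mul_le_of_le_one_right (pow_nonneg h.y_pos.le _)
    (pow_le_one₀ h.s_pos.le h.s_le))

theorem η_le_s : η ≤ y ^ 80 * s := by
  refine h.η_le'.trans (mul_le_mul_of_nonneg_left ?_ (pow_nonneg h.y_pos.le _))
  exact pow_le_of_le_one h.s_pos.le h.s_le (by norm_num)

/-- Since r²η is fixed at y^60 s⁴, the bound on ηα makes r² exceed α by y^(−20). In particular the
artificial noise dominates the oracle noise. -/
theorem α_le_noise : α ≤ r ^ 2 * y ^ 20 := by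
  have hy := h.y_pos
  have h1 : η * α * y ^ 60 ≤ η * (r ^ 2 * y ^ 20) * y ^ 60 := by
    calc η * α * y ^ 60 ≤ (y ^ 80 * s ^ 4) * y ^ 60 :=
          mul_le_mul_of_nonneg_right h.η_le (by positivity)
      _ = (y ^ 60 * s ^ 4) * y ^ 80 := by ring
      _ = _ := by rw [← h.noise_eq]; ring
  exact le_of_mul_le_mul_left (le_of_mul_le_mul_right h1 (by positivity)) h.η_pos

theorem σ_sq_le : σ ^ 2 ≤ r ^ 2 := by
  have hy := h.y_pos
  have h1 : σ ^ 2 * y ^ 2 ≤ 1 := by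
    rw [← mul_pow]; exact pow_le_one₀ (mul_nonneg h.σ_nonneg hy.le) h.σ_le
  have h2 := h.one_le_α.trans h.α_le_noise
  have h3 : σ ^ 2 * y ^ 2 ≤ r ^ 2 * y ^ 2 := by
    refine (h1.trans h2).trans (mul_le_mul_of_nonneg_left ?_ (sq_nonneg r))
    exact pow_le_pow_of_le_one hy.le h.y_lt_one.le (by norm_num)
  exact le_of_mul_le_mul_right h3 (by positivity)

theorem χ_le : χ ≤ 4 * r ^ 2 := by have := h.σ_sq_le; have := h.χ_eq; linarith

theorem χ_ge : 2 * r ^ 2 ≤ χ := by have := h.χ_eq; have := sq_nonneg σ; linarith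

theorem χ_nonneg : 0 ≤ χ := (by positivity : 0 ≤ 2 * r ^ 2).trans h.χ_ge

theorem η_mul_χ_le : η * χ ≤ 4 * (y ^ 60 * s ^ 4) := by
  rw [← h.noise_eq]
  have := mul_le_mul_of_nonneg_left h.χ_le h.η_pos.le
  linarith

theorem κ_pos : 0 < κ := (mul_pos h.y_pos h.s_pos).trans_le h.κ_ge

theorem η_mul_L_le : 8 * (η * L) ≤ 1 := by
  have hy := h.y_pos
  have h1 : η * L ≤ y ^ 79 * 1 := by
    calc η * L ≤ y ^ 80 * L := mul_le_mul_of_nonneg_right h.η_le_y h.L_nonneg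
      _ = y ^ 79 * (L * y) := by ring
      _ ≤ _ := mul_le_mul_of_nonneg_left h.L_le (by positivity)
  have h2 := mul_pow_le_one hy h.y_le (c := 8) 79 (by norm_num)
  linarith

theorem η_one_sub_le : η * (1 - μ) ≤ y ^ 80 * (μ * s ^ 2) := by
  refine (mul_le_mul_of_nonneg_left ?_ h.η_pos.le).trans h.η_sqrt_le
  refine Real.le_sqrt_of_sq_le ?_
  have := h.μ_pos
  have := h.μ_le
  nlinarith

theorem η_sq_one_sub_le : η ^ 2 * (1 - μ) ≤ y ^ 160 * (μ ^ 2 * s ^ 4) := by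
  have h0 : 0 ≤ η * √(1 - μ) := mul_nonneg h.η_pos.le (Real.sqrt_nonneg _)
  have h1 := pow_le_pow_left₀ h0 h.η_sqrt_le 2
  rw [mul_pow, Real.sq_sqrt (by have := h.μ_le; linarith)] at h1
  calc _ ≤ _ := h1
    _ = _ := by ring

theorem descent_condition : 24 * (L ^ 2 * η ^ 2) * (1 - μ) ≤ μ ^ 2 := by
  have hy := h.y_pos
  have hs := h.s_pos
  have hL : L ^ 2 * y ^ 2 ≤ 1 := by
    rw [← mul_pow]; exact pow_le_one₀ (mul_nonneg h.L_nonneg hy.le) h.L_le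
  calc 24 * (L ^ 2 * η ^ 2) * (1 - μ) = 24 * L ^ 2 * (η ^ 2 * (1 - μ)) := by ring
    _ ≤ 24 * L ^ 2 * (y ^ 160 * (μ ^ 2 * s ^ 4)) :=
        mul_le_mul_of_nonneg_left h.η_sq_one_sub_le (by positivity)
    _ = (L ^ 2 * y ^ 2) * (24 * y ^ 158) * s ^ 4 * μ ^ 2 := by ring
    _ ≤ 1 * 1 * 1 * μ ^ 2 := by
        gcongr
        · exact mul_pow_le_one hy h.y_le 158 (by norm_num)
        · exact pow_le_one₀ hs.le h.s_le
    _ = μ ^ 2 := by ring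

theorem compression_condition {ℓ₀ : ℝ} (hℓ0 : 0 ≤ ℓ₀) (hℓ : ℓ₀ * y ≤ 1) :
    5760000 * (L ^ 2 + 2 * ℓ₀ ^ 2) * (1 - μ) * η * χ ≤ μ ^ 2 * κ * (r ^ 2 / d) := by
  have hy := h.y_pos
  have hs := h.s_pos
  have hd : 0 < d := zero_lt_one.trans_le h.one_le_d
  have hL : L ^ 2 * y ^ 2 ≤ 1 := by
    rw [← mul_pow]; exact pow_le_one₀ (mul_nonneg h.L_nonneg hy.le) h.L_le
  have hl : ℓ₀ ^ 2 * y ^ 2 ≤ 1 := by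
    rw [← mul_pow]; exact pow_le_one₀ (mul_nonneg hℓ0 hy.le) hℓ
  have h0 : 0 ≤ 1 - μ := by have := h.μ_le; linarith
  have hμ := h.μ_pos
  calc 5760000 * (L ^ 2 + 2 * ℓ₀ ^ 2) * (1 - μ) * η * χ
      = 5760000 * (L ^ 2 + 2 * ℓ₀ ^ 2) * (η * ((1 - μ) * d)) * (χ / d) := by field_simp
    _ ≤ 5760000 * (L ^ 2 + 2 * ℓ₀ ^ 2) * (y ^ 80 * (μ ^ 2 * s)) * (4 * r ^ 2 / d) := by
        exact mul_le_mul (mul_le_mul_of_nonneg_left h.η_dim_le (by positivity))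
          (div_le_div_of_nonneg_right h.χ_le hd.le) (div_nonneg h.χ_nonneg hd.le) (by positivity)
    _ = (L ^ 2 * y ^ 2 + 2 * (ℓ₀ ^ 2 * y ^ 2)) * (23040000 * y ^ 77) *
        (μ ^ 2 * (y * s) * (r ^ 2 / d)) := by ring
    _ ≤ (1 + 2 * 1) * (23040000 * y ^ 77) * (μ ^ 2 * κ * (r ^ 2 / d)) := by
        gcongr
        exact h.κ_ge
    _ = (69120000 * y ^ 77) * (μ ^ 2 * κ * (r ^ 2 / d)) := by ring
    _ ≤ 1 * (μ ^ 2 * κ * (r ^ 2 / d)) := by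
        have := h.κ_pos
        gcongr
        exact mul_pow_le_one hy h.y_le 77 (by norm_num)
    _ = _ := one_mul _

section EpochLength

variable {N : ℝ} (hN : 1 ≤ N * η * s * y ^ 5) (hN2 : N * η * s * y ^ 5 ≤ 2)
include hN

theorem N_pos : 0 < N := by
  by_contra! h0
  have := mul_nonpos_of_nonpos_of_nonneg h0
    (by have := h.y_pos; have := h.s_pos; have := h.η_pos; positivity : 0 ≤ η * s * y ^ 5)
  have e : N * (η * s * y ^ 5) = N * η * s * y ^ 5 := by ring
  linarith

theorem one_le_N_mul : 1 ≤ N * (η * κ) := by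
  have hy := h.y_pos
  have hη := h.η_pos
  have hs := h.s_pos
  have hN0 := h.N_pos hN
  calc 1 ≤ N * η * s * y ^ 5 := hN
    _ = N * (η * (y * s)) * y ^ 4 := by ring
    _ ≤ N * (η * κ) * 1 := by
        have := h.κ_pos
        gcongr
        · exact h.κ_ge
        · exact pow_le_one₀ hy.le h.y_lt_one.le
    _ = _ := mul_one _

theorem radius_condition : (y ^ 11 * s) ^ 2 * L ≤ 16 * N * η * χ := by
  have hy := h.y_pos
  have hη := h.η_pos
  have hs := h.s_pos
  have hN0 := h.N_pos hN
  have hχ1 : 1 ≤ χ := by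
    have h1 := h.one_le_α.trans h.α_le_noise
    have h2 : r ^ 2 * y ^ 20 ≤ r ^ 2 * 1 :=
      mul_le_mul_of_nonneg_left (pow_le_one₀ hy.le h.y_lt_one.le) (sq_nonneg r)
    have := h.χ_ge
    linarith
  have h2 : 1 ≤ N * η := by
    calc 1 ≤ N * η * s * y ^ 5 := hN
      _ ≤ N * η * 1 * 1 := by
        gcongr
        · exact h.s_le
        · exact pow_le_one₀ hy.le h.y_lt_one.le
      _ = N * η := by ring
  calc (y ^ 11 * s) ^ 2 * L = (L * y) * y ^ 21 * s ^ 2 := by ring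
    _ ≤ 1 * 1 * 1 := by
        have := h.L_nonneg
        gcongr
        · exact h.L_le
        · exact pow_le_one₀ hy.le h.y_lt_one.le
        · exact pow_le_one₀ hs.le h.s_le
    _ ≤ 16 * (N * η) * χ := by nlinarith
    _ = _ := by ring

include hN2

/-- The radius carries y^11 against the y^(−5) of the epoch length, so NηρR, the Hessian variation
accumulated over an epoch, is a positive power of `y`. -/
theorem coupling_condition {ℓ₀ : ℝ} (hℓ0 : 0 ≤ ℓ₀) (hℓ : ℓ₀ * y ≤ 1) :
    N * (6 * N * η ^ 2 * ρ ^ 2 * (y ^ 11 * s) ^ 2 + 24 * ℓ₀ ^ 2 * η ^ 2) ≤ 1 / 40000 := by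
  have hy := h.y_pos
  have hη := h.η_pos
  have hs := h.s_pos
  have hρ := h.ρ_nonneg
  have hN0 := h.N_pos hN
  have h1 : 6 * (N * η * s * y ^ 5) ^ 2 * (ρ * y) ^ 2 * y ^ 10 ≤ 6 * 2 ^ 2 * 1 ^ 2 * y ^ 10 := by
    gcongr
    exact h.ρ_le
  have h2 : N * (24 * ℓ₀ ^ 2 * η ^ 2) ≤ 48 * y ^ 73 := by
    refine le_of_mul_le_mul_right (a := s * y ^ 7) ?_ (by positivity)
    calc N * (24 * ℓ₀ ^ 2 * η ^ 2) * (s * y ^ 7) =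
        24 * (N * η * s * y ^ 5) * (ℓ₀ * y) ^ 2 * η := by ring
      _ ≤ 24 * 2 * 1 ^ 2 * (y ^ 80 * s) := by
          gcongr
          exact h.η_le_s
      _ = _ := by ring
  have h3 := mul_pow_le_one hy h.y_le (c := 1920000) 10 (by norm_num)
  have h4 := mul_pow_le_one hy h.y_le (c := 3840000) 73 (by norm_num)
  have e : N * (6 * N * η ^ 2 * ρ ^ 2 * (y ^ 11 * s) ^ 2) =
    6 * (N * η * s * y ^ 5) ^ 2 * (ρ * y) ^ 2 * y ^ 10 := by ring
  rw [mul_add, e]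
  linarith

theorem exit_condition : 24 * N * η ^ 2 * χ ≤ (y ^ 11 * s) ^ 2 := by
  have hy := h.y_pos
  have hη := h.η_pos
  have hs := h.s_pos
  have hN0 := h.N_pos hN
  refine le_of_mul_le_mul_right (a := s * y ^ 5) ?_ (by positivity)
  calc 24 * N * η ^ 2 * χ * (s * y ^ 5) = 24 * (N * η * s * y ^ 5) * (η * χ) := by ring
    _ ≤ 24 * 2 * (4 * (y ^ 60 * s ^ 4)) := by
        exact mul_le_mul (by linarith) h.η_mul_χ_le (mul_nonneg hη.le h.χ_nonneg) (by norm_num)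
    _ = (192 * y ^ 33) * s * ((y ^ 11 * s) ^ 2 * (s * y ^ 5)) := by ring
    _ ≤ 1 * 1 * ((y ^ 11 * s) ^ 2 * (s * y ^ 5)) := by
        gcongr
        · exact mul_pow_le_one hy h.y_le 33 (by norm_num)
        · exact h.s_le
    _ = _ := by ring

end EpochLength

theorem oracle_noise_condition {σ₀ : ℝ} (hσ0 : 0 ≤ σ₀) (hσ : σ₀ * y ≤ 1)
    (hα : σ₀ = 0 ∨ α = d) : σ₀ ^ 2 ≤ r ^ 2 / d / 40000 := by
  have hy := h.y_pos
  have hd : 0 < d := zero_lt_one.trans_le h.one_le_d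
  rcases hα with rfl | hα
  · rw [zero_pow two_ne_zero]; positivity
  rw [div_div, le_div_iff₀ (by positivity)]
  have h1 := h.α_le_noise
  rw [hα] at h1
  refine le_of_mul_le_mul_right (a := y ^ 2) ?_ (by positivity)
  calc σ₀ ^ 2 * (d * 40000) * y ^ 2 = (σ₀ * y) ^ 2 * (d * 40000) := by ring
    _ ≤ 1 ^ 2 * (r ^ 2 * y ^ 20 * 40000) := by gcongr
    _ = r ^ 2 * (40000 * y ^ 18) * y ^ 2 := by ring
    _ ≤ r ^ 2 * 1 * y ^ 2 := by
        gcongr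
        exact mul_pow_le_one hy h.y_le 18 (by norm_num)
    _ = _ := by ring

/-- The Gaussian difference of the coupled runs outgrows the escaping radius. -/
theorem growth_condition (hd : d ≤ Real.exp (1 / y) * (s ^ 2 * μ))
    (hηd : y ^ 80 * (s ^ 4 * μ ^ 2) ≤ η * d) (hκη : η * κ ≤ 1) {I : ℕ}
    (hI : 1 ≤ I * η * s * y ^ 5) :
    64 * (y ^ 11 * s) ^ 2 ≤ gaussVar (1 + η * κ) ((2 * η) ^ 2 * (r ^ 2 / d)) (I + 1) := by
  have hy := h.y_pos
  have hη := h.η_pos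
  have hs := h.s_pos
  have hκ := h.κ_pos
  have hμ := h.μ_pos
  have hd0 : 0 < d := zero_lt_one.trans_le h.one_le_d
  set E := Real.exp (1 / y) with hE
  have hE0 : 0 < E := Real.exp_pos _
  have hEy : 1 ≤ E * y := by
    have h1 := Real.add_one_le_exp (1 / y)
    calc 1 = 1 / y * y := by field_simp
      _ ≤ E * y := by gcongr; linarith
  have hE1 : 1 ≤ E := hEy.trans (mul_le_of_le_one_right hE0.le h.y_lt_one.le)
  have hE6 : 6 ≤ E := by
    have h1 : E * y ≤ E * (1 / 6) := mul_le_mul_of_nonneg_left h.y_le hE0.le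
    linarith
  have hEs : 1 ≤ E * s ^ 2 := by
    refine h.one_le_d.trans (hd.trans ?_)
    rw [← mul_assoc]
    exact mul_le_of_le_one_right (by positivity) h.μ_le
  -- The exponent Iηκ is at least y^(−4), hence at least 216/y because 216 = 6³.
  have hexp : E ^ 216 ≤ ((1 + η * κ) ^ 2) ^ I := by
    refine le_trans ?_ (exp_mul_le_one_add_sq_pow (by positivity) hκη I)
    rw [hE, ← Real.exp_nat_mul]
    refine Real.exp_le_exp.2 ?_
    have h1 : (216 : ℝ) * y ^ 3 ≤ 1 := mul_pow_le_one hy h.y_le 3 (by norm_num)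
    calc ((216 : ℕ) : ℝ) * (1 / y) = (216 * y ^ 3) / y ^ 4 := by push_cast; field_simp
      _ ≤ 1 / y ^ 4 := by gcongr
      _ ≤ (I * η * s * y ^ 5) / y ^ 4 := by gcongr
      _ = I * (η * (y * s)) := by field_simp
      _ ≤ I * (η * κ) := by gcongr; exact h.κ_ge
  have hd2 : d ^ 2 ≤ E ^ 2 * (s ^ 4 * μ ^ 2) := by
    calc d ^ 2 ≤ (E * (s ^ 2 * μ)) ^ 2 := by gcongr
      _ = _ := by ring
  -- The 216 factors of E = exp(1/y) are spent on the constant, on d/(s²μ), on the inverse powers of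
  -- y (via Ey ≥ 1) and on s² (via Es² ≥ 1).
  have key : 16 * d ≤ E ^ 216 * (η * (y ^ 38 * s ^ 2)) := by
    refine le_of_mul_le_mul_right (a := d) ?_ hd0
    calc 16 * d * d = 16 * d ^ 2 := by ring
      _ ≤ E ^ 2 * (E ^ 2 * (s ^ 4 * μ ^ 2)) := by
          have : (16 : ℝ) ≤ E ^ 2 := by nlinarith
          gcongr
      _ = E ^ 4 * 1 * 1 * 1 * (s ^ 4 * μ ^ 2) := by ring
      _ ≤ E ^ 4 * (E * y) ^ 118 * (E * s ^ 2) * E ^ 93 * (s ^ 4 * μ ^ 2) := by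
          have e1 : 1 ≤ (E * y) ^ 118 := one_le_pow₀ hEy
          have e2 : 1 ≤ E ^ 93 := one_le_pow₀ hE1
          gcongr
      _ = E ^ 216 * (y ^ 38 * s ^ 2) * (y ^ 80 * (s ^ 4 * μ ^ 2)) := by ring
      _ ≤ E ^ 216 * (y ^ 38 * s ^ 2) * (η * d) := by gcongr
      _ = _ := by ring
  refine le_trans ?_ (pow_mul_le_gaussVar (by positivity) I)
  calc 64 * (y ^ 11 * s) ^ 2 = 16 * d * (4 * (y ^ 22 * s ^ 2) / d) := by field_simp; ring
    _ ≤ E ^ 216 * (η * (y ^ 38 * s ^ 2)) * (4 * (y ^ 22 * s ^ 2) / d) := by gcongr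
    _ = E ^ 216 * (4 * η * (y ^ 60 * s ^ 4) / d) := by ring
    _ = E ^ 216 * ((2 * η) ^ 2 * (r ^ 2 / d)) := by rw [← h.noise_eq]; ring
    _ ≤ _ := by gcongr

end Tuned

/-! ### The terms of the bad-end bound for tuned parameters. -/

namespace Tuned

variable {y s L ρ fmax σ δ d μ α η r κ χ : ℝ}
  (h : Tuned y s L ρ fmax σ δ d μ α η r κ χ)
include h

/-- The part driven by the gradients is controlled through η²(1 − μ) and the part driven by noise
through η(1 − μ); both use the second term of the step size. -/
theorem error_term_le {N S Se : ℝ} (hN0 : 0 ≤ N) (hS : 0 ≤ S)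
    (hSe : Se ≤ 2 * (1 - μ) / μ ^ 2 * (3 * S + μ * (χ * N))) :
    η ^ 2 * Se ≤ 6 * y ^ 160 * s ^ 4 * S + 8 * y ^ 140 * s ^ 6 * N := by
  have hy := h.y_pos
  have hs := h.s_pos
  have hμ := h.μ_pos
  have hη := h.η_pos
  calc η ^ 2 * Se ≤ η ^ 2 * (2 * (1 - μ) / μ ^ 2 * (3 * S + μ * (χ * N))) := by gcongr
    _ = 6 * (η ^ 2 * (1 - μ)) * (S / μ ^ 2) + 2 * (η * (1 - μ)) * (η * χ) * (N / μ) := by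
        field_simp; ring
    _ ≤ 6 * (y ^ 160 * (μ ^ 2 * s ^ 4)) * (S / μ ^ 2) +
        2 * (y ^ 80 * (μ * s ^ 2)) * (4 * (y ^ 60 * s ^ 4)) * (N / μ) := by
        refine add_le_add ?_ ?_
        · refine mul_le_mul_of_nonneg_right ?_ (by positivity)
          linarith [h.η_sq_one_sub_le]
        · refine mul_le_mul_of_nonneg_right ?_ (by positivity)
          exact mul_le_mul (by linarith [h.η_one_sub_le]) h.η_mul_χ_le
            (mul_nonneg hη.le h.χ_nonneg) (by positivity)
    _ = _ := by field_simp; ring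

theorem exit_term_le {N S : ℝ} (hN2 : N * η * s * y ^ 5 ≤ 2) (hS : 0 ≤ S) :
    (6 * N * η ^ 2 * S + 3 * N * η ^ 2 * χ) / (y ^ 11 * s) ^ 2 ≤
      12 / y ^ 27 * (η / s ^ 3 * S) + 24 * y ^ 33 := by
  have hy := h.y_pos
  have hs := h.s_pos
  have hη := h.η_pos
  calc (6 * N * η ^ 2 * S + 3 * N * η ^ 2 * χ) / (y ^ 11 * s) ^ 2 =
      (N * η * s * y ^ 5) * (6 * (η * S) / (y ^ 27 * s ^ 3)) +
        (N * η * s * y ^ 5) * (3 / (y ^ 27 * s ^ 3) * (η * χ)) := by field_simp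
    _ ≤ 2 * (6 * (η * S) / (y ^ 27 * s ^ 3)) +
        2 * (3 / (y ^ 27 * s ^ 3) * (4 * (y ^ 60 * s ^ 4))) := by
        refine add_le_add (mul_le_mul_of_nonneg_right hN2 (by positivity)) ?_
        refine mul_le_mul hN2 (mul_le_mul_of_nonneg_left h.η_mul_χ_le (by positivity))
          (mul_nonneg (by positivity) (mul_nonneg hη.le h.χ_nonneg)) (by norm_num)
    _ = 12 / y ^ 27 * (η / s ^ 3 * S) + 24 * y ^ 33 * s := by field_simp; ring
    _ ≤ 12 / y ^ 27 * (η / s ^ 3 * S) + 24 * y ^ 33 * 1 := by gcongr; exact h.s_le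
    _ = _ := by ring

/-- Averaging over the window divides by W ≥ 1/(4ηκ), which produces the scale ηS/s³ shared by all
gradient terms. -/
theorem window_term_le {N S W X : ℝ} (hN2 : N * η * s * y ^ 5 ≤ 2) (hS : 0 ≤ S)
    (hX0 : 0 ≤ X) (hX : X ≤ 6 * y ^ 160 * s ^ 4 * S + 8 * y ^ 140 * s ^ 6 * N)
    (hW : 1 ≤ 4 * (W * (η * κ))) (hW0 : 0 < W) :
    2 / s ^ 2 * (3 / (y ^ 6 * s ^ 2 * W) * (S + L ^ 2 * X)) ≤
      48 / y ^ 7 * (η / s ^ 3 * S) + 384 * y ^ 126 := by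
  have hy := h.y_pos
  have hs := h.s_pos
  have hη := h.η_pos
  have hL : L ^ 2 * y ^ 2 ≤ 1 := by
    rw [← mul_pow]; exact pow_le_one₀ (mul_nonneg h.L_nonneg hy.le) h.L_le
  have hLX : L ^ 2 * X ≤ S + 8 * y ^ 138 * s ^ 6 * N := by
    refine le_of_mul_le_mul_right (a := y ^ 2) ?_ (by positivity)
    calc L ^ 2 * X * y ^ 2 = (L ^ 2 * y ^ 2) * X := by ring
      _ ≤ 1 * X := by gcongr
      _ ≤ (6 * y ^ 158) * s ^ 4 * y ^ 2 * S + 8 * y ^ 140 * s ^ 6 * N := by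
          rw [one_mul]; exact hX.trans (le_of_eq (by ring))
      _ ≤ 1 * 1 * y ^ 2 * S + 8 * y ^ 140 * s ^ 6 * N := by
          gcongr
          · exact mul_pow_le_one hy h.y_le 158 (by norm_num)
          · exact pow_le_one₀ hs.le h.s_le
      _ = _ := by ring
  have hWi : 1 / W ≤ 4 * η * s / y := by
    rw [div_le_div_iff₀ hW0 hy, one_mul]
    calc y ≤ y * (4 * (W * (η * κ))) := le_mul_of_one_le_right hy.le hW
      _ = 4 * W * η * (κ * y) := by ring
      _ ≤ 4 * W * η * s := by gcongr; exact h.κ_le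
      _ = _ := by ring
  have hT : 0 ≤ S + L ^ 2 * X := by positivity
  calc 2 / s ^ 2 * (3 / (y ^ 6 * s ^ 2 * W) * (S + L ^ 2 * X)) =
      6 / (y ^ 6 * s ^ 4) * (S + L ^ 2 * X) * (1 / W) := by field_simp; ring
    _ ≤ 6 / (y ^ 6 * s ^ 4) * (S + (S + 8 * y ^ 138 * s ^ 6 * N)) * (4 * η * s / y) := by
        gcongr
        have := hT.trans (add_le_add_right hLX S); positivity
    _ = 48 / y ^ 7 * (η / s ^ 3 * S) + 192 * y ^ 126 * s ^ 2 * (N * η * s * y ^ 5) := by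
        field_simp; ring
    _ ≤ 48 / y ^ 7 * (η / s ^ 3 * S) + 192 * y ^ 126 * 1 * 2 := by
        refine add_le_add le_rfl ?_
        refine (mul_le_mul_of_nonneg_left hN2 (by positivity)).trans ?_
        gcongr
        exact pow_le_one₀ hs.le h.s_le
    _ = _ := by ring

theorem curvature_term_le {N S W Se : ℝ} (hN2 : N * η * s * y ^ 5 ≤ 2) (hS : 0 ≤ S)
    (hX0 : 0 ≤ η ^ 2 * Se)
    (hX : η ^ 2 * Se ≤ 6 * y ^ 160 * s ^ 4 * S + 8 * y ^ 140 * s ^ 6 * N)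
    (hW0 : 0 ≤ W) (hWκ : W * (η * (2 * κ)) ≤ 1) :
    2 / s ^ 2 * (9 / 4 * W * η ^ 4 * L ^ 4 / (y ^ 6 * s ^ 2) * Se) ≤
      η / s ^ 3 * S + 36 * y ^ 124 := by
  have hy := h.y_pos
  have hs := h.s_pos
  have hη := h.η_pos
  have hL : L ^ 4 * y ^ 4 ≤ 1 := by
    rw [← mul_pow]; exact pow_le_one₀ (mul_nonneg h.L_nonneg hy.le) h.L_le
  have hWη : W * η ≤ 1 / (2 * (y * s)) := by
    rw [le_div_iff₀ (by positivity)]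
    calc W * η * (2 * (y * s)) ≤ W * η * (2 * κ) := by gcongr; exact h.κ_ge
      _ = W * (η * (2 * κ)) := by ring
      _ ≤ 1 := hWκ
  calc 2 / s ^ 2 * (9 / 4 * W * η ^ 4 * L ^ 4 / (y ^ 6 * s ^ 2) * Se) =
      9 / 2 / (y ^ 10 * s ^ 4) * (W * η) * η * (L ^ 4 * y ^ 4) * (η ^ 2 * Se) := by
        field_simp; ring
    _ ≤ 9 / 2 / (y ^ 10 * s ^ 4) * (1 / (2 * (y * s))) * η * 1 *
        (6 * y ^ 160 * s ^ 4 * S + 8 * y ^ 140 * s ^ 6 * N) := by gcongr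
    _ = (27 / 2 * y ^ 149) * s ^ 2 * (η / s ^ 3 * S) +
        18 * y ^ 124 * (N * η * s * y ^ 5) := by field_simp; ring
    _ ≤ 1 * 1 * (η / s ^ 3 * S) + 18 * y ^ 124 * 2 := by
        gcongr
        · exact mul_pow_le_one hy h.y_le 149 (by norm_num)
        · exact pow_le_one₀ hs.le h.s_le
    _ = _ := by ring

theorem drift_term_le {S : ℝ} (hS : 0 ≤ S) :
    2 / s ^ 2 * ((3 * η * κ / (2 * (y ^ 6 * s ^ 2)) + 3 * ρ * η ^ 2) * S) ≤
      3 / y ^ 7 * (η / s ^ 3 * S) + 6 / y * (η / s ^ 3 * S) := by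
  have hy := h.y_pos
  have hs := h.s_pos
  have hη := h.η_pos
  have hηs : η * s ≤ 1 :=
    mul_le_one₀ (h.η_le_y.trans (pow_le_one₀ hy.le h.y_lt_one.le)) hs.le h.s_le
  calc 2 / s ^ 2 * ((3 * η * κ / (2 * (y ^ 6 * s ^ 2)) + 3 * ρ * η ^ 2) * S) =
      3 / (y ^ 7 * s ^ 4) * η * S * (κ * y) + 6 / (y * s ^ 3) * η * S * ((ρ * y) * (η * s)) := by
        field_simp; ring
    _ ≤ 3 / (y ^ 7 * s ^ 4) * η * S * s + 6 / (y * s ^ 3) * η * S * (1 * 1) := by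
        have := h.ρ_nonneg
        gcongr
        · exact h.κ_le
        · exact h.ρ_le
    _ = _ := by field_simp

theorem hessian_term_le {W : ℝ} (hW0 : 0 ≤ W) (hWκ : W * (η * (2 * κ)) ≤ 1) :
    2 / s ^ 2 * (3 * ρ * η ^ 2 * W * χ) ≤ 12 * y ^ 58 := by
  have hy := h.y_pos
  have hs := h.s_pos
  have hη := h.η_pos
  have hWη : W * η ≤ 1 / (2 * (y * s)) := by
    rw [le_div_iff₀ (by positivity)]
    calc W * η * (2 * (y * s)) ≤ W * η * (2 * κ) := by gcongr; exact h.κ_ge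
      _ = W * (η * (2 * κ)) := by ring
      _ ≤ 1 := hWκ
  have hW1 : (ρ * y) * (W * η) ≤ 1 * (1 / (2 * (y * s))) :=
    mul_le_mul h.ρ_le hWη (by positivity) zero_le_one
  calc 2 / s ^ 2 * (3 * ρ * η ^ 2 * W * χ) =
      6 / (y * s ^ 2) * ((ρ * y) * (W * η) * (η * χ)) := by field_simp; ring
    _ ≤ 6 / (y * s ^ 2) * (1 * (1 / (2 * (y * s))) * (4 * (y ^ 60 * s ^ 4))) := by
        refine mul_le_mul_of_nonneg_left ?_ (by positivity)
        exact mul_le_mul hW1 h.η_mul_χ_le (mul_nonneg hη.le h.χ_nonneg) (by positivity)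
    _ = 12 * y ^ 58 * s := by field_simp; ring
    _ ≤ 12 * y ^ 58 * 1 := by gcongr; exact h.s_le
    _ = _ := mul_one _

theorem noise_term_le :
    4 / (s ^ 2) ^ 2 * (χ * (η * (4 * L + 82 * κ))) ≤ 1376 * y ^ 59 := by
  have hy := h.y_pos
  have hs := h.s_pos
  have hη := h.η_pos
  have h1 : (4 * L + 82 * κ) * y ≤ 86 := by
    have := h.L_le
    have := h.κ_le.trans h.s_le
    linarith
  have h2 : 0 ≤ (4 * L + 82 * κ) * y := by
    have := h.L_nonneg
    have := h.κ_pos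
    positivity
  calc 4 / (s ^ 2) ^ 2 * (χ * (η * (4 * L + 82 * κ))) =
      4 / (y * s ^ 4) * ((η * χ) * ((4 * L + 82 * κ) * y)) := by field_simp
    _ ≤ 4 / (y * s ^ 4) * ((4 * (y ^ 60 * s ^ 4)) * 86) := by
        refine mul_le_mul_of_nonneg_left ?_ (by positivity)
        exact mul_le_mul h.η_mul_χ_le h1 h2 (by positivity)
    _ = _ := by field_simp; ring

/-- With remainder level q = y⁶ε every term is a multiple of ηS/s³ plus a small constant. The exit
term has the worst coefficient, 12/y^27; the largest constant is 2/ε·4q = 8y⁶. -/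
theorem badEnd_bound_le {N S Se W : ℝ} (hN : 1 ≤ N * η * s * y ^ 5)
    (hN2 : N * η * s * y ^ 5 ≤ 2) (hS : 0 ≤ S) (hSe0 : 0 ≤ Se)
    (hSe : Se ≤ 2 * (1 - μ) / μ ^ 2 * (3 * S + μ * (χ * N)))
    (hW : 1 ≤ 4 * (W * (η * κ))) (hW0 : 0 < W) (hWκ : W * (η * (2 * κ)) ≤ 1) :
    (6 * N * η ^ 2 * S + 3 * N * η ^ 2 * χ) / (y ^ 11 * s) ^ 2 +
      2 / s ^ 2 * (4 * (y ^ 6 * s ^ 2) + 3 / (y ^ 6 * s ^ 2 * W) * (S + L ^ 2 * η ^ 2 * Se) +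
        9 / 4 * W * η ^ 4 * L ^ 4 / (y ^ 6 * s ^ 2) * Se +
        (3 * η * κ / (2 * (y ^ 6 * s ^ 2)) + 3 * ρ * η ^ 2) * S + 3 * ρ * η ^ 2 * W * χ) +
      4 / (s ^ 2) ^ 2 * (χ * (η * (4 * L + 82 * κ))) ≤
    η / (s ^ 3 * y ^ 29) * S + y ^ 4 := by
  have hy := h.y_pos
  have hs := h.s_pos
  have hη := h.η_pos
  have hN0 := h.N_pos hN
  have hX := h.error_term_le hN0.le hS hSe
  have hX0 : 0 ≤ η ^ 2 * Se := by positivity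
  have t0 := h.exit_term_le hN2 hS
  have t2 := h.window_term_le hN2 hS hX0 hX hW hW0
  have t3 := h.curvature_term_le hN2 hS hX0 hX hW0.le hWκ
  have t4 := h.drift_term_le hS
  have t5 := h.hessian_term_le hW0.le hWκ
  have t6 := h.noise_term_le
  have t1 : 2 / s ^ 2 * (4 * (y ^ 6 * s ^ 2)) = 8 * y ^ 6 := by field_simp; ring
  rw [← mul_assoc (L ^ 2)] at t2
  have hsum : 2 / s ^ 2 * (4 * (y ^ 6 * s ^ 2) + 3 / (y ^ 6 * s ^ 2 * W) *
        (S + L ^ 2 * η ^ 2 * Se) + 9 / 4 * W * η ^ 4 * L ^ 4 / (y ^ 6 * s ^ 2) * Se +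
        (3 * η * κ / (2 * (y ^ 6 * s ^ 2)) + 3 * ρ * η ^ 2) * S + 3 * ρ * η ^ 2 * W * χ) =
      2 / s ^ 2 * (4 * (y ^ 6 * s ^ 2)) +
      2 / s ^ 2 * (3 / (y ^ 6 * s ^ 2 * W) * (S + L ^ 2 * η ^ 2 * Se)) +
      2 / s ^ 2 * (9 / 4 * W * η ^ 4 * L ^ 4 / (y ^ 6 * s ^ 2) * Se) +
      2 / s ^ 2 * ((3 * η * κ / (2 * (y ^ 6 * s ^ 2)) + 3 * ρ * η ^ 2) * S) +
      2 / s ^ 2 * (3 * ρ * η ^ 2 * W * χ) := by ring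
  have hcoef : 12 / y ^ 27 + 48 / y ^ 7 + 1 + 3 / y ^ 7 + 6 / y ≤ 1 / y ^ 29 := by
    rw [le_div_iff₀ (by positivity)]
    have e : (12 / y ^ 27 + 48 / y ^ 7 + 1 + 3 / y ^ 7 + 6 / y) * y ^ 29 =
      12 * y ^ 2 + 51 * y ^ 22 + y ^ 29 + 6 * y ^ 28 := by field_simp; ring
    have h1 := mul_pow_le_one hy h.y_le (c := 36) 2 (by norm_num)
    have h2 := mul_pow_le_one hy h.y_le (c := 510) 22 (by norm_num)
    have h3 := mul_pow_le_one hy h.y_le (c := 10) 29 (by norm_num)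
    have h4 := mul_pow_le_one hy h.y_le (c := 60) 28 (by norm_num)
    linarith
  have hC := mul_le_mul_of_nonneg_right hcoef (by positivity : 0 ≤ η / s ^ 3 * S)
  have eC : 1 / y ^ 29 * (η / s ^ 3 * S) = η / (s ^ 3 * y ^ 29) * S := by field_simp
  have hconst : 24 * y ^ 33 + 8 * y ^ 6 + 384 * y ^ 126 + 36 * y ^ 124 + 12 * y ^ 58 +
      1376 * y ^ 59 ≤ y ^ 4 := by
    have e : 24 * y ^ 33 + 8 * y ^ 6 + 384 * y ^ 126 + 36 * y ^ 124 + 12 * y ^ 58 +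
      1376 * y ^ 59 = (24 * y ^ 29 + 8 * y ^ 2 + 384 * y ^ 122 + 36 * y ^ 120 + 12 * y ^ 54 +
      1376 * y ^ 55) * y ^ 4 := by ring
    rw [e]
    refine mul_le_of_le_one_left (by positivity) ?_
    have h1 := mul_pow_le_one hy h.y_le (c := 36) 2 (by norm_num)
    have h2 := mul_pow_le_one hy h.y_le (c := 240) 29 (by norm_num)
    have h3 := mul_pow_le_one hy h.y_le (c := 3840) 122 (by norm_num)
    have h4 := mul_pow_le_one hy h.y_le (c := 360) 120 (by norm_num)
    have h5 := mul_pow_le_one hy h.y_le (c := 120) 54 (by norm_num)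
    have h6 := mul_pow_le_one hy h.y_le (c := 13760) 55 (by norm_num)
    linarith
  rw [hsum, ← eC]
  linarith

end Tuned

/-! ### Gradient budget and failure probability. -/

namespace Tuned

variable {y s L ρ fmax σ δ d μ α η r κ χ : ℝ}
  (h : Tuned y s L ρ fmax σ δ d μ α η r κ χ)
include h

section Budget

variable {N T : ℝ} (hN : 1 ≤ N * η * s * y ^ 5) (hN2 : N * η * s * y ^ 5 ≤ 2)
  (hT : 1 ≤ T * (s ^ 4 * η) * y ^ 46) (hT2 : T * (s ^ 4 * η) * y ^ 46 ≤ 2)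
include hN hN2 hT

theorem epochs_fit : 8 * N ≤ T := by
  have hy := h.y_pos
  have hs := h.s_pos
  have hη := h.η_pos
  refine le_of_mul_le_mul_right (a := s ^ 4 * η * y ^ 46) ?_ (by positivity)
  calc 8 * N * (s ^ 4 * η * y ^ 46) = (N * η * s * y ^ 5) * (8 * y ^ 41) * s ^ 3 := by ring
    _ ≤ 2 * (8 * y ^ 41) * 1 := by
        gcongr
        exact pow_le_one₀ hs.le h.s_le
    _ = 16 * y ^ 41 := by ring
    _ ≤ 1 := mul_pow_le_one hy h.y_le 41 (by norm_num)
    _ ≤ _ := hT.trans (le_of_eq (by ring))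

include hT2

/-- `T` is of order y^(−46)/(s⁴η) while ηχ ≤ 4y^60 s⁴, so the noise accumulated over the run stays
below the allowance 1/y for `fmax`. -/
theorem gradient_budget : 4 / η * (fmax + (T + N) * (2 * L * η ^ 2 * χ)) ≤ 8 / (y * η) := by
  have hy := h.y_pos
  have hs := h.s_pos
  have hη := h.η_pos
  have hN0 := h.N_pos hN
  have hNT := h.epochs_fit hN hN2 hT
  have h1 : (T + N) * (2 * L * η ^ 2 * χ) * y ≤ 1 := by
    calc (T + N) * (2 * L * η ^ 2 * χ) * y = 2 * (T + N) * η * (L * y) * (η * χ) := by ring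
      _ ≤ 2 * (T + T) * η * 1 * (4 * (y ^ 60 * s ^ 4)) := by
          have hT0 : 0 ≤ T := by linarith
          refine mul_le_mul ?_ h.η_mul_χ_le (mul_nonneg hη.le h.χ_nonneg) (by positivity)
          have := h.L_nonneg
          gcongr
          · linarith
          · exact h.L_le
      _ = (T * (s ^ 4 * η) * y ^ 46) * (16 * y ^ 14) := by ring
      _ ≤ 2 * (16 * y ^ 14) := by gcongr
      _ = 32 * y ^ 14 := by ring
      _ ≤ 1 := mul_pow_le_one hy h.y_le 14 (by norm_num)
  have h2 := h.fmax_le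
  rw [div_mul_eq_mul_div, div_le_div_iff₀ hη (by positivity)]
  calc 4 * (fmax + (T + N) * (2 * L * η ^ 2 * χ)) * (y * η) =
      4 * (fmax * y + (T + N) * (2 * L * η ^ 2 * χ) * y) * η := by ring
    _ ≤ 4 * (1 + 1) * η := by gcongr
    _ = _ := by ring

-- The cost of one escape is of order s³/η, so the budget pays for O(s^(−3)) bad epochs up to powers
-- of 1/y. The factor y^(−46) in `T` makes the number of epochs T/N larger by a further power of
-- 1/y, which leaves a fraction below y ≤ δ.
omit hT2 in
theorem failure_budget : 4 * N * (8 / (y * η) / ((y ^ 11 * s) ^ 2 / (48 * N * η ^ 2)) +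
    2 * (η / (s ^ 3 * y ^ 29) * (8 / (y * η)) + y ^ 4 * (T / N + 1))) ≤ δ * T := by
  have hy := h.y_pos
  have hs := h.s_pos
  have hη := h.η_pos
  have hN0 := h.N_pos hN
  have hNT := h.epochs_fit hN hN2 hT
  have hT0 : 0 < T := by linarith
  have hTi : 1 / (s ^ 4 * η) ≤ T * y ^ 46 := by
    rw [div_le_iff₀ (by positivity)]
    exact hT.trans (le_of_eq (by ring))
  have e1 : 4 * N * (8 / (y * η) / ((y ^ 11 * s) ^ 2 / (48 * N * η ^ 2))) ≤
      6144 * y ^ 13 * T := by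
    calc 4 * N * (8 / (y * η) / ((y ^ 11 * s) ^ 2 / (48 * N * η ^ 2))) =
        1536 / y ^ 33 * (N * η * s * y ^ 5) ^ 2 * (1 / (s ^ 4 * η)) := by field_simp; ring
      _ ≤ 1536 / y ^ 33 * 2 ^ 2 * (T * y ^ 46) := by gcongr
      _ = _ := by field_simp; ring
  have e2 : 4 * N * (2 * (η / (s ^ 3 * y ^ 29) * (8 / (y * η)))) ≤ 128 * y ^ 11 * T := by
    calc 4 * N * (2 * (η / (s ^ 3 * y ^ 29) * (8 / (y * η)))) =
        64 / y ^ 35 * (N * η * s * y ^ 5) * (1 / (s ^ 4 * η)) := by field_simp; ring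
      _ ≤ 64 / y ^ 35 * 2 * (T * y ^ 46) := by gcongr
      _ = _ := by field_simp; ring
  have e3 : 4 * N * (2 * (y ^ 4 * (T / N + 1))) ≤ 16 * y ^ 4 * T := by
    calc 4 * N * (2 * (y ^ 4 * (T / N + 1))) = 8 * y ^ 4 * (T + N) := by field_simp; norm_num
      _ ≤ 8 * y ^ 4 * (T + T) := by gcongr; linarith
      _ = _ := by ring
  have e4 : 6144 * y ^ 13 * T + 128 * y ^ 11 * T + 16 * y ^ 4 * T ≤ y * T := by
    have h1 := mul_pow_le_one hy h.y_le (c := 61440) 12 (by norm_num)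
    have h2 := mul_pow_le_one hy h.y_le (c := 1280) 10 (by norm_num)
    have h3 := mul_pow_le_one hy h.y_le (c := 32) 3 (by norm_num)
    calc _ = (6144 * y ^ 12 + 128 * y ^ 10 + 16 * y ^ 3) * (y * T) := by ring
      _ ≤ 1 * (y * T) := by gcongr; linarith
      _ = _ := one_mul _
  have e5 : y * T ≤ δ * T := mul_le_mul_of_nonneg_right h.le_δ hT0.le
  linarith

end Budget

/-- The window on which gradients are averaged. -/
theorem exists_window (hηκ : η * κ * 4 ≤ 1) {N : ℕ} (hN : 1 ≤ N * (η * κ)) :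
    ∃ W : ℕ, 1 ≤ W ∧ W ≤ N ∧ (W : ℝ) * (η * (2 * κ)) ≤ 1 ∧ 1 ≤ 4 * ((W : ℝ) * (η * κ)) := by
  have hη := h.η_pos
  have hκ := h.κ_pos
  have hx : 0 < η * (2 * κ) := by positivity
  have h1 : (⌊1 / (η * (2 * κ))⌋₊ : ℝ) ≤ 1 / (η * (2 * κ)) := Nat.floor_le (by positivity)
  have h2 : 1 / (η * (2 * κ)) < ⌊1 / (η * (2 * κ))⌋₊ + 1 := Nat.lt_floor_add_one _
  rw [le_div_iff₀ hx] at h1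
  rw [div_lt_iff₀ hx] at h2
  set W := ⌊1 / (η * (2 * κ))⌋₊
  refine ⟨W, ?_, ?_, h1, by linarith⟩
  · by_contra! h3
    have : W = 0 := by omega
    rw [this] at h2
    norm_num at h2
    linarith
  · have h3 : (W : ℝ) * (η * κ) ≤ N * (η * κ) := by linarith
    exact_mod_cast le_of_mul_le_mul_right h3 (by positivity)

end Tuned

namespace SGDSetting

variable {d : ℕ} {Ω Θ Θ' : Type*} [MeasurableSpace Ω] [MeasurableSpace Θ]
    [MeasurableSpace Θ'] {P : Measure Ω} {D : Measure Θ} {D' : Measure Θ'}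
    [IsProbabilityMeasure P] [IsProbabilityMeasure D] [IsProbabilityMeasure D']
    {f : EuclideanSpace ℝ (Fin d) → ℝ}
    {G : EuclideanSpace ℝ (Fin d) → Θ → EuclideanSpace ℝ (Fin d)}
    {C : EuclideanSpace ℝ (Fin d) → Θ' → EuclideanSpace ℝ (Fin d)}
    {z : ℕ → Ω → EuclideanSpace ℝ (Fin d) × Θ × Θ'} {fmax L ρ σ μ η r χ : ℝ}
    (hS : SGDSetting P D D' f G C z fmax L ρ σ μ η r χ)
    {y s δ α κ : ℝ} (ht : Tuned y s L ρ fmax σ δ d μ α η r κ χ)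
include hS ht

theorem measureReal_badEnd_le_of_tuned {N : ℕ} (hN : 1 ≤ N * η * s * y ^ 5)
    (hN2 : N * η * s * y ^ 5 ≤ 2) (y₀ : EuclideanSpace ℝ (Fin d)) :
    P.real {ω | BadEnd f (y ^ 11 * s) κ (s ^ 2) y₀
      (epoch η (y ^ 11 * s) G C y₀ (fun t => z t ω) N).1} ≤
    η / (s ^ 3 * y ^ 29) * ∑ n ∈ Finset.range N, epochGrad P f G C z η (y ^ 11 * s) y₀ n +
      y ^ 4 := by
  have hy := ht.y_pos
  have hs := ht.s_pos
  have hη := ht.η_pos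
  have hκ := ht.κ_pos
  have hR : 0 < y ^ 11 * s := by positivity
  have hρR : ρ * (y ^ 11 * s) ≤ κ := by
    calc ρ * (y ^ 11 * s) = (ρ * y) * y ^ 9 * (y * s) := by ring
      _ ≤ 1 * 1 * κ := by
          have := ht.ρ_nonneg
          gcongr
          · exact ht.ρ_le
          · exact pow_le_one₀ hy.le ht.y_lt_one.le
          · exact ht.κ_ge
      _ = κ := by ring
  have hηκ : η * κ * 4 ≤ 1 := by
    calc η * κ * 4 ≤ y ^ 80 * κ * 4 := by gcongr; exact ht.η_le_y
      _ = 4 * y ^ 79 * (κ * y) := by ring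
      _ ≤ 1 * 1 := by
          gcongr
          · exact mul_pow_le_one hy ht.y_le 79 (by norm_num)
          · exact ht.κ_le.trans ht.s_le
      _ = 1 := one_mul 1
  obtain ⟨W, hW1, hWN, hWκ, hW4⟩ := ht.exists_window hηκ (ht.one_le_N_mul hN)
  have hηL : η * L ≤ 1 := by
    have := ht.η_mul_L_le
    have := mul_nonneg hη.le ht.L_nonneg
    linarith
  have hSe := hS.sum_epochErr_le (y ^ 11 * s) y₀ N (w := fun _ => 1) (fun _ => zero_le_one)
    (fun _ => le_rfl) (fun _ => le_rfl)
  simp only [one_mul, Finset.sum_const, Finset.card_range, nsmul_eq_mul, mul_one] at hSe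
  have hb := hS.measureReal_badEnd_le hR hκ hρR hηL y₀ hW1 hWN hWκ (ε := s ^ 2) (by positivity)
    (q := y ^ 6 * s ^ 2) (by positivity)
  refine le_trans hb (ht.badEnd_bound_le hN hN2
    (Finset.sum_nonneg fun n _ => epochGrad_nonneg _ _ _)
    (Finset.sum_nonneg fun n _ => epochErr_nonneg _ _ _) hSe hW4 (by exact_mod_cast hW1) hWκ)

theorem sum_epochGrad_ge_of_tuned {ℓ₀ σ₀ : ℝ} (hV : OracleDifferenceBound f G D ℓ₀ σ₀)
    (hℓ0 : 0 ≤ ℓ₀) (hℓ : ℓ₀ * y ≤ 1) (hσ0 : 0 ≤ σ₀) (hσ : σ₀ * y ≤ 1) (hα : σ₀ = 0 ∨ α = d)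
    (hr : 0 < r) (hd : (d : ℝ) ≤ Real.exp (1 / y) * (s ^ 2 * μ))
    (hηd : y ^ 80 * (s ^ 4 * μ ^ 2) ≤ η * d) {I : ℕ} (hI : 1 ≤ I * η * s * y ^ 5)
    (hN2 : ((I + 1 : ℕ) : ℝ) * η * s * y ^ 5 ≤ 2) {y₀ : EuclideanSpace ℝ (Fin d)}
    (hneg : NegCurvature f κ y₀) :
    (y ^ 11 * s) ^ 2 / (48 * ((I + 1 : ℕ) : ℝ) * η ^ 2) ≤
      ∑ n ∈ Finset.range (I + 1), epochGrad P f G C z η (y ^ 11 * s) y₀ n := by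
  have hy := ht.y_pos
  have hs := ht.s_pos
  have hη := ht.η_pos
  have hκ := ht.κ_pos
  have hN : 1 ≤ ((I + 1 : ℕ) : ℝ) * η * s * y ^ 5 := by
    refine hI.trans ?_
    gcongr
    linarith
  have hηL : η * L ≤ 1 := by
    have := ht.η_mul_L_le
    have := mul_nonneg hη.le ht.L_nonneg
    linarith
  have hηκ : η * κ ≤ 1 := by
    calc η * κ ≤ y ^ 80 * κ := by gcongr; exact ht.η_le_y
      _ = y ^ 79 * (κ * y) := by ring
      _ ≤ 1 * 1 := by
          gcongr
          · exact pow_le_one₀ hy.le ht.y_lt_one.le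
          · exact ht.κ_le.trans ht.s_le
      _ = 1 := one_mul 1
  exact hS.sum_epochGrad_ge_of_negCurvature (by positivity) hV hκ hneg hηL (by omega)
    (ht.one_le_N_mul hN) hr (ht.radius_condition hN)
    (ht.compression_condition hℓ0 hℓ) (ht.coupling_condition hN hN2 hℓ0 hℓ)
    (ht.oracle_noise_condition hσ0 hσ hα) (ht.exit_condition hN hN2)
    (ht.growth_condition hd hηd hηκ hI)

end SGDSetting

/-! ### Bounds for the step size scale. -/

section StepScale

variable {α ε μ : ℝ} {d : ℕ} (hα : 1 ≤ α) (hε : 0 < ε) (hε1 : ε ≤ 1) (hμ : 0 < μ) (hμ1 : μ ≤ 1)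
include hα hε

theorem stepScale_inv_pos :
    0 < max (α / ε ^ 2) (max (√(1 - μ) / (μ * ε)) ((1 - μ) * (d : ℝ) / (μ ^ 2 * √ε))) :=
  lt_max_of_lt_left (by have := zero_lt_one.trans_le hα; positivity)

theorem stepScale_pos : 0 < stepScale α d ε μ := inv_pos.2 (stepScale_inv_pos hα hε)

theorem stepScale_mul_le : stepScale α d ε μ * α ≤ ε ^ 2 := by
  have h := stepScale_inv_pos (μ := μ) (d := d) hα hε
  rw [stepScale, inv_mul_le_iff₀ h, ← div_le_iff₀ (by positivity)]
  exact le_max_left _ _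

include hμ

theorem stepScale_mul_sqrt_le : stepScale α d ε μ * √(1 - μ) ≤ μ * ε := by
  have h := stepScale_inv_pos (μ := μ) (d := d) hα hε
  rw [stepScale, inv_mul_le_iff₀ h, ← div_le_iff₀ (by positivity)]
  exact (le_max_left _ _).trans (le_max_right _ _)

theorem stepScale_mul_dim_le : stepScale α d ε μ * ((1 - μ) * d) ≤ μ ^ 2 * √ε := by
  have h := stepScale_inv_pos (μ := μ) (d := d) hα hε
  have hs := Real.sqrt_pos.2 hε
  rw [stepScale, inv_mul_le_iff₀ h, ← div_le_iff₀ (by positivity)]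
  exact (le_max_right _ _).trans (le_max_right _ _)

include hμ1

theorem inv_stepScale_le : (stepScale α d ε μ)⁻¹ ≤
    α / ε ^ 2 + √(1 - μ) / (μ * ε) + (1 - μ) * (d : ℝ) / (μ ^ 2 * √ε) := by
  have hs := Real.sqrt_pos.2 hε
  have h1 : 0 ≤ α / ε ^ 2 := by have := zero_lt_one.trans_le hα; positivity
  have h2 : 0 ≤ √(1 - μ) / (μ * ε) := by positivity
  have h3 : 0 ≤ (1 - μ) * (d : ℝ) / (μ ^ 2 * √ε) :=
    div_nonneg (mul_nonneg (by linarith) (by positivity)) (by positivity)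
  rw [stepScale, inv_inv]
  refine max_le (by linarith) (max_le (by linarith) (by linarith))

include hε1

theorem le_stepScale_mul (hd : 1 ≤ d) (hαd : α ≤ d) :
    ε ^ 2 * μ ^ 2 ≤ stepScale α d ε μ * d := by
  have h := stepScale_inv_pos (μ := μ) (d := d) hα hε
  have hs := Real.sqrt_pos.2 hε
  have hd' : (1 : ℝ) ≤ d := by exact_mod_cast hd
  have hεs : ε ^ 2 ≤ √ε := by
    refine Real.le_sqrt_of_sq_le ?_
    rw [← pow_mul]
    exact pow_le_of_le_one hε.le hε1 (by norm_num)
  have hsq : √(1 - μ) ≤ 1 := Real.sqrt_le_one.2 (by linarith)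
  have hμ2 : μ ^ 2 ≤ μ := pow_le_of_le_one hμ.le hμ1 two_ne_zero
  have hε2 : ε ^ 2 ≤ ε := pow_le_of_le_one hε.le hε1 two_ne_zero
  rw [stepScale, ← div_eq_inv_mul, le_div_iff₀ h, mul_comm, ← le_div_iff₀ (by positivity)]
  refine max_le ?_ (max_le ?_ ?_)
  · refine div_le_div₀ (by positivity) hαd (by positivity) ?_
    exact mul_le_of_le_one_right (by positivity) (pow_le_one₀ hμ.le hμ1)
  · refine div_le_div₀ (by positivity) (hsq.trans hd') (by positivity) ?_
    rw [mul_comm]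
    exact mul_le_mul hμ2 hε2 (by positivity) hμ.le
  · refine div_le_div₀ (by positivity) ?_ (by positivity) ?_
    · exact mul_le_of_le_one_left (by positivity) (by linarith)
    · rw [mul_comm]
      exact mul_le_mul_of_nonneg_left hεs (by positivity)

end StepScale

/-- The base `y` is the inverse of the product of the constants and 1 + log(d/(εμ)). Including the
logarithm makes exp(1/y) dominate d/(εμ), as the exponential growth at a saddle requires. -/
theorem exists_hiddenFactor_base {fmax L ρ σ ℓ δ : ℝ} {d : ℕ} {ε μ : ℝ} (hf : 0 ≤ fmax)
    (hL : 0 < L) (hρ : 0 < ρ) (hσ : 0 ≤ σ) (hℓ : 0 ≤ ℓ) (hδ : 0 < δ) (hδ1 : δ < 1) (hd : 1 ≤ d)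
    (hε : 0 < ε) (hε1 : ε ≤ 1) (hμ : 0 < μ) (hμ1 : μ ≤ 1) (k : ℕ) :
    ∃ y : ℝ, 0 < y ∧ y ≤ 1 / 6 ∧ L * y ≤ 1 ∧ ρ * y ≤ 1 ∧ y ≤ ρ ∧ fmax * y ≤ 1 ∧ σ * y ≤ 1 ∧
      ℓ * y ≤ 1 ∧ y ≤ δ ∧ (d : ℝ) ≤ Real.exp (1 / y) * (ε * μ) ∧
      hiddenFactor 1 k fmax L ρ σ ℓ δ d ε μ = (y ^ k)⁻¹ := by
  have hd' : (1 : ℝ) ≤ d := by exact_mod_cast hd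
  have hL2 : 2 ≤ L + L⁻¹ := by
    have : 0 ≤ (L - 1) ^ 2 / L := by positivity
    have e : (L - 1) ^ 2 / L = L + L⁻¹ - 2 := by field_simp; ring
    linarith
  have hρ2 : 2 ≤ ρ + ρ⁻¹ := by
    have : 0 ≤ (ρ - 1) ^ 2 / ρ := by positivity
    have e : (ρ - 1) ^ 2 / ρ = ρ + ρ⁻¹ - 2 := by field_simp; ring
    linarith
  have hδ2 : 1 ≤ δ⁻¹ := (one_le_inv₀ hδ).2 hδ1.le
  have hLi := inv_pos.2 hL
  have hρi := inv_pos.2 hρ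
  have hlog : 0 ≤ Real.log ((d : ℝ) / (ε * μ)) := by
    refine Real.log_nonneg ((one_le_div (by positivity)).2 ?_)
    exact (mul_le_one₀ hε1 hμ.le hμ1).trans hd'
  set Q := 1 + fmax + L + L⁻¹ + ρ + ρ⁻¹ + σ + ℓ + δ⁻¹ with hQ
  set l := Real.log ((d : ℝ) / (ε * μ)) with hl
  -- The summands 1, L + 1/L, ρ + 1/ρ and 1/δ contribute at least 1, 2, 2 and 1.
  have hQ6 : 6 ≤ Q := by linarith
  have hQB : Q ≤ Q * (1 + l) := le_mul_of_one_le_right (by linarith) (by linarith)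
  have hB0 : 0 < Q * (1 + l) := by linarith
  have hlB : l ≤ Q * (1 + l) := by nlinarith
  have key : ∀ c, c ≤ Q → c * (Q * (1 + l))⁻¹ ≤ 1 := fun c hc => by
    rw [← div_eq_mul_inv, div_le_one hB0]; linarith
  have key' : ∀ c, 0 < c → c⁻¹ ≤ Q → (Q * (1 + l))⁻¹ ≤ c := fun c hc h =>
    inv_le_of_inv_le₀ hc (h.trans hQB)
  refine ⟨(Q * (1 + l))⁻¹, inv_pos.2 hB0, ?_, key _ (by linarith), key _ (by linarith),
    key' _ hρ (by linarith), key _ (by linarith), key _ (by linarith), key _ (by linarith),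
    key' _ hδ (by linarith), ?_, ?_⟩
  · rw [one_div]
    exact inv_anti₀ (by norm_num) (hQ6.trans hQB)
  · rw [one_div, inv_inv, ← div_le_iff₀ (by positivity), ← Real.log_le_iff_le_exp (by positivity)]
    exact hlB
  · rw [hiddenFactor, one_mul, inv_pow, inv_inv, mul_pow]

theorem eqUpTo_of_eq_pow_mul {y a b : ℝ} (hy : 0 < y) (hy1 : y ≤ 1) {j k : ℕ} (hjk : j ≤ k)
    (hb : 0 ≤ b) (ha : a = y ^ j * b) : EqUpTo (y ^ k)⁻¹ a b := by
  rw [EqUpTo, div_inv_eq_mul, ha, mul_comm b]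
  refine ⟨mul_le_mul_of_nonneg_right (pow_le_pow_of_le_one hy.le hy1 hjk) hb,
    mul_le_mul_of_nonneg_right ?_ hb⟩
  exact (pow_le_one₀ hy.le hy1).trans ((one_le_inv₀ (by positivity)).2 (pow_le_one₀ hy.le hy1))

theorem two_le_inv_pow_mul {y : ℝ} (hy : 0 < y) (hy6 : y ≤ 1 / 6) {j k : ℕ} (hjk : j < k) :
    2 ≤ (y ^ k)⁻¹ * y ^ j := by
  obtain ⟨m, rfl⟩ := Nat.exists_eq_add_of_lt hjk
  rw [← div_eq_inv_mul, le_div_iff₀ (by positivity)]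
  have h1 := mul_pow_le_one hy hy6 (c := 2) 1 (by norm_num)
  calc 2 * y ^ (j + m + 1) = (2 * y ^ 1) * y ^ m * y ^ j := by ring
    _ ≤ 1 * 1 * y ^ j := by gcongr; exact pow_le_one₀ hy.le (by linarith)
    _ = _ := by ring

/-- Integer counts comparable with `1 / (y ^ j * x)`. -/
theorem exists_count {y x : ℝ} (hy : 0 < y) (hy6 : y ≤ 1 / 6) (hx : 0 < x) (hx2 : x ≤ 1 / 2)
    {j k : ℕ} (hjk : j < k) : ∃ n : ℕ, 1 ≤ n * x * y ^ j ∧ (n + 1 : ℝ) * x * y ^ j ≤ 2 ∧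
      EqUpTo (y ^ k)⁻¹ n (1 / x) := by
  have hz : 0 < x * y ^ j := by positivity
  have hz2 : x * y ^ j ≤ 1 / 2 :=
    (mul_le_of_le_one_right hx.le (pow_le_one₀ hy.le (by linarith))).trans hx2
  have h1 : 1 / (x * y ^ j) ≤ ⌈1 / (x * y ^ j)⌉₊ := Nat.le_ceil _
  have h2 : (⌈1 / (x * y ^ j)⌉₊ : ℝ) < 1 / (x * y ^ j) + 1 := Nat.ceil_lt_add_one (by positivity)
  set n := ⌈1 / (x * y ^ j)⌉₊
  have h3 : 1 ≤ n * x * y ^ j := by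
    rw [div_le_iff₀ hz] at h1; linarith
  have h4 : (n + 1 : ℝ) * x * y ^ j ≤ 2 := by
    have h5 := mul_le_mul_of_nonneg_right h2.le hz.le
    have e : (1 / (x * y ^ j) + 1) * (x * y ^ j) = 1 + x * y ^ j := by field_simp
    rw [e] at h5
    linarith
  have hy1 : y ^ j ≤ 1 := pow_le_one₀ hy.le (by linarith)
  refine ⟨n, h3, h4, ?_, ?_⟩
  · rw [div_inv_eq_mul, div_mul_eq_mul_div, one_mul, div_le_iff₀ hx]
    have : (n : ℝ) * x * y ^ j ≤ n * x * 1 := by gcongr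
    have : y ^ k ≤ 1 := pow_le_one₀ hy.le (by linarith)
    linarith
  · rw [mul_one_div, le_div_iff₀ hx]
    refine le_of_mul_le_mul_right (a := y ^ j) ?_ (by positivity)
    have := two_le_inv_pow_mul hy hy6 hjk
    have : 0 ≤ x * y ^ j := hz.le
    linarith

/-- The tuned parameters exist. -/
theorem exists_tuned {fmax L ρ σ δ α y s μ : ℝ} {d : ℕ}
    (hL : 0 < L) (hρ : 0 < ρ) (hσ : 0 ≤ σ) (hd : 1 ≤ d)
    (hs : 0 < s) (hs1 : s ≤ 1) (hμ : 0 < μ) (hμ1 : μ ≤ 1) (hα : 1 ≤ α)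
    (hy : 0 < y) (hy6 : y ≤ 1 / 6) (hLy : L * y ≤ 1) (hρy : ρ * y ≤ 1) (hyρ : y ≤ ρ)
    (hfy : fmax * y ≤ 1) (hσy : σ * y ≤ 1) (hyδ : y ≤ δ) {η r : ℝ}
    (hη : η = y ^ 80 * stepScale α d (s ^ 2) μ) (hr : r = y ^ 30 * (s ^ 2 / √η)) :
    0 < r ∧ Tuned y s L ρ fmax σ δ d μ α η r (√(ρ * s ^ 2)) (2 * σ ^ 2 + 2 * r ^ 2) := by
  have hε : 0 < s ^ 2 := by positivity
  have hη0 : 0 < η := by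
    rw [hη]; exact mul_pos (by positivity) (stepScale_pos hα hε)
  have hsη := Real.sqrt_pos.2 hη0
  have hsqrt : √(s ^ 2) = s := Real.sqrt_sq hs.le
  have hκ : √(ρ * s ^ 2) = √ρ * s := by rw [Real.sqrt_mul hρ.le, hsqrt]
  have hy1 : y ≤ 1 := by linarith
  refine ⟨by rw [hr]; positivity, ?_⟩
  refine
    { y_pos := hy, y_le := hy6, s_pos := hs, s_le := hs1, L_nonneg := hL.le, L_le := hLy
      ρ_nonneg := hρ.le, ρ_le := hρy, fmax_le := hfy, σ_nonneg := hσ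
      σ_le := hσy, le_δ := hyδ, one_le_d := by exact_mod_cast hd
      μ_pos := hμ, μ_le := hμ1, one_le_α := hα, η_pos := hη0, η_le := ?_, η_sqrt_le := ?_
      η_dim_le := ?_, noise_eq := ?_, κ_ge := ?_, κ_le := ?_, χ_eq := rfl }
  · rw [hη, mul_assoc]
    refine mul_le_mul_of_nonneg_left ?_ (by positivity)
    exact (stepScale_mul_le hα hε).trans (le_of_eq (by ring))
  · rw [hη, mul_assoc]
    exact mul_le_mul_of_nonneg_left (stepScale_mul_sqrt_le hα hε hμ) (by positivity)
  · rw [hη, mul_assoc]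
    refine mul_le_mul_of_nonneg_left ?_ (by positivity)
    exact (stepScale_mul_dim_le hα hε hμ).trans (le_of_eq (by rw [hsqrt]))
  · have e : r ^ 2 * √η ^ 2 = y ^ 60 * s ^ 4 := by rw [hr]; field_simp
    rwa [Real.sq_sqrt hη0.le] at e
  · rw [hκ]
    refine mul_le_mul_of_nonneg_right (Real.le_sqrt_of_sq_le ?_) hs.le
    exact (pow_le_of_le_one hy.le hy1 two_ne_zero).trans hyρ
  · rw [hκ]
    have h1 : √ρ ≤ 1 / y := by
      rw [Real.sqrt_le_iff]
      refine ⟨by positivity, ?_⟩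
      rw [div_pow, one_pow, le_div_iff₀ (by positivity)]
      calc ρ * y ^ 2 = ρ * y * y := by ring
        _ ≤ 1 * 1 := by gcongr
        _ = 1 := one_mul 1
    calc √ρ * s * y ≤ 1 / y * s * y := by gcongr
      _ = s := by field_simp

/-- The number of iterations, in terms of the accuracy. -/
theorem iterations_le {y s η α μ T : ℝ} {d : ℕ} (hy : 0 < y) (hy6 : y ≤ 1 / 6) (hs : 0 < s)
    (hμ : 0 < μ) (hμ1 : μ ≤ 1) (hα : 1 ≤ α) (hη : η = y ^ 80 * stepScale α d (s ^ 2) μ)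
    (hT : T * (s ^ 4 * η) * y ^ 46 ≤ 2) :
    T ≤ (y ^ 200)⁻¹ * (α / (s ^ 2) ^ 4 + √(1 - μ) / (μ * (s ^ 2) ^ 3) +
      (d : ℝ) * (1 - μ) / (μ ^ 2 * ((s ^ 2) ^ 2 * √(s ^ 2)))) := by
  have hε : 0 < s ^ 2 := by positivity
  have hp := stepScale_pos (d := d) (μ := μ) hα hε
  have hinv := inv_stepScale_le (d := d) hα hε hμ hμ1
  rw [Real.sqrt_sq hs.le] at hinv ⊢
  set p := stepScale α d (s ^ 2) μ
  have h1 : T ≤ (y ^ 200)⁻¹ * (p⁻¹ / s ^ 4) := by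
    have h2 := two_le_inv_pow_mul hy hy6 (j := 126) (k := 200) (by norm_num)
    refine le_of_mul_le_mul_right (a := s ^ 4 * p * y ^ 126) ?_ (by positivity)
    calc T * (s ^ 4 * p * y ^ 126) = T * (s ^ 4 * η) * y ^ 46 := by rw [hη]; ring
      _ ≤ (y ^ 200)⁻¹ * y ^ 126 := hT.trans h2
      _ = _ := by field_simp
  refine h1.trans (mul_le_mul_of_nonneg_left ?_ (by positivity))
  calc p⁻¹ / s ^ 4 ≤ _ / s ^ 4 := div_le_div_of_nonneg_right hinv (by positivity)
    _ = _ := by field_simp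

/-- The number of resets is at most 2T/(I + 1), of order (ε²η)^(−1)·η√ε = ε^(−3/2) up to powers of
`y`. -/
theorem resetCommunication_le {y s η n I T d : ℝ} (hy : 0 < y) (hy6 : y ≤ 1 / 6) (hs : 0 < s)
    (hη : 0 < η) (hn0 : 0 ≤ n) (hd : 0 ≤ d) (hI : 1 ≤ (I + 1) * (η * s) * y ^ 5)
    (hT : T * (s ^ 4 * η) * y ^ 46 ≤ 2) (hn : n * (I + 1) ≤ 2 * T) :
    n * d ≤ (y ^ 200)⁻¹ * (d / (s ^ 2) ^ (3 / 2 : ℝ)) := by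
  have e : (s ^ 2) ^ (3 / 2 : ℝ) = s ^ 3 := by
    rw [← Real.rpow_natCast s 2, ← Real.rpow_mul hs.le, ← Real.rpow_natCast s 3]
    norm_num
  have h2 := two_le_inv_pow_mul hy hy6 (j := 40) (k := 200) (by norm_num)
  have h1 : n ≤ (y ^ 200)⁻¹ / s ^ 3 := by
    rw [le_div_iff₀ (by positivity)]
    refine le_of_mul_le_mul_right (a := y ^ 41) ?_ (by positivity)
    calc n * s ^ 3 * y ^ 41 ≤ n * s ^ 3 * y ^ 41 * ((I + 1) * (η * s) * y ^ 5) :=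
          le_mul_of_one_le_right (by positivity) hI
      _ = n * (I + 1) * (η * s ^ 4 * y ^ 46) := by ring
      _ ≤ 2 * T * (η * s ^ 4 * y ^ 46) := mul_le_mul_of_nonneg_right hn (by positivity)
      _ = 2 * (T * (s ^ 4 * η) * y ^ 46) := by ring
      _ ≤ 2 * 2 := by gcongr
      _ ≤ (y ^ 200)⁻¹ * y ^ 41 := by
        have h3 := two_le_inv_pow_mul hy hy6 (j := 42) (k := 200) (by norm_num)
        have h4 : y ^ 42 = y ^ 41 * y := by ring
        have h5 : (0 : ℝ) ≤ (y ^ 200)⁻¹ * y ^ 41 := by positivity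
        rw [h4, ← mul_assoc] at h3
        have h6 := mul_le_mul_of_nonneg_left hy6 h5
        linarith
  rw [e]
  calc n * d ≤ (y ^ 200)⁻¹ / s ^ 3 * d := mul_le_mul_of_nonneg_right h1 hd
    _ = _ := by ring

/-! ### Assembly of the estimates. -/

namespace SGDSetting

variable {d : ℕ} {Ω Θ Θ' : Type*} [MeasurableSpace Ω] [MeasurableSpace Θ]
    [MeasurableSpace Θ'] {P : Measure Ω} {D : Measure Θ} {D' : Measure Θ'}
    [IsProbabilityMeasure P] [IsProbabilityMeasure D] [IsProbabilityMeasure D']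
    {f : EuclideanSpace ℝ (Fin d) → ℝ}
    {G : EuclideanSpace ℝ (Fin d) → Θ → EuclideanSpace ℝ (Fin d)}
    {C : EuclideanSpace ℝ (Fin d) → Θ' → EuclideanSpace ℝ (Fin d)}
    {z : ℕ → Ω → EuclideanSpace ℝ (Fin d) × Θ × Θ'} {fmax L ρ σ μ η r χ : ℝ}
    (hS : SGDSetting P D D' f G C z fmax L ρ σ μ η r χ)
    {y s δ α : ℝ} (ht : Tuned y s L ρ fmax σ δ d μ α η r (√(ρ * s ^ 2)) χ)
include hS ht

theorem run_succeeds_of_tuned {ℓ₀ σ₀ : ℝ} (hV : OracleDifferenceBound f G D ℓ₀ σ₀)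
    (hℓ0 : 0 ≤ ℓ₀) (hℓ : ℓ₀ * y ≤ 1) (hσ0 : 0 ≤ σ₀) (hσ : σ₀ * y ≤ 1) (hα : σ₀ = 0 ∨ α = d)
    (hr : 0 < r) (hd : (d : ℝ) ≤ Real.exp (1 / y) * (s ^ 2 * μ))
    (hηd : y ^ 80 * (s ^ 4 * μ ^ 2) ≤ η * d) {I T : ℕ} (hI : 1 ≤ I * (η * s) * y ^ 5)
    (hN2 : (I + 1 : ℝ) * (η * s) * y ^ 5 ≤ 2) (hT : 1 ≤ T * (s ^ 4 * η) * y ^ 46)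
    (hT2 : T * (s ^ 4 * η) * y ^ 46 ≤ 2) {p : CompressedSGDParams}
    (hp : p = { stepSize := η, escapeIters := I, escapeRadius := y ^ 11 * s, resetError := true })
    (x₀ : EuclideanSpace ℝ (Fin d)) :
    ENNReal.ofReal (1 - δ) ≤ P {ω |
      0 < (CompressedSGD.resetTimes p G C x₀ (fun t => z t ω) T).card ∧
      (CompressedSGD.resetTimes p G C x₀ (fun t => z t ω) T).card ≤
        2 * (CompressedSGD.sospResetTimes p G C x₀ (fun t => z t ω) T f ρ (s ^ 2)).card ∧
      (CompressedSGD.resetTimes p G C x₀ (fun t => z t ω) T).card * (I + 1) ≤ 2 * T} := by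
  have hy := ht.y_pos
  have hs := ht.s_pos
  have hη := ht.η_pos
  have hcast : ((I + 1 : ℕ) : ℝ) = (I : ℝ) + 1 := by push_cast; ring
  have hI1 : 1 ≤ I * η * s * y ^ 5 := hI.trans (le_of_eq (by ring))
  have hN1 : 1 ≤ ((I : ℝ) + 1) * η * s * y ^ 5 := by
    refine hI1.trans ?_
    gcongr
    linarith
  have hN2' : ((I : ℝ) + 1) * η * s * y ^ 5 ≤ 2 := (le_of_eq (by ring)).trans hN2
  have hN0 : (0 : ℝ) < (I : ℝ) + 1 := by positivity
  refine hS.run_succeeds (s := (y ^ 11 * s) ^ 2 / (48 * ((I : ℝ) + 1) * η ^ 2))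
    (c := η / (s ^ 3 * y ^ 29)) (τ := y ^ 4) ht.η_mul_L_le ht.descent_condition
    (by positivity) (by positivity) (by positivity) (by positivity) ?_ ?_ ?_ ?_
    (ht.gradient_budget hN1 hN2' hT hT2) (ht.failure_budget hN1 hN2' hT) hp x₀
  · have := mul_pow_le_one hy ht.y_le (c := 2) 4 (by norm_num)
    linarith
  · intro t y₀ hneg
    rw [← hcast]
    exact (hS.shift t).sum_epochGrad_ge_of_tuned ht hV hℓ0 hℓ hσ0 hσ hα hr hd hηd hI1
      (by rw [hcast]; exact hN2') hneg
  · intro t y₀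
    exact (hS.shift t).measureReal_badEnd_le_of_tuned ht (by rw [hcast]; exact hN1)
      (by rw [hcast]; exact hN2') y₀
  · have := ht.epochs_fit hN1 hN2' hT
    exact_mod_cast this

end SGDSetting

theorem mainTheorem2 :
    ∃ (K : ℝ) (k : ℕ), 0 < K ∧
    -- problem constants, failure probability, dimension, accuracy, compression parameter
    ∀ (fmax L ρ σ ℓ δ : ℝ) (d : ℕ) (ε μ : ℝ) (lipschitzOracle : Bool) (A α : ℝ),
      0 ≤ fmax → 0 < L → 0 < ρ → 0 ≤ σ → 0 ≤ ℓ → 0 < δ → δ < 1 → 1 ≤ d →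
      0 < ε → ε ≤ 1 → 0 < μ → μ ≤ 1 →
      A = hiddenFactor K k fmax L ρ σ ℓ δ d ε μ →
      α = (if lipschitzOracle then 1 else (d : ℝ)) →
    -- step size, noise level, escaping radius, escaping time, number of iterations
    ∃ (η r R : ℝ) (I T : ℕ),
      EqUpTo A η (stepScale α d ε μ) ∧
      EqUpTo A r (ε / √η) ∧
      EqUpTo A R (√ε) ∧
      EqUpTo A I (1 / (η * √ε)) ∧
      EqUpTo A T (1 / (ε ^ 2 * η)) ∧
      (T : ℝ) ≤ A * (α / ε ^ 4 + √(1 - μ) / (μ * ε ^ 3)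
        + (d : ℝ) * (1 - μ) / (μ ^ 2 * (ε ^ 2 * √ε))) ∧
      ∀ {Θ Θ' Ω : Type*} [MeasurableSpace Θ] [MeasurableSpace Θ'] [MeasurableSpace Ω]
        (D : Measure Θ) (D' : Measure Θ') (P : Measure Ω)
        [IsProbabilityMeasure D] [IsProbabilityMeasure D'] [IsProbabilityMeasure P]
        (f : EuclideanSpace ℝ (Fin d) → ℝ)
        (G : EuclideanSpace ℝ (Fin d) → Θ → EuclideanSpace ℝ (Fin d))
        (C : EuclideanSpace ℝ (Fin d) → Θ' → EuclideanSpace ℝ (Fin d))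
        (x₀ : EuclideanSpace ℝ (Fin d)) (z : ℕ → Ω → EuclideanSpace ℝ (Fin d) × Θ × Θ')
        (p : CompressedSGDParams),
        IsRegularObjective f fmax L ρ →
        IsStochasticGradient f G D σ →
        (lipschitzOracle = true → IsLipschitzStochasticGradient G ℓ) →
        IsCompressor C D' μ →
        IsSampleSequence P D D' r z →
        p = { stepSize := η, escapeIters := I, escapeRadius := R, resetError := true } →
        ENNReal.ofReal (1 - δ) ≤
          P {ω |
            -- the condition is triggered, and at least half of the reset points are SOSP
            (CompressedSGD.resetTimes p G C x₀ (fun t => z t ω) T).Nonempty ∧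
            (CompressedSGD.resetTimes p G C x₀ (fun t => z t ω) T).card ≤
              2 * (CompressedSGD.sospResetTimes p G C x₀ (fun t => z t ω) T f ρ ε).card ∧
            -- the additional communication due to the resets
            (CompressedSGD.resetCommunication p G C x₀ (fun t => z t ω) T : ℝ) ≤
              A * ((d : ℝ) / ε ^ (3 / 2 : ℝ))} := by
  -- The exponent 200 exceeds every power of 1/y lost in the parameters, the iteration count and the
  -- communication bound.
  refine ⟨1, 200, zero_lt_one, ?_⟩
  intro fmax L ρ σ ℓ δ d ε μ lip A α hf hL hρ hσ hℓ hδ hδ1 hd hε hε1 hμ hμ1 hA hα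
  obtain ⟨y, hy, hy6, hLy, hρy, hyρ, hfy, hσy, hℓy, hyδ, hdy, hAy⟩ :=
    exists_hiddenFactor_base hf hL hρ hσ hℓ hδ hδ1 hd hε hε1 hμ hμ1 200
  rw [hAy] at hA
  subst hA
  obtain ⟨s, hs, rfl⟩ : ∃ s : ℝ, 0 < s ∧ ε = s ^ 2 :=
    ⟨√ε, Real.sqrt_pos.2 hε, (Real.sq_sqrt hε.le).symm⟩
  have hs1 : s ≤ 1 := by
    by_contra! h
    have := one_lt_pow₀ h two_ne_zero
    linarith
  have hsqrt : √(s ^ 2) = s := Real.sqrt_sq hs.le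
  have hd' : (1 : ℝ) ≤ d := by exact_mod_cast hd
  have hα1 : 1 ≤ α := by rw [hα]; split_ifs; exacts [le_rfl, hd']
  have hαd : α ≤ d := by rw [hα]; split_ifs; exacts [hd', le_rfl]
  have hy1 : y ≤ 1 := by linarith
  have hp := stepScale_pos (d := d) (μ := μ) hα1 hε
  obtain ⟨η, hη⟩ : ∃ η, η = y ^ 80 * stepScale α d (s ^ 2) μ := ⟨_, rfl⟩
  obtain ⟨r, hr⟩ : ∃ r, r = y ^ 30 * (s ^ 2 / √η) := ⟨_, rfl⟩
  have hη0 : 0 < η := by rw [hη]; positivity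
  obtain ⟨hr0, ht⟩ := exists_tuned hL hρ hσ hd hs hs1 hμ hμ1 hα1 hy hy6 hLy hρy hyρ hfy hσy hyδ
    hη hr
  have hη2 : η ≤ 1 / 2 := by
    have := mul_pow_le_one hy hy6 (c := 2) 80 (by norm_num)
    have := ht.η_le_y
    linarith
  obtain ⟨I, hI1, hI2, hI3⟩ := exists_count (x := η * s) hy hy6 (by positivity)
    ((mul_le_of_le_one_right hη0.le hs1).trans hη2) (j := 5) (k := 200) (by norm_num)
  obtain ⟨T, hT1, hT2', hT3⟩ := exists_count (x := s ^ 4 * η) hy hy6 (by positivity)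
    ((mul_le_of_le_one_left hη0.le (pow_le_one₀ hs.le hs1)).trans hη2) (j := 46) (k := 200)
    (by norm_num)
  have hT2 : T * (s ^ 4 * η) * y ^ 46 ≤ 2 := by
    have : 0 ≤ s ^ 4 * η * y ^ 46 := by positivity
    linarith
  have hηd : y ^ 80 * (s ^ 4 * μ ^ 2) ≤ η * d := by
    have h1 := le_stepScale_mul hα1 hε hε1 hμ hμ1 hd hαd
    rw [hη, mul_assoc]
    refine mul_le_mul_of_nonneg_left ((le_of_eq (by ring)).trans h1) (by positivity)
  refine ⟨η, r, y ^ 11 * s, I, T, eqUpTo_of_eq_pow_mul hy hy1 (by norm_num) hp.le hη,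
    eqUpTo_of_eq_pow_mul hy hy1 (by norm_num) (by positivity) hr,
    eqUpTo_of_eq_pow_mul hy hy1 (j := 11) (by norm_num) (Real.sqrt_nonneg _) (by rw [hsqrt]),
    by rw [hsqrt]; exact hI3, ?_, iterations_le hy hy6 hs hμ hμ1 hα1 hη hT2, ?_⟩
  · have e : (s ^ 2) ^ 2 * η = s ^ 4 * η := by ring
    rw [e]; exact hT3
  intro Θ Θ' Ω _ _ _ D D' P _ _ _ f G C x₀ z p hobj horacle hlip hcomp hsamples hpe
  have hS : SGDSetting P D D' f G C z fmax L ρ σ μ η r (2 * σ ^ 2 + 2 * r ^ 2) :=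
    { objective := hobj, oracle := horacle, compressor := hcomp
      samples := hsamples.isIIDSequence, dim_pos := hd, L_pos := hL, ρ_pos := hρ, μ_pos := hμ
      μ_le := hμ1, η_pos := hη0, noise_le := le_rfl }
  -- The two cases for the oracle meet here: either the residual noise σ₀ is zero, or α = d pays for
  -- it.
  obtain ⟨ℓ₀, σ₀, hV, hℓ₀, hℓ₀y, hσ₀, hσ₀y, hσα⟩ : ∃ ℓ₀ σ₀ : ℝ, OracleDifferenceBound f G D ℓ₀ σ₀ ∧
      0 ≤ ℓ₀ ∧ ℓ₀ * y ≤ 1 ∧ 0 ≤ σ₀ ∧ σ₀ * y ≤ 1 ∧ (σ₀ = 0 ∨ α = d) := by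
    cases lip with
    | true => exact ⟨ℓ, 0, horacle.oracleDifferenceBound_of_lipschitz (hlip rfl), hℓ, hℓy, le_rfl,
        by simp, Or.inl rfl⟩
    | false => exact ⟨0, σ, horacle.oracleDifferenceBound, le_rfl, by simp, hσ, hσy,
        Or.inr (by simpa using hα)⟩
  refine (hS.run_succeeds_of_tuned ht hV hℓ₀ hℓ₀y hσ₀ hσ₀y hσα hr0 hdy hηd hI1 hI2 hT1 hT2 hpe
    x₀).trans (measure_mono fun ω hω => ⟨Finset.card_pos.1 hω.1, hω.2.1, ?_⟩)
  have hI1' : 1 ≤ ((I : ℝ) + 1) * (η * s) * y ^ 5 := by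
    refine hI1.trans ?_
    gcongr
    linarith
  rw [CompressedSGD.resetCommunication, Finset.sum_const, smul_eq_mul, Nat.cast_mul]
  exact resetCommunication_le hy hy6 hs hη0 (Nat.cast_nonneg _) (by positivity) hI1' hT2
    (by exact_mod_cast hω.2.2)
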